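/- Let $X$ be a compact connected complex manifold of dimension $d$ (for instance the complex manifold attached to a connected smooth proper variety over $\mathbb C$), and let $Y, Z$ be effective divisors on $X$ with disjoint supports such that $(Y+Z)_{\mathrm{red}}$ is a simple normal crossing divisor. For effective divisors $Y', Z'$ with $|Y'|=|Y|$ and $|Z'|=|Z|$ put $$\Omega^p_{X|Y',Z'} := \Omega^p_X(\log (Y+Z)_{\mathrm{red}})\otimes \mathcal O_X(-Y'+Z'-Z'_{\mathrm{red}}),$$ sheaves of meromorphic $p$-forms on $X$ which form a complex $\Omega^\bullet_{X|Y',Z'}$ under the exterior derivative; if $Y'\ge Y''$ and $Z'\le Z''$ (same supports) then $\Omega^\bullet_{X|Y',Z'}\subset\Omega^\bullet_{X|Y'',Z''}$. (1) All these inclusions between the four complexes $\Omega^\bullet_{X|Y,Z}$, $\Omega^\bullet_{X|Y,Z_{\mathrm{red}}}$, $\Omega^\bullet_{X|Y_{\mathrm{red}},Z}$, $\Omega^\bullet_{X|Y_{\mathrm{red}},Z_{\mathrm{red}}}$, i.e. the inclusions $$\Omega^\bullet_{X|Y,Z_{\mathrm{red}}}\subset\Omega^\bullet_{X|Y,Z}\subset\Omega^\bullet_{X|Y_{\mathrm{red}},Z},\qquad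 \Omega^\bullet_{X|Y,Z_{\mathrm{red}}}\subset\Omega^\bullet_{X|Y_{\mathrm{red}},Z_{\mathrm{red}}}\subset\Omega^\bullet_{X|Y_{\mathrm{red}},Z}$$ and their composites, are quasi-isomorphisms of complexes of sheaves of complex vector spaces. (2) Let $H^n_{\mathbb C}=H^n(X\setminus Z, Y;\mathbb C)$ denote the relative cohomology, that is, the cohomology of $X\setminus |Z|$ with coefficients in the sheaf $F$ of locally constant $\mathbb C$-valued functions vanishing on $|Y|$. For all $Y'\in\{Y,Y_{\mathrm{red}}\}$, $Z'\in\{Z,Z_{\mathrm{red}}\}$ and $n\in\mathbb Z$, the restriction map $\rho\colon H^n(X,\Omega^\bullet_{X|Y',Z'})\to H^n(X\setminus |Z|,\Omega^\bullet_{X|Y',Z'})$ is bijective, and there is a $\mathbb C$-linear isomorphism $$e\colon H^n_{\mathbb C}\xrightarrow{\ \simeq\ }H^n(X,\Omega^\bullet_{X|Y',Z'})$$ such that $\rho\circ e$ is the map induced by the canonical morphism $F\to\Omega^\bullet_{X|Y',Z'}$ which views a locally constant function vanishing on $|Y|$ as a $0$-form. -/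

import Mathlib

open CategoryTheory Topology TopologicalSpace Filter
open scoped Manifold ContDiff

universe w

noncomputable section

/-! ### Sheaves of functions defined by a local condition -/

section Cut

variable {X A : Type} [TopologicalSpace X] [Zero A]

/-- Cutting a function off outside of an open set (the extension by zero of its restriction). -/
def cutOff (V : Opens X) (f : X → A) : X → A := Set.indicator (V : Set X) f

lemma cutOff_of_mem {V : Opens X} {f : X → A} {x : X} (h : x ∈ V) : cutOff V f x = f x :=
  Set.indicator_of_mem (s := (V : Set X)) h f

lemma cutOff_of_notMem {V : Opens X} {f : X → A} {x : X} (h : x ∉ V) : cutOff V f x = 0 :=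
  Set.indicator_of_notMem (s := (V : Set X)) h f

lemma cutOff_eventuallyEq {V : Opens X} {f : X → A} {x : X} (h : x ∈ V) : cutOff V f =ᶠ[𝓝 x] f := by
  filter_upwards [V.isOpen.mem_nhds h] with y hy using cutOff_of_mem hy

lemma cutOff_cut {V W : Opens X} (h : W ≤ V) (f : X → A) : cutOff W (cutOff V f) = cutOff W f := by
  funext x
  by_cases hx : x ∈ W
  · rw [cutOff_of_mem hx, cutOff_of_mem hx, cutOff_of_mem (h hx)]
  · rw [cutOff_of_notMem hx, cutOff_of_notMem hx]

end Cut

/-- A linear condition on germs of functions `X → A`. -/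
structure LocalCondition (X A : Type) [TopologicalSpace X] [AddCommGroup A] [Module ℂ A] where
  holds : (X → A) → X → Prop
  congr : ∀ {f g : X → A} {x : X}, f =ᶠ[𝓝 x] g → holds f x → holds g x
  zero : ∀ x, holds 0 x
  add : ∀ {f g : X → A} {x : X}, holds f x → holds g x → holds (f + g) x
  smul : ∀ (c : ℂ) {f : X → A} {x : X}, holds f x → holds (c • f) x

namespace LocalCondition

variable {X A B : Type} [TopologicalSpace X] [AddCommGroup A] [Module ℂ A]
  [AddCommGroup B] [Module ℂ B]

/-- The functions `V → A` which satisfy the condition at every point of `V`. A function on `V`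
is represented by its extension by zero to `X`. -/
def sections (P : LocalCondition X A) (V : Opens X) : Submodule ℂ (X → A) where
  carrier := {f | (∀ x ∈ V, P.holds f x) ∧ ∀ x ∉ V, f x = 0}
  zero_mem' := ⟨fun x _ => P.zero x, fun _ _ => rfl⟩
  add_mem' := fun hf hg => ⟨fun x hx => P.add (hf.1 x hx) (hg.1 x hx), fun x hx => by
    simp [hf.2 x hx, hg.2 x hx]⟩
  smul_mem' := fun c f hf => ⟨fun x hx => P.smul c (hf.1 x hx), fun x hx => by
    simp [hf.2 x hx]⟩

lemma cutOff_self (P : LocalCondition X A) {V : Opens X} {f : X → A} (hf : f ∈ P.sections V) :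
    cutOff V f = f := by
  funext x
  by_cases hx : x ∈ V
  · exact cutOff_of_mem hx
  · rw [cutOff_of_notMem hx, hf.2 x hx]

/-- Restriction of sections to a smaller open set. -/
def restrict (P : LocalCondition X A) {V W : Opens X} (h : W ≤ V) :
    P.sections V →ₗ[ℂ] P.sections W where
  toFun f := ⟨cutOff W f.1, fun x hx => P.congr (cutOff_eventuallyEq hx).symm (f.2.1 x (h hx)),
    fun _ hx => cutOff_of_notMem hx⟩
  map_add' f g := by
    apply Subtype.ext
    exact Set.indicator_add _ _ _
  map_smul' c f := by
    apply Subtype.ext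
    exact Set.indicator_const_smul (W : Set X) c f.1

/-- The presheaf of functions satisfying the condition. -/
def presheaf (P : LocalCondition X A) : (Opens X)ᵒᵖ ⥤ ModuleCat.{0} ℂ where
  obj V := ModuleCat.of ℂ (P.sections V.unop)
  map i := ModuleCat.ofHom (P.restrict (leOfHom i.unop))
  map_id V := by
    refine ModuleCat.hom_ext (LinearMap.ext fun f => Subtype.ext ?_)
    exact cutOff_self P f.2
  map_comp {U V W} i j := by
    refine ModuleCat.hom_ext (LinearMap.ext fun f => Subtype.ext ?_)
    exact (cutOff_cut (leOfHom j.unop) f.1).symm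

lemma presheaf_isSheaf (P : LocalCondition X A) :
    Presheaf.IsSheaf (Opens.grothendieckTopology X) P.presheaf := by
  change TopCat.Presheaf.IsSheaf (X := TopCat.of X) P.presheaf
  rw [TopCat.Presheaf.isSheaf_iff_isSheafUniqueGluing.{0}]
  intro ι U sf hsf
  have key : ∀ i j x, x ∈ U i → x ∈ U j → (sf i).1 x = (sf j).1 x := by
    intro i j x hi hj
    have h := congrFun (congrArg Subtype.val (hsf i j)) x
    have hx : x ∈ U i ⊓ U j := ⟨hi, hj⟩
    have h1 : cutOff (U i ⊓ U j) (sf i).1 x = cutOff (U i ⊓ U j) (sf j).1 x := h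
    rwa [cutOff_of_mem hx, cutOff_of_mem hx] at h1
  classical
  let s : X → A := fun x => if h : ∃ i, x ∈ U i then (sf h.choose).1 x else 0
  have hs : ∀ i x, x ∈ U i → s x = (sf i).1 x := by
    intro i x hi
    have h : ∃ i, x ∈ U i := ⟨i, hi⟩
    simp only [s, dif_pos h]
    exact key _ _ _ h.choose_spec hi
  have hmem : s ∈ P.sections (iSup U) := by
    refine ⟨fun x hx => ?_, fun x hx => ?_⟩
    · obtain ⟨i, hi⟩ := Opens.mem_iSup.1 hx
      refine P.congr ?_ ((sf i).2.1 x hi)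
      filter_upwards [(U i).isOpen.mem_nhds hi] with y hy using (hs i y hy).symm
    · have h : ¬ ∃ i, x ∈ U i := fun h => hx (Opens.mem_iSup.2 h)
      simp only [s, dif_neg h]
  refine ⟨⟨s, hmem⟩, fun i => ?_, fun t ht => ?_⟩
  · apply Subtype.ext
    funext x
    change cutOff (U i) s x = (sf i).1 x
    by_cases hx : x ∈ U i
    · rw [cutOff_of_mem hx, hs i x hx]
    · rw [cutOff_of_notMem hx, (sf i).2.2 x hx]
  · apply Subtype.ext
    funext x
    by_cases hx : x ∈ iSup U
    · obtain ⟨i, hi⟩ := Opens.mem_iSup.1 hx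
      have h := congrFun (congrArg Subtype.val (ht i)) x
      have h1 : cutOff (U i) t.1 x = (sf i).1 x := h
      rw [cutOff_of_mem hi] at h1
      rw [h1]
      exact (hs i x hi).symm
    · exact (t.2.2 x hx).trans (hmem.2 x hx).symm

/-- The sheaf of functions satisfying the condition. -/
def sheaf (P : LocalCondition X A) : Sheaf (Opens.grothendieckTopology X) (ModuleCat.{0} ℂ) :=
  ⟨P.presheaf, P.presheaf_isSheaf⟩

/-- An operator on functions which acts on germs and which is linear on those germs that satisfy
the condition `P`, and takes them to germs that satisfy `Q`. -/
structure Operator (P : LocalCondition X A) (Q : LocalCondition X B) where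
  toFun : (X → A) → X → B
  congr : ∀ {f g : X → A} {x : X}, f =ᶠ[𝓝 x] g → toFun f x = toFun g x
  add : ∀ {f g : X → A} {x : X}, P.holds f x → P.holds g x →
    toFun (f + g) x = toFun f x + toFun g x
  smul : ∀ (c : ℂ) {f : X → A} {x : X}, P.holds f x → toFun (c • f) x = c • toFun f x
  maps : ∀ {f : X → A} {x : X}, (∀ᶠ y in 𝓝 x, P.holds f y) → Q.holds (toFun f) x

variable {P : LocalCondition X A} {Q : LocalCondition X B}

/-- The map on sections over `V` given by an operator. -/
def Operator.onSections (T : Operator P Q) (V : Opens X) : P.sections V →ₗ[ℂ] Q.sections V where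
  toFun f := ⟨cutOff V (T.toFun f.1), fun x hx => Q.congr (cutOff_eventuallyEq hx).symm
      (T.maps (by filter_upwards [V.isOpen.mem_nhds hx] with y hy using f.2.1 y hy)),
    fun _ hx => cutOff_of_notMem hx⟩
  map_add' f g := by
    apply Subtype.ext
    funext x
    change cutOff V (T.toFun (f.1 + g.1)) x = cutOff V (T.toFun f.1) x + cutOff V (T.toFun g.1) x
    by_cases hx : x ∈ V
    · rw [cutOff_of_mem hx, cutOff_of_mem hx, cutOff_of_mem hx, T.add (f.2.1 x hx) (g.2.1 x hx)]
    · simp [cutOff_of_notMem hx]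
  map_smul' c f := by
    apply Subtype.ext
    funext x
    change cutOff V (T.toFun (c • f.1)) x = c • cutOff V (T.toFun f.1) x
    by_cases hx : x ∈ V
    · rw [cutOff_of_mem hx, cutOff_of_mem hx, T.smul c (f.2.1 x hx)]
    · simp [cutOff_of_notMem hx]

/-- The morphism of sheaves given by an operator. -/
def Operator.sheafHom (T : Operator P Q) : P.sheaf ⟶ Q.sheaf where
  hom :=
    { app := fun V => ModuleCat.ofHom (T.onSections V.unop)
      naturality := fun V W i => by
        ext f
        apply Subtype.ext
        funext x
        change cutOff W.unop (T.toFun (cutOff W.unop f.1)) x = cutOff W.unop (cutOff V.unop (T.toFun f.1)) x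
        rw [cutOff_cut (leOfHom i.unop)]
        by_cases hx : x ∈ W.unop
        · rw [cutOff_of_mem hx, cutOff_of_mem hx, T.congr (cutOff_eventuallyEq hx)]
        · rw [cutOff_of_notMem hx, cutOff_of_notMem hx] }

/-- Two operators whose composite kills all germs satisfying `P` give composable morphisms of
sheaves with zero composite. -/
lemma Operator.sheafHom_comp_eq_zero {C : Type} [AddCommGroup C] [Module ℂ C]
    {R : LocalCondition X C} (T : Operator P Q) (S : Operator Q R)
    (h : ∀ f x, (∀ᶠ y in 𝓝 x, P.holds f y) → S.toFun (T.toFun f) x = 0) :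
    T.sheafHom ≫ S.sheafHom = 0 := by
  ext V f
  apply Subtype.ext
  funext x
  change cutOff V.unop (S.toFun (cutOff V.unop (T.toFun f.1))) x = 0
  by_cases hx : x ∈ V.unop
  · rw [cutOff_of_mem hx, S.congr (cutOff_eventuallyEq hx)]
    exact h _ _ (by filter_upwards [V.unop.isOpen.mem_nhds hx] with y hy using f.2.1 y hy)
  · exact cutOff_of_notMem hx

/-- A condition that implies another one gives an inclusion of sheaves. -/
def inclusion (P Q : LocalCondition X A) (h : ∀ f x, P.holds f x → Q.holds f x) :
    P.sheaf ⟶ Q.sheaf where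
  hom :=
    { app := fun V => ModuleCat.ofHom (Submodule.inclusion
        (fun f hf => ⟨fun x hx => h f x (hf.1 x hx), hf.2⟩ : P.sections V.unop ≤ Q.sections V.unop))
      naturality := fun _ _ _ => rfl }

end LocalCondition

/-! ### Divisors on complex manifolds -/

section Divisors

variable (d : ℕ) (X : Type) [TopologicalSpace X] [ChartedSpace (Fin d → ℂ) X]

variable {X} in
/-- Holomorphy of a function near a point. -/
def HolomorphicNear (f : X → ℂ) (x : X) : Prop :=
  ContMDiffAt 𝓘(ℂ, Fin d → ℂ) 𝓘(ℂ) ω f x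

variable {X} in
/-- Closed analytic subsets: locally, common zero sets of finitely many holomorphic functions. -/
def IsAnalyticSubset (A : Set X) : Prop :=
  IsClosed A ∧ ∀ x : X, ∃ (m : ℕ) (f : Fin m → X → ℂ), (∀ i, HolomorphicNear d (f i) x) ∧
    ∀ᶠ y in 𝓝 x, y ∈ A ↔ ∀ i, f i y = 0

variable {X} in
/-- Analytic hypersurfaces: locally, zero sets of one holomorphic function with nonzero germ. -/
def IsHypersurface (A : Set X) : Prop :=
  IsClosed A ∧ ∀ x : X, ∃ f : X → ℂ, HolomorphicNear d f x ∧ ¬ (∀ᶠ y in 𝓝 x, f y = 0) ∧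
    ∀ᶠ y in 𝓝 x, y ∈ A ↔ f y = 0

/-- Prime divisors: irreducible analytic hypersurfaces. -/
@[ext]
structure PrimeDivisor where
  carrier : Set X
  isHypersurface : IsHypersurface d carrier
  nonempty : carrier.Nonempty
  irreducible : ∀ A B : Set X, IsAnalyticSubset d A → IsAnalyticSubset d B →
    carrier ⊆ A ∪ B → carrier ⊆ A ∨ carrier ⊆ B

/-- Effective divisors (with finitely many components, as on a compact manifold). -/
abbrev EffectiveDivisor : Type := PrimeDivisor d X →₀ ℕ

namespace EffectiveDivisor

variable {d X}

/-- The reduced divisor with the same support. -/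
def red (Y : EffectiveDivisor d X) : EffectiveDivisor d X :=
  Y.mapRange (fun m => min m 1) rfl

/-- The union of the components of a divisor. -/
def supp (Y : EffectiveDivisor d X) : Set X := ⋃ T ∈ Y.support, T.carrier

lemma red_apply (Y : EffectiveDivisor d X) (T : PrimeDivisor d X) : Y.red T = min (Y T) 1 := rfl

lemma support_red (Y : EffectiveDivisor d X) : Y.red.support = Y.support := by
  ext T
  simp [red_apply]

end EffectiveDivisor

variable {d X}

/-- The union of finitely many prime divisors. -/
def unionOf (S : Finset (PrimeDivisor d X)) : Set X := ⋃ T ∈ S, T.carrier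

lemma isClosed_unionOf (S : Finset (PrimeDivisor d X)) : IsClosed (unionOf S) :=
  S.finite_toSet.isClosed_biUnion fun T _ => T.isHypersurface.1

/-- Holomorphic coordinates around `x` in which the members of `S` are coordinate hyperplanes:
`comp k` is the member of `S` through `x` given by the vanishing of the `k`-th coordinate,
if there is one. -/
structure AdaptedChart (S : Finset (PrimeDivisor d X)) (x : X) where
  chart : OpenPartialHomeomorph X (Fin d → ℂ)
  mem_atlas : chart ∈ IsManifold.maximalAtlas 𝓘(ℂ, Fin d → ℂ) ω X
  mem_source : x ∈ chart.source
  comp : Fin d → Option (PrimeDivisor d X)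
  comp_mem : ∀ k T, comp k = some T → T ∈ S ∧ x ∈ T.carrier
  comp_zero : ∀ k T, comp k = some T → ∀ y ∈ chart.source, y ∈ T.carrier ↔ chart y k = 0
  comp_unique : ∀ T ∈ S, x ∈ T.carrier → ∃! k, comp k = some T
  disjoint : ∀ T ∈ S, x ∉ T.carrier → Disjoint T.carrier chart.source

/-- The reduced divisor with components `S` is a simple normal crossing divisor. -/
def IsSNC (S : Finset (PrimeDivisor d X)) : Prop :=
  ∀ x : X, Nonempty (AdaptedChart S x)

/-! ### Differential forms -/

/-- The expression of a differential form in a chart, i.e. its pullback under the inverse of the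
chart. The value of the form at `y` is an alternating form on the tangent space of `X` at `y`,
which in Mathlib is the model space. -/
def inChart {p : ℕ} (φ : OpenPartialHomeomorph X (Fin d → ℂ))
    (η : X → (Fin d → ℂ) [⋀^Fin p]→L[ℂ] ℂ) (z : Fin d → ℂ) : (Fin d → ℂ) [⋀^Fin p]→L[ℂ] ℂ :=
  (η (φ.symm z)).compContinuousLinearMap
    (mfderiv 𝓘(ℂ, Fin d → ℂ) 𝓘(ℂ, Fin d → ℂ) φ.symm z)

/-- The exterior derivative of a form defined off `D`; it is extended by zero to `D`. It is
computed at `x` in the chart at `x` that Mathlib uses to identify the tangent space at `x` with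
the model space. -/
def extDerivOff {p : ℕ} (D : Set X) (η : X → (Fin d → ℂ) [⋀^Fin p]→L[ℂ] ℂ) (x : X) :
    (Fin d → ℂ) [⋀^Fin (p + 1)]→L[ℂ] ℂ :=
  open Classical in
  if x ∈ D then 0 else extDeriv (inChart (chartAt (Fin d → ℂ) x) η) (chartAt (Fin d → ℂ) x x)

namespace AdaptedChart

variable {S : Finset (PrimeDivisor d X)} {x : X} (c : AdaptedChart S x)

/-- `z k` if the `k`-th coordinate cuts out a member of `S`, and `1` otherwise. -/
def logCoord (k : Fin d) (z : Fin d → ℂ) : ℂ := if (c.comp k).isSome then z k else 1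

/-- The coefficient in `E` of the component cut out by the `k`-th coordinate, if any. -/
def mult (E : PrimeDivisor d X → ℤ) (k : Fin d) : ℤ := (c.comp k).elim 0 E

/-- The local generator `∏ z_k ^ (- E_k)` of `𝒪(E)`. -/
def generator (E : PrimeDivisor d X → ℤ) (z : Fin d → ℂ) : ℂ := ∏ k, z k ^ (-(c.mult E k))

end AdaptedChart

/-- The form `η`, defined off the union `D` of `S` (and extended by zero), is near `x` a section
of `Ω^p(log D) ⊗ 𝒪(E)`: in adapted coordinates it is a combination, with coefficients that are
holomorphic multiples of the generator of `𝒪(E)`, of wedge products of the forms `dz_k / z_k`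
where the `k`-th coordinate cuts out a component of `D` and `dz_k` where it does not. The
coefficient of `dz_{I 1} ∧ ⋯ ∧ dz_{I p}` is the value on the coordinate vectors. -/
def IsLogFormAt {p : ℕ} (S : Finset (PrimeDivisor d X)) (E : PrimeDivisor d X → ℤ)
    (η : X → (Fin d → ℂ) [⋀^Fin p]→L[ℂ] ℂ) (x : X) : Prop :=
  (x ∈ unionOf S → η x = 0) ∧
  ∀ (c : AdaptedChart S x) (I : Fin p → Fin d), ∃ g : (Fin d → ℂ) → ℂ,
    AnalyticAt ℂ g (c.chart x) ∧
    ∀ᶠ z in 𝓝 (c.chart x), (∀ k, (c.comp k).isSome → z k ≠ 0) →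
      inChart c.chart η z (fun j => Pi.single (I j) 1) * ∏ j, c.logCoord (I j) z =
        c.generator E z * g z

lemma inChart_congr {p : ℕ} {φ : OpenPartialHomeomorph X (Fin d → ℂ)}
    {η θ : X → (Fin d → ℂ) [⋀^Fin p]→L[ℂ] ℂ} {x : X} (hx : x ∈ φ.source) (h : η =ᶠ[𝓝 x] θ) :
    inChart φ η =ᶠ[𝓝 (φ x)] inChart φ θ := by
  have h1 : Tendsto φ.symm (𝓝 (φ x)) (𝓝 x) := by
    have := φ.symm.continuousAt (φ.map_source hx)
    rwa [ContinuousAt, φ.left_inv hx] at this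
  filter_upwards [h1.eventually h] with z hz
  simp only [inChart, hz]

lemma inChart_add {p : ℕ} (φ : OpenPartialHomeomorph X (Fin d → ℂ))
    (η θ : X → (Fin d → ℂ) [⋀^Fin p]→L[ℂ] ℂ) :
    inChart φ (η + θ) = inChart φ η + inChart φ θ := rfl

lemma inChart_smul {p : ℕ} (φ : OpenPartialHomeomorph X (Fin d → ℂ)) (a : ℂ)
    (η : X → (Fin d → ℂ) [⋀^Fin p]→L[ℂ] ℂ) :
    inChart φ (a • η) = a • inChart φ η := rfl

/-- The local condition that defines the sheaf `Ω^p(log D) ⊗ 𝒪(E)`. -/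
def logFormCondition (S : Finset (PrimeDivisor d X)) (E : PrimeDivisor d X → ℤ) (p : ℕ) :
    LocalCondition X ((Fin d → ℂ) [⋀^Fin p]→L[ℂ] ℂ) where
  holds := IsLogFormAt S E
  congr := by
    intro f g x hfg hf
    refine ⟨fun hx => hfg.self_of_nhds ▸ hf.1 hx, fun c I => ?_⟩
    obtain ⟨a, ha, h⟩ := hf.2 c I
    refine ⟨a, ha, ?_⟩
    filter_upwards [h, inChart_congr c.mem_source hfg] with z hz hz' hk
    rw [← hz']
    exact hz hk
  zero := by
    intro x
    refine ⟨fun _ => rfl, fun c I => ⟨0, analyticAt_const, ?_⟩⟩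
    filter_upwards with z _
    change (0 : ℂ) * _ = _ * (0 : ℂ)
    rw [zero_mul, mul_zero]
  add := by
    intro f g x hf hg
    refine ⟨fun hx => by simp [hf.1 hx, hg.1 hx], fun c I => ?_⟩
    obtain ⟨a, ha, h⟩ := hf.2 c I
    obtain ⟨b, hb, h'⟩ := hg.2 c I
    refine ⟨a + b, ha.add hb, ?_⟩
    filter_upwards [h, h'] with z hz hz' hk
    rw [inChart_add, Pi.add_apply, Pi.add_apply, ContinuousAlternatingMap.add_apply, add_mul,
      hz hk, hz' hk, mul_add]
  smul := by
    intro r f x hf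
    refine ⟨fun hx => by simp [hf.1 hx], fun c I => ?_⟩
    obtain ⟨a, ha, h⟩ := hf.2 c I
    refine ⟨r • a, ha.const_smul, ?_⟩
    filter_upwards [h] with z hz hk
    rw [inChart_smul, Pi.smul_apply, Pi.smul_apply, ContinuousAlternatingMap.smul_apply,
      smul_eq_mul, smul_eq_mul, mul_assoc, hz hk]
    ring

/-! ### The exterior derivative preserves logarithmic forms -/

section Derivative

lemma AdaptedChart.symm_notMem {S : Finset (PrimeDivisor d X)} {x : X} (c : AdaptedChart S x)
    {z : Fin d → ℂ} (hz : z ∈ c.chart.target) (h : ∀ k, (c.comp k).isSome → z k ≠ 0) :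
    c.chart.symm z ∉ unionOf S := by
  intro hD
  simp only [unionOf, Set.mem_iUnion] at hD
  obtain ⟨T, hTS, hT⟩ := hD
  have hs := c.chart.map_target hz
  have hx : x ∈ T.carrier := by
    by_contra hx
    exact Set.disjoint_left.1 (c.disjoint T hTS hx) hT hs
  obtain ⟨k, hk, -⟩ := c.comp_unique T hTS hx
  refine h k (by simp [hk]) ?_
  have := (c.comp_zero k T hk _ hs).1 hT
  rwa [c.chart.right_inv hz] at this

/-- `F` is differentiable at `z`, with logarithmic derivatives `m k` along the coordinates. -/
def AdaptedChart.HasLogDeriv {S : Finset (PrimeDivisor d X)} {x : X} (c : AdaptedChart S x)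
    (F : (Fin d → ℂ) → ℂ) (z : Fin d → ℂ) (m : Fin d → ℂ) : Prop :=
  AnalyticAt ℂ F z ∧ ∀ k, fderiv ℂ F z (Pi.single k 1) * c.logCoord k z = m k * F z

lemma AdaptedChart.HasLogDeriv.mul {S : Finset (PrimeDivisor d X)} {x : X} {c : AdaptedChart S x}
    {F G : (Fin d → ℂ) → ℂ} {z : Fin d → ℂ} {m n : Fin d → ℂ} (hF : c.HasLogDeriv F z m)
    (hG : c.HasLogDeriv G z n) : c.HasLogDeriv (fun w => F w * G w) z (m + n) := by
  refine ⟨hF.1.mul hG.1, fun k => ?_⟩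
  rw [fderiv_fun_mul hF.1.differentiableAt hG.1.differentiableAt]
  simp only [add_apply, smul_apply, smul_eq_mul,
    Pi.add_apply]
  linear_combination F z * hG.2 k + G z * hF.2 k

lemma AdaptedChart.hasLogDeriv_prod {S : Finset (PrimeDivisor d X)} {x : X} {c : AdaptedChart S x}
    {ι : Type} (s : Finset ι) {F : ι → (Fin d → ℂ) → ℂ} {z : Fin d → ℂ} {m : ι → Fin d → ℂ}
    (h : ∀ i, c.HasLogDeriv (F i) z (m i)) :
    c.HasLogDeriv (fun w => ∏ i ∈ s, F i w) z (∑ i ∈ s, m i) := by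
  classical
  induction s using Finset.induction_on with
  | empty =>
    simp only [Finset.prod_empty, Finset.sum_empty]
    exact ⟨analyticAt_const, fun k => by simp⟩
  | insert a s ha ih =>
    simp only [Finset.prod_insert ha, Finset.sum_insert ha]
    exact (h a).mul ih

lemma AdaptedChart.hasLogDeriv_zpow {S : Finset (PrimeDivisor d X)} {x : X}
    {c : AdaptedChart S x} {z : Fin d → ℂ} (k : Fin d) (e : ℤ)
    (h : e ≠ 0 → (c.comp k).isSome ∧ z k ≠ 0) :
    c.HasLogDeriv (fun w => w k ^ e) z (Pi.single k (e : ℂ)) := by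
  by_cases he : e = 0
  · subst he
    simp only [zpow_zero, Int.cast_zero, Pi.single_zero]
    exact ⟨analyticAt_const, fun k => by simp⟩
  obtain ⟨hk, hz⟩ := h he
  have hp : HasFDerivAt (fun w : Fin d → ℂ => w k)
      (ContinuousLinearMap.proj (R := ℂ) (φ := fun _ : Fin d => ℂ) k) z :=
    (ContinuousLinearMap.proj (R := ℂ) (φ := fun _ : Fin d => ℂ) k).hasFDerivAt
  have hd : HasFDerivAt (fun w : Fin d → ℂ => w k ^ e)
      (((e : ℂ) * z k ^ (e - 1)) •
        ContinuousLinearMap.proj (R := ℂ) (φ := fun _ : Fin d => ℂ) k) z :=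
    HasDerivAt.comp_hasFDerivAt (h₂ := fun t : ℂ => t ^ e) z
      (hasDerivAt_zpow e (z k) (Or.inl hz)) hp
  have ha : AnalyticAt ℂ (fun w : Fin d → ℂ => w k) z :=
    (ContinuousLinearMap.proj (R := ℂ) (φ := fun _ : Fin d => ℂ) k).analyticAt z
  refine ⟨ha.fun_zpow hz, fun l => ?_⟩
  rw [hd.fderiv]
  by_cases hl : l = k
  · subst hl
    simp only [smul_apply, ContinuousLinearMap.proj_apply, Pi.single_eq_same,
      smul_eq_mul, AdaptedChart.logCoord, hk, if_true, mul_one]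
    rw [mul_assoc, ← zpow_add_one₀ hz, sub_add_cancel]
  · simp [Pi.single_eq_of_ne hl, Pi.single_eq_of_ne (Ne.symm hl)]

/-- The factor that turns a holomorphic function into a coefficient of a logarithmic form. -/
def AdaptedChart.factor {S : Finset (PrimeDivisor d X)} {x : X} (c : AdaptedChart S x)
    (E : PrimeDivisor d X → ℤ) {p : ℕ} (I : Fin p → Fin d) (z : Fin d → ℂ) : ℂ :=
  c.generator E z * ∏ j, z (I j) ^ (if (c.comp (I j)).isSome then (-1 : ℤ) else 0)

/-- Its logarithmic derivatives. -/
def AdaptedChart.factorDeriv {S : Finset (PrimeDivisor d X)} {x : X} (c : AdaptedChart S x)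
    (E : PrimeDivisor d X → ℤ) {p : ℕ} (I : Fin p → Fin d) : Fin d → ℂ :=
  (∑ k, Pi.single k ((-(c.mult E k) : ℤ) : ℂ)) +
    ∑ j, Pi.single (I j) ((if (c.comp (I j)).isSome then (-1 : ℤ) else 0 : ℤ) : ℂ)

lemma AdaptedChart.hasLogDeriv_factor {S : Finset (PrimeDivisor d X)} {x : X}
    (c : AdaptedChart S x) (E : PrimeDivisor d X → ℤ) {p : ℕ} (I : Fin p → Fin d) {z : Fin d → ℂ}
    (h : ∀ k, (c.comp k).isSome → z k ≠ 0) :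
    c.HasLogDeriv (c.factor E I) z (c.factorDeriv E I) := by
  refine AdaptedChart.HasLogDeriv.mul (AdaptedChart.hasLogDeriv_prod _ fun k => ?_)
    (AdaptedChart.hasLogDeriv_prod _ fun j => ?_)
  · refine AdaptedChart.hasLogDeriv_zpow k _ fun he => ?_
    have hk : (c.comp k).isSome := by
      by_contra hk
      rw [Option.not_isSome_iff_eq_none] at hk
      simp [AdaptedChart.mult, hk] at he
    exact ⟨hk, h k hk⟩
  · refine AdaptedChart.hasLogDeriv_zpow (I j) _ fun he => ?_
    have hk : (c.comp (I j)).isSome := by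
      by_contra hk
      simp [hk] at he
    exact ⟨hk, h _ hk⟩

lemma AdaptedChart.factor_mul {S : Finset (PrimeDivisor d X)} {x : X} (c : AdaptedChart S x)
    (E : PrimeDivisor d X → ℤ) {p : ℕ} (I : Fin p → Fin d) {z : Fin d → ℂ}
    (h : ∀ k, (c.comp k).isSome → z k ≠ 0) :
    c.factor E I z * ∏ j, c.logCoord (I j) z = c.generator E z := by
  rw [AdaptedChart.factor, mul_assoc, ← Finset.prod_mul_distrib, Finset.prod_eq_one, mul_one]
  intro j _
  by_cases hk : (c.comp (I j)).isSome
  · simp [AdaptedChart.logCoord, hk, h _ hk]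
  · simp [AdaptedChart.logCoord, hk]

lemma AdaptedChart.logCoord_ne_zero {S : Finset (PrimeDivisor d X)} {x : X}
    (c : AdaptedChart S x) {z : Fin d → ℂ} (h : ∀ k, (c.comp k).isSome → z k ≠ 0) (k : Fin d) :
    c.logCoord k z ≠ 0 := by
  by_cases hk : (c.comp k).isSome
  · simpa [AdaptedChart.logCoord, hk] using h k hk
  · simp [AdaptedChart.logCoord, hk]

lemma transition_contDiffAt {φ ψ : OpenPartialHomeomorph X (Fin d → ℂ)}
    (hφ : φ ∈ IsManifold.maximalAtlas 𝓘(ℂ, Fin d → ℂ) ω X)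
    (hψ : ψ ∈ IsManifold.maximalAtlas 𝓘(ℂ, Fin d → ℂ) ω X) {z : Fin d → ℂ}
    (hz : z ∈ ψ.target) (hz' : ψ.symm z ∈ φ.source) : ContDiffAt ℂ ω (φ ∘ ψ.symm) z := by
  have h1 := (contMDiffOn_symm_of_mem_maximalAtlas hψ).contMDiffAt (ψ.open_target.mem_nhds hz)
  have h2 := (contMDiffOn_of_mem_maximalAtlas hφ).contMDiffAt (φ.open_source.mem_nhds hz')
  exact (h2.comp z h1).contDiffAt

lemma mfderiv_symm_eq {φ : OpenPartialHomeomorph X (Fin d → ℂ)}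
    (hφ : φ ∈ IsManifold.maximalAtlas 𝓘(ℂ, Fin d → ℂ) ω X) {z : Fin d → ℂ} (hz : z ∈ φ.target) :
    MDifferentiableAt 𝓘(ℂ, Fin d → ℂ) 𝓘(ℂ, Fin d → ℂ) φ.symm z ∧
    mfderiv 𝓘(ℂ, Fin d → ℂ) 𝓘(ℂ, Fin d → ℂ) φ.symm z =
      fderiv ℂ (chartAt (Fin d → ℂ) (φ.symm z) ∘ φ.symm) z := by
  have h : MDifferentiableAt 𝓘(ℂ, Fin d → ℂ) 𝓘(ℂ, Fin d → ℂ) φ.symm z :=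
    ((contMDiffOn_symm_of_mem_maximalAtlas hφ).contMDiffAt
      (φ.open_target.mem_nhds hz)).mdifferentiableAt (by simp)
  refine ⟨h, ?_⟩
  rw [h.mfderiv]
  simp only [writtenInExtChartAt, extChartAt, mfld_simps]
  exact congrFun (fderivWithin_univ (𝕜 := ℂ)
    (f := chartAt (Fin d → ℂ) (φ.symm z) ∘ φ.symm)) z

/-- A family of alternating forms is analytic as soon as its coefficients are. -/
lemma analyticAt_of_coefficients {p : ℕ} {f : (Fin d → ℂ) → (Fin d → ℂ) [⋀^Fin p]→L[ℂ] ℂ}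
    {z : Fin d → ℂ}
    (h : ∀ I : Fin p → Fin d, AnalyticAt ℂ (fun w => f w (fun j => Pi.single (I j) 1)) z) :
    AnalyticAt ℂ f z := by
  let L : ((Fin d → ℂ) [⋀^Fin p]→L[ℂ] ℂ) →ₗ[ℂ] ((Fin p → Fin d) → ℂ) :=
    { toFun := fun a I => a (fun j => Pi.single (I j) 1)
      map_add' := fun _ _ => rfl
      map_smul' := fun _ _ => rfl }
  have hL : LinearMap.ker L = ⊥ := by
    rw [LinearMap.ker_eq_bot]
    intro a b hab
    apply ContinuousAlternatingMap.toAlternatingMap_injective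
    refine Module.Basis.ext_alternating (Pi.basisFun ℂ (Fin d)) fun I _ => ?_
    have := congrFun hab I
    simpa [L] using this
  obtain ⟨R, hR⟩ := L.exists_leftInverse_of_injective hL
  have hfR : f = fun w => LinearMap.toContinuousLinearMap R (L (f w)) := by
    funext w
    exact (LinearMap.congr_fun hR (f w)).symm
  rw [hfR]
  exact (ContinuousLinearMap.analyticAt _ _).comp (analyticAt_pi_iff.2 h)

/-- A logarithmic form is, near every point of an adapted chart off the divisor, given by the
factors and holomorphic functions. -/
lemma IsLogFormAt.exists_coefficients {p : ℕ} {S : Finset (PrimeDivisor d X)}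
    {E : PrimeDivisor d X → ℤ} {η : X → (Fin d → ℂ) [⋀^Fin p]→L[ℂ] ℂ} {x : X}
    (hη : IsLogFormAt S E η x) (c : AdaptedChart S x) :
    ∃ g : (Fin p → Fin d) → (Fin d → ℂ) → ℂ, (∀ I, AnalyticAt ℂ (g I) (c.chart x)) ∧
      ∀ᶠ z in 𝓝 (c.chart x), (∀ k, (c.comp k).isSome → z k ≠ 0) →
        AnalyticAt ℂ (inChart c.chart η) z ∧ ∀ I, AnalyticAt ℂ (g I) z ∧
          (fun w => inChart c.chart η w (fun j => Pi.single (I j) 1)) =ᶠ[𝓝 z]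
            fun w => c.factor E I w * g I w := by
  choose g hg h using hη.2 c
  refine ⟨g, hg, ?_⟩
  have h1 : ∀ᶠ z in 𝓝 (c.chart x), ∀ I, AnalyticAt ℂ (g I) z :=
    eventually_all.2 fun I => (hg I).eventually_analyticAt
  have h2 := eventually_eventually_nhds.2 (eventually_all.2 h)
  filter_upwards [h1, h2] with z hz1 hz2 hk
  have hopen : ∀ᶠ w in 𝓝 z, ∀ k, (c.comp k).isSome → w k ≠ 0 := by
    refine eventually_all.2 fun k => ?_
    by_cases hs : (c.comp k).isSome
    · filter_upwards [(continuous_apply k).continuousAt.eventually_ne (hk k hs)] with w hw _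
      exact hw
    · exact Eventually.of_forall fun w hw => absurd hw hs
  have key : ∀ I, (fun w => inChart c.chart η w (fun j => Pi.single (I j) 1)) =ᶠ[𝓝 z]
      fun w => c.factor E I w * g I w := by
    intro I
    filter_upwards [hz2, hopen] with w hw hw'
    have h3 := hw I hw'
    have h4 := c.factor_mul E I hw'
    have h5 : ∏ j, c.logCoord (I j) w ≠ 0 :=
      Finset.prod_ne_zero_iff.2 fun j _ => c.logCoord_ne_zero hw' _
    apply mul_right_cancel₀ h5
    rw [h3, ← h4]
    ring
  refine ⟨analyticAt_of_coefficients fun I => ?_, fun I => ⟨hz1 I, key I⟩⟩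
  exact (((c.hasLogDeriv_factor E I hk).1.mul (hz1 I)).congr (key I).symm)

lemma IsLogFormAt.analyticAt {p : ℕ} {S : Finset (PrimeDivisor d X)}
    {E : PrimeDivisor d X → ℤ} {η : X → (Fin d → ℂ) [⋀^Fin p]→L[ℂ] ℂ} {x : X}
    (hη : IsLogFormAt S E η x) (hx : x ∉ unionOf S) {φ : OpenPartialHomeomorph X (Fin d → ℂ)}
    (hφ : φ ∈ IsManifold.maximalAtlas 𝓘(ℂ, Fin d → ℂ) ω X) (hxφ : x ∈ φ.source) :
    AnalyticAt ℂ (inChart φ η) (φ x) := by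
  have ho : IsOpen (unionOf S)ᶜ := (isClosed_unionOf S).isOpen_compl
  let c : AdaptedChart S x :=
    { chart := φ.restr (unionOf S)ᶜ
      mem_atlas := restr_mem_maximalAtlas _ hφ ho
      mem_source := by
        rw [φ.restr_source' _ ho]
        exact ⟨hxφ, hx⟩
      comp := fun _ => none
      comp_mem := by simp
      comp_zero := by simp
      comp_unique := fun T hT hxT => absurd (Set.mem_biUnion hT hxT) hx
      disjoint := fun T hT _ => by
        rw [φ.restr_source' _ ho]
        exact Set.disjoint_left.2 fun y hy hy' => hy'.2 (Set.mem_biUnion hT hy) }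
  obtain ⟨g, -, h⟩ := hη.exists_coefficients c
  exact (h.self_of_nhds (by simp [c])).1

variable [IsManifold 𝓘(ℂ, Fin d → ℂ) ω X]

lemma chartAt_mem (x : X) :
    chartAt (Fin d → ℂ) x ∈ IsManifold.maximalAtlas 𝓘(ℂ, Fin d → ℂ) ω X :=
  IsManifold.chart_mem_maximalAtlas x

/-- Change of charts for the local expressions of a form. -/
lemma inChart_transition {p : ℕ} {φ ψ : OpenPartialHomeomorph X (Fin d → ℂ)}
    (hφ : φ ∈ IsManifold.maximalAtlas 𝓘(ℂ, Fin d → ℂ) ω X)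
    (hψ : ψ ∈ IsManifold.maximalAtlas 𝓘(ℂ, Fin d → ℂ) ω X)
    (η : X → (Fin d → ℂ) [⋀^Fin p]→L[ℂ] ℂ) {z : Fin d → ℂ}
    (hz : z ∈ ψ.target) (hz' : ψ.symm z ∈ φ.source) :
    inChart ψ η z = (inChart φ η ((φ ∘ ψ.symm) z)).compContinuousLinearMap
      (fderiv ℂ (φ ∘ ψ.symm) z) := by
  have hpt : φ.symm ((φ ∘ ψ.symm) z) = ψ.symm z := φ.left_inv hz'
  have hzt : (φ ∘ ψ.symm) z ∈ φ.target := φ.map_source hz'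
  unfold inChart
  rw [(mfderiv_symm_eq hφ hzt).2, (mfderiv_symm_eq hψ hz).2, hpt]
  have hch : DifferentiableAt ℂ (chartAt (Fin d → ℂ) (ψ.symm z) ∘ φ.symm) ((φ ∘ ψ.symm) z) := by
    refine (transition_contDiffAt (chartAt_mem _) hφ hzt ?_).differentiableAt (by simp)
    rw [hpt]
    exact mem_chart_source _ _
  have hcomp : (chartAt (Fin d → ℂ) (ψ.symm z) ∘ φ.symm) ∘ (φ ∘ ψ.symm) =ᶠ[𝓝 z]
      chartAt (Fin d → ℂ) (ψ.symm z) ∘ ψ.symm := by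
    have : ∀ᶠ w in 𝓝 z, ψ.symm w ∈ φ.source :=
      (ψ.symm.continuousAt hz).eventually (φ.open_source.mem_nhds hz')
    filter_upwards [this] with w hw
    simp only [Function.comp_apply, φ.left_inv hw]
  rw [← hcomp.fderiv_eq, fderiv_comp z hch
    ((transition_contDiffAt hφ hψ hz hz').differentiableAt (by simp))]
  rfl

/-- The exterior derivative can be computed in any chart. -/
lemma inChart_extDerivOff {p : ℕ} {D : Set X} {φ : OpenPartialHomeomorph X (Fin d → ℂ)}
    (hφ : φ ∈ IsManifold.maximalAtlas 𝓘(ℂ, Fin d → ℂ) ω X)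
    {η : X → (Fin d → ℂ) [⋀^Fin p]→L[ℂ] ℂ} {z : Fin d → ℂ} (hz : z ∈ φ.target)
    (hD : φ.symm z ∉ D) (hη : DifferentiableAt ℂ (inChart φ η) z) :
    inChart φ (extDerivOff D η) z = extDeriv (inChart φ η) z := by
  set y := φ.symm z with hy
  set ψ := chartAt (Fin d → ℂ) y with hψdef
  have hψ : ψ ∈ IsManifold.maximalAtlas 𝓘(ℂ, Fin d → ℂ) ω X := chartAt_mem y
  have hyφ : y ∈ φ.source := φ.map_target hz
  have hyψ : y ∈ ψ.source := mem_chart_source _ _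
  have hzy : φ y = z := φ.right_inv hz
  have hy' : ψ.symm (ψ y) = y := ψ.left_inv hyψ
  have ht0 : (φ ∘ ψ.symm) (ψ y) = z := by simp only [Function.comp_apply, hy', hzy]
  have hyt : ψ y ∈ ψ.target := ψ.map_source hyψ
  have hyt' : ψ.symm (ψ y) ∈ φ.source := by rwa [hy']
  have h1 : inChart ψ η =ᶠ[𝓝 (ψ y)] fun w =>
      (inChart φ η ((φ ∘ ψ.symm) w)).compContinuousLinearMap (fderiv ℂ (φ ∘ ψ.symm) w) := by
    have e1 : ∀ᶠ w in 𝓝 (ψ y), ψ.symm w ∈ φ.source :=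
      (ψ.symm.continuousAt hyt).eventually (φ.open_source.mem_nhds hyt')
    filter_upwards [e1, ψ.open_target.mem_nhds hyt] with w hw hw'
    exact inChart_transition hφ hψ η hw' hw
  have h2 : extDerivOff D η y = (extDeriv (inChart φ η) z).compContinuousLinearMap
      (fderiv ℂ (φ ∘ ψ.symm) (ψ y)) := by
    rw [extDerivOff, if_neg hD, ← hψdef, h1.extDeriv_eq, extDeriv_pullback
      (by rwa [ht0]) (transition_contDiffAt hφ hψ hyt hyt') (by simp), ht0]
  have h3 : (fderiv ℂ (φ ∘ ψ.symm) (ψ y)).comp (fderiv ℂ (ψ ∘ φ.symm) z) =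
      ContinuousLinearMap.id ℂ (Fin d → ℂ) := by
    have hz2 : (ψ ∘ φ.symm) z = ψ y := rfl
    have e : (φ ∘ ψ.symm) ∘ (ψ ∘ φ.symm) =ᶠ[𝓝 z] id := by
      have e1 : ∀ᶠ w in 𝓝 z, φ.symm w ∈ ψ.source :=
        (φ.symm.continuousAt hz).eventually (ψ.open_source.mem_nhds hyψ)
      filter_upwards [e1, φ.open_target.mem_nhds hz] with w hw hw'
      simp only [Function.comp_apply, ψ.left_inv hw, φ.right_inv hw', id]
    have h4 := fderiv_comp z (g := φ ∘ ψ.symm) (f := ψ ∘ φ.symm)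
      ((transition_contDiffAt hφ hψ hyt hyt').differentiableAt (by simp))
      ((transition_contDiffAt hψ hφ hz hyψ).differentiableAt (by simp))
    rw [e.fderiv_eq, fderiv_id, hz2] at h4
    exact h4.symm
  unfold inChart
  rw [(mfderiv_symm_eq hφ hz).2, ← hy, ← hψdef, h2]
  ext v
  change extDeriv (inChart φ η) z (fun i => ((fderiv ℂ (φ ∘ ψ.symm) (ψ y)).comp
    (fderiv ℂ (ψ ∘ φ.symm) z)) (v i)) = _
  rw [h3]
  rfl

lemma IsLogFormAt.extDerivOff {p : ℕ} {S : Finset (PrimeDivisor d X)}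
    {E : PrimeDivisor d X → ℤ} {η : X → (Fin d → ℂ) [⋀^Fin p]→L[ℂ] ℂ} {x : X}
    (hη : IsLogFormAt S E η x) : IsLogFormAt S E (extDerivOff (unionOf S) η) x := by
  refine ⟨fun hx => if_pos hx, fun c J => ?_⟩
  obtain ⟨g, hg, h⟩ := hη.exists_coefficients c
  refine ⟨fun w => ∑ i : Fin (p + 1), (-1 : ℂ) ^ (i : ℕ) *
    (c.logCoord (J i) w * fderiv ℂ (g (i.removeNth J)) w (Pi.single (J i) 1) +
      c.factorDeriv E (i.removeNth J) (J i) * g (i.removeNth J) w), ?_, ?_⟩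
  · refine Finset.analyticAt_fun_sum _ fun i _ => ?_
    have hl : AnalyticAt ℂ (c.logCoord (J i)) (c.chart x) := by
      by_cases hk : (c.comp (J i)).isSome
      · have : c.logCoord (J i) = fun w => w (J i) := by
          funext w
          simp [AdaptedChart.logCoord, hk]
        rw [this]
        exact (ContinuousLinearMap.proj (R := ℂ) (φ := fun _ : Fin d => ℂ) (J i)).analyticAt _
      · have : c.logCoord (J i) = fun w => 1 := by
          funext w
          simp [AdaptedChart.logCoord, hk]
        rw [this]
        exact analyticAt_const
    have hf : AnalyticAt ℂ (fun w => fderiv ℂ (g (i.removeNth J)) w (Pi.single (J i) 1))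
        (c.chart x) :=
      ((ContinuousLinearMap.apply ℂ ℂ
        (Pi.single (J i) 1 : Fin d → ℂ)).analyticAt _).comp (hg (i.removeNth J)).fderiv
    exact analyticAt_const.mul ((hl.mul hf).add (analyticAt_const.mul (hg _)))
  · filter_upwards [h, c.chart.open_target.mem_nhds (c.chart.map_source c.mem_source)]
      with z hz hzt hk
    obtain ⟨ha, hI⟩ := hz hk
    rw [inChart_extDerivOff c.mem_atlas hzt (c.symm_notMem hzt hk) ha.differentiableAt,
      extDeriv_apply ha.differentiableAt, Finset.sum_mul, Finset.mul_sum]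
    refine Finset.sum_congr rfl fun i _ => ?_
    have hv : (i.removeNth fun j => (Pi.single (J j) 1 : Fin d → ℂ)) =
        fun j => Pi.single (i.removeNth J j) 1 := rfl
    obtain ⟨hg1, hg2⟩ := hI (i.removeNth J)
    have hF := c.hasLogDeriv_factor E (i.removeNth J) hk
    rw [hv, hg2.fderiv_eq, fderiv_fun_mul hF.1.differentiableAt hg1.differentiableAt,
      Fin.prod_univ_succAbove _ i]
    have h1 := hF.2 (J i)
    have h2 := c.factor_mul E (i.removeNth J) hk
    have h3 : ∏ j, c.logCoord (J (i.succAbove j)) z = ∏ j, c.logCoord (i.removeNth J j) z := rfl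
    rw [h3, ← h2]
    simp only [add_apply, smul_apply, smul_eq_mul,
      zsmul_eq_mul, Int.cast_pow, Int.cast_neg, Int.cast_one]
    linear_combination (-1 : ℂ) ^ (i : ℕ) * g (i.removeNth J) z *
      (∏ j, c.logCoord (i.removeNth J j) z) * h1

/-- The exterior derivative as an operator between sheaves of logarithmic forms. -/
def logFormDeriv (S : Finset (PrimeDivisor d X)) (E : PrimeDivisor d X → ℤ) (p : ℕ) :
    LocalCondition.Operator (logFormCondition S E p) (logFormCondition S E (p + 1)) where
  toFun := extDerivOff (unionOf S)
  congr := by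
    intro f g x hfg
    unfold extDerivOff
    split_ifs
    · rfl
    · exact (inChart_congr (mem_chart_source _ x) hfg).extDeriv_eq
  add := by
    intro f g x hf hg
    unfold extDerivOff
    split_ifs with hx
    · simp
    · rw [inChart_add]
      exact extDeriv_add
        (IsLogFormAt.analyticAt hf hx (chartAt_mem x) (mem_chart_source _ x)).differentiableAt
        (IsLogFormAt.analyticAt hg hx (chartAt_mem x) (mem_chart_source _ x)).differentiableAt
  smul := by
    intro a f x hf
    unfold extDerivOff
    split_ifs with hx
    · simp
    · rw [inChart_smul]
      exact extDeriv_smul a _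
  maps := fun h => h.self_of_nhds.extDerivOff

lemma extDerivOff_extDerivOff {p : ℕ} {S : Finset (PrimeDivisor d X)}
    {E : PrimeDivisor d X → ℤ} {η : X → (Fin d → ℂ) [⋀^Fin p]→L[ℂ] ℂ} {x : X}
    (hη : IsLogFormAt S E η x) :
    extDerivOff (unionOf S) (extDerivOff (unionOf S) η) x = 0 := by
  by_cases hx : x ∈ unionOf S
  · exact if_pos hx
  rw [extDerivOff, if_neg hx]
  set ψ := chartAt (Fin d → ℂ) x with hψ
  have hxs : x ∈ ψ.source := mem_chart_source _ x
  have ha : AnalyticAt ℂ (inChart ψ η) (ψ x) := hη.analyticAt hx (chartAt_mem x) hxs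
  have h1 : ∀ᶠ z in 𝓝 (ψ x), ψ.symm z ∉ unionOf S := by
    have := ψ.symm.continuousAt (ψ.map_source hxs)
    refine this.eventually ((isClosed_unionOf S).isOpen_compl.mem_nhds ?_)
    rwa [ψ.left_inv hxs]
  have h2 : inChart ψ (extDerivOff (unionOf S) η) =ᶠ[𝓝 (ψ x)] extDeriv (inChart ψ η) := by
    filter_upwards [h1, ha.eventually_analyticAt, ψ.open_target.mem_nhds (ψ.map_source hxs)]
      with z hz hz' hzt
    exact inChart_extDerivOff (chartAt_mem x) hzt hz hz'.differentiableAt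
  rw [h2.extDeriv_eq]
  exact extDeriv_extDeriv_apply (r := ω) ha.contDiffAt (by simp)

end Derivative

/-! ### The complexes `Ω_{X|Y,Z}` -/

/-- Sheaves of complex vector spaces on `X`. -/
abbrev CSheaf (X : Type) [TopologicalSpace X] : Type 1 :=
  Sheaf (Opens.grothendieckTopology X) (ModuleCat.{0} ℂ)

section Complexes

lemma IsLogFormAt.mono {p : ℕ} {S S' : Finset (PrimeDivisor d X)} {E E' : PrimeDivisor d X → ℤ}
    (hS : S = S') (hE : ∀ T ∈ S, E T ≤ E' T) {η : X → (Fin d → ℂ) [⋀^Fin p]→L[ℂ] ℂ} {x : X}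
    (hη : IsLogFormAt S E η x) : IsLogFormAt S' E' η x := by
  subst hS
  refine ⟨hη.1, fun c I => ?_⟩
  obtain ⟨g, hg, h⟩ := hη.2 c I
  have hm : ∀ k, c.mult E k ≤ c.mult E' k := by
    intro k
    unfold AdaptedChart.mult
    rcases hk : c.comp k with _ | T
    · simp
    · simpa using hE T (c.comp_mem k T hk).1
  refine ⟨fun w => (∏ k, w k ^ (c.mult E' k - c.mult E k).toNat) * g w, ?_, ?_⟩
  · refine AnalyticAt.mul (Finset.analyticAt_fun_prod _ fun k _ => ?_) hg
    exact ((ContinuousLinearMap.proj (R := ℂ) (φ := fun _ : Fin d => ℂ) k).analyticAt _).fun_pow _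
  · filter_upwards [h] with z hz hk
    rw [hz hk, ← mul_assoc]
    congr 1
    unfold AdaptedChart.generator
    rw [← Finset.prod_mul_distrib]
    refine Finset.prod_congr rfl fun k _ => ?_
    by_cases hs : (c.comp k).isSome
    · rw [← zpow_natCast, Int.toNat_of_nonneg (sub_nonneg.2 (hm k)), ← zpow_add₀ (hk k hs)]
      congr 1
      ring
    · rw [Option.not_isSome_iff_eq_none] at hs
      simp [AdaptedChart.mult, hs]

/-- The sheaf of locally constant functions vanishing on the closed set `A`: the kernel of
`ℂ_X → i_* ℂ_A`, i.e. the extension by zero `j_! ℂ_{X ∖ A}`. -/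
def constVanishing (X : Type) [TopologicalSpace X] (A : Set X) : LocalCondition X ℂ where
  holds f x := (∀ᶠ y in 𝓝 x, f y = f x) ∧ (x ∈ A → f x = 0)
  congr := by
    intro f g x hfg hf
    refine ⟨?_, fun hx => hfg.self_of_nhds ▸ hf.2 hx⟩
    filter_upwards [hf.1, hfg] with y h1 h2
    rw [← h2, h1, hfg.self_of_nhds]
  zero := fun x => ⟨by simp, fun _ => rfl⟩
  add := by
    intro f g x hf hg
    refine ⟨?_, fun hx => by simp [hf.2 hx, hg.2 hx]⟩
    filter_upwards [hf.1, hg.1] with y h1 h2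
    simp [h1, h2]
  smul := by
    intro c f x hf
    refine ⟨?_, fun hx => by simp [hf.2 hx]⟩
    filter_upwards [hf.1] with y h1
    simp [h1]

/-- A function off `D`, viewed as a differential form of degree zero. -/
def toZeroForm (D : Set X) (f : X → ℂ) (x : X) : (Fin d → ℂ) [⋀^Fin 0]→L[ℂ] ℂ :=
  open Classical in
  if x ∈ D then 0 else ContinuousAlternatingMap.constOfIsEmpty ℂ (Fin d → ℂ) (Fin 0) (f x)

lemma isLogFormAt_toZeroForm {S : Finset (PrimeDivisor d X)} {E : PrimeDivisor d X → ℤ}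
    {A : Set X} (hA : ∀ T ∈ S, E T < 0 → T.carrier ⊆ A) {f : X → ℂ} {x : X}
    (hf : (constVanishing X A).holds f x) :
    IsLogFormAt S E (toZeroForm (d := d) (unionOf S) f) x := by
  refine ⟨fun hx => if_pos hx, fun c I => ?_⟩
  refine ⟨fun w => (∏ k, w k ^ (c.mult E k).toNat) * f x, ?_, ?_⟩
  · refine AnalyticAt.mul (Finset.analyticAt_fun_prod _ fun k _ => ?_) analyticAt_const
    exact ((ContinuousLinearMap.proj (R := ℂ) (φ := fun _ : Fin d => ℂ) k).analyticAt _).fun_pow _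
  · have h1 : Tendsto c.chart.symm (𝓝 (c.chart x)) (𝓝 x) := by
      have := c.chart.symm.continuousAt (c.chart.map_source c.mem_source)
      rwa [ContinuousAt, c.chart.left_inv c.mem_source] at this
    filter_upwards [h1.eventually hf.1,
      c.chart.open_target.mem_nhds (c.chart.map_source c.mem_source)] with z hz hzt hk
    have hD := c.symm_notMem hzt hk
    have e1 : inChart c.chart (toZeroForm (d := d) (unionOf S) f) z
        (fun j => Pi.single (I j) 1) = f x := by
      unfold inChart toZeroForm
      rw [if_neg hD, hz]
      rfl
    rw [e1, Finset.univ_eq_empty, Finset.prod_empty, mul_one]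
    by_cases hfx : f x = 0
    · simp [hfx]
    have hE : ∀ k, 0 ≤ c.mult E k := by
      intro k
      unfold AdaptedChart.mult
      rcases hk : c.comp k with _ | T
      · simp
      · by_contra hneg
        exact hfx (hf.2 (hA T (c.comp_mem k T hk).1 (by simpa using hneg)
          (c.comp_mem k T hk).2))
    rw [← mul_assoc]
    unfold AdaptedChart.generator
    rw [← Finset.prod_mul_distrib, Finset.prod_eq_one, one_mul]
    intro k _
    by_cases hs : (c.comp k).isSome
    · rw [← zpow_natCast, Int.toNat_of_nonneg (hE k), ← zpow_add₀ (hk k hs)]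
      simp
    · rw [Option.not_isSome_iff_eq_none] at hs
      simp [AdaptedChart.mult, hs]

namespace EffectiveDivisor

lemma support_eq {Y Y' : EffectiveDivisor d X} (h : Y' = Y ∨ Y' = Y.red) :
    Y'.support = Y.support := by
  rcases h with rfl | rfl
  · rfl
  · exact support_red Y

lemma supp_eq {Y Y' : EffectiveDivisor d X} (h : Y' = Y ∨ Y' = Y.red) : Y'.supp = Y.supp := by
  unfold supp
  rw [support_eq h]

lemma support_add_eq {Y Z Y' Z' Y'' Z'' : EffectiveDivisor d X}
    (hY' : Y' = Y ∨ Y' = Y.red) (hZ' : Z' = Z ∨ Z' = Z.red)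
    (hY'' : Y'' = Y ∨ Y'' = Y.red) (hZ'' : Z'' = Z ∨ Z'' = Z.red) :
    (Y' + Z').support = (Y'' + Z'').support := by
  have h1 : Y'.support = Y''.support := (support_eq hY').trans (support_eq hY'').symm
  have h2 : Z'.support = Z''.support := (support_eq hZ').trans (support_eq hZ'').symm
  ext T
  have h3 := congrArg (T ∈ ·) h1
  have h4 := congrArg (T ∈ ·) h2
  simp only [Finsupp.mem_support_iff, eq_iff_iff] at h3 h4
  simp only [Finsupp.mem_support_iff, Finsupp.add_apply]
  omega

lemma isClosed_supp (Y : EffectiveDivisor d X) : IsClosed Y.supp := isClosed_unionOf Y.support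

/-- The open complement of the support of a divisor. -/
def compl (Y : EffectiveDivisor d X) : Opens X := ⟨Y.suppᶜ, Y.isClosed_supp.isOpen_compl⟩

end EffectiveDivisor

lemma extDerivOff_toZeroForm {S : Finset (PrimeDivisor d X)} {f : X → ℂ} {x : X}
    (hf : ∀ᶠ y in 𝓝 x, f y = f x) :
    extDerivOff (unionOf S) (toZeroForm (d := d) (unionOf S) f) x = 0 := by
  by_cases hx : x ∈ unionOf S
  · exact if_pos hx
  rw [extDerivOff, if_neg hx]
  have h : toZeroForm (d := d) (unionOf S) f =ᶠ[𝓝 x] fun _ =>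
      ContinuousAlternatingMap.constOfIsEmpty ℂ (Fin d → ℂ) (Fin 0) (f x) := by
    filter_upwards [hf, (isClosed_unionOf S).isOpen_compl.mem_nhds hx] with y hy hyD
    rw [toZeroForm, if_neg hyD, hy]
  have h2 : inChart (chartAt (Fin d → ℂ) x) (fun _ =>
      ContinuousAlternatingMap.constOfIsEmpty ℂ (Fin d → ℂ) (Fin 0) (f x)) = fun _ =>
      ContinuousAlternatingMap.constOfIsEmpty ℂ (Fin d → ℂ) (Fin 0) (f x) := rfl
  rw [(inChart_congr (mem_chart_source _ x) h).extDeriv_eq, h2, extDeriv_constOfIsEmpty]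
  ext v
  simp

/-- The coefficients of the divisor `-Y + Z - Z_red`. -/
def twist (Y Z : EffectiveDivisor d X) (T : PrimeDivisor d X) : ℤ :=
  -(Y T : ℤ) + (Z T : ℤ) - (Z.red T : ℤ)

lemma subset_of_twist_neg {Y Z : EffectiveDivisor d X} {A : Set X} (hA : Y.supp = A) :
    ∀ T ∈ (Y + Z).support, twist Y Z T < 0 → T.carrier ⊆ A := by
  intro T _ hT
  have hY : T ∈ Y.support := by
    rw [Finsupp.mem_support_iff]
    intro h0
    simp only [twist, EffectiveDivisor.red_apply, h0] at hT
    omega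
  rw [← hA]
  exact Set.subset_biUnion_of_mem (u := fun T : PrimeDivisor d X => T.carrier) hY

variable [IsManifold 𝓘(ℂ, Fin d → ℂ) ω X]

/-- The complex with terms `Ω^p(log D) ⊗ 𝒪(E)`, where `D` is the union of `S` and `E` is a
divisor supported in `D` (only the values of `E` on `S` are used). -/
def logDeRham (S : Finset (PrimeDivisor d X)) (E : PrimeDivisor d X → ℤ) :
    CochainComplex (CSheaf X) ℕ :=
  CochainComplex.of (fun p => (logFormCondition S E p).sheaf)
    (fun p => (logFormDeriv S E p).sheafHom)
    (fun _ => LocalCondition.Operator.sheafHom_comp_eq_zero _ _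
      fun _ _ h => extDerivOff_extDerivOff (E := E) h.self_of_nhds)

lemma logDeRham_d (S : Finset (PrimeDivisor d X)) (E : PrimeDivisor d X → ℤ) (p : ℕ) :
    (logDeRham S E).d p (p + 1) = (logFormDeriv S E p).sheafHom :=
  CochainComplex.of_d (fun p => (logFormCondition S E p).sheaf)
    (fun p => (logFormDeriv S E p).sheafHom) p

/-- The complex `Ω_{X|Y,Z}` with terms `Ω^p(log (Y + Z)_red) ⊗ 𝒪(-Y + Z - Z_red)`. -/
def omegaComplex (Y Z : EffectiveDivisor d X) : CochainComplex (CSheaf X) ℕ :=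
  logDeRham (Y + Z).support (twist Y Z)

/-- The inclusion `Ω(log D) ⊗ 𝒪(E) ⊆ Ω(log D) ⊗ 𝒪(E')` for `E ≤ E'`. -/
def logDeRhamInclusion {S S' : Finset (PrimeDivisor d X)} {E E' : PrimeDivisor d X → ℤ}
    (hS : S = S') (hE : ∀ T ∈ S, E T ≤ E' T) : logDeRham S E ⟶ logDeRham S' E' :=
  CochainComplex.ofHom
    (fun p => LocalCondition.inclusion (logFormCondition S E p) (logFormCondition S' E' p)
      fun _ _ h => IsLogFormAt.mono hS hE h)
    (fun p => by
      subst hS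
      simp only [logDeRham, CochainComplex.of_d]
      rfl)

/-- The inclusion `Ω_{X|Y,Z} ⊆ Ω_{X|Y',Z'}` for `Y ≥ Y'` and `Z ≤ Z'`, for pairs with the same
supports. -/
def omegaInclusion {Y Z Y' Z' : EffectiveDivisor d X}
    (hS : (Y + Z).support = (Y' + Z').support) (hY : Y' ≤ Y) (hZ : Z ≤ Z') :
    omegaComplex Y Z ⟶ omegaComplex Y' Z' :=
  logDeRhamInclusion hS fun T _ => by
    have h1 : Y' T ≤ Y T := hY T
    have h2 : Z T ≤ Z' T := hZ T
    simp only [twist, EffectiveDivisor.red_apply]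
    omega

/-- Locally constant functions vanishing on `A` as sections of `𝒪(E)`, if all components with
negative coefficient in `E` are contained in `A`. -/
def zeroFormOperator {S : Finset (PrimeDivisor d X)} {E : PrimeDivisor d X → ℤ}
    {A : Set X} (hA : ∀ T ∈ S, E T < 0 → T.carrier ⊆ A) :
    LocalCondition.Operator (constVanishing X A) (logFormCondition S E 0) where
  toFun := toZeroForm (unionOf S)
  congr := by
    intro f g x hfg
    unfold toZeroForm
    rw [hfg.self_of_nhds]
  add := by
    intro f g x _ _
    unfold toZeroForm
    split_ifs
    · simp
    · rfl
  smul := by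
    intro a f x _
    unfold toZeroForm
    split_ifs
    · simp
    · rfl
  maps := fun h => isLogFormAt_toZeroForm hA h.self_of_nhds

/-- The canonical morphism of sheaves `j_! ℂ_{X ∖ A} → 𝒪(E)` composes to zero with `d`. -/
lemma zeroFormOperator_comp_d {S : Finset (PrimeDivisor d X)} {E : PrimeDivisor d X → ℤ}
    {A : Set X} (hA : ∀ T ∈ S, E T < 0 → T.carrier ⊆ A) :
    (show (constVanishing X A).sheaf ⟶ (logDeRham S E).X 0 from
      (zeroFormOperator hA).sheafHom) ≫ (logDeRham S E).d 0 1 = 0 := by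
  have h : (zeroFormOperator hA).sheafHom ≫ (logFormDeriv S E 0).sheafHom = 0 :=
    LocalCondition.Operator.sheafHom_comp_eq_zero _ _
      fun f x h => extDerivOff_toZeroForm (Eventually.self_of_nhds h).1
  rw [← logDeRham_d S E 0] at h
  exact h

/-- The canonical morphism of complexes `j_! ℂ_{X ∖ |Y|} → Ω_{X|Y,Z}` which views a locally
constant function vanishing on `|Y|` as a section of `𝒪(-Y + Z - Z_red)`. -/
def augmentation (Y Z : EffectiveDivisor d X) {A : Set X} (hA : Y.supp = A) :
    (CochainComplex.single₀ (CSheaf X)).obj (constVanishing X A).sheaf ⟶ omegaComplex Y Z :=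
  (CochainComplex.fromSingle₀Equiv (omegaComplex Y Z) (constVanishing X A).sheaf).symm
    ⟨(zeroFormOperator (subset_of_twist_neg (Z := Z) hA)).sheafHom,
      zeroFormOperator_comp_d (subset_of_twist_neg (Z := Z) hA)⟩

end Complexes

end Divisors

/-! ### Hypercohomology -/

section Hypercohomology

variable {X : Type} [TopologicalSpace X]

/-- The sheaf `j_! ℂ_V` for an open subset `V`, as the sheaf associated with the presheaf of free
modules on the representable presheaf of sets; homomorphisms from it to a sheaf `F` are the
sections of `F` over `V`. -/
def freeSheaf (X : Type) [TopologicalSpace X] : Opens X ⥤ CSheaf X :=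
  yoneda ⋙ (Functor.whiskeringRight _ _ _).obj (ModuleCat.free ℂ) ⋙
    presheafToSheaf (Opens.grothendieckTopology X) (ModuleCat.{0} ℂ)

variable [HasDerivedCategory.{w} (CSheaf X)]

/-- A complex in nonnegative degrees as an object of the derived category. -/
def toDerived (X : Type) [TopologicalSpace X] [HasDerivedCategory.{w} (CSheaf X)] :
    CochainComplex (CSheaf X) ℕ ⥤ DerivedCategory (CSheaf X) :=
  ComplexShape.embeddingUpNat.extendFunctor (CSheaf X) ⋙ DerivedCategory.Q

/-- The hypercohomology `H^n(V, K)`, as the space of morphisms from `j_! ℂ_V` to `K[n]` in the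
derived category of sheaves of complex vector spaces on `X`. -/
abbrev Hyper (V : Opens X) (K : CochainComplex (CSheaf X) ℕ) (n : ℤ) : Type w :=
  (DerivedCategory.singleFunctor (CSheaf X) 0).obj ((freeSheaf X).obj V) ⟶
    ((toDerived X).obj K)⟦n⟧

/-- The map on hypercohomology induced by a morphism of complexes. -/
def hyperMap (V : Opens X) {K L : CochainComplex (CSheaf X) ℕ} (f : K ⟶ L) (n : ℤ) :
    Hyper V K n →ₗ[ℂ] Hyper V L n :=
  Linear.rightComp ℂ _ (((toDerived X).map f)⟦n⟧')

/-- Restriction of hypercohomology classes to a smaller open set. -/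
def hyperRestrict {V W : Opens X} (h : W ≤ V) (K : CochainComplex (CSheaf X) ℕ) (n : ℤ) :
    Hyper V K n →ₗ[ℂ] Hyper W K n :=
  Linear.leftComp ℂ _ ((DerivedCategory.singleFunctor (CSheaf X) 0).map
    ((freeSheaf X).map (homOfLE h)))

/-- The relative cohomology `H^n(V, A ∩ V; ℂ)` for an open set `V` and a closed set `A`: the
cohomology of `V` with coefficients in the kernel of `ℂ → i_* ℂ_A`. -/
abbrev RelCohomology (V : Opens X) (A : Set X) (n : ℤ) : Type w :=
  Hyper V ((CochainComplex.single₀ (CSheaf X)).obj (constVanishing X A).sheaf) n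

end Hypercohomology

end

/-!
# Twisted logarithmic de Rham complexes of a pair of divisors

Near a point choose coordinates in which the divisor is `∏_{k ∈ L} z_k = 0`. In the frame of the forms
`dz_k / z_k` (`k ∈ L`) and `dz_k` (`k ∉ L`), multiplied by the generator `∏ z_k ^ m_k` of the twist, the
exterior derivative becomes the operator `dLog`: the exterior derivative along the commuting vector
fields `z_k ∂/∂z_k` and `∂/∂z_k`, plus the exterior product with `∑ m_k dz_k / z_k`
(`extDeriv_frame`). Thus a component has the residue `m_k`, which is the negative of its coefficient
in the twist; along `Y` the residues are positive, along `Z` they are at most zero, and along `Z_red`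
they vanish. The basic tool is Cartan's formula `ι_k D + D ι_k = z_k ∂/∂z_k + m_k` (`contr_dLog`)
together with existence and uniqueness for the Euler equation `z_k ∂u/∂z_k + m u = g`
(`exists_euler_solution`, `euler_unique`).

*Change of the twist.* Let the coefficient of one component be raised by one, to a nonzero value.
Subtracting from a form its restriction to the component gives a form that comes from the smaller
twist, and by Cartan's formula the restriction of a closed form is exact, as the residue is not zero.
Hence the inclusion is a quasi-isomorphism (`locInj_update`, `locSurj_update`). The coefficients in
question are all negative along `Y` and all nonnegative along `Z`, so that one may pass between any two
of the complexes in such steps (`quasiIso_logDeRhamInclusion`, `quasiIso_omegaInclusion`).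

*Off `Z`.* A positive residue makes all closed forms exact (`exists_dLog_eq_of_pos`), and off the
divisor the Poincaré lemma holds (`exists_d_eq_of_notMem`). So over the complement of `Z` the complex
is a resolution of the sheaf of locally constant functions vanishing on `Y` (`locInj_augmentation`,
`locSurj_augmentation`).

*Restriction to the complement of `Z`.* By the change of the twist `Z` may be taken reduced, with zero
residues along `Z`. Let `I` be an injective resolution. It has to be shown that the global sections of
`I` with support in `Z` form an exact complex, and as these sheaves are flasque, it is enough to do
this locally (`SecCx.exact_of_locally_exact`, `hyperRestrict_bijective`). Near a point of `Z`, a closed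
section of `I` is, up to an exact one, a combination with constant coefficients of products of the
`dz_k / z_k` (`exists_const_add_dLog`). These forms represent the cohomology of a box punctured along
the hyperplanes `z_k = 0`: this follows by induction on the number of hyperplanes from the case of a
box, by the Mayer–Vietoris sequence, with branches of `log z_k` as connecting primitives
(`represents_puncturedBox`). Consequently a combination which is exact off `Z` is zero, and the
remaining primitive can be corrected to vanish off `Z` (`Represents.exists_primitive_vanishing`).

Hypercohomology is a group of morphisms in the derived category from the sheaf `j_! ℂ_U`. By its
universal property and the K-injectivity of bounded below injective complexes, these morphisms
vanish when the corresponding complex of sections of a resolution is exact (`derived_hom_eq_zero`).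
The isomorphism `e` is the map induced by the resolution over the complement of `Z`, followed by the
inverse of the restriction map.
-/

noncomputable section

/-! ### Sections of sheaves and quasi-isomorphisms -/

section SheafSections

open Opposite

variable {X : Type} [TopologicalSpace X]

/-- The sections of a sheaf over an open set. -/
abbrev Sec (F : CSheaf X) (V : Opens X) : Type := F.obj.obj (op V)

/-- Restriction of sections. -/
def resL (F : CSheaf X) {V W : Opens X} (h : W ≤ V) : Sec F V →ₗ[ℂ] Sec F W :=
  (F.obj.map (homOfLE h).op).hom

/-- The effect of a morphism of sheaves on sections. -/
def secMap {F G : CSheaf X} (f : F ⟶ G) (V : Opens X) : Sec F V →ₗ[ℂ] Sec G V :=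
  (f.hom.app (op V)).hom

lemma resL_resL (F : CSheaf X) {V W W' : Opens X} (h : W ≤ V) (h' : W' ≤ W) (s : Sec F V) :
    resL F h' (resL F h s) = resL F (h'.trans h) s := by
  have := F.obj.map_comp (homOfLE h).op (homOfLE h').op
  exact (LinearMap.congr_fun (congrArg ModuleCat.Hom.hom this) s).symm

lemma resL_self (F : CSheaf X) {V : Opens X} (h : V ≤ V) (s : Sec F V) : resL F h s = s := by
  have := F.obj.map_id (op V)
  exact LinearMap.congr_fun (congrArg ModuleCat.Hom.hom this) s

lemma secMap_resL {F G : CSheaf X} (f : F ⟶ G) {V W : Opens X} (h : W ≤ V) (s : Sec F V) :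
    secMap f W (resL F h s) = resL G h (secMap f V s) := by
  have := f.hom.naturality (homOfLE h).op
  exact LinearMap.congr_fun (congrArg ModuleCat.Hom.hom this) s

lemma secMap_comp {F G H : CSheaf X} (f : F ⟶ G) (g : G ⟶ H) (V : Opens X) (s : Sec F V) :
    secMap (f ≫ g) V s = secMap g V (secMap f V s) := rfl

lemma secMap_id {F : CSheaf X} (V : Opens X) (s : Sec F V) : secMap (𝟙 F) V s = s := rfl

lemma secMap_zero {F G : CSheaf X} (V : Opens X) (s : Sec F V) : secMap (0 : F ⟶ G) V s = 0 := rfl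

lemma secMap_add {F G : CSheaf X} (f g : F ⟶ G) (V : Opens X) (s : Sec F V) :
    secMap (f + g) V s = secMap f V s + secMap g V s := rfl

lemma secMap_ext {F G : CSheaf X} {f g : F ⟶ G} (h : ∀ V s, secMap f V s = secMap g V s) :
    f = g := by
  ext V s
  exact h V.unop s

/-- The sections of a sheaf glue uniquely. -/
lemma existsUnique_glue (F : CSheaf X) {ι : Type} (U : ι → Opens X) (s : ∀ i, Sec F (U i))
    (hs : ∀ i j, resL F (inf_le_left : U i ⊓ U j ≤ U i) (s i) =
      resL F (inf_le_right : U i ⊓ U j ≤ U j) (s j)) :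
    ∃! t : Sec F (iSup U), ∀ i, resL F (le_iSup U i) t = s i := by
  have h : TopCat.Presheaf.IsSheaf (X := TopCat.of X) F.obj := F.property
  rw [TopCat.Presheaf.isSheaf_iff_isSheafUniqueGluing.{0}] at h
  exact h U s hs

/-- The tautological section of `j_! ℂ_V` over `V`. -/
def unitSec (V : Opens X) : Sec ((freeSheaf X).obj V) V :=
  ((sheafificationAdjunction (Opens.grothendieckTopology X) (ModuleCat.{0} ℂ)).unit.app
    (yoneda.obj V ⋙ ModuleCat.free ℂ)).app (op V)
    (ModuleCat.freeMk (R := ℂ) (𝟙 V))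

/-- The morphism `j_! ℂ_W → j_! ℂ_V` maps the tautological section to the restriction of the tautological
section. -/
lemma secMap_free_unitSec {V W : Opens X} (h : W ≤ V) :
    secMap ((freeSheaf X).map (homOfLE h)) W (unitSec W) =
      resL ((freeSheaf X).obj V) h (unitSec V) := by
  let J := Opens.grothendieckTopology X
  let η := (sheafificationAdjunction J (ModuleCat.{0} ℂ)).unit
  have h1 := congrArg (fun t => (ConcreteCategory.hom (t.app (op W))) (ModuleCat.freeMk (R := ℂ) (𝟙 W)))
    (η.naturality (Functor.whiskerRight (yoneda.map (homOfLE h)) (ModuleCat.free ℂ)))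
  have h2 := congrArg (fun t => (ConcreteCategory.hom t) (ModuleCat.freeMk (R := ℂ) (𝟙 V)))
    ((η.app (yoneda.obj V ⋙ ModuleCat.free ℂ)).naturality (homOfLE h).op)
  refine Eq.trans ?_ (Eq.trans h1.symm (Eq.trans ?_ h2))
  · rfl
  · change (ConcreteCategory.hom ((η.app (yoneda.obj V ⋙ ModuleCat.free ℂ)).app (op W)))
        ((ModuleCat.free ℂ).map ((yoneda.map (homOfLE h)).app (op W)) (ModuleCat.freeMk (𝟙 W))) =
      (ConcreteCategory.hom ((η.app (yoneda.obj V ⋙ ModuleCat.free ℂ)).app (op W)))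
        ((ModuleCat.free ℂ).map ((yoneda.obj V).map (homOfLE h).op) (ModuleCat.freeMk (𝟙 V)))
    rw [ModuleCat.free_map_apply, ModuleCat.free_map_apply]
    rfl

lemma unitSec_bijective (V : Opens X) (F : CSheaf X) :
    Function.Bijective (fun a : (freeSheaf X).obj V ⟶ F => secMap a V (unitSec V)) := by
  let e := ((sheafificationAdjunction (Opens.grothendieckTopology X) (ModuleCat.{0} ℂ)).homEquiv
    (yoneda.obj V ⋙ ModuleCat.free ℂ) F).trans
    ((((ModuleCat.adj ℂ).whiskerRight (Opens X)ᵒᵖ).homEquiv (yoneda.obj V) F.obj).trans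
    yonedaEquiv)
  have : (fun a : (freeSheaf X).obj V ⟶ F => secMap a V (unitSec V)) = e := by
    funext a
    rfl
  rw [this]
  exact e.bijective

/-- The morphism `j_! ℂ_V → F` given by a section of `F` over `V`. -/
def freeHom {F : CSheaf X} {V : Opens X} (s : Sec F V) : (freeSheaf X).obj V ⟶ F :=
  ((unitSec_bijective V F).2 s).choose

lemma secMap_freeHom {F : CSheaf X} {V : Opens X} (s : Sec F V) :
    secMap (freeHom s) V (unitSec V) = s :=
  ((unitSec_bijective V F).2 s).choose_spec

lemma free_hom_ext {F : CSheaf X} {V : Opens X} {a b : (freeSheaf X).obj V ⟶ F}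
    (h : secMap a V (unitSec V) = secMap b V (unitSec V)) : a = b :=
  (unitSec_bijective V F).1 h

/-- Epimorphisms of sheaves are the morphisms that are surjective on germs. -/
lemma epi_iff_locally {F G : CSheaf X} (f : F ⟶ G) :
    Epi f ↔ ∀ (V : Opens X) (s : Sec G V), ∀ x ∈ V, ∃ (W : Opens X) (h : W ≤ V), x ∈ W ∧
      ∃ t : Sec F W, secMap f W t = resL G h s := by
  rw [← Sheaf.isLocallySurjective_iff_epi']
  constructor
  · intro hf V s x hx
    obtain ⟨W, i, ⟨t, ht⟩, hxW⟩ := Presheaf.imageSieve_mem (Opens.grothendieckTopology X) f.hom s x hx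
    exact ⟨W, leOfHom i, hxW, t, ht⟩
  · intro hf
    refine ⟨fun {V} s x hx => ?_⟩
    obtain ⟨W, h, hxW, t, ht⟩ := hf V s x hx
    exact ⟨W, homOfLE h, ⟨t, ht⟩, hxW⟩

/-- Sections of a fibre product. -/
lemma exists_pullback_section {F G H : CSheaf X} (f : F ⟶ H) (g : G ⟶ H) {V : Opens X}
    (s : Sec F V) (t : Sec G V) (h : secMap f V s = secMap g V t) :
    ∃ r : Sec (Limits.pullback f g) V,
      secMap (Limits.pullback.fst f g) V r = s ∧ secMap (Limits.pullback.snd f g) V r = t := by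
  have hw : freeHom s ≫ f = freeHom t ≫ g := free_hom_ext (by
    rw [secMap_comp, secMap_comp, secMap_freeHom, secMap_freeHom, h])
  refine ⟨secMap (Limits.pullback.lift _ _ hw) V (unitSec V), ?_, ?_⟩
  · rw [← secMap_comp, Limits.pullback.lift_fst, secMap_freeHom]
  · rw [← secMap_comp, Limits.pullback.lift_snd, secMap_freeHom]

section Homology

variable {ι : Type} {c : ComplexShape ι} {K L : HomologicalComplex (CSheaf X) c} (f : K ⟶ L)

lemma secMap_comm (i j : ι) {V : Opens X} (s : Sec (K.X i) V) :
    secMap (f.f j) V (secMap (K.d i j) V s) = secMap (L.d i j) V (secMap (f.f i) V s) := by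
  rw [← secMap_comp, ← secMap_comp, f.comm]

lemma secMap_d_d (i j k : ι) {V : Opens X} (s : Sec (K.X i) V) :
    secMap (K.d j k) V (secMap (K.d i j) V s) = 0 := by
  rw [← secMap_comp, K.d_comp_d, secMap_zero]

/-- A morphism of complexes of sheaves is injective on the `j`-th cohomology sheaves over `U`,
expressed in terms of sections. -/
def LocInj (i j k : ι) (U : Opens X) : Prop :=
  ∀ (V : Opens X) (_ : V ≤ U) (s : Sec (K.X j) V) (_ : secMap (K.d j k) V s = 0)
    (t : Sec (L.X i) V) (_ : secMap (f.f j) V s = secMap (L.d i j) V t), ∀ x ∈ V,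
    ∃ (W : Opens X) (h : W ≤ V), x ∈ W ∧ ∃ u : Sec (K.X i) W,
      secMap (K.d i j) W u = resL (K.X j) h s

/-- A morphism of complexes of sheaves is surjective on the `j`-th cohomology sheaves over `U`,
expressed in terms of sections. -/
def LocSurj (i j k : ι) (U : Opens X) : Prop :=
  ∀ (V : Opens X) (_ : V ≤ U) (t : Sec (L.X j) V) (_ : secMap (L.d j k) V t = 0), ∀ x ∈ V,
    ∃ (W : Opens X) (h : W ≤ V), x ∈ W ∧ ∃ s : Sec (K.X j) W, secMap (K.d j k) W s = 0 ∧
      ∃ u : Sec (L.X i) W, resL (L.X j) h t = secMap (f.f j) W s + secMap (L.d i j) W u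

lemma mono_homologyMap_iff_locInj (i j k : ι) (hi : c.prev j = i) (hk : c.next j = k) :
    Mono (HomologicalComplex.homologyMap f j) ↔ LocInj f i j k ⊤ := by
  rw [HomologicalComplex.mono_homologyMap_iff_up_to_refinements f i j k hi hk]
  constructor
  · intro H V _ s hs t hst x hx
    obtain ⟨A', π, hπ, x₁, h1⟩ := H (freeHom s)
      (free_hom_ext (by rw [secMap_comp, secMap_freeHom, hs, secMap_zero])) (freeHom t)
      (free_hom_ext (by rw [secMap_comp, secMap_comp, secMap_freeHom, secMap_freeHom, hst]))
    obtain ⟨W, h, hxW, r, hr⟩ := (epi_iff_locally π).1 hπ V (unitSec V) x hx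
    refine ⟨W, h, hxW, secMap x₁ W r, ?_⟩
    rw [← secMap_comp, ← h1, secMap_comp, hr, secMap_resL, secMap_freeHom]
  · intro H A x₂ hx₂ y₁ hy₁
    refine ⟨Limits.pullback x₂ (K.d i j), Limits.pullback.fst _ _, ?_, Limits.pullback.snd _ _,
      Limits.pullback.condition⟩
    rw [epi_iff_locally]
    intro V a x hx
    obtain ⟨W, h, hxW, u, hu⟩ := H V le_top (secMap x₂ V a)
      (by rw [← secMap_comp, hx₂, secMap_zero]) (secMap y₁ V a)
      (by rw [← secMap_comp, hy₁, secMap_comp]) x hx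
    obtain ⟨r, hr, -⟩ := exists_pullback_section x₂ (K.d i j) (resL A h a) u
      (by rw [secMap_resL, hu])
    exact ⟨W, h, hxW, r, hr⟩

lemma epi_homologyMap_iff_locSurj (i j k : ι) (hi : c.prev j = i) (hk : c.next j = k) :
    Epi (HomologicalComplex.homologyMap f j) ↔ LocSurj f i j k ⊤ := by
  rw [HomologicalComplex.epi_homologyMap_iff_up_to_refinements f i j k hi hk]
  constructor
  · intro H V _ t ht x hx
    obtain ⟨A', π, hπ, x₂, hx₂, y₁, h1⟩ := H (freeHom t)
      (free_hom_ext (by rw [secMap_comp, secMap_freeHom, ht, secMap_zero]))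
    obtain ⟨W, h, hxW, r, hr⟩ := (epi_iff_locally π).1 hπ V (unitSec V) x hx
    refine ⟨W, h, hxW, secMap x₂ W r, ?_, secMap y₁ W r, ?_⟩
    · rw [← secMap_comp, hx₂, secMap_zero]
    · have := congrArg (fun a => secMap a W r) h1
      simp only [secMap_add, secMap_comp, hr, secMap_resL, secMap_freeHom] at this
      exact this
  · intro H A y₂ hy₂
    let g : Limits.kernel (K.d j k) ⊞ L.X i ⟶ L.X j :=
      Limits.biprod.desc (Limits.kernel.ι (K.d j k) ≫ f.f j) (L.d i j)
    refine ⟨Limits.pullback y₂ g, Limits.pullback.fst _ _, ?_,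
      Limits.pullback.snd _ _ ≫ Limits.biprod.fst ≫ Limits.kernel.ι _, by simp,
      Limits.pullback.snd _ _ ≫ Limits.biprod.snd, ?_⟩
    · rw [epi_iff_locally]
      intro V a x hx
      obtain ⟨W, h, hxW, s, hs, u, hu⟩ := H V le_top (secMap y₂ V a)
        (by rw [← secMap_comp, hy₂, secMap_zero]) x hx
      have hz : freeHom s ≫ K.d j k = 0 :=
        free_hom_ext (by rw [secMap_comp, secMap_freeHom, hs, secMap_zero])
      let q : (freeSheaf X).obj W ⟶ Limits.kernel (K.d j k) ⊞ L.X i :=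
        Limits.biprod.lift (Limits.kernel.lift _ _ hz) (freeHom u)
      obtain ⟨r, hr, -⟩ := exists_pullback_section y₂ g (resL A h a) (secMap q W (unitSec W))
        (by
          have hq : q ≫ g = freeHom s ≫ f.f j + freeHom u ≫ L.d i j := by
            simp [q, g]
          rw [← secMap_comp, hq, secMap_add, secMap_comp, secMap_comp, secMap_freeHom,
            secMap_freeHom, ← hu, secMap_resL])
      exact ⟨W, h, hxW, r, hr⟩
    · rw [Limits.pullback.condition]
      have : g = Limits.biprod.fst ≫ Limits.kernel.ι _ ≫ f.f j + Limits.biprod.snd ≫ L.d i j := by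
        apply Limits.biprod.hom_ext' <;> simp [g]
      rw [this]
      simp

lemma quasiIsoAt_iff_locally (i j k : ι) (hi : c.prev j = i) (hk : c.next j = k) :
    QuasiIsoAt f j ↔ LocInj f i j k ⊤ ∧ LocSurj f i j k ⊤ := by
  rw [quasiIsoAt_iff_isIso_homologyMap, ← mono_homologyMap_iff_locInj f i j k hi hk,
    ← epi_homologyMap_iff_locSurj f i j k hi hk]
  constructor
  · intro h
    exact ⟨inferInstance, inferInstance⟩
  · rintro ⟨h1, h2⟩
    exact isIso_of_mono_of_epi _

end Homology

/-- The morphism `j_! ℂ_W → j_! ℂ_V` is a monomorphism for `W ≤ V`. -/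
lemma mono_freeSheaf_map {V W : Opens X} (h : W ≤ V) : Mono ((freeSheaf X).map (homOfLE h)) := by
  have h1 : Mono (yoneda.map (homOfLE h)) := inferInstance
  have h2 : Mono (Functor.whiskerRight (yoneda.map (homOfLE h)) (ModuleCat.free ℂ)) := by
    rw [NatTrans.mono_iff_mono_app]
    intro U
    rw [ModuleCat.mono_iff_injective]
    have : Function.Injective ((yoneda.map (homOfLE h)).app U) := fun a b _ =>
      Subsingleton.elim (α := (U.unop ⟶ W)) a b
    exact Finsupp.mapDomain_injective this
  change Mono ((presheafToSheaf (Opens.grothendieckTopology X) (ModuleCat.{0} ℂ)).map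
    (Functor.whiskerRight (yoneda.map (homOfLE h)) (ModuleCat.free ℂ)))
  infer_instance

/-- Injective sheaves are flasque. -/
lemma resL_surjective (F : CSheaf X) [Injective F] {V W : Opens X} (h : W ≤ V) :
    Function.Surjective (resL F h) := by
  intro s
  have := mono_freeSheaf_map h
  refine ⟨secMap (Injective.factorThru (freeHom s) ((freeSheaf X).map (homOfLE h))) V
    (unitSec V), ?_⟩
  rw [← secMap_resL, ← secMap_free_unitSec, ← secMap_comp, Injective.comp_factorThru,
    secMap_freeHom]

end SheafSections

/-! ### Flasque complexes -/

section Triangulated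

open Pretriangulated

/-- If `A → B → Q → A[1]` is distinguished and all morphisms from `Q` to shifts of `K` vanish, then
morphisms to the shifts of `K` extend uniquely along `A → B`. -/
lemma precomp_bijective_of_distTriang {D : Type*} [Category* D] [Limits.HasZeroObject D]
    [HasShift D ℤ] [Preadditive D] [∀ n : ℤ, (shiftFunctor D n).Additive] [Pretriangulated D]
    (T : Triangle D) (hT : T ∈ distTriang D) (K : D)
    (h : ∀ (n : ℤ) (a : T.obj₃ ⟶ K⟦n⟧), a = 0) (n : ℤ) :
    Function.Bijective (fun a : T.obj₂ ⟶ K⟦n⟧ => T.mor₁ ≫ a) := by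
  constructor
  · intro a b hab
    obtain ⟨g, hg⟩ := Triangle.yoneda_exact₂ T hT (a - b)
      (by rw [Preadditive.comp_sub]; exact sub_eq_zero.2 hab)
    rw [h n g, Limits.comp_zero, sub_eq_zero] at hg
    exact hg
  · intro f
    -- `f[1]` extends along `A[1] → B[1]` since it vanishes on `Q`; shifts are full
    have h0 : T.mor₃ ≫ f⟦(1 : ℤ)⟧' = 0 := by
      have := h (n + 1) (T.mor₃ ≫ f⟦(1 : ℤ)⟧' ≫ (shiftFunctorAdd D n 1).inv.app K)
      rw [← Category.assoc] at this
      exact (cancel_mono ((shiftFunctorAdd D n 1).inv.app K)).1 (by rw [this, Limits.zero_comp])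
    obtain ⟨g, hg⟩ : ∃ g : T.obj₂⟦(1 : ℤ)⟧ ⟶ (K⟦n⟧)⟦(1 : ℤ)⟧, f⟦(1 : ℤ)⟧' = (-T.mor₁⟦1⟧') ≫ g :=
      Triangle.yoneda_exact₃ T.rotate (rot_of_distTriang _ hT) (f⟦(1 : ℤ)⟧') h0
    obtain ⟨g', hg'⟩ := (shiftFunctor D (1 : ℤ)).map_surjective g
    refine ⟨-g', (shiftFunctor D (1 : ℤ)).map_injective ?_⟩
    have h1 : (shiftFunctor D (1 : ℤ)).map (T.mor₁ ≫ (-g')) = -(T.mor₁⟦(1 : ℤ)⟧' ≫ g) := by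
      rw [Functor.map_comp, Functor.map_neg, hg', Preadditive.comp_neg]
    exact h1.trans ((Preadditive.neg_comp _ _).symm.trans hg.symm)

/-- If there are no morphisms from `A` to `T.obj₃[-1]`, then `T.mor₁` is injective on morphisms from
`A`. -/
lemma hom_eq_zero_of_distTriang {D : Type*} [Category* D] [Limits.HasZeroObject D]
    [HasShift D ℤ] [Preadditive D] [∀ n : ℤ, (shiftFunctor D n).Additive] [Pretriangulated D]
    (T : Triangle D) (hT : T ∈ distTriang D) {A : D} (h : ∀ a : A ⟶ T.obj₃⟦(-1 : ℤ)⟧, a = 0)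
    (a : A ⟶ T.obj₁) (ha : a ≫ T.mor₁ = 0) : a = 0 := by
  obtain ⟨g, hg⟩ := Triangle.coyoneda_exact₂ T.invRotate (inv_rot_of_distTriang _ hT) a ha
  have hg0 : g = 0 := h g
  exact hg.trans (by rw [hg0, Limits.zero_comp]; rfl)

/-- If `K → L → C → K[1]` is distinguished and all morphisms from `A` to shifts of `C` vanish, then
`K → L` induces bijections on morphisms from `A`. -/
lemma postcomp_bijective_of_distTriang {D : Type*} [Category* D] [Limits.HasZeroObject D]
    [HasShift D ℤ] [Preadditive D] [∀ n : ℤ, (shiftFunctor D n).Additive] [Pretriangulated D]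
    (T : Triangle D) (hT : T ∈ distTriang D) (A : D)
    (h : ∀ (n : ℤ) (a : A ⟶ T.obj₃⟦n⟧), a = 0) (n : ℤ) :
    Function.Bijective (fun a : A ⟶ T.obj₁⟦n⟧ => a ≫ T.mor₁⟦n⟧') := by
  have hT' : (Triangle.shiftFunctor D n).obj T ∈ distTriang D := Triangle.shift_distinguished T hT n
  have hu : ∀ {U V W : D} (f : U ⟶ V) (g : V ⟶ W) (u : ℤˣ), f ≫ (u • g) = u • (f ≫ g) := by
    intro U V W f g u
    rw [Units.smul_def, Units.smul_def, Preadditive.comp_zsmul]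
  have hu' : ∀ {U V W : D} (f : U ⟶ V) (g : V ⟶ W) (u : ℤˣ), (u • f) ≫ g = u • (f ≫ g) := by
    intro U V W f g u
    rw [Units.smul_def, Units.smul_def, Preadditive.zsmul_comp]
  constructor
  · intro a b hab
    refine sub_eq_zero.1 (hom_eq_zero_of_distTriang _ hT' (A := A) (fun g => ?_) (a - b) ?_)
    · have h1 : (show A ⟶ (T.obj₃⟦n⟧)⟦(-1 : ℤ)⟧ from g) ≫
          (shiftFunctorAdd D n (-1)).inv.app T.obj₃ = 0 := h (n + -1) _
      exact (cancel_mono ((shiftFunctorAdd D n (-1)).inv.app T.obj₃)).1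
        (h1.trans Limits.zero_comp.symm)
    · refine (hu (a - b) (T.mor₁⟦n⟧') n.negOnePow).trans ?_
      have h1 : (a - b) ≫ T.mor₁⟦n⟧' = 0 := by
        rw [Preadditive.sub_comp]
        exact sub_eq_zero.2 hab
      exact (congrArg (n.negOnePow • ·) h1).trans (smul_zero _)
  · intro f
    obtain ⟨g, hg⟩ := Triangle.coyoneda_exact₂ _ hT' f (h n _)
    refine ⟨n.negOnePow • g, ?_⟩
    exact (hu' g (T.mor₁⟦n⟧') n.negOnePow).trans
      ((hu g (T.mor₁⟦n⟧') n.negOnePow).symm.trans hg.symm)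

end Triangulated

section DerivedVanishing

variable {C : Type*} [Category* C] [Abelian C] [HasDerivedCategory.{w} C]

open CochainComplex HomComplex in
/-- Morphisms in the derived category from an object to a K-injective complex `I` vanish if the
complex of morphisms to the terms of `I` is exact. -/
lemma derived_hom_eq_zero (A : C) (I : CochainComplex C ℤ) [I.IsKInjective]
    (h : ∀ (n : ℤ) (f : A ⟶ I.X n), f ≫ I.d n (n + 1) = 0 →
      ∃ g : A ⟶ I.X (n - 1), g ≫ I.d (n - 1) n = f) (n : ℤ)
    (a : (DerivedCategory.singleFunctor C 0).obj A ⟶ (DerivedCategory.Q.obj I)⟦n⟧) : a = 0 := by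
  let e : (DerivedCategory.Q.obj I)⟦n⟧ ≅
      DerivedCategory.Qh.obj ((HomotopyCategory.quotient C (.up ℤ)).obj (I⟦n⟧)) :=
    (DerivedCategory.Q.commShiftIso n).symm.app I ≪≫
      (DerivedCategory.quotientCompQhIso C).symm.app (I⟦n⟧)
  obtain ⟨g, hg⟩ := (CochainComplex.IsKInjective.Qh_map_bijective
    ((HomotopyCategory.quotient C (.up ℤ)).obj ((CochainComplex.singleFunctor C 0).obj A))
    (I⟦n⟧)).2 (a ≫ e.hom)
  obtain ⟨x, rfl⟩ := (CohomologyClass.toHom_bijective ((CochainComplex.singleFunctor C 0).obj A)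
    I n).2 g
  obtain ⟨z, rfl⟩ := x.mk_surjective
  obtain ⟨f, hf, rfl⟩ := z.fromSingleMk_surjective n (zero_add n) (n + 1) rfl
  have hz : CohomologyClass.mk (Cocycle.fromSingleMk f (zero_add n) (n + 1) rfl hf) = 0 := by
    rw [CohomologyClass.mk_eq_zero_iff,
      Cocycle.fromSingleMk_mem_coboundaries_iff f (zero_add n) (n + 1) rfl hf (n - 1) (by omega)]
    exact h n f hf
  rw [hz, map_zero, Functor.map_zero] at hg
  exact (cancel_mono e.hom).1 (hg.symm.trans Limits.zero_comp.symm)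

end DerivedVanishing

/-- A complex of flasque sheaves of complex vector spaces, bounded below, given by its spaces of
sections `S n A`. The differentials `d m n` are defined for all pairs of degrees. -/
structure SecCx (E : Type) [TopologicalSpace E] where
  S : ℤ → Opens E → Type
  [grp : ∀ n A, AddCommGroup (S n A)]
  [mod : ∀ n A, Module ℂ (S n A)]
  res : ∀ (n : ℤ) {A B : Opens E}, B ≤ A → S n A →ₗ[ℂ] S n B
  d : ∀ (m n : ℤ) (A : Opens E), S m A →ₗ[ℂ] S n A
  res_res : ∀ {n : ℤ} {A B C : Opens E} (h : B ≤ A) (h' : C ≤ B) (s : S n A),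
    res n h' (res n h s) = res n (h'.trans h) s
  res_self : ∀ {n : ℤ} {A : Opens E} (h : A ≤ A) (s : S n A), res n h s = s
  d_res : ∀ {m n : ℤ} {A B : Opens E} (h : B ≤ A) (s : S m A),
    d m n B (res m h s) = res n h (d m n A s)
  d_d : ∀ {l m n : ℤ} {A : Opens E} (s : S l A), d m n A (d l m A s) = 0
  glue : ∀ {n : ℤ} {ι : Type} (U : ι → Opens E) (s : ∀ i, S n (U i)),
    (∀ i j, res n (inf_le_left : U i ⊓ U j ≤ U i) (s i) =
      res n (inf_le_right : U i ⊓ U j ≤ U j) (s j)) →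
    ∃! t : S n (iSup U), ∀ i, res n (le_iSup U i) t = s i
  flasque : ∀ {n : ℤ} {A B : Opens E} (h : B ≤ A), Function.Surjective (res n h)
  lower : ℤ
  eq_zero : ∀ {n : ℤ} {A : Opens E}, n < lower → ∀ s : S n A, s = 0

namespace SecCx

attribute [instance] SecCx.grp SecCx.mod

variable {E : Type} [TopologicalSpace E] (G : SecCx E) {n : ℤ} {A B : Opens E}

lemma ext_local {s t : G.S n A}
    (h : ∀ x ∈ A, ∃ (W : Opens E) (hW : W ≤ A), x ∈ W ∧ G.res n hW s = G.res n hW t) : s = t := by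
  choose W hW hx hst using h
  let U : A → Opens E := fun x => W x x.2
  have hle : A ≤ iSup U := fun x hxV => Opens.mem_iSup.2 ⟨⟨x, hxV⟩, hx x hxV⟩
  have hle' : iSup U ≤ A := iSup_le fun x => hW x x.2
  have key : G.res n hle' s = G.res n hle' t := by
    obtain ⟨r, -, hr⟩ := G.glue U (fun x => G.res n (hW x x.2) s)
      (fun i j => by rw [G.res_res, G.res_res])
    rw [hr (G.res n hle' s) (fun i => by rw [G.res_res]),
      hr (G.res n hle' t) (fun i => by rw [G.res_res]; exact (hst i.1 i.2).symm)]
  have := congrArg (G.res n hle) key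
  rwa [G.res_res, G.res_res, G.res_self, G.res_self] at this

lemma ext_two {s t : G.S n (A ⊔ B)}
    (h : G.res n (le_sup_left : A ≤ A ⊔ B) s = G.res n le_sup_left t)
    (h' : G.res n (le_sup_right : B ≤ A ⊔ B) s = G.res n le_sup_right t) : s = t :=
  G.ext_local fun _ hx => hx.elim (fun hx => ⟨A, le_sup_left, hx, h⟩)
    (fun hx => ⟨B, le_sup_right, hx, h'⟩)

lemma ext_bot (hA : A = ⊥) (s t : G.S n A) : s = t :=
  G.ext_local fun x hx => by
    subst hA
    exact hx.elim

lemma exists_glue_two (s : G.S n A) (t : G.S n B)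
    (h : G.res n (inf_le_left : A ⊓ B ≤ A) s = G.res n inf_le_right t) :
    ∃ r : G.S n (A ⊔ B), G.res n le_sup_left r = s ∧ G.res n le_sup_right r = t := by
  let U : Bool → Opens E := fun b => if b then A else B
  let f : ∀ b, G.S n (U b) := fun b => match b with
    | true => s
    | false => t
  obtain ⟨r, hr, -⟩ := G.glue U f (by
    have hsymm : G.res n (inf_le_left : B ⊓ A ≤ B) t = G.res n inf_le_right s := by
      have := congrArg (G.res n (inf_comm B A).le) h
      rw [G.res_res, G.res_res] at this
      exact this.symm
    rintro (_ | _) (_ | _)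
    · rfl
    · exact hsymm
    · exact h
    · rfl)
  have hle : A ⊔ B ≤ iSup U := sup_le (le_iSup U true) (le_iSup U false)
  refine ⟨G.res n hle r, ?_, ?_⟩
  · rw [G.res_res]
    exact hr true
  · rw [G.res_res]
    exact hr false

/-- A section that vanishes on `U` extends to a section that vanishes on `U`. -/
lemma exists_extension_vanishing (U : Opens E) (h : B ≤ A) (c : G.S n B)
    (hc : G.res n (inf_le_left : B ⊓ U ≤ B) c = 0) :
    ∃ c' : G.S n A, G.res n h c' = c ∧ G.res n (inf_le_left : A ⊓ U ≤ A) c' = 0 := by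
  obtain ⟨r, hr1, hr2⟩ := G.exists_glue_two c (0 : G.S n (A ⊓ U)) (by
    rw [map_zero]
    have h1 : B ⊓ (A ⊓ U) ≤ B ⊓ U := le_inf inf_le_left (inf_le_right.trans inf_le_right)
    have := congrArg (G.res n h1) hc
    rwa [G.res_res, map_zero] at this)
  obtain ⟨c', rfl⟩ := G.flasque (n := n) (sup_le h inf_le_left : B ⊔ A ⊓ U ≤ A) r
  exact ⟨c', by rw [← hr1, G.res_res], by rw [← hr2, G.res_res]⟩

/-- A complex of flasque sheaves with supports outside of `U` that is locally exact is exact on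
sections. -/
lemma exact_of_locally_exact (U V₀ : Opens E)
    (hloc : ∀ (n : ℤ) (V : Opens E), V ≤ V₀ → ∀ a : G.S n V, G.d n (n + 1) V a = 0 →
      G.res n (inf_le_left : V ⊓ U ≤ V) a = 0 → ∀ x ∈ V, ∃ (W : Opens E) (h : W ≤ V), x ∈ W ∧
        ∃ b : G.S (n - 1) W, G.res (n - 1) (inf_le_left : W ⊓ U ≤ W) b = 0 ∧
          G.d (n - 1) n W b = G.res n h a)
    (n : ℤ) (V : Opens E) (hV : V ≤ V₀) (a : G.S n V) (ha : G.d n (n + 1) V a = 0)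
    (haU : G.res n (inf_le_left : V ⊓ U ≤ V) a = 0) :
    ∃ b : G.S (n - 1) V, G.res (n - 1) (inf_le_left : V ⊓ U ≤ V) b = 0 ∧
      G.d (n - 1) n V b = a := by
  -- induction on the distance of the degree from the bound below which all sections vanish
  obtain ⟨k, hk⟩ : ∃ k : ℕ, n < G.lower + k := ⟨(n - G.lower).toNat + 1, by omega⟩
  induction k generalizing n V with
  | zero => exact ⟨0, by simp, by rw [G.eq_zero (by simpa using hk) a, map_zero]⟩
  | succ k ih =>
    -- by Zorn there is a maximal open subset of `V` with a primitive vanishing on `U`; at any other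
    -- point of `V` the primitive extends: its difference to a local primitive is closed, hence, in
    -- lower degree, `d c`, and extending `c` by flasqueness corrects the local primitive
    let T := {p : (W : Opens E) × G.S (n - 1) W // ∃ h : p.1 ≤ V,
      G.res (n - 1) (inf_le_left : p.1 ⊓ U ≤ p.1) p.2 = 0 ∧ G.d (n - 1) n p.1 p.2 = G.res n h a}
    let r : T → T → Prop := fun p q => ∃ h : p.1.1 ≤ q.1.1, G.res (n - 1) h q.1.2 = p.1.2
    obtain ⟨⟨⟨W, b⟩, hW, hbU, hb⟩, hmax⟩ : ∃ m : T, ∀ q, r m q → r q m := by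
      refine exists_maximal_of_chains_bounded (r := r) ?_ ?_
      · intro c hc
        obtain ⟨t, ht, -⟩ := G.glue (fun p : c => p.1.1.1) (fun p : c => p.1.1.2) (by
          intro p q
          by_cases hpq : p = q
          · subst hpq
            rfl
          · rcases hc p.2 q.2 (fun h => hpq (Subtype.ext h)) with ⟨h, e⟩ | ⟨h, e⟩
            · rw [← e, G.res_res]
            · rw [← e, G.res_res])
        refine ⟨⟨⟨_, t⟩, iSup_le fun p => p.1.2.choose, ?_, ?_⟩, fun p hp =>
          ⟨le_iSup (fun p : c => p.1.1.1) ⟨p, hp⟩, ht ⟨p, hp⟩⟩⟩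
        · refine G.ext_local fun x hx => ?_
          obtain ⟨p, hp⟩ := Opens.mem_iSup.1 hx.1
          refine ⟨p.1.1.1 ⊓ U, inf_le_inf_right _ (le_iSup (fun p : c => p.1.1.1) p), ⟨hp, hx.2⟩, ?_⟩
          obtain ⟨_, h2, _⟩ := p.1.2
          rw [G.res_res, map_zero, ← h2, ← ht p, G.res_res]
        · refine G.ext_local fun x hx => ?_
          obtain ⟨p, hp⟩ := Opens.mem_iSup.1 hx
          refine ⟨p.1.1.1, le_iSup (fun p : c => p.1.1.1) p, hp, ?_⟩
          obtain ⟨_, _, h2⟩ := p.1.2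
          rw [← G.d_res, ht p, h2, G.res_res]
      · rintro p q s ⟨h, e⟩ ⟨h', e'⟩
        exact ⟨h.trans h', by rw [← e, ← e', G.res_res]⟩
    dsimp only at hW hbU hb
    have hVW : V ≤ W := by
      intro x hx
      obtain ⟨W', hW', hxW', b', hbU', hb'⟩ := hloc n V hV a ha haU x hx
      set P := W ⊓ W' with hP
      have hPW : P ≤ W := inf_le_left
      have hPW' : P ≤ W' := inf_le_right
      -- the induction hypothesis for the difference of the two primitives
      obtain ⟨c, hcU, hc⟩ := ih (n - 1) P ((hPW.trans hW).trans hV)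
        (G.res (n - 1) hPW b - G.res (n - 1) hPW' b')
        (by
          have hn : n - 1 + 1 = n := by omega
          rw [hn, map_sub, G.d_res, G.d_res, hb, hb', G.res_res, G.res_res, sub_self])
        (by
          have h1 := congrArg (G.res (n - 1) (inf_le_inf_right U hPW)) hbU
          have h2 := congrArg (G.res (n - 1) (inf_le_inf_right U hPW')) hbU'
          rw [G.res_res, map_zero] at h1 h2
          rw [map_sub, G.res_res, G.res_res, h1, h2, sub_self])
        (by push_cast at hk; omega)
      obtain ⟨c', hc', hcU'⟩ := G.exists_extension_vanishing U hPW' c hcU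
      obtain ⟨t, ht1, ht2⟩ := G.exists_glue_two b (b' + G.d (n - 1 - 1) (n - 1) W' c') (by
        have h3 : G.res (n - 1) hPW' (b' + G.d (n - 1 - 1) (n - 1) W' c') = G.res (n - 1) hPW b := by
          rw [map_add, ← G.d_res, hc', hc]
          abel
        exact h3.symm)
      have hU' : G.res (n - 1) (inf_le_left : W' ⊓ U ≤ W') (b' + G.d (n - 1 - 1) (n - 1) W' c') = 0 := by
        rw [map_add, hbU', ← G.d_res, hcU', map_zero, add_zero]
      have hd' : G.d (n - 1) n W' (b' + G.d (n - 1 - 1) (n - 1) W' c') = G.res n hW' a := by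
        rw [map_add, G.d_d, add_zero, hb']
      obtain ⟨h, -⟩ := hmax ⟨⟨W ⊔ W', t⟩, sup_le hW hW', by
          refine G.ext_local fun y hy => ?_
          rcases hy with ⟨hy | hy, hyU⟩
          · refine ⟨W ⊓ U, inf_le_inf_right _ le_sup_left, ⟨hy, hyU⟩, ?_⟩
            rw [G.res_res, map_zero, ← hbU, ← ht1, G.res_res]
          · refine ⟨W' ⊓ U, inf_le_inf_right _ le_sup_right, ⟨hy, hyU⟩, ?_⟩
            rw [G.res_res, map_zero, ← hU', ← ht2, G.res_res],
          G.ext_two (by rw [← G.d_res, ht1, hb, G.res_res])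
            (by rw [← G.d_res, ht2, hd', G.res_res])⟩ ⟨le_sup_left, ht1⟩
      exact h (le_sup_right (a := W) hxW')
    have hWV : W = V := le_antisymm hW hVW
    subst hWV
    exact ⟨b, hbU, by rw [hb, G.res_self]⟩

end SecCx

/-- The sections of a bounded below complex of injective sheaves. -/
def secCxOf {X : Type} [TopologicalSpace X] (I : CochainComplex (CSheaf X) ℤ)
    (hI : ∀ n, Injective (I.X n)) (l : ℤ) (hl : I.IsStrictlyGE l) : SecCx X where
  S n A := Sec (I.X n) A
  res n _ _ h := resL (I.X n) h
  d m n A := secMap (I.d m n) A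
  res_res h h' s := resL_resL _ h h' s
  res_self h s := resL_self _ h s
  d_res h s := secMap_resL _ h s
  d_d s := secMap_d_d _ _ _ s
  glue U s hs := existsUnique_glue _ U s hs
  flasque h := resL_surjective _ h
  lower := l
  eq_zero := fun {n A} hn s => by
    have h : (𝟙 (I.X n)) = 0 := (I.isZero_of_isStrictlyGE l n hn).eq_of_src _ _
    have := congrArg (fun f => secMap f A s) h
    exact this

/-! ### Hypercohomology in terms of resolutions -/

section Resolutions

variable {X : Type} [TopologicalSpace X]

/-- Local exactness over `U` of a complex of sheaves in degree `n`, in terms of sections. -/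
def LocExact (C : CochainComplex (CSheaf X) ℤ) (U : Opens X) (n : ℤ) : Prop :=
  ∀ (V : Opens X) (_ : V ≤ U) (s : Sec (C.X n) V) (_ : secMap (C.d n (n + 1)) V s = 0), ∀ x ∈ V,
    ∃ (W : Opens X) (h : W ≤ V), x ∈ W ∧ ∃ u : Sec (C.X (n - 1)) W,
      secMap (C.d (n - 1) n) W u = resL (C.X n) h s

/-- Local exactness is a property of the cohomology sheaves. -/
lemma LocExact.of_quasiIso {C I : CochainComplex (CSheaf X) ℤ} (ι : C ⟶ I) [QuasiIso ι]
    {U : Opens X} {n : ℤ} (h : LocExact C U n) : LocExact I U n := by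
  intro V hV s hs x hx
  obtain ⟨-, h2⟩ := (quasiIsoAt_iff_locally ι (n - 1) n (n + 1) (by simp) (by simp)).1
    (‹QuasiIso ι›.quasiIsoAt n)
  obtain ⟨W, hW, hxW, t, ht, u, hu⟩ := h2 V le_top s hs x hx
  obtain ⟨W', hW', hxW', t', ht'⟩ := h W (hW.trans hV) t ht x hxW
  refine ⟨W', hW'.trans hW, hxW', secMap (ι.f (n - 1)) W' t' + resL _ hW' u, ?_⟩
  rw [map_add, ← secMap_comm, ht', secMap_resL, secMap_resL, ← map_add, ← hu, resL_resL]

open CochainComplex HomComplex in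
/-- The mapping cone of a morphism that is bijective on cohomology sheaves over `U` is locally
exact over `U`. -/
lemma locExact_mappingCone {K L : CochainComplex (CSheaf X) ℤ} (φ : K ⟶ L) (U : Opens X)
    (h1 : ∀ n, LocInj φ (n - 1) n (n + 1) U) (h2 : ∀ n, LocSurj φ (n - 1) n (n + 1) U) (n : ℤ) :
    LocExact (mappingCone φ) U n := by
  intro V hV s hs x hx
  -- a cocycle of the cone is a pair `(k, l)` with `d k = 0` and `φ k + d l = 0`
  set k := secMap ((mappingCone.fst φ).1.v n (n + 1) rfl) V s with hk
  set l := secMap ((mappingCone.snd φ).v n n (add_zero n)) V s with hl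
  have hd1 := mappingCone.d_fst_v φ n (n + 1) (n + 2) rfl (by omega)
  have hd2 := mappingCone.d_snd_v φ n (n + 1) rfl
  have hk0 : secMap (K.d (n + 1) (n + 2)) V k = 0 := by
    have := congrArg (fun f => secMap f V s) hd1
    beta_reduce at this
    rw [secMap_comp, hs, map_zero] at this
    have h3 : secMap (-(mappingCone.fst φ).1.v n (n + 1) rfl ≫ K.d (n + 1) (n + 2)) V s =
      - secMap (K.d (n + 1) (n + 2)) V k := rfl
    rw [h3, eq_comm, neg_eq_zero] at this
    exact this
  have hl0 : secMap (φ.f (n + 1)) V k + secMap (L.d n (n + 1)) V l = 0 := by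
    have := congrArg (fun f => secMap f V s) hd2
    beta_reduce at this
    rw [secMap_comp, hs, map_zero] at this
    exact this.symm
  have e : n + 1 - 1 = n := by omega
  have e2 : n + 1 + 1 = n + 2 := by omega
  have h1' := h1 (n + 1)
  rw [e, e2] at h1'
  -- write `k = d k'` by injectivity
  obtain ⟨W, hW, hxW, k', hk'⟩ := h1' V hV k hk0 (-l) (by
    rw [map_neg]
    exact eq_neg_of_add_eq_zero_left hl0) x hx
  -- `l + φ k'` is closed: by surjectivity it is `φ k''` up to `d l'`
  obtain ⟨W', hW', hxW', k'', hk'', l', hl'⟩ := h2 n W (hW.trans hV)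
    (resL _ hW l + secMap (φ.f n) W k') (by
      rw [map_add, ← secMap_comm, hk', secMap_resL, secMap_resL, ← map_add,
        add_comm (secMap (L.d n (n + 1)) V l), hl0, map_zero]) x hxW
  have hi1 : secMap ((mappingCone φ).d (n - 1) n) W'
      (secMap ((mappingCone.inl φ).v n (n - 1) (by omega)) W' (k'' - resL _ hW' k')) =
      secMap ((mappingCone.inr φ).f n) W' (secMap (φ.f n) W' (k'' - resL _ hW' k')) -
      secMap ((mappingCone.inl φ).v (n + 1) n (by omega)) W'
        (secMap (K.d n (n + 1)) W' (k'' - resL _ hW' k')) := by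
    have := congrArg (fun f => secMap f W' (k'' - resL _ hW' k'))
      (mappingCone.inl_v_d φ n (n - 1) (n + 1) (by omega) (by omega))
    exact this
  have hi2 : secMap ((mappingCone φ).d (n - 1) n) W'
      (secMap ((mappingCone.inr φ).f (n - 1)) W' l') =
      secMap ((mappingCone.inr φ).f n) W' (secMap (L.d (n - 1) n) W' l') := by
    rw [secMap_comm]
  refine ⟨W', hW'.trans hW, hxW', secMap ((mappingCone.inl φ).v n (n - 1) (by omega)) W'
    (k'' - resL _ hW' k') + secMap ((mappingCone.inr φ).f (n - 1)) W' l', ?_⟩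
  have hid : s = secMap ((mappingCone.inl φ).v (n + 1) n (by omega)) V k +
      secMap ((mappingCone.inr φ).f n) V l := by
    have := congrArg (fun f => secMap f V s) (mappingCone.id_X φ n (n + 1) rfl)
    exact this.symm
  have e1 : secMap (K.d n (n + 1)) W' (k'' - resL _ hW' k') = -resL _ (hW'.trans hW) k := by
    rw [map_sub, hk'', secMap_resL, hk', resL_resL, zero_sub]
  have e2 : secMap (φ.f n) W' (k'' - resL _ hW' k') + secMap (L.d (n - 1) n) W' l' =
      resL _ (hW'.trans hW) l := by
    rw [map_sub, sub_add_eq_add_sub, ← hl', map_add, resL_resL, secMap_resL, add_sub_cancel_right]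
  have e3 : resL _ (hW'.trans hW) s =
      secMap ((mappingCone.inl φ).v (n + 1) n (by omega)) W' (resL _ (hW'.trans hW) k) +
      secMap ((mappingCone.inr φ).f n) W' (resL _ (hW'.trans hW) l) := by
    rw [hid, map_add, secMap_resL, secMap_resL]
  rw [map_add, hi1, hi2, e1, e3, ← e2, map_neg, map_add, sub_neg_eq_add]
  abel

variable (K : CochainComplex (CSheaf X) ℕ)

/-- The complex `K`, extended by zero to negative degrees. -/
abbrev extendZ : CochainComplex (CSheaf X) ℤ := K.extend ComplexShape.embeddingUpNat

variable {K}

/-- The terms of the extended complex in nonnegative degrees. -/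
def extendZIso (n : ℕ) : (extendZ K).X (n : ℤ) ≅ K.X n :=
  K.extendXIso ComplexShape.embeddingUpNat (i := n) (i' := (n : ℤ)) rfl

lemma extendZIso_d (n m : ℕ) :
    (extendZ K).d n m ≫ (extendZIso m).hom = (extendZIso n).hom ≫ K.d n m := by
  rw [K.extend_d_eq ComplexShape.embeddingUpNat (i := n) (j := m) (i' := (n : ℤ)) (j' := (m : ℤ))
    rfl rfl]
  simp [extendZIso]

lemma extendZIso_map {L : CochainComplex (CSheaf X) ℕ} (f : K ⟶ L) (n : ℕ) :
    (HomologicalComplex.extendMap f ComplexShape.embeddingUpNat).f (n : ℤ) ≫ (extendZIso n).hom =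
      (extendZIso n).hom ≫ f.f n := by
  rw [HomologicalComplex.extendMap_f f ComplexShape.embeddingUpNat (i := n) (i' := (n : ℤ)) rfl]
  simp [extendZIso]

lemma extendZ_eq_zero {n : ℤ} (hn : n < 0) {V : Opens X} (s : Sec ((extendZ K).X n) V) : s = 0 := by
  have h : 𝟙 ((extendZ K).X n) = 0 :=
    (K.isZero_extend_X ComplexShape.embeddingUpNat n (fun i => by
      change (i : ℤ) ≠ n
      omega)).eq_of_src _ _
  exact congrArg (fun f => secMap f V s) h

lemma secMap_extendZIso_d {n m : ℕ} {V : Opens X} (s : Sec ((extendZ K).X n) V) :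
    secMap (K.d n m) V (secMap (extendZIso n).hom V s) =
      secMap (extendZIso m).hom V (secMap ((extendZ K).d n m) V s) := by
  rw [← secMap_comp, ← extendZIso_d, secMap_comp]

lemma secMap_extendZIso_inv {n : ℕ} {V : Opens X} (s : Sec ((extendZ K).X n) V) :
    secMap (extendZIso n).inv V (secMap (extendZIso n).hom V s) = s := by
  rw [← secMap_comp, Iso.hom_inv_id, secMap_id]

lemma secMap_extendZIso_hom {n : ℕ} {V : Opens X} (s : Sec (K.X n) V) :
    secMap (extendZIso n).hom V (secMap (extendZIso n).inv V s) = s := by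
  rw [← secMap_comp, Iso.inv_hom_id, secMap_id]

lemma secMap_extendZIso_injective {n : ℕ} {V : Opens X} {s t : Sec ((extendZ K).X n) V}
    (h : secMap (extendZIso n).hom V s = secMap (extendZIso n).hom V t) : s = t := by
  rw [← secMap_extendZIso_inv s, h, secMap_extendZIso_inv]

lemma secMap_extendZIso_inv_d {n m : ℕ} {V : Opens X} (s : Sec (K.X n) V) :
    secMap ((extendZ K).d n m) V (secMap (extendZIso n).inv V s) =
      secMap (extendZIso m).inv V (secMap (K.d n m) V s) := by
  apply secMap_extendZIso_injective
  rw [← secMap_extendZIso_d, secMap_extendZIso_hom, secMap_extendZIso_hom]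

lemma secMap_extendMap {L : CochainComplex (CSheaf X) ℕ} (f : K ⟶ L) {n : ℕ} {V : Opens X}
    (s : Sec ((extendZ K).X n) V) :
    secMap (extendZIso n).hom V
      (secMap ((HomologicalComplex.extendMap f ComplexShape.embeddingUpNat).f (n : ℤ)) V s) =
      secMap (f.f n) V (secMap (extendZIso n).hom V s) := by
  rw [← secMap_comp, extendZIso_map, secMap_comp]

lemma LocInj.extend {L : CochainComplex (CSheaf X) ℕ} {f : K ⟶ L} {U : Opens X}
    (h : ∀ n, LocInj f (n - 1) n (n + 1) U) (n : ℤ) :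
    LocInj (HomologicalComplex.extendMap f ComplexShape.embeddingUpNat) (n - 1) n (n + 1) U := by
  intro V hV s hs t hst x hx
  rcases lt_or_ge n 0 with hn | hn
  · exact ⟨V, le_rfl, hx, 0, by rw [extendZ_eq_zero hn s, map_zero, map_zero]⟩
  obtain ⟨n, rfl⟩ := Int.eq_ofNat_of_zero_le hn
  have hs' : secMap (K.d n (n + 1)) V (secMap (extendZIso n).hom V s) = 0 := by
    rw [secMap_extendZIso_d]
    exact (congrArg _ hs).trans (map_zero _)
  rcases n with _ | n
  · obtain ⟨W, hW, hxW, u, hu⟩ := h 0 V hV _ hs' 0 (by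
      rw [← secMap_extendMap, hst, extendZ_eq_zero (by simp) t, map_zero, map_zero, map_zero]) x hx
    refine ⟨W, hW, hxW, 0, ?_⟩
    rw [map_zero]
    apply secMap_extendZIso_injective
    rw [map_zero, secMap_resL, ← hu, K.shape _ _ (by simp), secMap_zero]
  · have e : ((n + 1 : ℕ) : ℤ) - 1 = n := by push_cast; ring
    revert t
    rw [e]
    intro t hst
    obtain ⟨W, hW, hxW, u, hu⟩ := h (n + 1) V hV _ hs' (secMap (extendZIso n).hom V t) (by
      rw [← secMap_extendMap, hst]
      exact (secMap_extendZIso_d t).symm) x hx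
    refine ⟨W, hW, hxW, secMap (extendZIso n).inv W u, ?_⟩
    apply secMap_extendZIso_injective
    rw [secMap_extendZIso_inv_d, secMap_extendZIso_hom, secMap_resL, ← hu]
    rfl

lemma LocSurj.extend {L : CochainComplex (CSheaf X) ℕ} {f : K ⟶ L} {U : Opens X}
    (h : ∀ n, LocSurj f (n - 1) n (n + 1) U) (n : ℤ) :
    LocSurj (HomologicalComplex.extendMap f ComplexShape.embeddingUpNat) (n - 1) n (n + 1) U := by
  intro V hV t ht x hx
  rcases lt_or_ge n 0 with hn | hn
  · exact ⟨V, le_rfl, hx, 0, map_zero _, 0, by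
      rw [extendZ_eq_zero hn t, map_zero, map_zero, map_zero, add_zero]⟩
  obtain ⟨n, rfl⟩ := Int.eq_ofNat_of_zero_le hn
  obtain ⟨W, hW, hxW, s, hs, u, hu⟩ := h n V hV (secMap (extendZIso n).hom V t) (by
    rw [secMap_extendZIso_d]
    exact (congrArg _ ht).trans (map_zero _)) x hx
  refine ⟨W, hW, hxW, secMap (extendZIso n).inv W s, ?_, ?_⟩
  · refine (secMap_extendZIso_inv_d (m := n + 1) s).trans ?_
    rw [hs, map_zero]
  rcases n with _ | n
  · refine ⟨0, ?_⟩
    apply secMap_extendZIso_injective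
    rw [map_zero, add_zero, secMap_extendMap, secMap_extendZIso_hom, secMap_resL, hu,
      L.shape _ _ (by simp), secMap_zero, add_zero]
  · have e : ((n + 1 : ℕ) : ℤ) - 1 = n := by push_cast; ring
    rw [e]
    refine ⟨secMap (extendZIso n).inv W u, ?_⟩
    apply secMap_extendZIso_injective
    rw [map_add, secMap_extendMap, secMap_extendZIso_hom, secMap_resL, hu, secMap_extendZIso_inv_d,
      secMap_extendZIso_hom]
    rfl

/-- The components of a morphism from `K`, extended by zero, to a complex indexed by `ℤ`. -/
def natHom {I : CochainComplex (CSheaf X) ℤ} (ι : extendZ K ⟶ I) (n : ℕ) : K.X n ⟶ I.X n :=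
  (extendZIso n).inv ≫ ι.f n

lemma secMap_natHom_d {I : CochainComplex (CSheaf X) ℤ} (ι : extendZ K ⟶ I) (n m : ℕ)
    {V : Opens X} (s : Sec (K.X n) V) :
    secMap (I.d n m) V (secMap (natHom ι n) V s) = secMap (natHom ι m) V (secMap (K.d n m) V s) := by
  rw [natHom, natHom, secMap_comp, ← secMap_comm, secMap_extendZIso_inv_d, secMap_comp]

/-- A closed section of a resolution is locally, up to exact sections, the image of a closed section
of the complex. -/
lemma exists_local_natHom {I : CochainComplex (CSheaf X) ℤ} (ι : extendZ K ⟶ I) [QuasiIso ι]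
    (n : ℕ) {V : Opens X} (a : Sec (I.X n) V) (ha : secMap (I.d n (n + 1)) V a = 0) {x : X}
    (hx : x ∈ V) : ∃ (W : Opens X) (h : W ≤ V), x ∈ W ∧ ∃ k : Sec (K.X n) W,
      secMap (K.d n (n + 1)) W k = 0 ∧ ∃ b : Sec (I.X ((n : ℤ) - 1)) W,
        resL (I.X n) h a = secMap (natHom ι n) W k + secMap (I.d (n - 1) n) W b := by
  obtain ⟨-, h2⟩ := (quasiIsoAt_iff_locally ι ((n : ℤ) - 1) n (n + 1) (by simp) (by simp)).1
    (‹QuasiIso ι›.quasiIsoAt _)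
  obtain ⟨W, hW, hxW, s, hs, u, hu⟩ := h2 V le_top a ha x hx
  refine ⟨W, hW, hxW, secMap (extendZIso n).hom W s, ?_, u, ?_⟩
  · rw [secMap_extendZIso_d]
    exact (congrArg _ hs).trans (map_zero _)
  · rw [hu, natHom, secMap_comp, secMap_extendZIso_inv]

/-- In degree zero there are no exact sections: a closed section that dies in the resolution vanishes
locally. -/
lemma natHom_zero_injective {I : CochainComplex (CSheaf X) ℤ} (ι : extendZ K ⟶ I) [QuasiIso ι]
    {V : Opens X} (k : Sec (K.X 0) V) (hk : secMap (K.d 0 1) V k = 0)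
    (h : secMap (natHom ι 0) V k = 0) {x : X} (hx : x ∈ V) :
    ∃ (W : Opens X) (hW : W ≤ V), x ∈ W ∧ resL _ hW k = 0 := by
  obtain ⟨h1, -⟩ := (quasiIsoAt_iff_locally ι (-1 : ℤ) ((0 : ℕ) : ℤ) ((1 : ℕ) : ℤ)
    (by simp) (by simp)).1 (‹QuasiIso ι›.quasiIsoAt _)
  obtain ⟨W, hW, hxW, u, hu⟩ := h1 V le_top (secMap (extendZIso 0).inv V k) (by
    rw [secMap_extendZIso_inv_d, hk, map_zero]) 0 (by
      rw [map_zero]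
      exact h) x hx
  refine ⟨W, hW, hxW, ?_⟩
  rw [extendZ_eq_zero (by simp) u, map_zero, ← secMap_resL] at hu
  rw [← secMap_extendZIso_hom (resL _ hW k), ← hu, map_zero]

section Derived

variable [HasDerivedCategory.{w} (CSheaf X)]

open CochainComplex in
/-- Restriction to `U` is bijective on hypercohomology if the complex of sections with support in
the complement of `U` of an injective resolution is exact. -/
lemma hyperRestrict_bijective {I : CochainComplex (CSheaf X) ℤ} (ι : extendZ K ⟶ I) [QuasiIso ι]
    (hI : ∀ n, Injective (I.X n)) [I.IsStrictlyGE 0] (U : Opens X)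
    (h : ∀ (n : ℤ) (s : Sec (I.X n) ⊤), secMap (I.d n (n + 1)) ⊤ s = 0 →
      resL (I.X n) (le_top : U ≤ ⊤) s = 0 → ∃ t : Sec (I.X (n - 1)) ⊤,
        resL (I.X (n - 1)) (le_top : U ≤ ⊤) t = 0 ∧ secMap (I.d (n - 1) n) ⊤ t = s) (n : ℤ) :
    Function.Bijective (hyperRestrict (le_top : U ≤ ⊤) K n) := by
  have := mono_freeSheaf_map (le_top : U ≤ ⊤)
  have hIK : I.IsKInjective := isKInjective_of_injective I 0
  -- the cokernel of `j_! ℂ_U → ℂ_X`: morphisms from it into a sheaf are global sections that vanish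
  -- on `U`
  let f := (freeSheaf X).map (homOfLE (le_top : U ≤ ⊤))
  let S : ShortComplex (CSheaf X) := ShortComplex.mk f (Limits.cokernel.π f) (by simp)
  have hS : S.ShortExact :=
    { exact := ShortComplex.exact_cokernel f
      mono_f := this
      epi_g := inferInstanceAs (Epi (Limits.cokernel.π f)) }
  refine precomp_bijective_of_distTriang hS.singleTriangle hS.singleTriangle_distinguished
    ((toDerived X).obj K) (fun m a => ?_) n
  have key := derived_hom_eq_zero (Limits.cokernel f) I (fun m g hg => ?_) m
    (a ≫ ((DerivedCategory.Q.map ι)⟦m⟧'))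
  · exact (cancel_mono ((DerivedCategory.Q.map ι)⟦m⟧')).1
      (key.trans (Limits.zero_comp).symm)
  · -- a cocycle `g` of the complex of morphisms is a closed section vanishing on `U`
    obtain ⟨t, ht, hts⟩ := h m (secMap (Limits.cokernel.π f ≫ g) ⊤ (unitSec ⊤))
      (by rw [← secMap_comp, Category.assoc, hg, Limits.comp_zero, secMap_zero])
      (by rw [← secMap_resL, ← secMap_free_unitSec, ← secMap_comp]
          change secMap (f ≫ _) U (unitSec U) = 0
          rw [← Category.assoc, Limits.cokernel.condition, Limits.zero_comp, secMap_zero])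
    refine ⟨Limits.cokernel.desc f (freeHom t) (free_hom_ext ?_), ?_⟩
    · rw [secMap_comp, secMap_zero]
      change secMap (freeHom t) U (secMap ((freeSheaf X).map (homOfLE le_top)) U (unitSec U)) = 0
      rw [secMap_free_unitSec, secMap_resL, secMap_freeHom, ht]
    · rw [← cancel_epi (Limits.cokernel.π f), Limits.cokernel.π_desc_assoc]
      refine free_hom_ext ?_
      rw [secMap_comp, secMap_freeHom, hts]

open CochainComplex in
/-- A morphism of complexes that is bijective on the cohomology sheaves over `U` induces bijections
on the hypercohomology of `U`. -/
lemma hyperMap_bijective {L : CochainComplex (CSheaf X) ℕ} (f : K ⟶ L) (U : Opens X)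
    (h1 : ∀ n, LocInj f (n - 1) n (n + 1) U) (h2 : ∀ n, LocSurj f (n - 1) n (n + 1) U) (n : ℤ) :
    Function.Bijective (hyperMap U f n) := by
  -- the mapping cone is locally exact over `U`, so that an injective resolution of it has exact
  -- sections over `U`
  let φ := HomologicalComplex.extendMap f ComplexShape.embeddingUpNat
  have : (mappingCone φ).IsStrictlyGE (-1) := isStrictlyGE_mappingCone φ 0 0 (-1)
  obtain ⟨I, ι, _, hI, _⟩ := Plus.modelCategoryQuillen.exists_quasiIso_injective (mappingCone φ) (-1)
  have hIK : I.IsKInjective := isKInjective_of_injective I (-1)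
  have hloc : ∀ m, LocExact I U m := fun m =>
    LocExact.of_quasiIso ι (locExact_mappingCone φ U (LocInj.extend h1) (LocSurj.extend h2) m)
  refine postcomp_bijective_of_distTriang _ (DerivedCategory.mappingCone_triangle_distinguished φ) _
    (fun m a => ?_) n
  have key := derived_hom_eq_zero ((freeSheaf X).obj U) I (fun m g hg => ?_) m
    (a ≫ ((DerivedCategory.Q.map ι)⟦m⟧'))
  · exact (cancel_mono ((DerivedCategory.Q.map ι)⟦m⟧')).1
      (key.trans (Limits.zero_comp).symm)
  · obtain ⟨t, -, ht⟩ := (secCxOf I hI (-1) inferInstance).exact_of_locally_exact ⊥ U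
      (fun m V hV s hs _ x hx => by
        obtain ⟨W, hW, hxW, u, hu⟩ := hloc m V hV s hs x hx
        exact ⟨W, hW, hxW, u, (secCxOf I hI (-1) inferInstance).ext_bot (by simp) _ _, hu⟩) m U
      le_rfl (secMap g U (unitSec U))
      (by change secMap (I.d m (m + 1)) U _ = 0
          rw [← secMap_comp, hg, secMap_zero])
      ((secCxOf I hI (-1) inferInstance).ext_bot (by simp) _ _)
    refine ⟨freeHom (show Sec (I.X (m - 1)) U from t), free_hom_ext ?_⟩
    exact (congrArg (secMap (I.d (m - 1) m) U)
      (secMap_freeHom (show Sec (I.X (m - 1)) U from t))).trans ht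

lemma hyperMap_bijective_of_quasiIso {L : CochainComplex (CSheaf X) ℕ} (f : K ⟶ L) [QuasiIso f]
    (U : Opens X) (n : ℤ) : Function.Bijective (hyperMap U f n) := by
  have h := fun m : ℕ => (quasiIsoAt_iff_locally f (m - 1) m (m + 1)
    (by rcases m with _ | m <;> simp) (by simp)).1 (‹QuasiIso f›.quasiIsoAt m)
  exact hyperMap_bijective f U (fun m V _ => (h m).1 V le_top) (fun m V _ => (h m).2 V le_top) n

lemma hyperRestrict_hyperMap {L : CochainComplex (CSheaf X) ℕ} (f : K ⟶ L) {V W : Opens X}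
    (h : W ≤ V) (n : ℤ) (a : Hyper V K n) :
    hyperRestrict h L n (hyperMap V f n a) = hyperMap W f n (hyperRestrict h K n a) :=
  (Category.assoc _ _ _).symm

end Derived

end Resolutions

/-! ### Flasque complexes on boxes -/

section Boxes

variable {E ι : Type} [TopologicalSpace E] [Fintype ι] (u : E ≃ₜ (ι → ℝ))

/-- Open boxes with respect to real coordinates `u` on `E`. -/
def openBox (a b : ι → ℝ) : Opens E where
  carrier := {x | ∀ i, a i < u x i ∧ u x i < b i}
  is_open' := by
    have : {x | ∀ i, a i < u x i ∧ u x i < b i} = ⋂ i, {x | a i < u x i ∧ u x i < b i} := by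
      ext x
      simp
    rw [this]
    refine isOpen_iInter_of_finite fun i => ?_
    have h : Continuous fun x => u x i := (continuous_apply i).comp u.continuous
    exact (isOpen_lt continuous_const h).inter (isOpen_lt h continuous_const)

variable {u}

lemma mem_openBox {a b : ι → ℝ} {x : E} : x ∈ openBox u a b ↔ ∀ i, a i < u x i ∧ u x i < b i :=
  Iff.rfl

lemma openBox_mono {a b a' b' : ι → ℝ} (ha : a' ≤ a) (hb : b ≤ b') :
    openBox u a b ≤ openBox u a' b' :=
  fun _ hx i => ⟨(ha i).trans_lt (hx i).1, (hx i).2.trans_le (hb i)⟩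

lemma exists_openBox_le {x : E} {W : Opens E} (hx : x ∈ W) :
    ∃ ε > 0, openBox u (u x - fun _ => ε) (u x + fun _ => ε) ≤ W := by
  have h : u.symm ⁻¹' (W : Set E) ∈ 𝓝 (u x) :=
    u.symm.continuous.continuousAt.preimage_mem_nhds
      (by rw [u.symm_apply_apply]; exact W.isOpen.mem_nhds hx)
  obtain ⟨ε, hε, hb⟩ := Metric.mem_nhds_iff.1 h
  refine ⟨ε, hε, fun y hy => ?_⟩
  have : u y ∈ Metric.ball (u x) ε := by
    rw [Metric.mem_ball, dist_pi_lt_iff hε]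
    intro i
    have h1 := hy i
    simp only [Pi.sub_apply, Pi.add_apply] at h1
    rw [Real.dist_eq, abs_lt]
    constructor <;> linarith
  simpa using hb this

end Boxes

namespace SecCx

variable {E ι : Type} [TopologicalSpace E] [Fintype ι] {u : E ≃ₜ (ι → ℝ)} (G : SecCx E)

/-- The differentials in nonnegative degrees. -/
abbrev D (k : ℕ) {A : Opens E} : G.S k A →ₗ[ℂ] G.S (k + 1 : ℕ) A := G.d k (k + 1 : ℕ) A

lemma D_res {k : ℕ} {A B : Opens E} (h : B ≤ A) (s : G.S k A) :
    G.D k (G.res _ h s) = G.res _ h (G.D k s) :=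
  G.d_res h s

/-- Local exactness over `W₀` in positive degrees. -/
def LocallyExact (W₀ : Opens E) : Prop :=
  ∀ (k : ℕ) (A : Opens E) (_ : A ≤ W₀) (α : G.S (k + 1 : ℕ) A) (_ : G.D (k + 1) α = 0),
    ∀ x ∈ A, ∃ (W : Opens E) (h : W ≤ A), x ∈ W ∧ ∃ β : G.S k W, G.D k β = G.res _ h α

variable (u) in
/-- Closed sections of degree `0` over boxes in `W₀` extend to larger boxes. -/
def ExtendsOnBoxes (W₀ : Opens E) : Prop :=
  ∀ (a b a' b' : ι → ℝ) (h : openBox u a b ≤ openBox u a' b') (_ : openBox u a' b' ≤ W₀)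
    (α : G.S (0 : ℕ) (openBox u a b)) (_ : G.D 0 α = 0),
    ∃ β : G.S (0 : ℕ) (openBox u a' b'), G.D 0 β = 0 ∧ G.res _ h β = α

variable (u) in
/-- The section `α` is exact on a neighbourhood of the closed box with corners `a` and `b`. -/
def ExactNear {k : ℕ} {A : Opens E} (α : G.S (k + 1 : ℕ) A) (a b : ι → ℝ) : Prop :=
  ∃ ε > 0, ∃ (h : openBox u (a - fun _ => ε) (b + fun _ => ε) ≤ A) (β : G.S k _),
    G.D k β = G.res _ h α

variable {G}

lemma ExactNear.mono {k : ℕ} {A : Opens E} {α : G.S (k + 1 : ℕ) A} {a b : ι → ℝ}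
    {ε : ℝ} (hε : 0 < ε) {Q : Opens E} (hQ : Q ≤ A) (hb : ∃ β : G.S k Q, G.D k β = G.res _ hQ α)
    (h : openBox u (a - fun _ => ε) (b + fun _ => ε) ≤ Q) : G.ExactNear u α a b := by
  obtain ⟨β, hβ⟩ := hb
  exact ⟨ε, hε, h.trans hQ, G.res _ h β, by rw [D, G.d_res, hβ, G.res_res]⟩

/-- Corrections for gluing primitives: a closed section near a box agrees near that box with the
restriction of a closed section on a larger box. -/
lemma exists_closed_extension {W₀ : Opens E} (hC : G.ExtendsOnBoxes u W₀) (k : ℕ)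
    (ih : ∀ l, k = l + 1 → ∀ (A : Opens E) (_ : A ≤ W₀) (α : G.S (l + 1 : ℕ) A)
      (_ : G.D (l + 1) α = 0) (a b : ι → ℝ) (_ : a ≤ b) (_ : ∀ x, (∀ i, a i ≤ u x i ∧ u x i ≤ b i) →
        x ∈ A), G.ExactNear u α a b)
    {a b a₁ b₁ a₂ b₂ : ι → ℝ} (hab : a ≤ b) (h₁ : ∀ i, a₁ i < a i ∧ b i < b₁ i)
    (h₂ : openBox u a₂ b₂ ≤ W₀) (h₁₂ : openBox u a₁ b₁ ≤ openBox u a₂ b₂)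
    (γ : G.S k (openBox u a₁ b₁)) (hγ : G.D k γ = 0) :
    ∃ ε > 0, ∀ ε' > 0, ε' ≤ ε →
      ∃ (h : openBox u (a - fun _ => ε') (b + fun _ => ε') ≤ openBox u a₁ b₁)
      (δ : G.S k (openBox u a₂ b₂)), G.D k δ = 0 ∧ G.res _ (h.trans h₁₂) δ = G.res _ h γ := by
  obtain rfl | ⟨l, rfl⟩ : k = 0 ∨ ∃ l, k = l + 1 := by
    rcases k with _ | l
    · exact Or.inl rfl
    · exact Or.inr ⟨l, rfl⟩
  · -- degree zero: closed sections extend by assumption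
    obtain ⟨ε, hε, h⟩ : ∃ ε > 0, ∀ i, a₁ i ≤ a i - ε ∧ b i + ε ≤ b₁ i := by
      have h1 : ∀ i, ∃ e > 0, a₁ i ≤ a i - e ∧ b i + e ≤ b₁ i := fun i =>
        ⟨min (a i - a₁ i) (b₁ i - b i), lt_min (sub_pos.2 (h₁ i).1) (sub_pos.2 (h₁ i).2), by
          linarith [min_le_left (a i - a₁ i) (b₁ i - b i)], by
          linarith [min_le_right (a i - a₁ i) (b₁ i - b i)]⟩
      choose e he h2 using h1
      obtain ⟨ε, hε, hle⟩ : ∃ ε > 0, ∀ i, ε ≤ e i := by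
        rcases isEmpty_or_nonempty ι with hι | hι
        · exact ⟨1, one_pos, fun i => hι.elim i⟩
        · obtain ⟨i, hi⟩ := Finite.exists_min e
          exact ⟨e i, he i, hi⟩
      exact ⟨ε, hε, fun i => ⟨by linarith [(h2 i).1, hle i], by linarith [(h2 i).2, hle i]⟩⟩
    obtain ⟨δ, hδ, e⟩ := hC _ _ _ _ h₁₂ h₂ γ hγ
    refine ⟨ε, hε, fun ε' _ hle => ⟨openBox_mono (fun i => ?_) (fun i => ?_), δ, hδ, ?_⟩⟩
    · simp only [Pi.sub_apply]
      linarith [(h i).1]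
    · simp only [Pi.add_apply]
      linarith [(h i).2]
    · rw [← e, G.res_res]
  · -- positive degree: the section is exact on a smaller box, and its primitive extends by
    -- flasqueness
    obtain ⟨ε, hε, h, β, hβ⟩ := ih l rfl _ (h₁₂.trans h₂) γ hγ a b hab
      (fun x hx i => ⟨(h₁ i).1.trans_le (hx i).1, (hx i).2.trans_lt (h₁ i).2⟩)
    refine ⟨ε, hε, fun ε' _ hle => ?_⟩
    have h' : openBox u (a - fun _ => ε') (b + fun _ => ε') ≤
        openBox u (a - fun _ => ε) (b + fun _ => ε) :=
      openBox_mono (fun i => by simp only [Pi.sub_apply]; linarith)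
        (fun i => by simp only [Pi.add_apply]; linarith)
    obtain ⟨β', rfl⟩ := G.flasque (n := (l : ℕ)) (h.trans h₁₂) β
    refine ⟨h'.trans h, G.D l β', G.d_d _, ?_⟩
    have := congrArg (G.res _ h') hβ
    rw [D, G.d_res, G.res_res, G.res_res] at this
    exact this

variable [DecidableEq ι]

/-- Primitives near two adjacent boxes give a primitive near their union. -/
lemma ExactNear.union {W₀ : Opens E} (hC : G.ExtendsOnBoxes u W₀) {k : ℕ}
    (ih : ∀ l, k = l + 1 → ∀ (A : Opens E) (_ : A ≤ W₀) (α : G.S (l + 1 : ℕ) A)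
      (_ : G.D (l + 1) α = 0) (a b : ι → ℝ) (_ : a ≤ b) (_ : ∀ x, (∀ i, a i ≤ u x i ∧ u x i ≤ b i) →
        x ∈ A), G.ExactNear u α a b)
    {A : Opens E} (hA : A ≤ W₀) {α : G.S (k + 1 : ℕ) A} {a b : ι → ℝ} (hab : a ≤ b)
    (j : ι) {c : ℝ} (hac : a j ≤ c) (hcb : c ≤ b j)
    (h1 : G.ExactNear u α a (Function.update b j c))
    (h2 : G.ExactNear u α (Function.update a j c) b) : G.ExactNear u α a b := by
  obtain ⟨ε₁, hε₁, hl₁, β₁, hβ₁⟩ := h1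
  obtain ⟨ε₂, hε₂, hl₂, β₂, hβ₂⟩ := h2
  set ε₀ := min ε₁ ε₂ with hε₀
  have hε₀pos : 0 < ε₀ := lt_min hε₁ hε₂
  let P₁ : ℝ → Opens E := fun ε => openBox u (a - fun _ => ε) (Function.update b j c + fun _ => ε)
  let P₂ : ℝ → Opens E := fun ε => openBox u (Function.update a j c - fun _ => ε) (b + fun _ => ε)
  let P : ℝ → Opens E := fun ε =>
    openBox u (Function.update a j c - fun _ => ε) (Function.update b j c + fun _ => ε)
  have hm₁ : ∀ {e e'}, e ≤ e' → P₁ e ≤ P₁ e' := fun he =>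
    openBox_mono (fun i => sub_le_sub_left he _) (fun i => add_le_add_right he _)
  have hm₂ : ∀ {e e'}, e ≤ e' → P₂ e ≤ P₂ e' := fun he =>
    openBox_mono (fun i => sub_le_sub_left he _) (fun i => add_le_add_right he _)
  have hua : a ≤ Function.update a j c := by
    intro i
    by_cases hi : i = j
    · subst hi
      simpa using hac
    · simp [Function.update_of_ne hi]
  have hub : Function.update b j c ≤ b := by
    intro i
    by_cases hi : i = j
    · subst hi
      simpa using hcb
    · simp [Function.update_of_ne hi]
  have hPP₁ : ∀ e, P e ≤ P₁ e := fun e =>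
    openBox_mono (fun i => sub_le_sub_right (hua i) _) le_rfl
  have hPP₂ : ∀ e, P e ≤ P₂ e := fun e =>
    openBox_mono le_rfl (fun i => add_le_add_left (hub i) _)
  have hinf : ∀ e, P₁ e ⊓ P₂ e ≤ P e := by
    intro e x hx i
    exact ⟨(hx.2 i).1, (hx.1 i).2⟩
  -- `β₁ - β₂` is closed on the overlap; extend it to a closed section `δ` on the second box and
  -- replace `β₂` by `β₂ + δ`
  obtain ⟨ε, hε, hδ⟩ := exists_closed_extension hC k ih (a := Function.update a j c)
    (b := Function.update b j c) (a₁ := Function.update a j c - fun _ => ε₀)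
    (b₁ := Function.update b j c + fun _ => ε₀) (a₂ := Function.update a j c - fun _ => ε₂)
    (b₂ := b + fun _ => ε₂)
    (by
      intro i
      by_cases hi : i = j
      · subst hi
        simp
      · simpa [Function.update_of_ne hi] using hab i)
    (fun i => ⟨by simpa using hε₀pos, by simpa using hε₀pos⟩) (hl₂.trans hA)
    ((hPP₂ ε₀).trans (hm₂ (min_le_right _ _)))
    (G.res _ ((hPP₁ ε₀).trans (hm₁ (min_le_left _ _))) β₁ -
      G.res _ ((hPP₂ ε₀).trans (hm₂ (min_le_right _ _))) β₂)
    (by rw [D, map_sub, G.d_res, G.d_res, hβ₁, hβ₂, G.res_res, G.res_res, sub_self])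
  obtain ⟨h, δ, hδ0, hδ⟩ := hδ (min ε ε₀) (lt_min hε hε₀pos) (min_le_left _ _)
  set e := min ε ε₀ with he
  have hee : e ≤ ε₀ := min_le_right _ _
  have hep : 0 < e := lt_min hε hε₀pos
  have h1e : P₁ e ≤ P₁ ε₁ := hm₁ (hee.trans (min_le_left _ _))
  have h2e : P₂ e ≤ P₂ ε₂ := hm₂ (hee.trans (min_le_right _ _))
  obtain ⟨t, ht₁, ht₂⟩ := G.exists_glue_two (G.res _ h1e β₁) (G.res _ h2e (β₂ + δ)) (by
    have := congrArg (G.res _ (hinf e)) hδ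
    rw [map_sub, map_sub, G.res_res, G.res_res, G.res_res, G.res_res, G.res_res] at this
    rw [G.res_res, G.res_res, map_add, this]
    abel)
  have hcov : openBox u (a - fun _ => e) (b + fun _ => e) ≤ P₁ e ⊔ P₂ e := by
    intro x hx
    rcases lt_or_ge (u x j) (c + e) with hlt | hge
    · refine Or.inl fun i => ⟨(hx i).1, ?_⟩
      by_cases hi : i = j
      · subst hi
        simpa using hlt
      · simpa [Function.update_of_ne hi] using (hx i).2
    · refine Or.inr fun i => ⟨?_, (hx i).2⟩
      by_cases hi : i = j
      · subst hi
        simp only [Pi.sub_apply, Function.update_self]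
        linarith
      · simpa [Function.update_of_ne hi] using (hx i).1
  have hsup : P₁ e ⊔ P₂ e ≤ A := sup_le (h1e.trans hl₁) (h2e.trans hl₂)
  refine ExactNear.mono hep hsup ⟨t, ?_⟩ hcov
  refine G.ext_two ?_ ?_
  · rw [D, ← G.d_res, ht₁, G.d_res, hβ₁, G.res_res, G.res_res]
  · rw [D, ← G.d_res, ht₂, G.d_res, map_add, hβ₂, hδ0, add_zero, G.res_res, G.res_res]

/-- Closed sections of positive degree are exact near closed boxes. -/
lemma exactNear {W₀ : Opens E} (hL : G.LocallyExact W₀) (hC : G.ExtendsOnBoxes u W₀) (k : ℕ) :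
    ∀ (A : Opens E) (_ : A ≤ W₀) (α : G.S (k + 1 : ℕ) A)
      (_ : G.D (k + 1) α = 0) (a b : ι → ℝ) (_ : a ≤ b) (_ : ∀ x, (∀ i, a i ≤ u x i ∧ u x i ≤ b i) →
        x ∈ A), G.ExactNear u α a b := by
  induction k using Nat.strong_induction_on with
  | _ k ih =>
  intro A hA α hα a b hab hsub
  -- induction on the number of directions in which the box has positive length
  have key : ∀ s : Finset ι, ∀ a b : ι → ℝ, a ≤ b → (∀ i ∉ s, a i = b i) →
      (∀ x, (∀ i, a i ≤ u x i ∧ u x i ≤ b i) → x ∈ A) → G.ExactNear u α a b := by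
    intro s
    induction s using Finset.induction_on with
    | empty =>
      intro a b hab hs hsub
      have hab' : a = b := funext fun i => hs i (by simp)
      subst hab'
      obtain ⟨W, hW, hxW, β, hβ⟩ := hL k A hA α hα (u.symm a) (hsub _ (by simp))
      obtain ⟨ε, hε, h⟩ := exists_openBox_le (u := u) hxW
      rw [u.apply_symm_apply] at h
      exact ExactNear.mono hε hW ⟨β, hβ⟩ h
    | insert j s hj ihs =>
      intro a b hab hs hsub
      have hslice : ∀ t : Set.Icc (a j) (b j),
          G.ExactNear u α (Function.update a j t) (Function.update b j t) := by
        intro t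
        refine ihs _ _ ?_ ?_ ?_
        · intro i
          by_cases hi : i = j
          · subst hi
            simp
          · simpa [Function.update_of_ne hi] using hab i
        · intro i hi
          by_cases hij : i = j
          · subst hij
            simp
          · simpa [Function.update_of_ne hij] using hs i (by simp [hij, hi])
        · intro x hx
          refine hsub x fun i => ?_
          by_cases hi : i = j
          · subst hi
            have := hx i
            simp only [Function.update_self] at this
            exact ⟨t.2.1.trans this.1, this.2.trans t.2.2⟩
          · simpa [Function.update_of_ne hi] using hx i
      choose ε hε hε' using hslice
      -- there are primitives near the slices in the direction `j`; by Lebesgue, near finitely many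
      -- slabs covering the box, and these are joined one by one
      obtain ⟨t, ht0, htm, ⟨m, hm⟩, htc⟩ := exists_monotone_Icc_subset_open_cover_Icc (hab j)
        (c := fun t : Set.Icc (a j) (b j) => Metric.ball t (ε t)) (fun _ => Metric.isOpen_ball)
        (fun t _ => Set.mem_iUnion.2 ⟨t, Metric.mem_ball_self (hε t)⟩)
      have hpiece : ∀ n, G.ExactNear u α (Function.update a j (t n)) (Function.update b j (t (n + 1))) := by
        intro n
        obtain ⟨i, hi⟩ := htc n
        obtain ⟨hle, β, hβ⟩ := hε' i
        have e1 := hi ⟨le_rfl, htm (Nat.le_succ n)⟩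
        have e2 := hi ⟨htm (Nat.le_succ n), le_rfl⟩
        rw [Metric.mem_ball, Subtype.dist_eq, Real.dist_eq, abs_lt] at e1 e2
        set r := min (ε i) (min ((t n : ℝ) - i + ε i) (i + ε i - t (n + 1))) with hr
        have hr0 : 0 < r := lt_min (hε i) (lt_min (by linarith) (by linarith))
        have hr1 : r ≤ ε i := min_le_left _ _
        have hr2 : r ≤ (t n : ℝ) - i + ε i := (min_le_right _ _).trans (min_le_left _ _)
        have hr3 : r ≤ i + ε i - t (n + 1) := (min_le_right _ _).trans (min_le_right _ _)
        refine ExactNear.mono hr0 hle ⟨β, hβ⟩ (openBox_mono ?_ ?_)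
        · intro l
          by_cases hl : l = j
          · subst hl
            simp only [Pi.sub_apply, Function.update_self]
            linarith
          · simp only [Pi.sub_apply, Function.update_of_ne hl]
            linarith
        · intro l
          by_cases hl : l = j
          · subst hl
            simp only [Pi.add_apply, Function.update_self]
            linarith
          · simp only [Pi.add_apply, Function.update_of_ne hl]
            linarith
      have hup : ∀ n, G.ExactNear u α a (Function.update b j (t (n + 1))) := by
        intro n
        induction n with
        | zero =>
          have := hpiece 0
          rwa [ht0, Function.update_eq_self] at this
        | succ n ihn =>
          refine ExactNear.union hC (fun l hl => ih l (by omega)) hA ?_ j (c := t (n + 1))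
            (t (n + 1)).2.1 ?_ ?_ (hpiece (n + 1))
          · intro i
            by_cases hi : i = j
            · subst hi
              simpa using (t (n + 1 + 1)).2.1
            · simpa [Function.update_of_ne hi] using hab i
          · simpa using htm (Nat.le_succ (n + 1))
          · simpa using ihn
      have := hup m
      rwa [hm (m + 1) (Nat.le_succ m), Function.update_eq_self] at this
  exact key Finset.univ a b hab (by simp) hsub

/-- Closed sections of positive degree over open boxes are exact. -/
lemma exact_openBox {W₀ : Opens E} (hL : G.LocallyExact W₀) (hC : G.ExtendsOnBoxes u W₀) (k : ℕ)
    (a b : ι → ℝ) (hab : openBox u a b ≤ W₀) (α : G.S (k + 1 : ℕ) (openBox u a b))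
    (hα : G.D (k + 1) α = 0) : ∃ β : G.S k (openBox u a b), G.D k β = α := by
  by_cases hlt : ∀ i, a i < b i
  swap
  · refine ⟨0, G.ext_bot ?_ _ _⟩
    push Not at hlt
    obtain ⟨i, hi⟩ := hlt
    rw [eq_bot_iff]
    intro x hx
    have := hx i
    exact absurd (this.1.trans this.2) (not_lt.2 hi)
  -- an exhaustion by smaller boxes
  let e : ℕ → ι → ℝ := fun m i => (b i - a i) / (m + 3)
  have he : ∀ m i, 0 < e m i := fun m i => div_pos (sub_pos.2 (hlt i)) (by positivity)
  have hes : ∀ m i, e (m + 1) i < e m i := fun m i =>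
    div_lt_div_of_pos_left (sub_pos.2 (hlt i)) (by positivity) (by push_cast; linarith)
  have he2 : ∀ m i, 2 * e m i < b i - a i := by
    intro m i
    have h3 : (0 : ℝ) < m + 3 := by positivity
    have hm : (0 : ℝ) ≤ m := Nat.cast_nonneg m
    have hba := hlt i
    simp only [e]
    rw [← mul_div_assoc, div_lt_iff₀ h3]
    nlinarith
  let A : ℕ → Opens E := fun m => openBox u (a + e m) (b - e m)
  have hAs : ∀ m, A m ≤ A (m + 1) := fun m =>
    openBox_mono (fun i => add_le_add_right (hes m i).le _) (fun i => sub_le_sub_left (hes m i).le _)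
  have hAm : Monotone A := monotone_nat_of_le_succ hAs
  have hAle : ∀ m, A m ≤ openBox u a b := fun m =>
    openBox_mono (fun i => by simpa using (he m i).le) (fun i => by simpa using (he m i).le)
  have hcov : openBox u a b ≤ iSup A := by
    intro x hx
    have h1 : ∀ᶠ m : ℕ in atTop, ∀ i, a i + e m i < u x i ∧ u x i < b i - e m i := by
      refine eventually_all.2 fun i => ?_
      have ht : Tendsto (fun m : ℕ => e m i) atTop (𝓝 0) := by
        refine tendsto_const_nhds.div_atTop ?_
        exact tendsto_atTop_add_const_right _ _ tendsto_natCast_atTop_atTop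
      filter_upwards [ht.eventually_lt_const (sub_pos.2 (hx i).1),
        ht.eventually_lt_const (sub_pos.2 (hx i).2)] with m h1 h2
      constructor <;> linarith
    obtain ⟨m, hm⟩ := h1.exists
    exact Opens.mem_iSup.2 ⟨m, hm⟩
  have hclosed : ∀ m x, (∀ i, (a + e m) i ≤ u x i ∧ u x i ≤ (b - e m) i) → x ∈ openBox u a b := by
    intro m x hx i
    have := hx i
    have h1 := he m i
    simp only [Pi.add_apply, Pi.sub_apply] at this
    constructor <;> linarith
  have hle : ∀ m, a + e m ≤ b - e m := fun m i => by
    simp only [Pi.add_apply, Pi.sub_apply]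
    linarith [he2 m i]
  have hthick : ∀ m (ε : ℝ), 0 < ε →
      A m ≤ openBox u (a + e m - fun _ => ε) (b - e m + fun _ => ε) := fun m ε hε =>
    openBox_mono (fun i => by simpa using hε.le) (fun i => by simpa using hε.le)
  let T : ℕ → Type := fun m => {β : G.S k (A m) // G.D k β = G.res _ (hAle m) α}
  have hT : ∀ m, Nonempty (T m) := by
    intro m
    obtain ⟨ε, hε, h, β, hβ⟩ := exactNear hL hC k _ hab α hα _ _ (hle m) (hclosed m)
    exact ⟨⟨G.res _ (hthick m ε hε) β, by rw [D, G.d_res, hβ, G.res_res]⟩⟩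
  -- a primitive on a smaller box is changed by a closed section so as to extend the given one, up
  -- to shrinking the box on which they agree
  have step : ∀ m (β : T (m + 1)), ∃ β' : T (m + 2),
      G.res _ ((hAs m).trans (hAs (m + 1))) β'.1 = G.res _ (hAs m) β.1 := by
    intro m β
    obtain ⟨β'⟩ := hT (m + 2)
    obtain ⟨ε, hε, h⟩ := exists_closed_extension hC k
      (fun l _ A hA α hα => exactNear hL hC l A hA α hα) (a := a + e m) (b := b - e m)
      (a₁ := a + e (m + 1)) (b₁ := b - e (m + 1)) (a₂ := a + e (m + 2)) (b₂ := b - e (m + 2))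
      (hle m) (fun i => by simpa using hes m i) ((hAle (m + 2)).trans hab) (hAs (m + 1))
      (β.1 - G.res _ (hAs (m + 1)) β'.1)
      (by rw [map_sub, β.2, D_res, β'.2, G.res_res, sub_self])
    obtain ⟨h, δ, hδ, hδ'⟩ := h ε hε le_rfl
    refine ⟨⟨β'.1 + δ, by rw [map_add, β'.2, hδ, add_zero]⟩, ?_⟩
    have := congrArg (G.res _ (hthick m ε hε)) hδ'
    rw [G.res_res, G.res_res, map_sub, G.res_res] at this
    rw [map_add, this]
    abel
  choose next hnext using step
  let s : ∀ m, T (m + 1) := fun m => Nat.rec (hT 1).some (fun m β => next m β) m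
  have hs : ∀ m, s (m + 1) = next m (s m) := fun m => rfl
  obtain ⟨f, hfs⟩ : ∃ f : ∀ m, G.S k (A m), ∀ m, f m = G.res _ (hAs m) (s m).1 := ⟨_, fun _ => rfl⟩
  clear_value s
  have hf : ∀ m n (h : m ≤ n), G.res _ (hAm h) (f n) = f m := by
    intro m n h
    induction n, h using Nat.le_induction with
    | base => exact G.res_self _ _
    | succ n h ih =>
      have h1 : G.res _ (hAs n) (f (n + 1)) = f n := by
        rw [hfs, hfs, G.res_res, hs]
        exact hnext n (s n)
      rw [← ih, ← h1, G.res_res]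
  obtain ⟨t, ht, -⟩ := G.glue A f (by
    intro m n
    rcases le_total m n with h | h
    · rw [← hf m n h, G.res_res]
    · rw [← hf n m h, G.res_res])
  refine ⟨G.res _ hcov t, G.ext_local fun x hx => ?_⟩
  obtain ⟨m, hm⟩ := Opens.mem_iSup.1 (hcov hx)
  refine ⟨A m, hAle m, hm, ?_⟩
  rw [← D_res, G.res_res, ht m, hfs, D_res, (s m).2, G.res_res]

end SecCx

/-! ### The exterior derivative in a logarithmic frame -/

section LogFrames

open ContinuousAlternatingMap

variable {d p : ℕ}

/-- Alternating forms on `ℂ^d`. -/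
abbrev Alt (d p : ℕ) : Type := (Fin d → ℂ) [⋀^Fin p]→L[ℂ] ℂ

/-- The tuple of coordinate vectors with indices `I`. -/
abbrev basisVec (I : Fin p → Fin d) : Fin p → Fin d → ℂ := fun j => Pi.single (I j) 1

lemma alt_ext {a b : Alt d p} (h : ∀ I, a (basisVec I) = b (basisVec I)) : a = b := by
  apply ContinuousAlternatingMap.toAlternatingMap_injective
  refine Module.Basis.ext_alternating (Pi.basisFun ℂ (Fin d)) fun I _ => ?_
  simpa using h I

lemma alt_apply_eq_sum (a : Alt d p) (v : Fin p → Fin d → ℂ) :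
    a v = ∑ J : Fin p → Fin d, (∏ j, v j (J j)) * a (basisVec J) := by
  have h : v = fun j => ∑ k, v j k • (Pi.single k 1 : Fin d → ℂ) := by
    funext j
    exact pi_eq_sum_univ' (v j)
  conv_lhs => rw [h]
  rw [ContinuousAlternatingMap.map_sum]
  exact Finset.sum_congr rfl fun J _ => a.map_smul_univ _ _

/-- The diagonal endomorphism with given entries. -/
def diagL : (Fin d → ℂ) →L[ℂ] (Fin d → ℂ) →L[ℂ] (Fin d → ℂ) :=
  LinearMap.toContinuousLinearMap
    { toFun := fun t => ContinuousLinearMap.pi fun k =>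
        t k • ContinuousLinearMap.proj (R := ℂ) (φ := fun _ : Fin d => ℂ) k
      map_add' := fun s t => by
        ext v k
        simp [add_mul]
      map_smul' := fun s t => by
        ext v k
        simp [mul_assoc] }

lemma diagL_apply (t v : Fin d → ℂ) : diagL t v = t * v := rfl

lemma diagL_comp (s t : Fin d → ℂ) : (diagL s).comp (diagL t) = diagL (s * t) := by
  ext v k
  simp [diagL_apply, mul_assoc]

lemma diagL_one : diagL (1 : Fin d → ℂ) = ContinuousLinearMap.id ℂ (Fin d → ℂ) := by
  ext v k
  simp [diagL_apply]

lemma diagL_single (t : Fin d → ℂ) (k : Fin d) :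
    diagL t (Pi.single k 1) = t k • (Pi.single k 1 : Fin d → ℂ) := by
  rw [diagL_apply]
  ext l
  by_cases h : l = k
  · subst h
    simp
  · simp [Pi.single_eq_of_ne h]

lemma compDiag_apply_basis (a : Alt d p) (t : Fin d → ℂ) (I : Fin p → Fin d) :
    a.compContinuousLinearMap (diagL t) (basisVec I) = (∏ j, t (I j)) * a (basisVec I) := by
  have h : (fun j => diagL t (basisVec I j)) = fun j => t (I j) • basisVec I j :=
    funext fun j => diagL_single t (I j)
  exact (congrArg a h).trans (a.map_smul_univ _ _)

lemma AnalyticAt.compAlt {E : Type} [NormedAddCommGroup E] [NormedSpace ℂ E]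
    {G : E → Alt d p} {B : E → (Fin d → ℂ) →L[ℂ] (Fin d → ℂ)} {z : E}
    (hG : AnalyticAt ℂ G z) (hB : AnalyticAt ℂ B z) :
    AnalyticAt ℂ (fun w => (G w).compContinuousLinearMap (B w)) z := by
  let T := ContinuousAlternatingMap.compContinuousLinearMapCLM (𝕜 := ℂ) (F := ℂ) (ι := Fin p)
    (E := Fin d → ℂ) (E' := Fin d → ℂ)
  let L : (Alt d p) →ₗ[ℂ] ((Fin p → Fin d) → ℂ) :=
    { toFun := fun a I => a (basisVec I)
      map_add' := fun _ _ => rfl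
      map_smul' := fun _ _ => rfl }
  have hL : LinearMap.ker L = ⊥ := by
    rw [LinearMap.ker_eq_bot]
    intro a b hab
    exact alt_ext fun I => congrFun hab I
  obtain ⟨R, hR⟩ := L.exists_leftInverse_of_injective hL
  have hfR : (fun w => (G w).compContinuousLinearMap (B w)) = fun w =>
      LinearMap.toContinuousLinearMap R (L ((G w).compContinuousLinearMap (B w))) := by
    funext w
    exact (LinearMap.congr_fun hR _).symm
  rw [hfR]
  refine (ContinuousLinearMap.analyticAt _ _).comp (analyticAt_pi_iff.2 fun I => ?_)
  have h1 : (fun w => L ((G w).compContinuousLinearMap (B w)) I) = fun w =>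
      ∑ J : Fin p → Fin d, (∏ j, B w (basisVec I j) (J j)) * G w (basisVec J) :=
    funext fun w => alt_apply_eq_sum (G w) fun j => B w (basisVec I j)
  rw [h1]
  refine Finset.analyticAt_fun_sum _ fun J _ => AnalyticAt.mul
    (Finset.analyticAt_fun_prod _ fun j _ => ?_) ?_
  · exact ((ContinuousLinearMap.proj (R := ℂ) (φ := fun _ : Fin d => ℂ) (J j)).comp
      (ContinuousLinearMap.apply ℂ (Fin d → ℂ) (basisVec I j))).analyticAt _ |>.comp hB
  · exact ((ContinuousAlternatingMap.apply ℂ (Fin d → ℂ) ℂ (basisVec J)).analyticAt _).comp hG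

section

variable {E E₁ E₂ E₃ : Type} [NormedAddCommGroup E] [NormedSpace ℂ E] [NormedAddCommGroup E₁]
  [NormedSpace ℂ E₁] [NormedAddCommGroup E₂] [NormedSpace ℂ E₂] [NormedAddCommGroup E₃]
  [NormedSpace ℂ E₃]

lemma AnalyticAt.clm_comp' {f : E → E₂ →L[ℂ] E₃} {g : E → E₁ →L[ℂ] E₂} {z : E}
    (hf : AnalyticAt ℂ f z) (hg : AnalyticAt ℂ g z) :
    AnalyticAt ℂ (fun w => (f w).comp (g w)) z :=
  ((ContinuousLinearMap.compL ℂ E₁ E₂ E₃).analyticAt_bilinear _).comp (hf.prod hg)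

lemma AnalyticAt.smulRight_const' {f : E → E₂} {z : E} (l : E₁ →L[ℂ] ℂ)
    (hf : AnalyticAt ℂ f z) : AnalyticAt ℂ (fun w => l.smulRight (f w)) z :=
  ((ContinuousLinearMap.smulRightL ℂ E₁ E₂ l).analyticAt _).comp hf

end

/-- Contraction with a vector in the first argument. -/
def contr (r : Fin d → ℂ) : Alt d (p + 1) →L[ℂ] Alt d p :=
  (ContinuousLinearMap.apply ℂ (Alt d p) r).comp
    (curryLeftLI (𝕜 := ℂ) (E := Fin d → ℂ) (F := ℂ)).toContinuousLinearMap

lemma contr_apply (r : Fin d → ℂ) (a : Alt d (p + 1)) (v : Fin p → Fin d → ℂ) :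
    contr r a v = a (Matrix.vecCons r v) := rfl

lemma contr_contr (r : Fin d → ℂ) (a : Alt d (p + 2)) : contr r (contr r a) = 0 :=
  curryLeft_same a r

/-- Contraction of an alternatized form. -/
lemma contr_alternatize (T : (Fin d → ℂ) →L[ℂ] Alt d (p + 1)) (r : Fin d → ℂ) :
    contr r (alternatizeUncurryFin T) = T r - alternatizeUncurryFin ((contr r).comp T) := by
  ext v
  rw [contr_apply, alternatizeUncurryFin_apply, Fin.sum_univ_succ, ContinuousAlternatingMap.sub_apply,
    alternatizeUncurryFin_apply, sub_eq_add_neg, ← Finset.sum_neg_distrib]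
  congr 1
  · simp
  · refine Finset.sum_congr rfl fun i _ => ?_
    have h1 : i.succ.removeNth (Matrix.vecCons r v) = Matrix.vecCons r (i.removeNth v) := by
      funext j
      cases j using Fin.cases with
      | zero => simp [Fin.removeNth]
      | succ j => simp [Fin.removeNth]
    rw [h1, Fin.val_succ, pow_succ]
    simp [contr_apply]

lemma contr_alternatize_zero (T : (Fin d → ℂ) →L[ℂ] Alt d 0) (r : Fin d → ℂ) :
    contr r (alternatizeUncurryFin T) = T r := by
  ext v
  rw [contr_apply, alternatizeUncurryFin_apply]
  simp

/-- The linear form with given coefficients. -/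
def linForm (μ : Fin d → ℂ) : (Fin d → ℂ) →L[ℂ] ℂ :=
  ∑ k, μ k • ContinuousLinearMap.proj (R := ℂ) (φ := fun _ : Fin d => ℂ) k

lemma linForm_apply (μ v : Fin d → ℂ) : linForm μ v = ∑ k, μ k * v k := by
  simp [linForm]

variable (L : Finset (Fin d))

/-- The coefficients `ℓ_k` of the frame `ℓ_k ∂/∂z_k` of logarithmic vector fields, where
`ℓ_k = z_k` for `k ∈ L` and `ℓ_k = 1` for the other indices. -/
def ell (z : Fin d → ℂ) : Fin d → ℂ := fun k => if k ∈ L then z k else 1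

/-- The monomial `∏ z_k ^ m_k`. -/
def monom (m : Fin d → ℤ) (z : Fin d → ℂ) : ℂ := ∏ k, z k ^ m k

/-- The differential form whose value on the logarithmic frame is `∏ z_k ^ m_k • G`. -/
def frame (m : Fin d → ℤ) (G : (Fin d → ℂ) → Alt d p) (z : Fin d → ℂ) : Alt d p :=
  monom m z • (G z).compContinuousLinearMap (diagL (ell L z)⁻¹)

/-- The exterior derivative in terms of the logarithmic frame with exponents `μ`: the derivatives are
taken along the vector fields `ℓ_k ∂/∂z_k`, and `μ_k` is the contribution of the factor `z_k ^ μ_k`. The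
fields commute, so that there are no further terms. -/
def dLog (μ : Fin d → ℂ) (G : (Fin d → ℂ) → Alt d p) (z : Fin d → ℂ) : Alt d (p + 1) :=
  alternatizeUncurryFin ((fderiv ℂ G z).comp (diagL (ell L z)) + (linForm μ).smulRight (G z))

variable {L}

lemma ell_ne_zero {z : Fin d → ℂ} (hz : ∀ k ∈ L, z k ≠ 0) (k : Fin d) : ell L z k ≠ 0 := by
  unfold ell
  split_ifs with h
  · exact hz k h
  · exact one_ne_zero

lemma inv_ell_mul_ell {z : Fin d → ℂ} (hz : ∀ k ∈ L, z k ≠ 0) : (ell L z)⁻¹ * ell L z = 1 :=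
  funext fun k => inv_mul_cancel₀ (ell_ne_zero hz k)

lemma monom_ne_zero {m : Fin d → ℤ} {z : Fin d → ℂ} (hm : ∀ k ∉ L, m k = 0)
    (hz : ∀ k ∈ L, z k ≠ 0) : monom m z ≠ 0 := by
  refine Finset.prod_ne_zero_iff.2 fun k _ => ?_
  by_cases hk : k ∈ L
  · exact zpow_ne_zero _ (hz k hk)
  · simp [hm k hk]

lemma frame_comp_ell {m : Fin d → ℤ} {G : (Fin d → ℂ) → Alt d p} {z : Fin d → ℂ}
    (hz : ∀ k ∈ L, z k ≠ 0) :
    (frame L m G z).compContinuousLinearMap (diagL (ell L z)) = monom m z • G z := by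
  have h : (diagL (ell L z)⁻¹).comp (diagL (ell L z)) = ContinuousLinearMap.id ℂ _ := by
    rw [diagL_comp, inv_ell_mul_ell hz, diagL_one]
  ext v
  have h1 : ∀ w, diagL (ell L z)⁻¹ (diagL (ell L z) w) = w := fun w => DFunLike.congr_fun h w
  simp only [frame, compContinuousLinearMap_apply, ContinuousAlternatingMap.smul_apply,
    Function.comp_def, h1]

lemma compDiag_injective {t : Fin d → ℂ} (ht : ∀ k, t k ≠ 0) {a b : Alt d p}
    (h : a.compContinuousLinearMap (diagL t) = b.compContinuousLinearMap (diagL t)) : a = b := by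
  refine alt_ext fun I => ?_
  have h1 := congrArg (fun c => c (basisVec I)) h
  simp only [compDiag_apply_basis] at h1
  exact mul_left_cancel₀ (Finset.prod_ne_zero_iff.2 fun j _ => ht _) h1

lemma frame_injective {m : Fin d → ℤ} (hm : ∀ k ∉ L, m k = 0) {G G' : (Fin d → ℂ) → Alt d p}
    {z : Fin d → ℂ} (hz : ∀ k ∈ L, z k ≠ 0) (h : frame L m G z = frame L m G' z) : G z = G' z := by
  have h1 := congrArg (fun a => a.compContinuousLinearMap (diagL (ell L z))) h
  simp only [frame_comp_ell hz] at h1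
  exact smul_right_injective _ (monom_ne_zero hm hz) h1

lemma analyticAt_coord (k : Fin d) (z : Fin d → ℂ) : AnalyticAt ℂ (fun w : Fin d → ℂ => w k) z :=
  (ContinuousLinearMap.proj (R := ℂ) (φ := fun _ : Fin d => ℂ) k).analyticAt z

lemma analyticAt_ell (z : Fin d → ℂ) : AnalyticAt ℂ (ell L) z := by
  rw [analyticAt_pi_iff]
  intro k
  by_cases hk : k ∈ L
  · simpa [ell, hk] using analyticAt_coord k z
  · simpa [ell, hk] using analyticAt_const

lemma analyticAt_monom {m : Fin d → ℤ} (hm : ∀ k ∉ L, m k = 0) {z : Fin d → ℂ}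
    (hz : ∀ k ∈ L, z k ≠ 0) : AnalyticAt ℂ (monom m) z := by
  refine Finset.analyticAt_fun_prod _ fun k _ => ?_
  by_cases hk : k ∈ L
  · exact (analyticAt_coord k z).fun_zpow (hz k hk)
  · simpa [hm k hk] using analyticAt_const

lemma AnalyticAt.frame {m : Fin d → ℤ} (hm : ∀ k ∉ L, m k = 0) {G : (Fin d → ℂ) → Alt d p}
    {z : Fin d → ℂ} (hz : ∀ k ∈ L, z k ≠ 0) (hG : AnalyticAt ℂ G z) :
    AnalyticAt ℂ (frame L m G) z := by
  refine (analyticAt_monom hm hz).smul (hG.compAlt ?_)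
  refine (diagL.analyticAt _).comp (analyticAt_pi_iff.2 fun k => ?_)
  exact (analyticAt_pi_iff.1 (analyticAt_ell z) k).inv (ell_ne_zero hz k)

lemma AnalyticAt.dLog {μ : Fin d → ℂ} {G : (Fin d → ℂ) → Alt d p} {z : Fin d → ℂ}
    (hG : AnalyticAt ℂ G z) : AnalyticAt ℂ (dLog L μ G) z := by
  have h := ContinuousLinearMap.analyticAt (𝕜 := ℂ) (E := (Fin d → ℂ) →L[ℂ] Alt d p)
    (F := Alt d (p + 1)) (alternatizeUncurryFinCLM ℂ (Fin d → ℂ) ℂ (n := p))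
    ((fderiv ℂ G z).comp (diagL (ell L z)) + (linForm μ).smulRight (G z))
  refine AnalyticAt.comp (f := fun w => (fderiv ℂ G w).comp (diagL (ell L w)) +
    (linForm μ).smulRight (G w)) h (AnalyticAt.add ?_ ?_)
  · exact hG.fderiv.clm_comp' ((diagL.analyticAt _).comp (analyticAt_ell z))
  · exact hG.smulRight_const' _

/-- The exponential map on the coordinates in `L`. -/
def expMap (L : Finset (Fin d)) (w : Fin d → ℂ) : Fin d → ℂ :=
  fun k => if k ∈ L then Complex.exp (w k) else w k

lemma analyticAt_expMap (w : Fin d → ℂ) : AnalyticAt ℂ (expMap L) w := by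
  rw [analyticAt_pi_iff]
  intro k
  by_cases hk : k ∈ L
  · have e : (fun x => expMap L x k) = Complex.exp ∘ fun x => x k := by
      funext x
      simp [expMap, hk]
    rw [e]
    exact (analyticAt_coord k w).cexp
  · simpa [expMap, hk] using analyticAt_coord k w

lemma hasFDerivAt_expMap (w : Fin d → ℂ) : HasFDerivAt (expMap L) (diagL (ell L (expMap L w))) w := by
  rw [hasFDerivAt_pi']
  intro k
  have h1 : HasFDerivAt (fun w : Fin d → ℂ => w k)
      (ContinuousLinearMap.proj (R := ℂ) (φ := fun _ : Fin d => ℂ) k) w :=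
    (ContinuousLinearMap.proj (R := ℂ) (φ := fun _ : Fin d => ℂ) k).hasFDerivAt
  by_cases hk : k ∈ L
  · have h2 := h1.cexp
    have e : (fun x => expMap L x k) = fun x => Complex.exp (x k) := by
      funext x
      simp [expMap, hk]
    rw [e]
    refine h2.congr_fderiv (ContinuousLinearMap.ext fun v => ?_)
    change Complex.exp (w k) * v k = ell L (expMap L w) k * v k
    simp [ell, expMap, hk]
  · have e : (fun x => expMap L x k) = fun x => x k := by
      funext x
      simp [expMap, hk]
    rw [e]
    refine h1.congr_fderiv (ContinuousLinearMap.ext fun v => ?_)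
    change v k = ell L (expMap L w) k * v k
    simp [ell, hk]

lemma exists_expMap {z : Fin d → ℂ} (hz : ∀ k ∈ L, z k ≠ 0) : ∃ w, expMap L w = z := by
  refine ⟨fun k => if k ∈ L then Complex.log (z k) else z k, funext fun k => ?_⟩
  by_cases hk : k ∈ L
  · simp [expMap, hk, Complex.exp_log (hz k hk)]
  · simp [expMap, hk]

lemma expMap_ne_zero (w : Fin d → ℂ) : ∀ k ∈ L, expMap L w k ≠ 0 := fun k hk => by
  simp [expMap, hk]

lemma monom_expMap {m : Fin d → ℤ} (hm : ∀ k ∉ L, m k = 0) (w : Fin d → ℂ) :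
    monom m (expMap L w) = Complex.exp (linForm (fun k => (m k : ℂ)) w) := by
  rw [linForm_apply, Complex.exp_sum]
  refine Finset.prod_congr rfl fun k _ => ?_
  by_cases hk : k ∈ L
  · simp [expMap, hk, ← Complex.exp_int_mul]
  · simp [hm k hk]

/-- The exterior derivative in the logarithmic frame: pull back along the exponential map, where
the frame becomes constant. -/
lemma extDeriv_frame {m : Fin d → ℤ} (hm : ∀ k ∉ L, m k = 0) {G : (Fin d → ℂ) → Alt d p}
    {z : Fin d → ℂ} (hz : ∀ k ∈ L, z k ≠ 0) (hG : AnalyticAt ℂ G z) :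
    extDeriv (frame L m G) z = frame L m (dLog L (fun k => m k) G) z := by
  obtain ⟨w, rfl⟩ := exists_expMap hz
  refine compDiag_injective (fun k => ell_ne_zero hz k) ?_
  rw [frame_comp_ell hz]
  have h1 : extDeriv (fun x => (frame L m G (expMap L x)).compContinuousLinearMap
      (fderiv ℂ (expMap L) x)) w = (extDeriv (frame L m G) (expMap L w)).compContinuousLinearMap
      (fderiv ℂ (expMap L) w) := extDeriv_pullback (f := expMap L) (x := w) (r := ω)
    (hG.frame hm hz).differentiableAt (analyticAt_expMap w).contDiffAt (by simp)
  rw [(hasFDerivAt_expMap w).fderiv] at h1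
  rw [← h1]
  have h2 : (fun x => (frame L m G (expMap L x)).compContinuousLinearMap (fderiv ℂ (expMap L) x)) =
      fun x => Complex.exp (linForm (fun k => (m k : ℂ)) x) • G (expMap L x) := by
    funext x
    rw [(hasFDerivAt_expMap x).fderiv, frame_comp_ell (expMap_ne_zero x), monom_expMap hm]
  have h3 := ((linForm (fun k => (m k : ℂ))).hasFDerivAt (x := w)).cexp.fun_smul
    (hG.differentiableAt.hasFDerivAt.comp w (hasFDerivAt_expMap w))
  rw [h2, extDeriv]
  refine (congrArg alternatizeUncurryFin h3.fderiv).trans ?_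
  rw [dLog, monom_expMap hm, ← alternatizeUncurryFin_smul]
  congr 1
  ext v
  simp
  ring

end LogFrames

/-! ### The Euler equation in one coordinate -/

section Averaging

variable {E F : Type} [NormedAddCommGroup E] [NormedSpace ℂ E] [NormedAddCommGroup F]
  [NormedSpace ℂ F] [CompleteSpace F]

/-- Averages of an analytic function along contractions of its ball of convergence are analytic. -/
lemma AnalyticAt.integral_comp_contraction {g : E → F} {c : E} (hg : AnalyticAt ℂ g c)
    {B : ℝ → E →L[ℂ] E} (hB : Continuous B) (hB1 : ∀ t ∈ Set.Icc (0 : ℝ) 1, ‖B t‖ ≤ 1)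
    {φ : ℝ → ℂ} (hφ : Continuous φ) (hφ1 : ∀ t ∈ Set.Icc (0 : ℝ) 1, ‖φ t‖ ≤ 1) :
    AnalyticAt ℂ (fun z => ∫ t in (0 : ℝ)..1, φ t • g (c + B t (z - c))) c := by
  obtain ⟨P, r, hP⟩ := hg
  have hu : Set.uIoc (0 : ℝ) 1 ⊆ Set.Icc 0 1 := by
    rw [Set.uIoc_of_le zero_le_one]
    exact Set.Ioc_subset_Icc_self
  have hcont : ∀ n, Continuous fun t => φ t • (P n).compContinuousLinearMap (fun _ => B t) := by
    intro n
    refine hφ.smul ?_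
    exact ((P n).compContinuousLinearMapLRight (E := fun _ : Fin n => E)).cont.comp
      (continuous_pi fun _ => hB)
  have hle : ∀ n, ∀ t ∈ Set.Icc (0 : ℝ) 1,
      ‖φ t • (P n).compContinuousLinearMap (fun _ => B t)‖ ≤ ‖P n‖ := by
    intro n t ht
    rw [norm_smul]
    refine (mul_le_mul (hφ1 t ht) (ContinuousMultilinearMap.norm_compContinuousLinearMap_le _ _)
      (norm_nonneg _) zero_le_one).trans ?_
    rw [one_mul]
    refine mul_le_of_le_one_right (norm_nonneg _) ?_
    exact Finset.prod_le_one (fun _ _ => norm_nonneg _) fun _ _ => hB1 t ht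
  -- the power series is obtained by averaging the coefficients of the power series of `g`
  let Q : FormalMultilinearSeries ℂ E F := fun n =>
    ∫ t in (0 : ℝ)..1, φ t • (P n).compContinuousLinearMap (fun _ => B t)
  have hQ : ∀ n, ‖Q n‖ ≤ ‖P n‖ := by
    intro n
    have h := intervalIntegral.norm_integral_le_of_norm_le_const (a := (0 : ℝ)) (b := 1)
      (f := fun t => φ t • (P n).compContinuousLinearMap (fun _ => B t)) (C := ‖P n‖)
      fun t ht => hle n t (hu ht)
    simpa using h
  refine ⟨Q, r, ?_, hP.r_pos, ?_⟩
  · refine hP.r_le.trans (ENNReal.le_of_forall_nnreal_lt fun s hs => ?_)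
    obtain ⟨C, -, hC⟩ := P.norm_mul_pow_le_of_lt_radius hs
    refine Q.le_radius_of_bound C fun n => ?_
    exact (mul_le_mul_of_nonneg_right (hQ n) (by positivity)).trans (hC n)
  · intro y hy
    have hmem : ∀ t ∈ Set.Icc (0 : ℝ) 1, B t y ∈ Metric.eball (0 : E) r := by
      intro t ht
      rw [Metric.mem_eball, edist_zero_right] at hy ⊢
      refine lt_of_le_of_lt ?_ hy
      have h1 : ‖B t y‖ ≤ ‖y‖ :=
        ((B t).le_opNorm y).trans (mul_le_of_le_one_left (norm_nonneg _) (hB1 t ht))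
      rw [enorm_le_iff_norm_le]
      exact h1
    have hQy : ∀ n, Q n (fun _ => y) = ∫ t in (0 : ℝ)..1, φ t • P n (fun _ => B t y) := by
      intro n
      exact ((ContinuousMultilinearMap.apply ℂ (fun _ : Fin n => E) F
        (fun _ => y)).intervalIntegral_comp_comm ((hcont n).intervalIntegrable 0 1)).symm
    simp only [hQy, add_sub_cancel_left]
    have hterm : ∀ n, ∀ t ∈ Set.Icc (0 : ℝ) 1,
        ‖φ t • P n (fun _ => B t y)‖ ≤ ‖P n‖ * ‖y‖ ^ n := by
      intro n t ht
      have h1 := ((P n).compContinuousLinearMap (fun _ => B t)).le_opNorm fun _ => y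
      rw [Finset.prod_const, Finset.card_univ, Fintype.card_fin] at h1
      have h2 := mul_le_mul_of_nonneg_right (hle n t ht) (pow_nonneg (norm_nonneg y) n)
      rw [norm_smul] at h2 ⊢
      refine le_trans ?_ h2
      rw [mul_assoc]
      exact mul_le_mul_of_nonneg_left h1 (norm_nonneg _)
    have hyr : (‖y‖₊ : ENNReal) < P.radius := by
      refine lt_of_lt_of_le ?_ hP.r_le
      rw [Metric.mem_eball, edist_zero_right] at hy
      exact hy
    have hsum : Summable fun n => ‖P n‖ * ‖y‖ ^ n := by
      have h := P.summable_norm_mul_pow hyr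
      rwa [coe_nnnorm] at h
    refine intervalIntegral.hasSum_integral_of_dominated_convergence
      (F := fun n t => φ t • P n (fun _ => B t y)) (fun n _ => ‖P n‖ * ‖y‖ ^ n) (fun n => ?_) (fun n => ?_) ?_ ?_ ?_
    · refine Continuous.aestronglyMeasurable ?_
      exact hφ.smul ((P n).cont.comp (continuous_pi fun _ => hB.clm_apply continuous_const))
    · exact Eventually.of_forall fun t ht => hterm n t (hu ht)
    · exact Eventually.of_forall fun t _ => hsum
    · exact intervalIntegrable_const
    · exact Eventually.of_forall fun t ht => (hP.hasSum (hmem t (hu ht))).const_smul _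

end Averaging

section Coordinate

variable {d : ℕ} {F : Type} [NormedAddCommGroup F] [NormedSpace ℂ F]

/-- Scaling of the `k`-th coordinate by a factor `t`. -/
def scaleL (k : Fin d) (t : ℂ) : (Fin d → ℂ) →L[ℂ] (Fin d → ℂ) := diagL (Function.update 1 k t)

/-- Scaling of the `k`-th coordinate with center `c`. -/
def scale (c : Fin d → ℂ) (k : Fin d) (t : ℂ) (z : Fin d → ℂ) : Fin d → ℂ := c + scaleL k t (z - c)

lemma scaleL_apply_same (k : Fin d) (t : ℂ) (v : Fin d → ℂ) : scaleL k t v k = t * v k := by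
  simp [scaleL, diagL_apply]

lemma scaleL_apply_ne {k l : Fin d} (h : l ≠ k) (t : ℂ) (v : Fin d → ℂ) :
    scaleL k t v l = v l := by
  simp [scaleL, diagL_apply, h]

lemma norm_scaleL_le (k : Fin d) {t : ℂ} (ht : ‖t‖ ≤ 1) : ‖scaleL k t‖ ≤ 1 := by
  refine ContinuousLinearMap.opNorm_le_bound _ zero_le_one fun v => ?_
  rw [one_mul, pi_norm_le_iff_of_nonneg (norm_nonneg _)]
  intro l
  by_cases h : l = k
  · subst h
    rw [scaleL_apply_same, norm_mul]
    exact (mul_le_of_le_one_left (norm_nonneg _) ht).trans (norm_le_pi_norm v l)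
  · rw [scaleL_apply_ne h]
    exact norm_le_pi_norm v l

lemma continuous_scaleL (k : Fin d) : Continuous (scaleL k) :=
  diagL.continuous.comp (continuous_const.update k continuous_id)

lemma scaleL_scaleL (k : Fin d) (s t : ℂ) (v : Fin d → ℂ) :
    scaleL k s (scaleL k t v) = scaleL k (s * t) v := by
  funext l
  by_cases h : l = k
  · subst h
    simp [scaleL_apply_same, mul_assoc]
  · simp [scaleL_apply_ne h]

lemma scaleL_one (k : Fin d) (v : Fin d → ℂ) : scaleL k 1 v = v := by
  funext l
  by_cases h : l = k
  · subst h
    simp [scaleL_apply_same]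
  · simp [scaleL_apply_ne h]

lemma scaleL_comm (k l : Fin d) (s t : ℂ) (v : Fin d → ℂ) :
    scaleL k s (scaleL l t v) = scaleL l t (scaleL k s v) := by
  simp only [scaleL, diagL_apply]
  ring

lemma scaleL_eq (k : Fin d) (t : ℂ) (v : Fin d → ℂ) :
    scaleL k t v = scaleL k 0 v + t • Pi.single k (v k) := by
  funext l
  by_cases h : l = k
  · subst h
    simp [scaleL_apply_same]
  · simp [scaleL_apply_ne h, h]

lemma scale_self (c : Fin d → ℂ) (k : Fin d) (t : ℂ) : scale c k t c = c := by
  simp [scale]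

lemma scale_one (c : Fin d → ℂ) (k : Fin d) (z : Fin d → ℂ) : scale c k 1 z = z := by
  simp [scale, scaleL_one]

lemma scale_scale (c : Fin d → ℂ) (k : Fin d) (s t : ℂ) (z : Fin d → ℂ) :
    scale c k s (scale c k t z) = scale c k (s * t) z := by
  simp [scale, scaleL_scaleL]

lemma scale_comm (c : Fin d → ℂ) (k l : Fin d) (s t : ℂ) (z : Fin d → ℂ) :
    scale c k s (scale c l t z) = scale c l t (scale c k s z) := by
  simp [scale, scaleL_comm]

lemma scale_apply_same (c : Fin d → ℂ) (k : Fin d) (t : ℂ) (z : Fin d → ℂ) :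
    scale c k t z k = c k + t * (z k - c k) := by
  rw [scale, Pi.add_apply, scaleL_apply_same, Pi.sub_apply]

lemma scale_apply_ne (c : Fin d → ℂ) {k l : Fin d} (h : l ≠ k) (t : ℂ) (z : Fin d → ℂ) :
    scale c k t z l = z l := by
  simp [scale, scaleL_apply_ne h]

lemma hasFDerivAt_scale (c : Fin d → ℂ) (k : Fin d) (t : ℂ) (z : Fin d → ℂ) :
    HasFDerivAt (scale c k t) (scaleL k t) z := by
  have h := ((scaleL k t).hasFDerivAt (x := z - c)).comp z ((hasFDerivAt_id z).sub_const c)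
  exact (h.const_add c)

lemma analyticAt_scale (c : Fin d → ℂ) (k : Fin d) (t : ℂ) (z : Fin d → ℂ) :
    AnalyticAt ℂ (scale c k t) z := by
  refine analyticAt_const.add ?_
  exact ((scaleL k t).analyticAt _).comp (analyticAt_id.sub analyticAt_const)

lemma continuous_scale (c : Fin d → ℂ) (k : Fin d) (t : ℂ) : Continuous (scale c k t) :=
  continuous_iff_continuousAt.2 fun z => (analyticAt_scale c k t z).continuousAt

lemma tendsto_scale (c : Fin d → ℂ) (k : Fin d) (t : ℂ) :
    Tendsto (scale c k t) (𝓝 c) (𝓝 c) := by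
  have h := (continuous_scale c k t).tendsto c
  rwa [scale_self] at h

lemma AnalyticAt.comp_scale {g : (Fin d → ℂ) → F} {c : Fin d → ℂ} (hg : AnalyticAt ℂ g c)
    (k : Fin d) (t : ℂ) : AnalyticAt ℂ (fun z => g (scale c k t z)) c := by
  refine AnalyticAt.comp (g := g) (f := scale c k t) ?_ (analyticAt_scale c k t c)
  rwa [scale_self]

lemma scale_mem_ball {c : Fin d → ℂ} (k : Fin d) {t : ℂ} (ht : ‖t‖ ≤ 1) {z : Fin d → ℂ} {r : ℝ}
    (hz : z ∈ Metric.ball c r) : scale c k t z ∈ Metric.ball c r := by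
  rw [mem_ball_iff_norm] at hz ⊢
  refine lt_of_le_of_lt ?_ hz
  rw [scale, add_sub_cancel_left]
  exact ((scaleL k t).le_opNorm _).trans
    (mul_le_of_le_one_left (norm_nonneg _) (norm_scaleL_le k ht))

/-- The derivative along the orbit of the scaling. -/
lemma hasDerivAt_comp_scale {g : (Fin d → ℂ) → F} {c z : Fin d → ℂ} {k : Fin d} {s : ℝ}
    (hg : DifferentiableAt ℂ g (scale c k s z)) :
    HasDerivAt (fun s : ℝ => g (scale c k s z))
      (fderiv ℂ g (scale c k s z) (Pi.single k (z k - c k))) s := by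
  have h1 : HasDerivAt (fun s : ℝ => scale c k s z) (Pi.single k (z k - c k)) s := by
    have e : (fun s : ℝ => scale c k s z) = fun s : ℝ => (c + scaleL k 0 (z - c)) +
        s • (Pi.single k (z k - c k) : Fin d → ℂ) := by
      funext s
      rw [scale, scaleL_eq, add_assoc]
      rfl
    rw [e]
    have := ((hasDerivAt_id s).smul_const
      (Pi.single k (z k - c k) : Fin d → ℂ)).const_add (c + scaleL k 0 (z - c))
    simpa using this
  exact HasFDerivAt.comp_hasDerivAt s (hg.hasFDerivAt.restrictScalars ℝ) h1

/-- Euler's equation in one coordinate has a solution: it is `∫₀¹ t^m g(…, t z_k, …) dt`. -/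
lemma exists_euler_solution [CompleteSpace F] {g : (Fin d → ℂ) → F} {c : Fin d → ℂ}
    (hg : AnalyticAt ℂ g c) (k : Fin d) (m : ℕ) :
    ∃ u, AnalyticAt ℂ u c ∧ ∀ᶠ z in 𝓝 c,
      fderiv ℂ u z (Pi.single k (z k - c k)) + ((m : ℂ) + 1) • u z = g z := by
  have hc : ∀ t ∈ Set.Icc (0 : ℝ) 1, ‖(t : ℂ)‖ ≤ 1 := fun t ht => by
    rw [Complex.norm_real, Real.norm_of_nonneg ht.1]
    exact ht.2
  have hu := hg.integral_comp_contraction (B := fun t : ℝ => scaleL k t)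
    ((continuous_scaleL k).comp Complex.continuous_ofReal)
    (fun t ht => norm_scaleL_le k (hc t ht))
    (φ := fun t : ℝ => (t : ℂ) ^ m) (by fun_prop)
    (fun t ht => by
      rw [norm_pow]
      exact pow_le_one₀ (norm_nonneg _) (hc t ht))
  obtain ⟨u, hudef⟩ : ∃ u : (Fin d → ℂ) → F, ∀ z, u z =
    ∫ t in (0 : ℝ)..1, (t : ℂ) ^ m • g (scale c k t z) := ⟨_, fun _ => rfl⟩
  have hu' : (fun z => ∫ t in (0 : ℝ)..1, (t : ℂ) ^ m • g (c + scaleL k t (z - c))) = u :=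
    funext fun z => (hudef z).symm
  rw [hu'] at hu
  refine ⟨u, hu, ?_⟩
  obtain ⟨r, hr, hgr⟩ := Metric.eventually_nhds_iff_ball.1 hg.eventually_analyticAt
  filter_upwards [hu.eventually_analyticAt, Metric.ball_mem_nhds c hr] with z hz hzr
  -- continuity of `s ↦ s^m g(…, s z_k, …)` on an open interval containing `[0, 1]`
  have hopen : IsOpen {s : ℝ | scale c k s z ∈ Metric.ball c r} := by
    have : Continuous fun s : ℝ => scale c k s z :=
      continuous_const.add (((continuous_scaleL k).comp Complex.continuous_ofReal).clm_apply
        continuous_const)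
    exact Metric.isOpen_ball.preimage this
  set f : ℝ → F := fun s => (s : ℂ) ^ m • g (scale c k s z) with hf
  have hfc : ∀ s : ℝ, scale c k s z ∈ Metric.ball c r → ContinuousAt f s := by
    intro s hs
    refine ContinuousAt.smul (by fun_prop) ?_
    exact (hasDerivAt_comp_scale (hgr _ hs).differentiableAt).continuousAt
  have h01 : ∀ s ∈ Set.Icc (0 : ℝ) 1, scale c k s z ∈ Metric.ball c r :=
    fun s hs => scale_mem_ball k (hc s hs) hzr
  -- substitution in the integral: `s^(m+1) u(…, s z_k, …) = ∫₀ˢ t^m g(…, t z_k, …) dt`; the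
  -- equation is the derivative of this identity at `s = 1`
  have hscale : ∀ s : ℝ, (s : ℂ) ^ (m + 1) • u (scale c k s z) = ∫ t in (0 : ℝ)..s, f t := by
    intro s
    have h := intervalIntegral.smul_integral_comp_mul_right f s (a := 0) (b := 1)
    rw [zero_mul, one_mul] at h
    rw [← h, hudef, ← intervalIntegral.integral_smul, ← intervalIntegral.integral_smul]
    refine intervalIntegral.integral_congr fun t _ => ?_
    simp only [hf, scale_scale, smul_smul, Complex.ofReal_mul, ← Complex.coe_smul]
    congr 1
    ring
  have h1m : (1 : ℝ) ∈ Set.Icc (0 : ℝ) 1 := ⟨zero_le_one, le_rfl⟩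
  have hder1 : HasDerivAt (fun s : ℝ => ∫ t in (0 : ℝ)..s, f t) (f 1) 1 := by
    refine intervalIntegral.integral_hasDerivAt_right ?_ ?_ (hfc 1 (h01 1 h1m))
    · refine ContinuousOn.intervalIntegrable fun s hs => (hfc s (h01 s ?_)).continuousWithinAt
      rwa [Set.uIcc_of_le zero_le_one] at hs
    · exact ContinuousOn.stronglyMeasurableAtFilter hopen
        (fun s hs => (hfc s hs).continuousWithinAt) 1 (h01 1 h1m)
  have hz1 : scale c k ((1 : ℝ) : ℂ) z = z := by
    rw [Complex.ofReal_one, scale_one]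
  have hder2 : HasDerivAt (fun s : ℝ => (s : ℂ) ^ (m + 1) • u (scale c k s z))
      (fderiv ℂ u z (Pi.single k (z k - c k)) + ((m : ℂ) + 1) • u z) 1 := by
    have ha : HasDerivAt (fun s : ℝ => (s : ℂ) ^ (m + 1)) ((m : ℂ) + 1) 1 := by
      have := ((hasDerivAt_id (((1 : ℝ) : ℂ))).pow (m + 1)).comp_ofReal
      simpa using this
    have hb := hasDerivAt_comp_scale (g := u) (c := c) (z := z) (k := k) (s := 1)
      (by rw [hz1]; exact hz.differentiableAt)
    have := ha.smul hb
    simp only [Complex.ofReal_one, scale_one, one_pow, one_smul] at this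
    exact this
  simp only [hscale] at hder2
  rw [hder2.unique hder1, hf]
  simp [scale_one]

/-- Solutions of the homogeneous Euler equation in one coordinate which vanish for `z_k = c_k`
are zero. -/
lemma euler_unique [CompleteSpace F] {u : (Fin d → ℂ) → F} {c : Fin d → ℂ} (hu : AnalyticAt ℂ u c) (k : Fin d)
    (m : ℕ) (h : ∀ᶠ z in 𝓝 c, fderiv ℂ u z (Pi.single k (z k - c k)) + (m : ℂ) • u z = 0)
    (h0 : ∀ᶠ z in 𝓝 c, u (scale c k 0 z) = 0) : ∀ᶠ z in 𝓝 c, u z = 0 := by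
  obtain ⟨r, hr, hgr⟩ := Metric.eventually_nhds_iff_ball.1
    (hu.eventually_analyticAt.and (h.and h0))
  filter_upwards [Metric.ball_mem_nhds c hr] with z hz
  have h01 : ∀ s ∈ Set.Icc (0 : ℝ) 1, scale c k s z ∈ Metric.ball c r := fun s hs =>
    scale_mem_ball k (by rw [Complex.norm_real, Real.norm_of_nonneg hs.1]; exact hs.2) hz
  -- `s^m u(…, s z_k, …)` is constant for `0 < s < 1`; it is `0` at `s = 0` and `u z` at `s = 1`
  set f : ℝ → F := fun s => (s : ℂ) ^ m • u (scale c k s z) with hf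
  have hd : ∀ s ∈ Set.Icc (0 : ℝ) 1, DifferentiableAt ℝ f s := by
    intro s hs
    refine DifferentiableAt.smul (by fun_prop) ?_
    exact (hasDerivAt_comp_scale (hgr _ (h01 s hs)).1.differentiableAt).differentiableAt
  have hd' : ∀ s ∈ Set.Ioo (0 : ℝ) 1, HasDerivAt f 0 s := by
    intro s hs
    have hs' : s ∈ Set.Icc (0 : ℝ) 1 := Set.Ioo_subset_Icc_self hs
    have hs0 : (s : ℂ) ≠ 0 := by
      exact_mod_cast hs.1.ne'
    have ha : HasDerivAt (fun s : ℝ => (s : ℂ) ^ m) ((m : ℂ) * (s : ℂ) ^ (m - 1)) s := by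
      have := ((hasDerivAt_id ((s : ℂ))).pow m).comp_ofReal
      simpa using this
    have hb := hasDerivAt_comp_scale (g := u) (c := c) (z := z) (k := k) (s := s)
      (hgr _ (h01 s hs')).1.differentiableAt
    have hE := (hgr _ (h01 s hs')).2.1
    have e1 : (Pi.single k (scale c k s z k - c k) : Fin d → ℂ) =
        (s : ℂ) • Pi.single k (z k - c k) := by
      rw [scale_apply_same, add_sub_cancel_left, ← smul_eq_mul, Pi.single_smul]
    rw [e1, map_smul] at hE
    have hab := ha.smul hb
    have e2 : (s : ℂ) • ((s : ℂ) ^ m • fderiv ℂ u (scale c k s z) (Pi.single k (z k - c k)) +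
        ((m : ℂ) * (s : ℂ) ^ (m - 1)) • u (scale c k s z)) = 0 := by
      have e3 : (s : ℂ) * ((m : ℂ) * (s : ℂ) ^ (m - 1)) = (s : ℂ) ^ m * m := by
        rcases m with _ | m
        · simp
        · simp only [Nat.add_sub_cancel]
          push_cast
          ring
      rw [smul_add, smul_smul, smul_smul, mul_comm, e3, ← smul_smul, ← smul_smul _ (m : ℂ),
        ← smul_add, hE, smul_zero]
    rw [(smul_eq_zero.1 e2).resolve_left hs0] at hab
    exact hab
  have hcst : ∀ s ∈ Set.Ioo (0 : ℝ) 1, ∀ t ∈ Set.Ioo (0 : ℝ) 1, f s = f t := by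
    intro s hs t ht
    exact (convex_Ioo (0 : ℝ) 1).is_const_of_fderivWithin_eq_zero (𝕜 := ℝ)
      (fun x hx => (hd' x hx).differentiableAt.differentiableWithinAt)
      (fun x hx => by
        rw [fderivWithin_of_isOpen isOpen_Ioo hx]
        have := (hd' x hx).hasFDerivAt.fderiv
        rw [this]
        ext
        simp) hs ht
  have hc0 : Tendsto f (𝓝[>] 0) (𝓝 (f 0)) :=
    ((hd 0 ⟨le_rfl, zero_le_one⟩).continuousAt).continuousWithinAt
  have hc1 : Tendsto f (𝓝[<] 1) (𝓝 (f 1)) :=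
    ((hd 1 ⟨zero_le_one, le_rfl⟩).continuousAt).continuousWithinAt
  have hhalf : (1 / 2 : ℝ) ∈ Set.Ioo (0 : ℝ) 1 := by norm_num
  have l0 : f 0 = f (1 / 2) := by
    refine tendsto_nhds_unique hc0 (tendsto_const_nhds.congr' ?_)
    filter_upwards [Ioo_mem_nhdsGT (zero_lt_one' ℝ)] with s hs using hcst _ hhalf _ hs
  have l1 : f 1 = f (1 / 2) := by
    refine tendsto_nhds_unique hc1 (tendsto_const_nhds.congr' ?_)
    filter_upwards [Ioo_mem_nhdsLT (zero_lt_one' ℝ)] with s hs using hcst _ hhalf _ hs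
  have e0 : f 0 = 0 := by
    have := (hgr _ hz).2.2
    simp only [hf, Complex.ofReal_zero, this, smul_zero]
  have e1 : f 1 = u z := by simp [hf, scale_one]
  rw [← e1, l1, ← l0, e0]

/-- Analytic functions which vanish for `z_k = c_k` are divisible by `z_k - c_k`. -/
lemma exists_eq_smul_of_vanishing [CompleteSpace F] {g : (Fin d → ℂ) → F} {c : Fin d → ℂ}
    (hg : AnalyticAt ℂ g c) (k : Fin d) (h0 : ∀ᶠ z in 𝓝 c, g (scale c k 0 z) = 0) :
    ∃ q, AnalyticAt ℂ q c ∧ ∀ᶠ z in 𝓝 c, g z = (z k - c k) • q z := by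
  have hg' : AnalyticAt ℂ (fun z => fderiv ℂ g z (Pi.single k 1)) c :=
    ((ContinuousLinearMap.apply ℂ F (Pi.single k 1 : Fin d → ℂ)).analyticAt _).comp hg.fderiv
  -- the quotient is `∫₀¹ (∂g/∂z_k)(…, t z_k, …) dt`; both sides satisfy the same Euler equation
  obtain ⟨q, hq, hqe⟩ := exists_euler_solution hg' k 0
  refine ⟨q, hq, ?_⟩
  have hl : ∀ z, AnalyticAt ℂ (fun z : Fin d → ℂ => z k - c k) z := fun z =>
    (analyticAt_coord k z).sub analyticAt_const
  have hmain := euler_unique (u := fun z => g z - (z k - c k) • q z) (hg.sub ((hl c).smul hq)) k 0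
    ?_ ?_
  · filter_upwards [hmain] with z hz using sub_eq_zero.1 hz
  · filter_upwards [hqe, hg.eventually_analyticAt, hq.eventually_analyticAt] with z hz h1 h2
    have hd : HasFDerivAt (fun z : Fin d → ℂ => z k - c k)
        (ContinuousLinearMap.proj (R := ℂ) (φ := fun _ : Fin d => ℂ) k) z :=
      ((ContinuousLinearMap.proj (R := ℂ) (φ := fun _ : Fin d => ℂ) k).hasFDerivAt).sub_const _
    have h3 := h1.differentiableAt.hasFDerivAt.fun_sub
      (hd.fun_smul h2.differentiableAt.hasFDerivAt)
    have e : (Pi.single k (z k - c k) : Fin d → ℂ) = (z k - c k) • Pi.single k 1 := by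
      rw [← Pi.single_smul, smul_eq_mul, mul_one]
    rw [h3.fderiv, e, map_smul]
    rw [e, map_smul] at hz
    simp only [Nat.cast_zero, zero_add, one_smul, zero_smul, add_zero] at hz ⊢
    rw [sub_apply, ← hz]
    simp
  · filter_upwards [h0] with z hz
    rw [hz, scale_apply_same]
    simp

/-- A primitive in the `k`-th coordinate which vanishes for `z_k = c_k`. -/
lemma exists_primitive [CompleteSpace F] {g : (Fin d → ℂ) → F} {c : Fin d → ℂ}
    (hg : AnalyticAt ℂ g c) (k : Fin d) :
    ∃ u, AnalyticAt ℂ u c ∧ (∀ z, u (scale c k 0 z) = 0) ∧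
      ∀ᶠ z in 𝓝 c, fderiv ℂ u z (Pi.single k 1) = g z := by
  obtain ⟨q, hq, hqe⟩ := exists_euler_solution hg k 0
  refine ⟨fun z => (z k - c k) • q z, ((analyticAt_coord k c).sub analyticAt_const).smul hq,
    fun z => by simp [scale_apply_same], ?_⟩
  filter_upwards [hqe, hq.eventually_analyticAt] with z hz h2
  have hd : HasFDerivAt (fun z : Fin d → ℂ => z k - c k)
      (ContinuousLinearMap.proj (R := ℂ) (φ := fun _ : Fin d => ℂ) k) z :=
    ((ContinuousLinearMap.proj (R := ℂ) (φ := fun _ : Fin d => ℂ) k).hasFDerivAt).sub_const _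
  have h3 := hd.fun_smul h2.differentiableAt.hasFDerivAt
  have e : (Pi.single k (z k - c k) : Fin d → ℂ) = (z k - c k) • Pi.single k 1 := by
    rw [← Pi.single_smul, smul_eq_mul, mul_one]
  rw [e, map_smul] at hz
  rw [h3.fderiv, ← hz]
  simp

end Coordinate

/-! ### The logarithmic Poincaré lemma -/

section LogPoincare

open ContinuousAlternatingMap hiding map_zero

variable {d p : ℕ} {L : Finset (Fin d)} {μ : Fin d → ℂ} {c : Fin d → ℂ}

@[simp]
lemma alt_zero_smul (a : Alt d p) : (0 : ℂ) • a = 0 := zero_smul ℂ a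

@[simp]
lemma alt_smul_zero (t : ℂ) : t • (0 : Alt d p) = 0 :=
  smul_zero (A := Alt d p) t

lemma alt_neg_one_smul (a : Alt d p) : (-1 : ℂ) • a = -a := neg_one_smul ℂ a

lemma eq_zero_of_alt_smul {t : ℂ} {a : Alt d p} (h : t • a = 0) (ht : t ≠ 0) : a = 0 :=
  (smul_eq_zero.1 h).resolve_left ht

/-- Identities between continuous functions may be checked off the coordinate hyperplanes. -/
lemma eventually_eq_of_off_hyperplanes {F : Type} [TopologicalSpace F] [T2Space F]
    {f g : (Fin d → ℂ) → F} (hf : ∀ᶠ z in 𝓝 c, ContinuousAt f z)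
    (hg : ∀ᶠ z in 𝓝 c, ContinuousAt g z)
    (h : ∀ᶠ z in 𝓝 c, (∀ k ∈ L, z k ≠ 0) → f z = g z) : f =ᶠ[𝓝 c] g := by
  filter_upwards [hf, hg, h.eventually_nhds] with z hfz hgz hz
  -- the points `z + (t, …, t)` lie off the hyperplanes for small `t ≠ 0`
  have ht : Tendsto (fun t : ℂ => z + fun _ => t) (𝓝[≠] 0) (𝓝 z) := by
    have h1 : Continuous fun t : ℂ => z + fun _ : Fin d => t := by fun_prop
    have h2 := h1.tendsto 0
    have e : (z + fun _ : Fin d => (0 : ℂ)) = z := add_zero z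
    rw [e] at h2
    exact h2.mono_left nhdsWithin_le_nhds
  have hne : ∀ᶠ t in 𝓝[≠] (0 : ℂ), ∀ k ∈ L, (z + fun _ : Fin d => t) k ≠ 0 := by
    refine (Filter.eventually_all_finset L).2 fun k _ => ?_
    by_cases hk : z k = 0
    · filter_upwards [self_mem_nhdsWithin] with t ht
      simpa [hk] using ht
    · have h3 : Tendsto (fun t : ℂ => (z + fun _ : Fin d => t) k) (𝓝[≠] 0) (𝓝 (z k)) :=
        (continuous_apply k).continuousAt.tendsto.comp ht
      exact h3.eventually_ne hk
  refine tendsto_nhds_unique_of_eventuallyEq (hfz.tendsto.comp ht) (hgz.tendsto.comp ht) ?_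
  filter_upwards [ht.eventually hz, hne] with t h1 h2 using h1 h2

lemma contr_comp_alternatize_dLog {G : (Fin d → ℂ) → Alt d (p + 1)} {z : Fin d → ℂ}
    (hG : DifferentiableAt ℂ G z) (r : Fin d → ℂ) :
    (contr r).comp ((fderiv ℂ G z).comp (diagL (ell L z)) + (linForm μ).smulRight (G z)) =
      (fderiv ℂ (fun w => contr r (G w)) z).comp (diagL (ell L z)) +
        (linForm μ).smulRight (contr r (G z)) := by
  have h : fderiv ℂ (fun w => contr r (G w)) z = (contr r).comp (fderiv ℂ G z) :=
    ((contr r).hasFDerivAt.comp z hG.hasFDerivAt).fderiv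
  rw [h]
  refine ContinuousLinearMap.ext fun v => ?_
  simp

lemma linForm_single (k : Fin d) : linForm μ (Pi.single k 1) = μ k := by
  rw [linForm_apply]
  simp [Pi.single_apply]

/-- Cartan's formula for the contraction with a vector field of the logarithmic frame. -/
lemma contr_dLog {G : (Fin d → ℂ) → Alt d (p + 1)} {z : Fin d → ℂ}
    (hG : DifferentiableAt ℂ G z) (k : Fin d) :
    contr (Pi.single k 1) (dLog L μ G z) + dLog L μ (fun w => contr (Pi.single k 1) (G w)) z =
      ell L z k • fderiv ℂ G z (Pi.single k 1) + μ k • G z := by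
  rw [dLog, contr_alternatize, contr_comp_alternatize_dLog hG, dLog, sub_add_cancel,
    _root_.add_apply, ContinuousLinearMap.comp_apply, diagL_single, map_smul,
    ContinuousLinearMap.smulRight_apply, linForm_single]

lemma contr_dLog_zero {G : (Fin d → ℂ) → Alt d 0} {z : Fin d → ℂ} (k : Fin d) :
    contr (Pi.single k 1) (dLog L μ G z) =
      ell L z k • fderiv ℂ G z (Pi.single k 1) + μ k • G z := by
  rw [dLog, contr_alternatize_zero, _root_.add_apply,
    ContinuousLinearMap.comp_apply, diagL_single, map_smul, ContinuousLinearMap.smulRight_apply,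
    linForm_single]

lemma Filter.EventuallyEq.dLog {G G' : (Fin d → ℂ) → Alt d p} (h : G =ᶠ[𝓝 c] G') :
    dLog L μ G =ᶠ[𝓝 c] dLog L μ G' := by
  filter_upwards [h, h.fderiv (𝕜 := ℂ)] with z h1 h2
  unfold _root_.dLog
  rw [h1, h2]

lemma dLog_zero : dLog L μ (0 : (Fin d → ℂ) → Alt d p) = 0 := by
  funext z
  unfold dLog
  have h : (fderiv ℂ (0 : (Fin d → ℂ) → Alt d p) z).comp (diagL (ell L z)) +
      (linForm μ).smulRight ((0 : (Fin d → ℂ) → Alt d p) z) = 0 := by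
    rw [fderiv_zero]
    refine ContinuousLinearMap.ext fun v => ?_
    simp
  rw [h]
  exact map_zero (alternatizeUncurryFinCLM ℂ (Fin d → ℂ) ℂ)

lemma dLog_sub {G G' : (Fin d → ℂ) → Alt d p} {z : Fin d → ℂ} (hG : DifferentiableAt ℂ G z)
    (hG' : DifferentiableAt ℂ G' z) :
    dLog L μ (G - G') z = dLog L μ G z - dLog L μ G' z := by
  unfold dLog
  refine Eq.trans ?_ (_root_.map_sub (alternatizeUncurryFinCLM ℂ (Fin d → ℂ) ℂ (n := p)) _ _)
  refine congrArg alternatizeUncurryFin ?_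
  rw [fderiv_sub hG hG']
  refine ContinuousLinearMap.ext fun v => ?_
  simp only [_root_.add_apply, ContinuousLinearMap.comp_apply,
    _root_.sub_apply, ContinuousLinearMap.smulRight_apply, Pi.sub_apply, smul_sub]
  abel

lemma dLog_const_smul (a : ℂ) {G : (Fin d → ℂ) → Alt d p} {z : Fin d → ℂ}
    (hG : DifferentiableAt ℂ G z) : dLog L μ (a • G) z = a • dLog L μ G z := by
  unfold dLog
  rw [← alternatizeUncurryFin_smul, fderiv_const_smul hG]
  congr 1
  refine ContinuousLinearMap.ext fun v => ?_
  simp [smul_comm a]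

lemma AnalyticAt.contr {G : (Fin d → ℂ) → Alt d (p + 1)} (hG : AnalyticAt ℂ G c)
    (r : Fin d → ℂ) : AnalyticAt ℂ (fun z => contr r (G z)) c :=
  ((_root_.contr r).analyticAt _).comp hG

/-- The logarithmic differential has square zero. -/
lemma dLog_dLog {m : Fin d → ℤ} (hm : ∀ k ∉ L, m k = 0) {G : (Fin d → ℂ) → Alt d p}
    (hG : AnalyticAt ℂ G c) :
    dLog L (fun k => m k) (dLog L (fun k => m k) G) =ᶠ[𝓝 c] 0 := by
  refine eventually_eq_of_off_hyperplanes (L := L) ?_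
    (Eventually.of_forall fun z => continuousAt_const) ?_
  · filter_upwards [hG.eventually_analyticAt] with z hz using hz.dLog.dLog.continuousAt
  · filter_upwards [hG.eventually_analyticAt] with z hz hzL
    refine frame_injective (G' := 0) hm hzL ?_
    rw [← extDeriv_frame hm hzL hz.dLog]
    have hL : ∀ᶠ w in 𝓝 z, ∀ k ∈ L, w k ≠ 0 :=
      (Filter.eventually_all_finset L).2 fun k hk => (continuousAt_apply k z).eventually_ne (hzL k hk)
    have h1 : frame L m (dLog L (fun k => m k) G) =ᶠ[𝓝 z] extDeriv (frame L m G) := by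
      filter_upwards [hz.eventually_analyticAt, hL] with w hw hwL
        using (extDeriv_frame hm hwL hw).symm
    rw [h1.extDeriv_eq, extDeriv_extDeriv_apply (r := ω) (hz.frame hm hzL).contDiffAt (by simp)]
    unfold frame
    rw [Pi.zero_apply]
    ext v
    simp

lemma scaleL_comp_diagL {k : Fin d} (hk : k ∈ L) (hck : c k = 0) (z : Fin d → ℂ) :
    (scaleL k 0).comp (diagL (ell L z)) = (diagL (ell L (scale c k 0 z))).comp
      (ContinuousLinearMap.id ℂ (Fin d → ℂ)) := by
  refine ContinuousLinearMap.ext fun v => funext fun l => ?_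
  simp only [ContinuousLinearMap.comp_apply, ContinuousLinearMap.id_apply]
  by_cases h : l = k
  · subst h
    rw [scaleL_apply_same, zero_mul, diagL_apply, Pi.mul_apply, ell, if_pos hk, scale_apply_same,
      hck, zero_mul, zero_add, zero_mul]
  · rw [scaleL_apply_ne h, diagL_apply, diagL_apply, Pi.mul_apply, Pi.mul_apply]
    simp only [ell, scale_apply_ne c h]

/-- The logarithmic differential commutes with the restriction to a coordinate hyperplane along
which the frame is logarithmic. -/
lemma dLog_comp_scale {k : Fin d} (hk : k ∈ L) (hck : c k = 0) {G : (Fin d → ℂ) → Alt d p}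
    {z : Fin d → ℂ} (hG : DifferentiableAt ℂ G (scale c k 0 z)) :
    dLog L μ (fun w => G (scale c k 0 w)) z = dLog L μ G (scale c k 0 z) := by
  unfold dLog
  have h : fderiv ℂ (fun w => G (scale c k 0 w)) z =
      (fderiv ℂ G (scale c k 0 z)).comp (scaleL k 0) :=
    (hG.hasFDerivAt.comp z (hasFDerivAt_scale c k 0 z)).fderiv
  rw [h, ContinuousLinearMap.comp_assoc, scaleL_comp_diagL hk hck, ContinuousLinearMap.comp_id]

lemma dLog_comp_scale_eventually {k : Fin d} (hk : k ∈ L) (hck : c k = 0)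
    {G : (Fin d → ℂ) → Alt d p} (hG : AnalyticAt ℂ G c) :
    dLog L μ (fun w => G (scale c k 0 w)) =ᶠ[𝓝 c] fun z => dLog L μ G (scale c k 0 z) := by
  filter_upwards [(tendsto_scale c k 0).eventually hG.eventually_analyticAt] with z hz
    using dLog_comp_scale hk hck hz.differentiableAt

lemma single_sub_eq {k : Fin d} (a : ℂ) :
    (Pi.single k a : Fin d → ℂ) = a • Pi.single k 1 := by
  rw [← Pi.single_smul, smul_eq_mul, mul_one]

lemma scaleL_zero_single_same (k : Fin d) : scaleL k 0 (Pi.single k 1) = 0 := by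
  rw [scaleL, diagL_single]
  simp

lemma scaleL_single_ne {j k : Fin d} (h : j ≠ k) (t : ℂ) :
    scaleL k t (Pi.single j 1) = Pi.single j 1 := by
  rw [scaleL, diagL_single]
  simp [h]

/-- The restriction of a closed form to a coordinate hyperplane along which the connection has a
nonzero residue is exact. -/
lemma dLog_contr_scale {k : Fin d} (hk : k ∈ L) (hck : c k = 0) (hμ : μ k ≠ 0)
    {G : (Fin d → ℂ) → Alt d (p + 1)} (hG : AnalyticAt ℂ G c) (hcl : dLog L μ G =ᶠ[𝓝 c] 0) :
    dLog L μ (fun z => (μ k)⁻¹ • contr (Pi.single k 1) (G (scale c k 0 z))) =ᶠ[𝓝 c]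
      fun z => G (scale c k 0 z) := by
  have hcl' := (tendsto_scale c k 0).eventually hcl
  filter_upwards [dLog_comp_scale_eventually (μ := μ) hk hck hG, hcl',
    (hG.comp_scale k 0).eventually_analyticAt,
    (tendsto_scale c k 0).eventually hG.eventually_analyticAt] with z h1 h2 h3 h4
  have h5 := contr_dLog (L := L) (μ := μ) h3.differentiableAt k
  have h6 : fderiv ℂ (fun w => G (scale c k 0 w)) z =
      (fderiv ℂ G (scale c k 0 z)).comp (scaleL k 0) :=
    (h4.differentiableAt.hasFDerivAt.comp z (hasFDerivAt_scale c k 0 z)).fderiv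
  rw [h1, h2, Pi.zero_apply, map_zero, zero_add, h6, ContinuousLinearMap.comp_apply,
    scaleL_zero_single_same, map_zero, alt_smul_zero, zero_add] at h5
  have h7 := dLog_const_smul (L := L) (μ := μ) (μ k)⁻¹ (h3.contr (Pi.single k 1)).differentiableAt
  refine h7.trans ?_
  rw [h5, smul_smul, inv_mul_cancel₀ hμ, one_smul]

/-- In degree zero, closed functions vanish on a hyperplane with nonzero residue. -/
lemma eq_zero_of_closed_scale {k : Fin d} (hk : k ∈ L) (hck : c k = 0) (hμ : μ k ≠ 0)
    {G : (Fin d → ℂ) → Alt d 0} (hG : AnalyticAt ℂ G c) (hcl : dLog L μ G =ᶠ[𝓝 c] 0) :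
    ∀ᶠ z in 𝓝 c, G (scale c k 0 z) = 0 := by
  have hcl' := (tendsto_scale c k 0).eventually hcl
  filter_upwards [dLog_comp_scale_eventually (μ := μ) hk hck hG, hcl',
    (tendsto_scale c k 0).eventually hG.eventually_analyticAt] with z h1 h2 h4
  have h5 := contr_dLog_zero (L := L) (μ := μ) (G := fun z => G (scale c k 0 z)) (z := z) k
  have h6 : fderiv ℂ (fun w => G (scale c k 0 w)) z =
      (fderiv ℂ G (scale c k 0 z)).comp (scaleL k 0) :=
    (h4.differentiableAt.hasFDerivAt.comp z (hasFDerivAt_scale c k 0 z)).fderiv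
  rw [h1, h2, Pi.zero_apply, map_zero, h6, ContinuousLinearMap.comp_apply,
    scaleL_zero_single_same, map_zero, alt_smul_zero, zero_add] at h5
  exact eq_zero_of_alt_smul h5.symm hμ

variable {m : Fin d → ℤ}

lemma euler_eq {F : Type} [NormedAddCommGroup F] [NormedSpace ℂ F] {k : Fin d} (hk : k ∈ L)
    (hck : c k = 0) (u : (Fin d → ℂ) → F) (z : Fin d → ℂ) :
    fderiv ℂ u z (Pi.single k (z k - c k)) = ell L z k • fderiv ℂ u z (Pi.single k 1) := by
  rw [single_sub_eq, map_smul, hck, sub_zero, ell, if_pos hk]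

/-- The derivative of `D u` along a vector field of the frame, in terms of the derivative `g` of
`u`. -/
lemma euler_dLog (hm : ∀ k ∉ L, m k = 0) {u g : (Fin d → ℂ) → Alt d (p + 1)} {k : Fin d}
    (hu : AnalyticAt ℂ u c) (hg : AnalyticAt ℂ g c)
    (h : ∀ᶠ z in 𝓝 c, ell L z k • fderiv ℂ u z (Pi.single k 1) + (m k : ℂ) • u z = g z)
    (hcl : dLog L (fun k => m k) g =ᶠ[𝓝 c] 0) :
    ∀ᶠ z in 𝓝 c, ell L z k • fderiv ℂ (dLog L (fun k => m k) u) z (Pi.single k 1) +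
      (m k : ℂ) • dLog L (fun k => m k) u z = 0 := by
  have e : (fun z => contr (Pi.single k 1) (dLog L (fun k => m k) u z)) =ᶠ[𝓝 c]
      g - dLog L (fun k => m k) fun z => contr (Pi.single k 1) (u z) := by
    filter_upwards [h, hu.eventually_analyticAt] with z hz hz'
    rw [Pi.sub_apply, ← hz, ← contr_dLog (μ := fun k => (m k : ℂ)) hz'.differentiableAt,
      add_sub_cancel_right]
  filter_upwards [dLog_dLog hm hu, e.dLog (L := L) (μ := fun k => (m k : ℂ)), hcl,
    dLog_dLog hm (hu.contr (Pi.single k 1)), hu.eventually_analyticAt,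
    hg.eventually_analyticAt] with z h1 h2 h3 h4 h5 h6
  rw [← contr_dLog (μ := fun k => (m k : ℂ)) h5.dLog.differentiableAt, h1, h2,
    dLog_sub h6.differentiableAt (h5.contr _).dLog.differentiableAt, h3, h4]
  simp

/-- The logarithmic Poincaré lemma in the presence of a coordinate with positive exponent: closed
forms are exact. -/
lemma exists_dLog_eq_of_pos (hm : ∀ k ∉ L, m k = 0) {k : Fin d} (hk : k ∈ L) (hck : c k = 0)
    (hmk : 0 < m k) {G : (Fin d → ℂ) → Alt d (p + 1)} (hG : AnalyticAt ℂ G c)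
    (hcl : dLog L (fun k => m k) G =ᶠ[𝓝 c] 0) :
    ∃ θ, AnalyticAt ℂ θ c ∧ dLog L (fun k => m k) θ =ᶠ[𝓝 c] G := by
  obtain ⟨n, hn⟩ : ∃ n : ℕ, m k = n + 1 := ⟨(m k - 1).toNat, by omega⟩
  have hn' : (m k : ℂ) = n + 1 := by exact_mod_cast congrArg (Int.cast : ℤ → ℂ) hn
  obtain ⟨u, hu, hue⟩ := exists_euler_solution hG k n
  have hue' : ∀ᶠ z in 𝓝 c, ell L z k • fderiv ℂ u z (Pi.single k 1) + (m k : ℂ) • u z = G z := by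
    filter_upwards [hue] with z hz
    rw [← hz, hn', euler_eq hk hck]
  -- `D u` solves the homogeneous equation with the exponent `m k > 0`, hence vanishes
  have h1 := euler_dLog hm hu hG hue' hcl
  have h2 : ∀ᶠ z in 𝓝 c, dLog L (fun k => m k) u z = 0 := by
    refine euler_unique hu.dLog k (n + 1) ?_ ?_
    · filter_upwards [h1] with z hz
      rw [euler_eq hk hck]
      push_cast
      rw [← hn']
      exact hz
    · filter_upwards [(tendsto_scale c k 0).eventually h1] with z hz
      have h0 : ell L (scale c k 0 z) k = 0 := by
        rw [ell, if_pos hk, scale_apply_same, hck, zero_mul, zero_add]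
      rw [h0, alt_zero_smul, zero_add] at hz
      exact eq_zero_of_alt_smul hz (by exact_mod_cast hmk.ne')
  -- Cartan's formula then gives `D (ι_k u) = G`
  refine ⟨_, hu.contr (Pi.single k 1), ?_⟩
  filter_upwards [h2, hue', hu.eventually_analyticAt] with z h3 h4 h5
  rw [← h4, ← contr_dLog (μ := fun k => (m k : ℂ)) h5.differentiableAt, h3, map_zero, zero_add]

/-- In degree zero, closed functions vanish in the presence of a positive exponent. -/
lemma eq_zero_of_closed_of_pos {k : Fin d} (hk : k ∈ L) (hck : c k = 0)
    (hmk : 0 < m k) {G : (Fin d → ℂ) → Alt d 0} (hG : AnalyticAt ℂ G c)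
    (hcl : dLog L (fun k => m k) G =ᶠ[𝓝 c] 0) : G =ᶠ[𝓝 c] 0 := by
  obtain ⟨n, hn⟩ : ∃ n : ℕ, m k = n := ⟨(m k).toNat, by omega⟩
  have hn' : (m k : ℂ) = n := by exact_mod_cast congrArg (Int.cast : ℤ → ℂ) hn
  refine euler_unique hG k n ?_ ?_
  · filter_upwards [hcl] with z hz
    have h5 := contr_dLog_zero (L := L) (μ := fun k => (m k : ℂ)) (G := G) (z := z) k
    rw [hz, Pi.zero_apply, map_zero] at h5
    rw [euler_eq hk hck, ← hn']
    exact h5.symm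
  · exact eq_zero_of_closed_scale hk hck (by exact_mod_cast hmk.ne') hG hcl

/-- Restriction to a coordinate hyperplane with zero residue changes a closed form by an exact
one. -/
lemma exists_scale_eq_sub_dLog (hm : ∀ k ∉ L, m k = 0) {k : Fin d} (hk : k ∈ L) (hck : c k = 0)
    (hmk : m k = 0) {G : (Fin d → ℂ) → Alt d (p + 1)} (hG : AnalyticAt ℂ G c)
    (hcl : dLog L (fun k => m k) G =ᶠ[𝓝 c] 0) :
    ∃ θ, AnalyticAt ℂ θ c ∧
      (fun z => G (scale c k 0 z)) =ᶠ[𝓝 c] G - dLog L (fun k => m k) θ := by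
  have hGS := hG.comp_scale k 0
  have hg : AnalyticAt ℂ (G - fun z => G (scale c k 0 z)) c := hG.sub hGS
  -- solve `z_k ∂u/∂z_k = G - G|_{z_k = 0}` with `u = 0` for `z_k = 0`; then `D u = 0` by
  -- uniqueness, and the primitive is `ι_k u`
  obtain ⟨q, hq, hqe⟩ := exists_eq_smul_of_vanishing hg k
    (Eventually.of_forall fun z => by simp [scale_scale])
  obtain ⟨u, hu, hu0, hue⟩ := exists_primitive hq k
  have hue' : ∀ᶠ z in 𝓝 c, ell L z k • fderiv ℂ u z (Pi.single k 1) + (m k : ℂ) • u z =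
      (G - fun z => G (scale c k 0 z)) z := by
    filter_upwards [hqe, hue] with z h1 h2
    rw [h1, h2, hmk, hck, sub_zero, ell, if_pos hk, Int.cast_zero, alt_zero_smul, add_zero]
  have hcl' : dLog L (fun k => m k) (G - fun z => G (scale c k 0 z)) =ᶠ[𝓝 c] 0 := by
    filter_upwards [hG.eventually_analyticAt, hGS.eventually_analyticAt, hcl,
      dLog_comp_scale_eventually hk hck hG, (tendsto_scale c k 0).eventually hcl]
      with z h1 h2 h3 h4 h5
    rw [dLog_sub h1.differentiableAt h2.differentiableAt, h3, h4, h5]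
    simp
  have h1 := euler_dLog hm hu hg hue' hcl'
  have h2 : ∀ᶠ z in 𝓝 c, dLog L (fun k => m k) u z = 0 := by
    refine euler_unique hu.dLog k 0 ?_ ?_
    · filter_upwards [h1] with z hz
      rw [euler_eq hk hck, Nat.cast_zero, alt_zero_smul, add_zero, ← hz, hmk, Int.cast_zero,
        alt_zero_smul, add_zero]
    · filter_upwards [dLog_comp_scale_eventually (μ := fun k => (m k : ℂ)) hk hck hu] with z hz
      rw [← hz]
      have e : (fun w => u (scale c k 0 w)) = 0 := funext hu0
      rw [e, dLog_zero, Pi.zero_apply]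
  refine ⟨_, hu.contr (Pi.single k 1), ?_⟩
  filter_upwards [h2, hue', hu.eventually_analyticAt] with z h3 h4 h5
  have h6 := contr_dLog (L := L) (μ := fun k => (m k : ℂ)) h5.differentiableAt k
  rw [h3, map_zero, zero_add, h4] at h6
  rw [Pi.sub_apply, h6]
  simp

lemma contr_contr_comm (r s : Fin d → ℂ) (a : Alt d (p + 2)) :
    contr r (contr s a) = -contr s (contr r a) := by
  have h := contr_contr (r + s) a
  have e : ∀ b : Alt d (p + 2), contr (r + s) b = contr r b + contr s b := fun b =>
    map_add b.curryLeft r s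
  have e' : ∀ b : Alt d (p + 1), contr (r + s) b = contr r b + contr s b := fun b =>
    map_add b.curryLeft r s
  rw [e, e', map_add, map_add, contr_contr, contr_contr, zero_add, add_zero] at h
  exact eq_neg_of_add_eq_zero_left h

/-- Integrating out an ordinary coordinate changes a closed form by an exact one and removes the
corresponding differential, without introducing the differentials that were removed before. -/
lemma exists_contr_sub_dLog_eq_zero {k : Fin d} (hk : k ∉ L)
    {G : (Fin d → ℂ) → Alt d (p + 1)} (hG : AnalyticAt ℂ G c)
    (hcl : dLog L 0 G =ᶠ[𝓝 c] 0) {s : Finset (Fin d)} (hs : ∀ j ∈ s, j ∉ L) (hks : k ∉ s)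
    (hsG : ∀ j ∈ s, ∀ᶠ z in 𝓝 c, contr (Pi.single j 1) (G z) = 0) :
    ∃ θ : (Fin d → ℂ) → Alt d p, AnalyticAt ℂ θ c ∧ ∀ j ∈ insert k s, ∀ᶠ z in 𝓝 c,
      contr (Pi.single j 1) ((G - dLog L 0 θ) z) = 0 := by
  have hz0 : (fun _ : Fin d => ((0 : ℤ) : ℂ)) = 0 := by
    funext k
    simp
  have hell : ∀ j ∉ L, ∀ z, ell L z j = 1 := fun j hj z => if_neg hj
  -- `u` is the primitive of `G` in the `k`-th coordinate; `ι_k u` is subtracted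
  obtain ⟨u, hu, hu0, hue⟩ := exists_primitive hG k
  have hue' : ∀ᶠ z in 𝓝 c, ell L z k • fderiv ℂ u z (Pi.single k 1) +
      ((0 : ℤ) : ℂ) • u z = G z := by
    filter_upwards [hue] with z hz
    rw [hell k hk, one_smul, hz]
    simp
  have hdu := euler_dLog (m := fun _ => 0) (fun _ _ => rfl) hu hG hue' (by rw [hz0]; exact hcl)
  rw [hz0] at hdu
  have hdu' : ∀ᶠ z in 𝓝 c, fderiv ℂ (dLog L 0 u) z (Pi.single k 1) = 0 := by
    filter_upwards [hdu] with z hz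
    rw [hell k hk, one_smul] at hz
    simpa using hz
  -- `G - D (ι_k u) = ι_k (D u)`
  have hH : ∀ᶠ z in 𝓝 c, (G - dLog L 0 fun z => contr (Pi.single k 1) (u z)) z =
      contr (Pi.single k 1) (dLog L 0 u z) := by
    filter_upwards [hue, hu.eventually_analyticAt] with z h1 h2
    have h3 := contr_dLog (L := L) (μ := 0) h2.differentiableAt k
    rw [hell k hk, one_smul, h1, Pi.zero_apply, alt_zero_smul, add_zero] at h3
    rw [Pi.sub_apply, ← h3]
    simp
  refine ⟨_, hu.contr (Pi.single k 1), fun j hj => ?_⟩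
  rcases Finset.mem_insert.1 hj with rfl | hj
  · filter_upwards [hH] with z hz
    rw [hz, contr_contr]
  have hjk : j ≠ k := fun h => hks (h ▸ hj)
  have hju : (fun z => contr (Pi.single j 1) (u z)) =ᶠ[𝓝 c] 0 := by
    refine euler_unique (hu.contr _) k 0 ?_ (Eventually.of_forall fun z => by rw [hu0, map_zero])
    filter_upwards [hue, hsG j hj, hu.eventually_analyticAt] with z h1 h2 h3
    have h4 : fderiv ℂ (fun w => contr (Pi.single j 1) (u w)) z =
        (contr (Pi.single j 1)).comp (fderiv ℂ u z) :=
      ((contr (Pi.single j 1)).hasFDerivAt.comp z h3.differentiableAt.hasFDerivAt).fderiv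
    rw [h4, single_sub_eq (z k - c k), map_smul, ContinuousLinearMap.comp_apply, h1, h2]
    simp
  -- `ι_j (D u)` is the derivative of `u` in the direction `j`
  have hjd : ∀ᶠ z in 𝓝 c, contr (Pi.single j 1) (dLog L 0 u z) =
      fderiv ℂ u z (Pi.single j 1) := by
    filter_upwards [hju.dLog (L := L) (μ := 0), hu.eventually_analyticAt] with z h1 h2
    have h3 := contr_dLog (L := L) (μ := 0) h2.differentiableAt j
    rw [h1, dLog_zero, hell j (hs j hj), one_smul, Pi.zero_apply, Pi.zero_apply, alt_zero_smul,
      add_zero, add_zero] at h3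
    exact h3
  have hjd0 : ∀ᶠ z in 𝓝 c, contr (Pi.single j 1) (dLog L 0 u z) = 0 := by
    refine euler_unique (hu.dLog.contr _) k 0 ?_ ?_
    · filter_upwards [hdu', hu.eventually_analyticAt] with z h1 h3
      have h4 : fderiv ℂ (fun w => contr (Pi.single j 1) (dLog L 0 u w)) z =
          (contr (Pi.single j 1)).comp (fderiv ℂ (dLog L 0 u) z) :=
        ((contr (Pi.single j 1)).hasFDerivAt.comp z h3.dLog.differentiableAt.hasFDerivAt).fderiv
      rw [h4, single_sub_eq (z k - c k), map_smul, ContinuousLinearMap.comp_apply, h1]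
      simp
    · filter_upwards [(tendsto_scale c k 0).eventually hjd,
        (tendsto_scale c k 0).eventually hu.eventually_analyticAt] with z h1 h2
      rw [h1]
      have h3 := (h2.differentiableAt.hasFDerivAt.comp z (hasFDerivAt_scale c k 0 z)).fderiv
      have e : u ∘ scale c k 0 = 0 := funext hu0
      rw [e, fderiv_zero] at h3
      have h4 := congrArg (fun T : (Fin d → ℂ) →L[ℂ] Alt d (p + 1) => T (Pi.single j 1)) h3
      simp only [ContinuousLinearMap.comp_apply, scaleL_single_ne hjk] at h4
      exact h4.symm
  filter_upwards [hH, hjd0] with z h1 h2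
  rw [h1, contr_contr_comm, h2]
  simp

lemma eventually_eq_const {F : Type} [NormedAddCommGroup F] [NormedSpace ℂ F]
    {g : (Fin d → ℂ) → F} (hg : ∀ᶠ z in 𝓝 c, DifferentiableAt ℂ g z)
    (h : ∀ᶠ z in 𝓝 c, fderiv ℂ g z = 0) : ∀ᶠ z in 𝓝 c, g z = g c := by
  obtain ⟨r, hr, hgr⟩ := Metric.eventually_nhds_iff_ball.1 (hg.and h)
  filter_upwards [Metric.ball_mem_nhds c hr] with z hz
  exact Metric.isOpen_ball.is_const_of_fderiv_eq_zero (𝕜 := ℂ)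
    (convex_ball c r).isPreconnected (fun x hx => (hgr x hx).1.differentiableWithinAt)
    (fun x hx => (hgr x hx).2) hz (Metric.mem_ball_self hr)

/-- The logarithmic Poincaré lemma in degree zero. -/
lemma eventually_const_of_closed {G : (Fin d → ℂ) → Alt d 0} (hG : AnalyticAt ℂ G c)
    (hcl : dLog L 0 G =ᶠ[𝓝 c] 0) : ∀ᶠ z in 𝓝 c, G z = G c := by
  refine eventually_eq_const (hG.eventually_analyticAt.mono fun z hz => hz.differentiableAt) ?_
  refine eventually_eq_of_off_hyperplanes (L := L) (g := fun _ => 0) ?_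
    (Eventually.of_forall fun z => continuousAt_const) ?_
  · filter_upwards [hG.eventually_analyticAt] with z hz using hz.fderiv.continuousAt
  · filter_upwards [hcl] with z hz hzL
    apply ContinuousLinearMap.coe_injective
    refine (Pi.basisFun ℂ (Fin d)).ext fun k => ?_
    have h5 := contr_dLog_zero (L := L) (μ := 0) (G := G) (z := z) k
    rw [hz, Pi.zero_apply, map_zero, Pi.zero_apply, alt_zero_smul, add_zero] at h5
    have h6 := eq_zero_of_alt_smul h5.symm (ell_ne_zero hzL k)
    simpa using h6

/-- The logarithmic Poincaré lemma with zero exponents: every closed form differs by an exact one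
from a combination with constant coefficients of products of the `dz_k / z_k`. -/
lemma exists_const_add_dLog (hc : ∀ k ∈ L, c k = 0) {G : (Fin d → ℂ) → Alt d (p + 1)}
    (hG : AnalyticAt ℂ G c) (hcl : dLog L 0 G =ᶠ[𝓝 c] 0) :
    ∃ a : Alt d (p + 1), (∀ j ∉ L, contr (Pi.single j 1) a = 0) ∧ ∃ θ, AnalyticAt ℂ θ c ∧
      G =ᶠ[𝓝 c] fun z => a + dLog L 0 θ z := by
  have hz0 : (fun _ : Fin d => ((0 : ℤ) : ℂ)) = 0 := by
    funext k
    simp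
  have hDD : ∀ {θ : (Fin d → ℂ) → Alt d p}, AnalyticAt ℂ θ c →
      dLog L 0 (dLog L 0 θ) =ᶠ[𝓝 c] 0 := by
    intro θ hθ
    have := dLog_dLog (L := L) (m := fun _ => 0) (fun _ _ => rfl) hθ
    rwa [hz0] at this
  have hsubcl : ∀ {G : (Fin d → ℂ) → Alt d (p + 1)} {θ : (Fin d → ℂ) → Alt d p},
      AnalyticAt ℂ G c → AnalyticAt ℂ θ c → dLog L 0 G =ᶠ[𝓝 c] 0 →
      dLog L 0 (G - dLog L 0 θ) =ᶠ[𝓝 c] 0 := by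
    intro G θ hG hθ hcl
    filter_upwards [hG.eventually_analyticAt, hθ.eventually_analyticAt, hcl, hDD hθ]
      with z h1 h2 h3 h4
    rw [dLog_sub h1.differentiableAt h2.dLog.differentiableAt, h3, h4]
    simp
  have hadd : ∀ {θ θ' : (Fin d → ℂ) → Alt d p}, AnalyticAt ℂ θ c → AnalyticAt ℂ θ' c →
      dLog L 0 (θ - -θ') =ᶠ[𝓝 c] dLog L 0 θ + dLog L 0 θ' := by
    intro θ θ' hθ hθ'
    filter_upwards [hθ.eventually_analyticAt, hθ'.eventually_analyticAt] with z h1 h2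
    have h3 := dLog_const_smul (L := L) (μ := 0) (-1) h2.differentiableAt
    rw [neg_one_smul ℂ θ', alt_neg_one_smul] at h3
    rw [dLog_sub h1.differentiableAt h2.neg.differentiableAt, h3]
    simp
  -- remove the ordinary coordinates
  have hN : ∀ s : Finset (Fin d), (∀ j ∈ s, j ∉ L) → ∃ θ : (Fin d → ℂ) → Alt d p, AnalyticAt ℂ θ c ∧
      ∀ j ∈ s, ∀ᶠ z in 𝓝 c, contr (Pi.single j 1) ((G - dLog L 0 θ) z) = 0 := by
    intro s
    induction s using Finset.induction_on with
    | empty => exact fun _ => ⟨0, analyticAt_const, by simp⟩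
    | insert k s hks ih =>
      intro hs
      obtain ⟨θ, hθ, h⟩ := ih fun j hj => hs j (Finset.mem_insert_of_mem hj)
      obtain ⟨θ', hθ', h'⟩ := exists_contr_sub_dLog_eq_zero (hs k (Finset.mem_insert_self k s))
        (hG.sub hθ.dLog) (hsubcl hG hθ hcl) (fun j hj => hs j (Finset.mem_insert_of_mem hj)) hks h
      refine ⟨θ - -θ', hθ.sub hθ'.neg, fun j hj => ?_⟩
      filter_upwards [h' j hj, hadd hθ hθ'] with z h1 h2
      rw [← h1]
      simp only [Pi.sub_apply, h2, Pi.add_apply, sub_sub]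
  -- restrict to the intersection of the hyperplanes
  have hM : ∀ s : Finset (Fin d), (∀ j ∈ s, j ∈ L) → ∃ θ : (Fin d → ℂ) → Alt d p, AnalyticAt ℂ θ c ∧
      (∀ j ∉ L, ∀ᶠ z in 𝓝 c, contr (Pi.single j 1) ((G - dLog L 0 θ) z) = 0) ∧
      ∀ j ∈ s, (fun z => (G - dLog L 0 θ) (scale c j 0 z)) =ᶠ[𝓝 c] G - dLog L 0 θ := by
    intro s
    induction s using Finset.induction_on with
    | empty =>
      intro _
      obtain ⟨θ, hθ, h⟩ := hN Lᶜ fun j hj => Finset.mem_compl.1 hj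
      exact ⟨θ, hθ, fun j hj => h j (Finset.mem_compl.2 hj), by simp⟩
    | insert k s hks ih =>
      intro hs
      obtain ⟨θ, hθ, h1, h2⟩ := ih fun j hj => hs j (Finset.mem_insert_of_mem hj)
      have hk := hs k (Finset.mem_insert_self k s)
      have hH := hsubcl hG hθ hcl
      obtain ⟨θ', hθ', h'⟩ := exists_scale_eq_sub_dLog (m := fun _ => 0) (fun _ _ => rfl) hk (hc k hk) rfl
        (hG.sub hθ.dLog) (by rw [hz0]; exact hH)
      rw [hz0] at h'
      have e : (G - dLog L 0 (θ - -θ')) =ᶠ[𝓝 c]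
          fun z => (G - dLog L 0 θ) (scale c k 0 z) := by
        filter_upwards [h', hadd hθ hθ'] with z h3 h4
        rw [h3]
        simp only [Pi.sub_apply, h4, Pi.add_apply, sub_sub]
      refine ⟨θ - -θ', hθ.sub hθ'.neg, fun j hj => ?_, fun j hj => ?_⟩
      · filter_upwards [e, (tendsto_scale c k 0).eventually (h1 j hj)] with z h3 h4
        rw [h3, h4]
      · have e' := (tendsto_scale c j 0).eventually e
        rcases Finset.mem_insert.1 hj with rfl | hj
        · filter_upwards [e, e'] with z h3 h4
          rw [h3, h4, scale_scale, zero_mul]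
        · filter_upwards [e, e', (tendsto_scale c k 0).eventually (h2 j hj)] with z h3 h4 h5
          rw [h3, h4, scale_comm, h5]
  obtain ⟨θ, hθ, h1, h2⟩ := hM L fun _ h => h
  set H := G - dLog L 0 θ with hHdef
  have hH : AnalyticAt ℂ H c := hG.sub hθ.dLog
  have hHcl : dLog L 0 H =ᶠ[𝓝 c] 0 := hsubcl hG hθ hcl
  -- the resulting form has no dependence on the coordinates in `L`, by invariance under
  -- restriction, and on the other ones, as it is closed without the corresponding differentials;
  -- hence it is constant
  have hfd : ∀ k, ∀ᶠ z in 𝓝 c, fderiv ℂ H z (Pi.single k 1) = 0 := by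
    intro k
    by_cases hk : k ∈ L
    · filter_upwards [(h2 k hk).fderiv (𝕜 := ℂ),
        (tendsto_scale c k 0).eventually hH.eventually_analyticAt] with z h3 h4
      have h5 := (h4.differentiableAt.hasFDerivAt.comp z (hasFDerivAt_scale c k 0 z)).fderiv
      have h6 : fderiv ℂ H z = (fderiv ℂ H (scale c k 0 z)).comp (scaleL k 0) :=
        h3.symm.trans h5
      rw [h6, ContinuousLinearMap.comp_apply, scaleL_zero_single_same, map_zero]
    · filter_upwards [hHcl, EventuallyEq.dLog (L := L) (μ := 0) (G' := 0) (h1 k hk),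
        hH.eventually_analyticAt] with z h3 h4 h5
      have h6 := contr_dLog (L := L) (μ := 0) h5.differentiableAt k
      rw [h3, h4, dLog_zero, ell, if_neg hk] at h6
      simpa using h6.symm
  have hcst := eventually_eq_const (hH.eventually_analyticAt.mono fun z hz => hz.differentiableAt)
    (by
      filter_upwards [eventually_all.2 hfd] with z hz
      apply ContinuousLinearMap.coe_injective
      refine (Pi.basisFun ℂ (Fin d)).ext fun k => ?_
      simpa using hz k)
  refine ⟨H c, fun j hj => (h1 j hj).self_of_nhds, θ, hθ, ?_⟩
  filter_upwards [hcst] with z hz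
  rw [← hz, hHdef]
  simp

end LogPoincare

/-! ### Change of adapted charts -/

section FramesInCharts

variable {d p : ℕ} {X : Type} [TopologicalSpace X] [ChartedSpace (Fin d → ℂ) X]
  {S : Finset (PrimeDivisor d X)} {E : PrimeDivisor d X → ℤ} {x y : X}

namespace AdaptedChart

/-- The indices of the coordinates that cut out a component of the divisor. -/
def logSet (c : AdaptedChart S x) : Finset (Fin d) :=
  Finset.univ.filter fun k => (c.comp k).isSome

/-- The exponents of the local generator of `𝒪(E)`. -/
def expo (c : AdaptedChart S x) (E : PrimeDivisor d X → ℤ) (k : Fin d) : ℤ := -(c.mult E k)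

lemma mem_logSet {c : AdaptedChart S x} {k : Fin d} : k ∈ c.logSet ↔ (c.comp k).isSome := by
  simp [logSet]

lemma mem_logSet_iff {c : AdaptedChart S x} {k : Fin d} :
    k ∈ c.logSet ↔ ∃ T, c.comp k = some T := by
  rw [mem_logSet, Option.isSome_iff_exists]

lemma expo_of_comp {c : AdaptedChart S x} {k : Fin d} {T : PrimeDivisor d X}
    (h : c.comp k = some T) : c.expo E k = -E T := by
  simp [expo, mult, h]

lemma expo_of_notMem {c : AdaptedChart S x} {k : Fin d} (h : k ∉ c.logSet) : c.expo E k = 0 := by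
  rw [mem_logSet, Option.not_isSome_iff_eq_none] at h
  simp [expo, mult, h]

lemma chart_apply_eq_zero (c : AdaptedChart S x) {k : Fin d} (hk : k ∈ c.logSet) :
    c.chart x k = 0 := by
  obtain ⟨T, hT⟩ := mem_logSet_iff.1 hk
  exact (c.comp_zero k T hT x c.mem_source).1 (c.comp_mem k T hT).2

lemma logCoord_eq_ell (c : AdaptedChart S x) (k : Fin d) (z : Fin d → ℂ) :
    c.logCoord k z = ell c.logSet z k := by
  simp [logCoord, ell, mem_logSet]

/-- The points of the domain of an adapted chart off the divisor are those with nonzero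
logarithmic coordinates. -/
lemma notMem_iff (c : AdaptedChart S x) (hy : y ∈ c.chart.source) :
    y ∉ unionOf S ↔ ∀ k ∈ c.logSet, c.chart y k ≠ 0 := by
  constructor
  · intro h k hk h0
    obtain ⟨T, hT⟩ := mem_logSet_iff.1 hk
    exact h (Set.mem_biUnion (c.comp_mem k T hT).1 ((c.comp_zero k T hT y hy).2 h0))
  · intro h
    have := c.symm_notMem (c.chart.map_source hy) fun k hk => h k (mem_logSet.2 hk)
    rwa [c.chart.left_inv hy] at this

lemma symm_notMem' (c : AdaptedChart S x) {z : Fin d → ℂ} (hz : z ∈ c.chart.target)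
    (h : ∀ k ∈ c.logSet, z k ≠ 0) : c.chart.symm z ∉ unionOf S :=
  c.symm_notMem hz fun k hk => h k (mem_logSet.2 hk)

/-- The form `η` has, near the point `y` of the chart, the coefficients `G` with respect to the
logarithmic frame multiplied by the generator of `𝒪(E)`. -/
def IsFrameOf (c : AdaptedChart S x) (E : PrimeDivisor d X → ℤ) (η : X → Alt d p) (y : X)
    (G : (Fin d → ℂ) → Alt d p) : Prop :=
  AnalyticAt ℂ G (c.chart y) ∧ ∀ᶠ z in 𝓝 (c.chart y), (∀ k ∈ c.logSet, z k ≠ 0) →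
    inChart c.chart η z = frame c.logSet (c.expo E) G z

end AdaptedChart

lemma frame_apply_basis (L : Finset (Fin d)) (m : Fin d → ℤ) (G : (Fin d → ℂ) → Alt d p)
    (z : Fin d → ℂ) (I : Fin p → Fin d) :
    frame L m G z (basisVec I) = monom m z * ((∏ j, (ell L z)⁻¹ (I j)) * G z (basisVec I)) := by
  rw [frame, ContinuousAlternatingMap.smul_apply, compDiag_apply_basis, smul_eq_mul]

lemma frame_apply_basis_mul {L : Finset (Fin d)} (m : Fin d → ℤ) (G : (Fin d → ℂ) → Alt d p)
    {z : Fin d → ℂ} (hz : ∀ k ∈ L, z k ≠ 0) (I : Fin p → Fin d) :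
    frame L m G z (basisVec I) * ∏ j, ell L z (I j) = monom m z * G z (basisVec I) := by
  rw [frame_apply_basis]
  have h : (∏ j, (ell L z)⁻¹ (I j)) * ∏ j, ell L z (I j) = 1 := by
    rw [← Finset.prod_mul_distrib]
    exact Finset.prod_eq_one fun j _ => inv_mul_cancel₀ (ell_ne_zero hz _)
  linear_combination monom m z * G z (basisVec I) * h

/-- There is an alternating form with prescribed values on coordinate vectors, depending
linearly on the values, whenever these values come from an alternating form. -/
lemma exists_alt_of_basis (d p : ℕ) : ∃ R : ((Fin p → Fin d) → ℂ) →L[ℂ] Alt d p,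
    ∀ a : Alt d p, R (fun I => a (basisVec I)) = a := by
  let L : (Alt d p) →ₗ[ℂ] ((Fin p → Fin d) → ℂ) :=
    { toFun := fun a I => a (basisVec I)
      map_add' := fun _ _ => rfl
      map_smul' := fun _ _ => rfl }
  have hL : LinearMap.ker L = ⊥ := by
    rw [LinearMap.ker_eq_bot]
    intro a b hab
    exact alt_ext fun I => congrFun hab I
  obtain ⟨R, hR⟩ := L.exists_leftInverse_of_injective hL
  exact ⟨LinearMap.toContinuousLinearMap R, fun a => LinearMap.congr_fun hR a⟩

/-- The coefficients of a logarithmic form on the basis vectors assemble into one function with values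
in the alternating forms. -/
lemma IsLogFormAt.exists_frame {η : X → Alt d p} (h : IsLogFormAt S E η x)
    (c : AdaptedChart S x) : ∃ G, c.IsFrameOf E η x G := by
  choose g hg hgz using h.2 c
  obtain ⟨R, hR⟩ := exists_alt_of_basis d p
  refine ⟨fun z => R fun I => g I z, (R.analyticAt _).comp (analyticAt_pi_iff.2 hg), ?_⟩
  filter_upwards [eventually_all.2 hgz] with z hz hzL
  have hzL' : ∀ k, (c.comp k).isSome → z k ≠ 0 := fun k hk => hzL k (AdaptedChart.mem_logSet.2 hk)
  set a : Alt d p := (monom (c.expo E) z)⁻¹ •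
    (inChart c.chart η z).compContinuousLinearMap (diagL (ell c.logSet z)) with ha
  have hm := monom_ne_zero (fun k hk => c.expo_of_notMem (E := E) hk) hzL
  have hga : (fun I => g I z) = fun I => a (basisVec I) := by
    funext I
    have h1 := hz I hzL'
    simp only [AdaptedChart.logCoord_eq_ell] at h1
    rw [ha, ContinuousAlternatingMap.smul_apply, compDiag_apply_basis, smul_eq_mul,
      mul_comm (∏ j, ell c.logSet z (I j))]
    refine (mul_left_cancel₀ hm ?_).symm
    rw [mul_inv_cancel_left₀ hm]
    exact h1
  refine alt_ext fun I => ?_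
  have h2 : R (fun I => g I z) = a := by rw [hga, hR]
  have hl : (∏ j, ell c.logSet z (I j)) ≠ 0 :=
    Finset.prod_ne_zero_iff.2 fun j _ => ell_ne_zero hzL _
  refine mul_right_cancel₀ hl ?_
  rw [frame_apply_basis_mul _ _ hzL, h2, ← congrFun hga I]
  have h1 := hz I hzL'
  simp only [AdaptedChart.logCoord_eq_ell] at h1
  exact h1

lemma isLogFormAt_of_frame {η : X → Alt d p} (h0 : x ∈ unionOf S → η x = 0)
    (h : ∀ c : AdaptedChart S x, ∃ G, c.IsFrameOf E η x G) : IsLogFormAt S E η x := by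
  refine ⟨h0, fun c I => ?_⟩
  obtain ⟨G, hG, hz⟩ := h c
  refine ⟨fun z => G z (basisVec I),
    ((ContinuousAlternatingMap.apply ℂ (Fin d → ℂ) ℂ (basisVec I)).analyticAt _).comp hG, ?_⟩
  filter_upwards [hz] with z hz hzL
  have hzL' : ∀ k ∈ c.logSet, z k ≠ 0 := fun k hk => hzL k (AdaptedChart.mem_logSet.1 hk)
  have h1 := frame_apply_basis_mul (c.expo E) G hzL' I
  simp only [AdaptedChart.logCoord_eq_ell]
  rw [hz hzL']
  exact h1

namespace AdaptedChart

lemma tendsto_symm (c : AdaptedChart S x) (hy : y ∈ c.chart.source) :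
    Tendsto c.chart.symm (𝓝 (c.chart y)) (𝓝 y) := by
  have := c.chart.symm.continuousAt (c.chart.map_source hy)
  rwa [ContinuousAt, c.chart.left_inv hy] at this

lemma analyticAt_transition (c : AdaptedChart S x) (c' : AdaptedChart S y)
    (hy : y ∈ c.chart.source) : AnalyticAt ℂ (c.chart ∘ c'.chart.symm) (c'.chart y) := by
  refine ContDiffAt.analyticAt (transition_contDiffAt c.mem_atlas c'.mem_atlas
    (c'.chart.map_source c'.mem_source) ?_)
  rwa [c'.chart.left_inv c'.mem_source]

lemma analyticAt_transition_symm (c : AdaptedChart S x) (c' : AdaptedChart S y)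
    (hy : y ∈ c.chart.source) : AnalyticAt ℂ (c'.chart ∘ c.chart.symm) (c.chart y) := by
  refine ContDiffAt.analyticAt (transition_contDiffAt c'.mem_atlas c.mem_atlas
    (c.chart.map_source hy) ?_)
  rw [c.chart.left_inv hy]
  exact c'.mem_source

end AdaptedChart

/-- A local equation of a component of the divisor is divisible by any other one, since it vanishes on
the coordinate hyperplane. -/
lemma divides_transition {X : Type} [TopologicalSpace X] {y : X}
    {φ ψ : OpenPartialHomeomorph X (Fin d → ℂ)} {T : Set X} {k l : Fin d}
    (hyφ : y ∈ φ.source) (hyψ : y ∈ ψ.source) (han : AnalyticAt ℂ (φ ∘ ψ.symm) (ψ y))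
    (hφ : ∀ x ∈ φ.source, x ∈ T ↔ φ x k = 0) (hψ : ∀ x ∈ ψ.source, x ∈ T ↔ ψ x l = 0)
    (hyT : y ∈ T) : ∃ q, AnalyticAt ℂ q (ψ y) ∧
      ∀ᶠ z in 𝓝 (ψ y), φ (ψ.symm z) k = z l * q z := by
  have hzl : ψ y l = 0 := (hψ y hyψ).1 hyT
  have han' : AnalyticAt ℂ (fun z => φ (ψ.symm z) k) (ψ y) := analyticAt_pi_iff.1 han k
  obtain ⟨q, hq, h⟩ := exists_eq_smul_of_vanishing han' l (by
    have ht : Tendsto (fun z => ψ.symm z) (𝓝 (ψ y)) (𝓝 y) := by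
      have := ψ.symm.continuousAt (ψ.map_source hyψ)
      rwa [ContinuousAt, ψ.left_inv hyψ] at this
    filter_upwards [(tendsto_scale (ψ y) l 0).eventually (ψ.open_target.mem_nhds (ψ.map_source hyψ)),
      (tendsto_scale (ψ y) l 0).eventually (ht.eventually (φ.open_source.mem_nhds hyφ))]
      with z h1 h2
    rw [← hφ _ h2, hψ _ (ψ.map_target h1), ψ.right_inv h1, scale_apply_same, hzl]
    simp)
  refine ⟨q, hq, ?_⟩
  filter_upwards [h] with z hz
  rw [hz, hzl, sub_zero, smul_eq_mul]

/-- The quotient of two local equations of a component of the divisor is a unit. -/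
lemma divides_transition_unit {X : Type} [TopologicalSpace X] {y : X}
    {φ ψ : OpenPartialHomeomorph X (Fin d → ℂ)} {T : Set X} {k l : Fin d}
    (hyφ : y ∈ φ.source) (hyψ : y ∈ ψ.source) (han : AnalyticAt ℂ (φ ∘ ψ.symm) (ψ y))
    (han' : AnalyticAt ℂ (ψ ∘ φ.symm) (φ y))
    (hφ : ∀ x ∈ φ.source, x ∈ T ↔ φ x k = 0) (hψ : ∀ x ∈ ψ.source, x ∈ T ↔ ψ x l = 0)
    (hyT : y ∈ T) : ∃ q, AnalyticAt ℂ q (ψ y) ∧ q (ψ y) ≠ 0 ∧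
      ∀ᶠ z in 𝓝 (ψ y), φ (ψ.symm z) k = z l * q z := by
  obtain ⟨q, hq, h⟩ := divides_transition hyφ hyψ han hφ hψ hyT
  obtain ⟨q', hq', h'⟩ := divides_transition hyψ hyφ han' hψ hφ hyT
  refine ⟨q, hq, fun h0 => ?_, h⟩
  have hτ : (φ ∘ ψ.symm) (ψ y) = φ y := by simp [ψ.left_inv hyψ]
  have hcomp : AnalyticAt ℂ (fun z => q' ((φ ∘ ψ.symm) z)) (ψ y) := by
    refine AnalyticAt.comp (g := q') ?_ han
    rwa [hτ]
  have hprod : AnalyticAt ℂ (fun z => q z * q' ((φ ∘ ψ.symm) z)) (ψ y) := hq.mul hcomp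
  have ht : Tendsto (φ ∘ ψ.symm) (𝓝 (ψ y)) (𝓝 (φ y)) := by
    have := han.continuousAt.tendsto
    rwa [hτ] at this
  have hts : Tendsto (fun z => ψ.symm z) (𝓝 (ψ y)) (𝓝 y) := by
    have := ψ.symm.continuousAt (ψ.map_source hyψ)
    rwa [ContinuousAt, ψ.left_inv hyψ] at this
  -- the product of the quotients in the two directions is `1` off the component, hence everywhere
  have h1 : (fun z => q z * q' ((φ ∘ ψ.symm) z)) =ᶠ[𝓝 (ψ y)] fun _ => 1 := by
    refine eventually_eq_of_off_hyperplanes (L := {l})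
      (hprod.eventually_analyticAt.mono fun z hz => hz.continuousAt)
      (Eventually.of_forall fun z => continuousAt_const) ?_
    filter_upwards [h, ht.eventually h', ψ.open_target.mem_nhds (ψ.map_source hyψ),
      hts.eventually (φ.open_source.mem_nhds hyφ)] with z h2 h3 h4 h5 h6
    have hz : z l ≠ 0 := h6 l (Finset.mem_singleton_self l)
    have h7 : φ.symm ((φ ∘ ψ.symm) z) = ψ.symm z := φ.left_inv h5
    rw [h7, ψ.right_inv h4, Function.comp_apply, h2] at h3
    refine mul_left_cancel₀ hz ?_
    rw [mul_one]
    refine Eq.trans ?_ h3.symm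
    rw [mul_assoc]
    rfl
  have h2 := h1.self_of_nhds
  simp [h0] at h2

namespace AdaptedChart

lemma exists_comp_of_comp (c : AdaptedChart S x) (c' : AdaptedChart S y)
    {k : Fin d} {T : PrimeDivisor d X} (hk : c.comp k = some T) (hyT : y ∈ T.carrier) :
    ∃ l, c'.comp l = some T := by
  obtain ⟨l, hl, _⟩ := c'.comp_unique T (c.comp_mem k T hk).1 hyT
  exact ⟨l, hl⟩

lemma exists_comp_of_comp' (c : AdaptedChart S x) (c' : AdaptedChart S y)
    (hy : y ∈ c.chart.source) {l : Fin d} {T : PrimeDivisor d X} (hl : c'.comp l = some T) :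
    ∃ k, c.comp k = some T := by
  obtain ⟨hTS, hyT⟩ := c'.comp_mem l T hl
  have hx : x ∈ T.carrier := by
    by_contra hx
    exact Set.disjoint_left.1 (c.disjoint T hTS hx) hyT hy
  obtain ⟨k, hk, _⟩ := c.comp_unique T hTS hx
  exact ⟨k, hk⟩

/-- Each coordinate of an adapted chart is, in another adapted chart, a local unit or the product
of a unit with the coordinate of the same component. -/
lemma transition_coord (c : AdaptedChart S x) (c' : AdaptedChart S y)
    (hy : y ∈ c.chart.source) {k : Fin d} (hk : k ∈ c.logSet) :
    ∃ q : (Fin d → ℂ) → ℂ, AnalyticAt ℂ q (c'.chart y) ∧ q (c'.chart y) ≠ 0 ∧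
      ((∃ l, c'.comp l = c.comp k ∧
        ∀ᶠ z in 𝓝 (c'.chart y), c.chart (c'.chart.symm z) k = z l * q z) ∨
      ((∀ l, c'.comp l ≠ c.comp k) ∧
        ∀ᶠ z in 𝓝 (c'.chart y), c.chart (c'.chart.symm z) k = q z)) := by
  obtain ⟨T, hT⟩ := mem_logSet_iff.1 hk
  by_cases hyT : y ∈ T.carrier
  · obtain ⟨l, hl⟩ := exists_comp_of_comp c c' hT hyT
    obtain ⟨q, hq, hq0, h⟩ := divides_transition_unit hy c'.mem_source
      (c.analyticAt_transition c' hy) (c.analyticAt_transition_symm c' hy)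
      (fun y hy => c.comp_zero k T hT y hy) (fun y hy => c'.comp_zero l T hl y hy) hyT
    exact ⟨q, hq, hq0, Or.inl ⟨l, hl.trans hT.symm, h⟩⟩
  · refine ⟨fun z => c.chart (c'.chart.symm z) k,
      analyticAt_pi_iff.1 (c.analyticAt_transition c' hy) k, ?_, Or.inr ⟨fun l hl => ?_, ?_⟩⟩
    · change c.chart (c'.chart.symm (c'.chart y)) k ≠ 0
      rw [c'.chart.left_inv c'.mem_source]
      exact fun h => hyT ((c.comp_zero k T hT y hy).2 h)
    · exact hyT (c'.comp_mem l T (hl.trans hT)).2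
    · exact Eventually.of_forall fun _ => rfl

/-- The matrix of a change of adapted charts with respect to the logarithmic frames is
holomorphic. -/
lemma exists_transition_frame (c : AdaptedChart S x) (c' : AdaptedChart S y)
    (hy : y ∈ c.chart.source) :
    ∃ B : (Fin d → ℂ) → (Fin d → ℂ) →L[ℂ] (Fin d → ℂ), AnalyticAt ℂ B (c'.chart y) ∧
      ∀ᶠ z in 𝓝 (c'.chart y), (∀ l ∈ c'.logSet, z l ≠ 0) →
        (diagL (ell c.logSet ((c.chart ∘ c'.chart.symm) z))⁻¹).comp
          ((fderiv ℂ (c.chart ∘ c'.chart.symm) z).comp (diagL (ell c'.logSet z))) = B z := by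
  have hτ := c.analyticAt_transition c' hy
  have hrow : ∀ k, ∃ b : (Fin d → ℂ) → (Fin d → ℂ) →L[ℂ] ℂ, AnalyticAt ℂ b (c'.chart y) ∧
      ∀ᶠ z in 𝓝 (c'.chart y), (∀ l ∈ c'.logSet, z l ≠ 0) →
        (ell c.logSet ((c.chart ∘ c'.chart.symm) z) k)⁻¹ •
          (fderiv ℂ (fun z => (c.chart ∘ c'.chart.symm) z k) z).comp (diagL (ell c'.logSet z)) =
            b z := by
    intro k
    have hτk : AnalyticAt ℂ (fun z => (c.chart ∘ c'.chart.symm) z k) (c'.chart y) :=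
      analyticAt_pi_iff.1 hτ k
    have hdiag : AnalyticAt ℂ (fun z => diagL (ell c'.logSet z)) (c'.chart y) :=
      (diagL.analyticAt _).comp (analyticAt_ell _)
    by_cases hk : k ∈ c.logSet
    · obtain ⟨q, hq, hq0, h⟩ := c.transition_coord c' hy hk
      rcases h with ⟨l, hl, h⟩ | ⟨-, h⟩
      · have hlL : l ∈ c'.logSet := by
          rw [mem_logSet, hl]
          exact mem_logSet.1 hk
        -- for a component through `y`, the logarithmic derivative of `z_l q` is
        -- `dz_l / z_l + dq / q`
        refine ⟨fun z => ContinuousLinearMap.proj (R := ℂ) (φ := fun _ : Fin d => ℂ) l +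
          (q z)⁻¹ • (fderiv ℂ q z).comp (diagL (ell c'.logSet z)), ?_, ?_⟩
        · exact analyticAt_const.add ((hq.inv hq0).smul (hq.fderiv.clm_comp' hdiag))
        · filter_upwards [h.eventually_nhds, hq.eventually_analyticAt,
            hq.continuousAt.eventually_ne hq0] with z h1 h2 h3 hz
          have hd : HasFDerivAt (fun z : Fin d → ℂ => z l)
              (ContinuousLinearMap.proj (R := ℂ) (φ := fun _ : Fin d => ℂ) l) z :=
            (ContinuousLinearMap.proj (R := ℂ) (φ := fun _ : Fin d => ℂ) l).hasFDerivAt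
          have h4 : (fun z => (c.chart ∘ c'.chart.symm) z k) =ᶠ[𝓝 z] fun z => z l * q z := h1
          have h5 := hd.fun_mul h2.differentiableAt.hasFDerivAt
          rw [h4.fderiv_eq, h5.fderiv, ell, if_pos hk,
            show (c.chart ∘ c'.chart.symm) z k = z l * q z from h4.self_of_nhds]
          have hzl := hz l hlL
          refine ContinuousLinearMap.ext fun v => ?_
          simp only [smul_apply, add_apply, ContinuousLinearMap.comp_apply, smul_eq_mul,
            ContinuousLinearMap.proj_apply]
          have h6 : diagL (ell c'.logSet z) v l = z l * v l := by
            rw [diagL_apply, Pi.mul_apply, ell, if_pos hlL]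
          rw [h6]
          field_simp
          ring
      · refine ⟨fun z => (q z)⁻¹ • (fderiv ℂ (fun z => (c.chart ∘ c'.chart.symm) z k) z).comp
          (diagL (ell c'.logSet z)), (hq.inv hq0).smul (hτk.fderiv.clm_comp' hdiag), ?_⟩
        filter_upwards [h] with z hz _
        rw [ell, if_pos hk, Function.comp_apply, hz]
    · refine ⟨fun z => (fderiv ℂ (fun z => (c.chart ∘ c'.chart.symm) z k) z).comp
          (diagL (ell c'.logSet z)), hτk.fderiv.clm_comp' hdiag, Eventually.of_forall fun z _ => ?_⟩
      rw [ell, if_neg hk, inv_one, one_smul]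
  choose b hb hbz using hrow
  refine ⟨fun z => ∑ k, (b k z).smulRight (Pi.single k 1 : Fin d → ℂ), ?_, ?_⟩
  · refine Finset.analyticAt_fun_sum _ fun k _ => ?_
    exact (((ContinuousLinearMap.smulRightL ℂ (Fin d → ℂ) (Fin d → ℂ)).flip
      (Pi.single k 1)).analyticAt _).comp (hb k)
  · filter_upwards [eventually_all.2 hbz, hτ.eventually_analyticAt] with z hz hz' hzL
    refine ContinuousLinearMap.ext fun v => funext fun k => ?_
    have h1 := congrArg (fun T : (Fin d → ℂ) →L[ℂ] ℂ => T v) (hz k hzL)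
    have h2 : fderiv ℂ (fun z => (c.chart ∘ c'.chart.symm) z k) z =
        (ContinuousLinearMap.proj (R := ℂ) (φ := fun _ : Fin d => ℂ) k).comp
          (fderiv ℂ (c.chart ∘ c'.chart.symm) z) :=
      ((ContinuousLinearMap.proj (R := ℂ) (φ := fun _ : Fin d => ℂ) k).hasFDerivAt.comp z
        hz'.differentiableAt.hasFDerivAt).fderiv
    rw [h2] at h1
    have h3 : (∑ k, (b k z).smulRight (Pi.single k 1 : Fin d → ℂ)) v k = b k z v := by
      rw [sum_apply, Finset.sum_apply]
      simp [Pi.single_apply]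
    rw [h3, ← h1]
    rfl

/-- The quotient of the local generators of `𝒪(E)` given by two adapted charts is holomorphic. -/
lemma exists_transition_monom (c : AdaptedChart S x) (c' : AdaptedChart S y)
    (hy : y ∈ c.chart.source) (E : PrimeDivisor d X → ℤ) :
    ∃ v : (Fin d → ℂ) → ℂ, AnalyticAt ℂ v (c'.chart y) ∧
      ∀ᶠ z in 𝓝 (c'.chart y), (∀ l ∈ c'.logSet, z l ≠ 0) →
        monom (c.expo E) ((c.chart ∘ c'.chart.symm) z) = monom (c'.expo E) z * v z := by
  classical
  have hfac : ∀ k, ∃ v : (Fin d → ℂ) → ℂ, AnalyticAt ℂ v (c'.chart y) ∧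
      ∀ᶠ z in 𝓝 (c'.chart y), (∀ l ∈ c'.logSet, z l ≠ 0) →
        (c.chart ∘ c'.chart.symm) z k ^ c.expo E k =
          (if h : k ∈ c.logSet ∧ ∃ l, c'.comp l = c.comp k then z h.2.choose else 1) ^ c.expo E k *
            v z := by
    intro k
    by_cases hk : k ∈ c.logSet
    · obtain ⟨q, hq, hq0, h⟩ := c.transition_coord c' hy hk
      refine ⟨fun z => q z ^ c.expo E k, hq.fun_zpow hq0, ?_⟩
      rcases h with ⟨l, hl, h⟩ | ⟨hn, h⟩
      · filter_upwards [h] with z hz _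
        have hex : k ∈ c.logSet ∧ ∃ l, c'.comp l = c.comp k := ⟨hk, l, hl⟩
        obtain ⟨T, hT⟩ := mem_logSet_iff.1 hk
        have hll : hex.2.choose = l := by
          have h1 := hex.2.choose_spec.trans hT
          obtain ⟨hTS, hyT⟩ := c'.comp_mem _ T h1
          exact (c'.comp_unique T hTS hyT).unique h1 (hl.trans hT)
        rw [dif_pos hex, hll, Function.comp_apply, hz, mul_zpow]
      · filter_upwards [h] with z hz _
        rw [dif_neg (fun h => hn _ h.2.choose_spec), one_zpow, one_mul, Function.comp_apply, hz]
    · refine ⟨fun _ => 1, analyticAt_const, Eventually.of_forall fun z _ => ?_⟩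
      simp [c.expo_of_notMem hk]
  choose v hv hvz using hfac
  refine ⟨fun z => ∏ k, v k z, Finset.analyticAt_fun_prod _ fun k _ => hv k, ?_⟩
  filter_upwards [eventually_all.2 hvz] with z hz hzL
  unfold monom
  rw [Finset.prod_congr rfl fun k _ => hz k hzL, Finset.prod_mul_distrib]
  congr 1
  -- a component through both points corresponds to one coordinate in each of the charts
  refine Finset.prod_bij_ne_one (fun k _ hk => if h : k ∈ c.logSet ∧ ∃ l, c'.comp l = c.comp k
    then h.2.choose else k) (fun _ _ _ => Finset.mem_univ _) ?_ ?_ ?_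
  · intro k₁ _ h₁ k₂ _ h₂ he
    have e₁ : k₁ ∈ c.logSet ∧ ∃ l, c'.comp l = c.comp k₁ := by
      by_contra hn
      simp [dif_neg hn] at h₁
    have e₂ : k₂ ∈ c.logSet ∧ ∃ l, c'.comp l = c.comp k₂ := by
      by_contra hn
      simp [dif_neg hn] at h₂
    rw [dif_pos e₁, dif_pos e₂] at he
    obtain ⟨T, hT⟩ := mem_logSet_iff.1 e₁.1
    have h3 : c.comp k₂ = some T := by
      rw [← e₂.2.choose_spec, ← he, e₁.2.choose_spec, hT]
    obtain ⟨hTS, hxT⟩ := c.comp_mem _ T hT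
    exact (c.comp_unique T hTS hxT).unique hT h3
  · intro l _ hl
    have hlL : l ∈ c'.logSet := by
      by_contra hn
      simp [c'.expo_of_notMem hn] at hl
    obtain ⟨T, hT⟩ := mem_logSet_iff.1 hlL
    obtain ⟨k, hk⟩ := exists_comp_of_comp' c c' hy hT
    have e : k ∈ c.logSet ∧ ∃ l, c'.comp l = c.comp k :=
      ⟨mem_logSet_iff.2 ⟨T, hk⟩, l, hT.trans hk.symm⟩
    have hll : e.2.choose = l := by
      have h1 := e.2.choose_spec.trans hk
      obtain ⟨hTS, hyT⟩ := c'.comp_mem _ T h1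
      exact (c'.comp_unique T hTS hyT).unique h1 hT
    refine ⟨k, Finset.mem_univ k, ?_, ?_⟩
    · rw [dif_pos e, hll, expo_of_comp hk, ← expo_of_comp (c := c') hT]
      exact hl
    · rw [dif_pos e, hll]
  · intro k _ hk
    have e : k ∈ c.logSet ∧ ∃ l, c'.comp l = c.comp k := by
      by_contra hn
      simp [dif_neg hn] at hk
    obtain ⟨T, hT⟩ := mem_logSet_iff.1 e.1
    rw [dif_pos e, dif_pos e, expo_of_comp hT, expo_of_comp (c := c') (e.2.choose_spec.trans hT)]

variable [IsManifold 𝓘(ℂ, Fin d → ℂ) ω X]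

/-- Being a section of `Ω^p(log D) ⊗ 𝒪(E)` may be checked in any adapted chart. -/
lemma IsFrameOf.transition {c : AdaptedChart S x} {η : X → Alt d p}
    {G : (Fin d → ℂ) → Alt d p} (h : c.IsFrameOf E η y G) (hy : y ∈ c.chart.source)
    (c' : AdaptedChart S y) : ∃ G', c'.IsFrameOf E η y G' := by
  obtain ⟨hG, hz⟩ := h
  obtain ⟨B, hB, hBz⟩ := c.exists_transition_frame c' hy
  obtain ⟨v, hv, hvz⟩ := c.exists_transition_monom c' hy E
  have hτ := c.analyticAt_transition c' hy
  have hτy : (c.chart ∘ c'.chart.symm) (c'.chart y) = c.chart y := by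
    simp [c'.chart.left_inv c'.mem_source]
  have ht : Tendsto (c.chart ∘ c'.chart.symm) (𝓝 (c'.chart y)) (𝓝 (c.chart y)) := by
    have := hτ.continuousAt.tendsto
    rwa [hτy] at this
  have hGτ : AnalyticAt ℂ (fun z => G ((c.chart ∘ c'.chart.symm) z)) (c'.chart y) := by
    refine AnalyticAt.comp (g := G) ?_ hτ
    rwa [hτy]
  refine ⟨fun z => v z • (G ((c.chart ∘ c'.chart.symm) z)).compContinuousLinearMap (B z),
    hv.smul (hGτ.compAlt hB), ?_⟩
  filter_upwards [hBz, hvz, ht.eventually hz,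
    c'.chart.open_target.mem_nhds (c'.chart.map_source c'.mem_source),
    (c'.tendsto_symm c'.mem_source).eventually (c.chart.open_source.mem_nhds hy)]
    with z h1 h2 h3 h4 h5 hzL
  have hD : c'.chart.symm z ∉ unionOf S := c'.symm_notMem' h4 hzL
  have hτL : ∀ k ∈ c.logSet, (c.chart ∘ c'.chart.symm) z k ≠ 0 := (c.notMem_iff h5).1 hD
  have hdd : (diagL (ell c'.logSet z)).comp (diagL (ell c'.logSet z)⁻¹) =
      ContinuousLinearMap.id ℂ (Fin d → ℂ) := by
    rw [diagL_comp, mul_comm, inv_ell_mul_ell hzL, diagL_one]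
  have h6 : (B z).comp (diagL (ell c'.logSet z)⁻¹) =
      (diagL (ell c.logSet ((c.chart ∘ c'.chart.symm) z))⁻¹).comp
        (fderiv ℂ (c.chart ∘ c'.chart.symm) z) := by
    rw [← h1 hzL, ContinuousLinearMap.comp_assoc, ContinuousLinearMap.comp_assoc, hdd,
      ContinuousLinearMap.comp_id]
  rw [inChart_transition c.mem_atlas c'.mem_atlas η h4 h5, h3 hτL]
  refine ContinuousAlternatingMap.ext fun w => ?_
  have h7 : ∀ a : Fin d → ℂ, B z (diagL (ell c'.logSet z)⁻¹ a) =
      diagL (ell c.logSet ((c.chart ∘ c'.chart.symm) z))⁻¹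
        (fderiv ℂ (c.chart ∘ c'.chart.symm) z a) := fun a => DFunLike.congr_fun h6 a
  simp only [frame, ContinuousAlternatingMap.compContinuousLinearMap_apply,
    ContinuousAlternatingMap.smul_apply, Function.comp_def, smul_eq_mul]
  simp only [Function.comp_def] at h2 h7
  simp only [h2 hzL, h7]
  ring

end AdaptedChart

end FramesInCharts

/-! ### Forms and their coefficients -/

section FramesAndForms

variable {d p : ℕ} {X : Type} [TopologicalSpace X] [ChartedSpace (Fin d → ℂ) X]
  {S : Finset (PrimeDivisor d X)} {E : PrimeDivisor d X → ℤ} {x y : X}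

namespace AdaptedChart

variable {c : AdaptedChart S x} {η η' : X → Alt d p} {G G' : (Fin d → ℂ) → Alt d p}

lemma IsFrameOf.sub (h : c.IsFrameOf E η y G) (h' : c.IsFrameOf E η' y G') :
    c.IsFrameOf E (η - η') y (G - G') := by
  refine ⟨h.1.sub h'.1, ?_⟩
  filter_upwards [h.2, h'.2] with z hz hz' hzL
  have e : inChart c.chart (η - η') z = inChart c.chart η z - inChart c.chart η' z := rfl
  rw [e, hz hzL, hz' hzL]
  simp only [frame, Pi.sub_apply]
  ext v
  simp [mul_sub]

lemma IsFrameOf.congr (h : c.IsFrameOf E η y G) (hG : G =ᶠ[𝓝 (c.chart y)] G') :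
    c.IsFrameOf E η y G' := by
  refine ⟨h.1.congr hG, ?_⟩
  filter_upwards [h.2, hG] with z hz hz' hzL
  rw [hz hzL, frame, frame, hz']

lemma IsFrameOf.congr_form (h : c.IsFrameOf E η y G) (hy : y ∈ c.chart.source)
    (hη : η =ᶠ[𝓝 y] η') : c.IsFrameOf E η' y G := by
  refine ⟨h.1, ?_⟩
  filter_upwards [h.2, inChart_congr hy hη] with z hz hz' hzL
  rw [← hz', hz hzL]

lemma IsFrameOf.eventually (h : c.IsFrameOf E η x G) : ∀ᶠ y in 𝓝 x, c.IsFrameOf E η y G := by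
  have ht : Tendsto c.chart (𝓝 x) (𝓝 (c.chart x)) := c.chart.continuousAt c.mem_source
  filter_upwards [ht.eventually h.1.eventually_analyticAt, ht.eventually h.2.eventually_nhds]
    with y h1 h2 using ⟨h1, h2⟩

lemma isFrameOf_zero {c : AdaptedChart S x} : c.IsFrameOf E (0 : X → Alt d p) x 0 := by
  refine ⟨analyticAt_const, Eventually.of_forall fun z _ => ContinuousAlternatingMap.ext fun v => ?_⟩
  exact (mul_zero (monom (c.expo E) z)).symm

lemma expo_notMem_zero : ∀ k ∉ c.logSet, c.expo E k = 0 := fun _ hk => c.expo_of_notMem hk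

/-- The coefficients of a form with respect to the frame are unique. -/
lemma IsFrameOf.coeff_eventuallyEq (h : c.IsFrameOf E η y G) (h' : c.IsFrameOf E η y G') :
    G =ᶠ[𝓝 (c.chart y)] G' := by
  refine eventually_eq_of_off_hyperplanes (L := c.logSet)
    (h.1.eventually_analyticAt.mono fun z hz => hz.continuousAt)
    (h'.1.eventually_analyticAt.mono fun z hz => hz.continuousAt) ?_
  filter_upwards [h.2, h'.2] with z hz hz' hzL
  exact frame_injective expo_notMem_zero hzL ((hz hzL).symm.trans (hz' hzL))

/-- Changing the twist by a component multiplies the coefficients by a coordinate. -/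
lemma frame_update [DecidableEq (PrimeDivisor d X)] {k : Fin d} {T : PrimeDivisor d X}
    (hk : c.comp k = some T) (G : (Fin d → ℂ) → Alt d p) {z : Fin d → ℂ}
    (hz : ∀ k ∈ c.logSet, z k ≠ 0) :
    frame c.logSet (c.expo (Function.update E T (E T + 1))) (fun w => w k • G w) z =
      frame c.logSet (c.expo E) G z := by
  have hkL : k ∈ c.logSet := mem_logSet_iff.2 ⟨T, hk⟩
  have hm : monom (c.expo E) z = monom (c.expo (Function.update E T (E T + 1))) z * z k := by
    unfold monom
    rw [← Finset.mul_prod_erase _ _ (Finset.mem_univ k),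
      ← Finset.mul_prod_erase _ _ (Finset.mem_univ k), expo_of_comp hk, expo_of_comp hk,
      Function.update_self]
    have h1 : ∀ l ∈ Finset.univ.erase k, z l ^ c.expo E l =
        z l ^ c.expo (Function.update E T (E T + 1)) l := by
      intro l hl
      by_cases hlL : l ∈ c.logSet
      · obtain ⟨T', hT'⟩ := mem_logSet_iff.1 hlL
        have hne : T' ≠ T := by
          rintro rfl
          obtain ⟨hTS, hxT⟩ := c.comp_mem _ _ hk
          exact Finset.ne_of_mem_erase hl ((c.comp_unique _ hTS hxT).unique hT' hk)
        rw [expo_of_comp hT', expo_of_comp hT', Function.update_of_ne hne]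
      · rw [c.expo_of_notMem hlL, c.expo_of_notMem hlL]
    rw [Finset.prod_congr rfl h1]
    have h2 : z k ^ (-E T) = z k ^ (-(E T + 1)) * z k := by
      rw [← zpow_add_one₀ (hz k hkL)]
      congr 1
      ring
    rw [h2]
    ring
  unfold frame
  rw [hm]
  ext v
  simp [mul_assoc]

lemma IsFrameOf.update [DecidableEq (PrimeDivisor d X)] {k : Fin d} {T : PrimeDivisor d X}
    (hk : c.comp k = some T) (h : c.IsFrameOf E η y G) :
    c.IsFrameOf (Function.update E T (E T + 1)) η y (fun w => w k • G w) := by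
  refine ⟨(analyticAt_coord k _).smul h.1, ?_⟩
  filter_upwards [h.2] with z hz hzL
  rw [frame_update hk G hzL, hz hzL]

lemma chart_mdifferentiable (c : AdaptedChart S x) :
    c.chart.MDifferentiable 𝓘(ℂ, Fin d → ℂ) 𝓘(ℂ, Fin d → ℂ) :=
  ⟨(contMDiffOn_of_mem_maximalAtlas c.mem_atlas).mdifferentiableOn (by simp),
    (contMDiffOn_symm_of_mem_maximalAtlas c.mem_atlas).mdifferentiableOn (by simp)⟩

/-- The form off the divisor, on the domain of the chart, with given coefficients with respect to
the frame; it is extended by zero. -/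
def toForm (c : AdaptedChart S x) (E : PrimeDivisor d X → ℤ) (G : (Fin d → ℂ) → Alt d p)
    (y : X) : Alt d p :=
  open Classical in
  if y ∈ c.chart.source ∧ y ∉ unionOf S then
    (frame c.logSet (c.expo E) G (c.chart y)).compContinuousLinearMap
      (mfderiv 𝓘(ℂ, Fin d → ℂ) 𝓘(ℂ, Fin d → ℂ) c.chart y) else 0

lemma toForm_of_mem (h : y ∈ unionOf S) : c.toForm E G y = 0 := if_neg fun h' => h'.2 h

lemma inChart_toForm (c : AdaptedChart S x) (E : PrimeDivisor d X → ℤ)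
    (G : (Fin d → ℂ) → Alt d p) {z : Fin d → ℂ} (hz : z ∈ c.chart.target)
    (hzL : ∀ k ∈ c.logSet, z k ≠ 0) :
    inChart c.chart (c.toForm E G) z = frame c.logSet (c.expo E) G z := by
  unfold inChart toForm
  rw [if_pos ⟨c.chart.map_target hz, c.symm_notMem' hz hzL⟩, c.chart.right_inv hz]
  have h := c.chart_mdifferentiable.comp_symm_deriv hz
  refine ContinuousAlternatingMap.ext fun v => ?_
  exact congrArg (fun w : Fin p → Fin d → ℂ => frame c.logSet (c.expo E) G z w)
    (funext fun j => DFunLike.congr_fun h (v j))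

lemma isFrameOf_toForm (c : AdaptedChart S x) (E : PrimeDivisor d X → ℤ) (hy : y ∈ c.chart.source)
    (hG : AnalyticAt ℂ G (c.chart y)) : c.IsFrameOf E (c.toForm E G) y G := by
  refine ⟨hG, ?_⟩
  filter_upwards [c.chart.open_target.mem_nhds (c.chart.map_source hy)] with z hz hzL
  exact c.inChart_toForm E G hz hzL

/-- A form is determined off the divisor by its coefficients with respect to the frame. -/
lemma IsFrameOf.eventuallyEq {y₀ : X} (h : c.IsFrameOf E η y₀ G) (h' : c.IsFrameOf E η' y₀ G)
    (hy₀ : y₀ ∈ c.chart.source) (h0 : ∀ᶠ y in 𝓝 y₀, y ∈ unionOf S → η y = 0)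
    (h0' : ∀ᶠ y in 𝓝 y₀, y ∈ unionOf S → η' y = 0) : η =ᶠ[𝓝 y₀] η' := by
  have ht : Tendsto c.chart (𝓝 y₀) (𝓝 (c.chart y₀)) := c.chart.continuousAt hy₀
  filter_upwards [ht.eventually h.2, ht.eventually h'.2, h0, h0',
    c.chart.open_source.mem_nhds hy₀] with y h1 h2 h3 h4 hy
  by_cases hD : y ∈ unionOf S
  · rw [h3 hD, h4 hD]
  have hL := (c.notMem_iff hy).1 hD
  have h5 := (h1 hL).trans (h2 hL).symm
  unfold inChart at h5
  rw [c.chart.left_inv hy] at h5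
  have h6 := c.chart_mdifferentiable.symm_comp_deriv hy
  refine ContinuousAlternatingMap.ext fun v => ?_
  have h8 : ∀ w : Fin d → ℂ, mfderiv 𝓘(ℂ, Fin d → ℂ) 𝓘(ℂ, Fin d → ℂ) c.chart.symm (c.chart y)
      (mfderiv 𝓘(ℂ, Fin d → ℂ) 𝓘(ℂ, Fin d → ℂ) c.chart y w) = w := fun w => DFunLike.congr_fun h6 w
  have h9 : (fun j => mfderiv 𝓘(ℂ, Fin d → ℂ) 𝓘(ℂ, Fin d → ℂ) c.chart.symm (c.chart y)
      (mfderiv 𝓘(ℂ, Fin d → ℂ) 𝓘(ℂ, Fin d → ℂ) c.chart y (v j))) = v := funext fun j => h8 (v j)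
  have h10 : ∀ a : Alt d p, (a fun j => mfderiv 𝓘(ℂ, Fin d → ℂ) 𝓘(ℂ, Fin d → ℂ) c.chart.symm
      (c.chart y) (mfderiv 𝓘(ℂ, Fin d → ℂ) 𝓘(ℂ, Fin d → ℂ) c.chart y (v j))) = a v :=
    fun a => congrArg a h9
  exact (h10 _).symm.trans (Eq.trans (congrArg (fun a : Alt d p => a fun j =>
    mfderiv 𝓘(ℂ, Fin d → ℂ) 𝓘(ℂ, Fin d → ℂ) c.chart y (v j)) h5) (h10 _))

variable [IsManifold 𝓘(ℂ, Fin d → ℂ) ω X]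

/-- The exterior derivative in terms of the coefficients with respect to the frame. -/
lemma IsFrameOf.extDerivOff (h : c.IsFrameOf E η y G) (hy : y ∈ c.chart.source) :
    c.IsFrameOf E (extDerivOff (unionOf S) η) y (dLog c.logSet (fun k => c.expo E k) G) := by
  refine ⟨h.1.dLog, ?_⟩
  filter_upwards [h.2.eventually_nhds, h.1.eventually_analyticAt,
    c.chart.open_target.mem_nhds (c.chart.map_source hy)] with z h1 h2 hz hzL
  have hL : ∀ᶠ w in 𝓝 z, ∀ k ∈ c.logSet, w k ≠ 0 :=
    (Filter.eventually_all_finset _).2 fun k hk =>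
      (continuousAt_apply k z).eventually_ne (hzL k hk)
  have h3 : inChart c.chart η =ᶠ[𝓝 z] frame c.logSet (c.expo E) G := by
    filter_upwards [h1, hL] with w hw hwL using hw hwL
  have h4 := h2.frame (expo_notMem_zero (c := c) (E := E)) hzL
  rw [inChart_extDerivOff c.mem_atlas hz (c.symm_notMem' hz hzL)
    (h4.differentiableAt.congr_of_eventuallyEq h3), h3.extDeriv_eq,
    extDeriv_frame expo_notMem_zero hzL h2]

/-- A form with holomorphic coefficients with respect to the frame at `x` is a section of
`Ω^p(log D) ⊗ 𝒪(E)` near `x`. -/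
lemma IsFrameOf.eventually_isLogFormAt (h : c.IsFrameOf E η x G)
    (h0 : ∀ᶠ y in 𝓝 x, y ∈ unionOf S → η y = 0) : ∀ᶠ y in 𝓝 x, IsLogFormAt S E η y := by
  filter_upwards [h.eventually, h0, c.chart.open_source.mem_nhds c.mem_source] with y h1 h2 hy
  exact isLogFormAt_of_frame h2 fun c' => h1.transition hy c'

end AdaptedChart

variable [IsManifold 𝓘(ℂ, Fin d → ℂ) ω X]

/-- The differential form given by a section of the logarithmic de Rham complex. -/
def formOf {V : Opens X} (s : Sec ((logDeRham S E).X p) V) : X → Alt d p :=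
  (show (logFormCondition S E p).sections V from s).1

lemma isLogFormAt_formOf {V : Opens X} (s : Sec ((logDeRham S E).X p) V) (hy : y ∈ V) :
    IsLogFormAt S E (formOf s) y := (show (logFormCondition S E p).sections V from s).2.1 y hy

lemma formOf_ext {V : Opens X} {s t : Sec ((logDeRham S E).X p) V} (h : formOf s = formOf t) :
    s = t := Subtype.ext (a1 := (show (logFormCondition S E p).sections V from s)) h

lemma formOf_resL {V W : Opens X} (h : W ≤ V) (s : Sec ((logDeRham S E).X p) V) :
    formOf (resL _ h s) = cutOff W (formOf s) := rfl

lemma formOf_resL_eventuallyEq {V W : Opens X} (h : W ≤ V) (s : Sec ((logDeRham S E).X p) V)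
    (hx : x ∈ W) : formOf (resL _ h s) =ᶠ[𝓝 x] formOf s := cutOff_eventuallyEq hx

lemma formOf_add {V : Opens X} (s t : Sec ((logDeRham S E).X p) V) :
    formOf (s + t) = formOf s + formOf t := rfl

lemma formOf_zero {V : Opens X} : formOf (0 : Sec ((logDeRham S E).X p) V) = 0 := rfl

lemma formOf_d {V : Opens X} (s : Sec ((logDeRham S E).X p) V) :
    formOf (secMap ((logDeRham S E).d p (p + 1)) V s) =
      cutOff V (extDerivOff (unionOf S) (formOf s)) := by
  rw [logDeRham_d]
  rfl

lemma formOf_d_eventuallyEq {V : Opens X} (s : Sec ((logDeRham S E).X p) V) (hx : x ∈ V) :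
    formOf (secMap ((logDeRham S E).d p (p + 1)) V s) =ᶠ[𝓝 x]
      extDerivOff (unionOf S) (formOf s) := by
  rw [formOf_d]
  exact cutOff_eventuallyEq hx

lemma formOf_inclusion {E' : PrimeDivisor d X → ℤ} (hE : ∀ T ∈ S, E T ≤ E' T) {V : Opens X}
    (s : Sec ((logDeRham S E).X p) V) :
    formOf (secMap ((logDeRhamInclusion rfl hE).f p) V s) = formOf s := rfl

lemma formOf_eq_zero {V : Opens X} (s : Sec ((logDeRham S E).X p) V) (hx : x ∈ V) :
    ∀ᶠ y in 𝓝 x, y ∈ unionOf S → formOf s y = 0 := by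
  filter_upwards [V.isOpen.mem_nhds hx] with y hy using (isLogFormAt_formOf s hy).1

lemma exists_frame_formOf {V : Opens X} (s : Sec ((logDeRham S E).X p) V) (hx : x ∈ V)
    (c : AdaptedChart S x) : ∃ G, c.IsFrameOf E (formOf s) x G :=
  (isLogFormAt_formOf s hx).exists_frame c

/-- A form that satisfies the condition near a point defines a section near the point. -/
lemma exists_section {V : Opens X} (hx : x ∈ V) {η : X → Alt d p}
    (h : ∀ᶠ y in 𝓝 x, IsLogFormAt S E η y) :
    ∃ (W : Opens X) (_ : W ≤ V) (_ : x ∈ W) (s : Sec ((logDeRham S E).X p) W),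
      formOf s =ᶠ[𝓝 x] η := by
  obtain ⟨W, hW, hWo, hxW⟩ := mem_nhds_iff.1 h
  have hxW' : x ∈ (⟨W, hWo⟩ : Opens X) ⊓ V := ⟨hxW, hx⟩
  refine ⟨⟨W, hWo⟩ ⊓ V, inf_le_right, hxW', show (logFormCondition S E p).sections _ from
    ⟨cutOff _ η, fun y hy => (logFormCondition S E p).congr (cutOff_eventuallyEq hy).symm
      (hW hy.1), fun _ hy => cutOff_of_notMem hy⟩, cutOff_eventuallyEq hxW'⟩

/-- Sections with the same germ agree near the point. -/
lemma exists_resL_eq {V V' : Opens X} (hx : x ∈ V) (hx' : x ∈ V')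
    (s : Sec ((logDeRham S E).X p) V) (t : Sec ((logDeRham S E).X p) V')
    (h : formOf s =ᶠ[𝓝 x] formOf t) :
    ∃ (W : Opens X) (hW : W ≤ V) (hW' : W ≤ V'), x ∈ W ∧ resL _ hW s = resL _ hW' t := by
  obtain ⟨W, hW, hWo, hxW⟩ := mem_nhds_iff.1 h
  refine ⟨⟨W, hWo⟩ ⊓ (V ⊓ V'), inf_le_right.trans inf_le_left, inf_le_right.trans inf_le_right,
    ⟨hxW, hx, hx'⟩, formOf_ext ?_⟩
  rw [formOf_resL, formOf_resL]
  funext y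
  by_cases hy : y ∈ (⟨W, hWo⟩ : Opens X) ⊓ (V ⊓ V')
  · rw [cutOff_of_mem hy, cutOff_of_mem hy]
    exact hW hy.1
  · rw [cutOff_of_notMem hy, cutOff_of_notMem hy]

lemma AdaptedChart.exists_section_toForm (c : AdaptedChart S x) {V : Opens X} (hx : x ∈ V)
    {G : (Fin d → ℂ) → Alt d p} (hG : AnalyticAt ℂ G (c.chart x)) :
    ∃ (W : Opens X) (_ : W ≤ V) (_ : x ∈ W) (s : Sec ((logDeRham S E).X p) W),
      c.IsFrameOf E (formOf s) x G := by
  have h := c.isFrameOf_toForm E c.mem_source hG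
  obtain ⟨W, hW, hxW, s, hs⟩ := exists_section hx
    (h.eventually_isLogFormAt (Eventually.of_forall fun y hy => c.toForm_of_mem hy))
  exact ⟨W, hW, hxW, s, h.congr_form c.mem_source hs.symm⟩

lemma isFrameOf_d {c : AdaptedChart S x} {V : Opens X} (hx : x ∈ V)
    {s : Sec ((logDeRham S E).X p) V} {G : (Fin d → ℂ) → Alt d p}
    (h : c.IsFrameOf E (formOf s) x G) :
    c.IsFrameOf E (formOf (secMap ((logDeRham S E).d p (p + 1)) V s)) x
      (dLog c.logSet (fun k => c.expo E k) G) :=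
  (h.extDerivOff c.mem_source).congr_form c.mem_source (formOf_d_eventuallyEq s hx).symm

/-- The coefficients of a closed section are closed. -/
lemma dLog_eq_zero_of_closed {c : AdaptedChart S x} {V : Opens X} (hx : x ∈ V)
    {s : Sec ((logDeRham S E).X p) V} {G : (Fin d → ℂ) → Alt d p}
    (h : c.IsFrameOf E (formOf s) x G) (hs : secMap ((logDeRham S E).d p (p + 1)) V s = 0) :
    dLog c.logSet (fun k => c.expo E k) G =ᶠ[𝓝 (c.chart x)] 0 := by
  have h1 := isFrameOf_d hx h
  rw [hs, formOf_zero] at h1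
  exact h1.coeff_eventuallyEq AdaptedChart.isFrameOf_zero

/-- Sections with the same coefficients agree near the point. -/
lemma exists_resL_eq_of_frame {c : AdaptedChart S x} {V V' : Opens X} (hx : x ∈ V) (hx' : x ∈ V')
    {s : Sec ((logDeRham S E).X p) V} {t : Sec ((logDeRham S E).X p) V'}
    {G G' : (Fin d → ℂ) → Alt d p} (h : c.IsFrameOf E (formOf s) x G)
    (h' : c.IsFrameOf E (formOf t) x G') (hG : G =ᶠ[𝓝 (c.chart x)] G') :
    ∃ (W : Opens X) (hW : W ≤ V) (hW' : W ≤ V'), x ∈ W ∧ resL _ hW s = resL _ hW' t :=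
  exists_resL_eq hx hx' s t
    ((h.congr hG).eventuallyEq h' c.mem_source (formOf_eq_zero s hx) (formOf_eq_zero t hx'))

end FramesAndForms

/-! ### Change of the twist -/

section TwistChange

variable {d p : ℕ} {X : Type} [TopologicalSpace X] [ChartedSpace (Fin d → ℂ) X]
  {S : Finset (PrimeDivisor d X)} {E E' E'' : PrimeDivisor d X → ℤ} {x y : X}

/-- The condition at `x` only depends on the coefficients of the components through `x`. -/
lemma IsLogFormAt.congr_twist {η : X → Alt d p} (h : IsLogFormAt S E η x)
    (hE : ∀ T ∈ S, x ∈ T.carrier → E T = E' T) : IsLogFormAt S E' η x := by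
  refine ⟨h.1, fun c I => ?_⟩
  have e : c.generator E = c.generator E' := by
    funext z
    unfold AdaptedChart.generator
    refine Finset.prod_congr rfl fun k _ => ?_
    have hm : c.mult E k = c.mult E' k := by
      unfold AdaptedChart.mult
      rcases hk : c.comp k with _ | T
      · rfl
      · exact hE T (c.comp_mem k T hk).1 (c.comp_mem k T hk).2
    rw [hm]
  rw [← e]
  exact h.2 c I

variable [IsManifold 𝓘(ℂ, Fin d → ℂ) ω X]

/-- At points off the components where the twists differ the inclusion is a local isomorphism. -/
lemma exists_lift_of_eq (hE : ∀ T ∈ S, E T ≤ E' T)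
    (hx' : ∀ T ∈ S, x ∈ T.carrier → E T = E' T) {V : Opens X} (hx : x ∈ V)
    (t : Sec ((logDeRham S E').X p) V) : ∃ (W : Opens X) (h : W ≤ V) (_ : x ∈ W)
      (s : Sec ((logDeRham S E).X p) W),
      secMap ((logDeRhamInclusion rfl hE).f p) W s = resL _ h t := by
  classical
  let A : Opens X := ⟨(unionOf (S.filter fun T => x ∉ T.carrier))ᶜ,
    (isClosed_unionOf _).isOpen_compl⟩
  have hA : ∀ {y T}, y ∈ A → T ∈ S → y ∈ T.carrier → x ∈ T.carrier := by
    intro y T hy hT hyT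
    by_contra hxT
    exact hy (Set.mem_biUnion (Finset.mem_filter.2 ⟨hT, hxT⟩) hyT)
  have hxA : x ∈ A := by
    intro h
    simp only [unionOf, Set.mem_iUnion] at h
    obtain ⟨T, hT, hxT⟩ := h
    exact (Finset.mem_filter.1 hT).2 hxT
  refine ⟨A ⊓ V, inf_le_right, ⟨hxA, hx⟩, show (logFormCondition S E p).sections _ from
    ⟨cutOff (A ⊓ V) (formOf t), fun y hy => (logFormCondition S E p).congr
      (cutOff_eventuallyEq hy).symm ?_, fun _ hy => cutOff_of_notMem hy⟩, rfl⟩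
  exact (isLogFormAt_formOf t hy.2).congr_twist
    fun T hT hyT => (hx' T hT (hA hy.1 hT hyT)).symm

lemma secMap_logDeRhamInclusion_injective (hE : ∀ T ∈ S, E T ≤ E' T) {V : Opens X}
    {s t : Sec ((logDeRham S E).X p) V}
    (h : secMap ((logDeRhamInclusion rfl hE).f p) V s =
      secMap ((logDeRhamInclusion rfl hE).f p) V t) : s = t :=
  formOf_ext ((formOf_inclusion hE s).symm.trans
    ((congrArg (formOf (E := E')) h).trans (formOf_inclusion hE t)))

lemma secMap_inclusion_d (hE : ∀ T ∈ S, E T ≤ E' T) {V : Opens X} (i j : ℕ)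
    (s : Sec ((logDeRham S E).X i) V) :
    secMap ((logDeRhamInclusion rfl hE).f j) V (secMap ((logDeRham S E).d i j) V s) =
      secMap ((logDeRham S E').d i j) V (secMap ((logDeRhamInclusion rfl hE).f i) V s) :=
  secMap_comm _ i j s

/-- Adding a component to the twist is injective on cohomology sheaves. -/
lemma locInj_update [DecidableEq (PrimeDivisor d X)] (hsnc : IsSNC S) {T : PrimeDivisor d X}
    (hE : ∀ T' ∈ S, E T' ≤ Function.update E T (E T + 1) T') (n : ℕ) :
    LocInj (logDeRhamInclusion (S' := S) rfl hE) (n - 1) n (n + 1) ⊤ := by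
  intro V _ s hs t hst x hx
  rcases n with _ | n
  · refine ⟨V, le_rfl, hx, 0, ?_⟩
    have h0 : s = 0 := by
      refine secMap_logDeRhamInclusion_injective hE ?_
      rw [hst, map_zero, HomologicalComplex.shape _ _ _ (by simp)]
      rfl
    rw [map_zero, h0, map_zero]
  change Sec ((logDeRham S (Function.update E T (E T + 1))).X n) V at t
  change secMap _ V s = secMap ((logDeRham S (Function.update E T (E T + 1))).d n (n + 1)) V t at hst
  change ∃ (W : Opens X) (h : W ≤ V), x ∈ W ∧ ∃ u : Sec ((logDeRham S E).X n) W,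
    secMap ((logDeRham S E).d n (n + 1)) W u = resL _ h s
  by_cases hxT : T ∈ S ∧ x ∈ T.carrier
  swap
  · obtain ⟨W, hW, hxW, u, hu⟩ := exists_lift_of_eq hE (fun T' hT' hx' => by
      rw [Function.update_of_ne]
      rintro rfl
      exact hxT ⟨hT', hx'⟩) hx t
    refine ⟨W, hW, hxW, u, secMap_logDeRhamInclusion_injective hE ?_⟩
    rw [secMap_inclusion_d, hu, secMap_resL, ← hst, secMap_resL]
  obtain ⟨c⟩ := hsnc x
  obtain ⟨k, hk, -⟩ := c.comp_unique T hxT.1 hxT.2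
  have hkL : k ∈ c.logSet := AdaptedChart.mem_logSet_iff.2 ⟨T, hk⟩
  have hck := c.chart_apply_eq_zero hkL
  -- the coefficients of `s` for the larger twist are `z_k Gs`, which vanishes for `z_k = 0`: the
  -- restriction of `t` to `T` is closed and may be subtracted from `t`
  obtain ⟨Gs, hGs⟩ := exists_frame_formOf s hx c
  obtain ⟨Gt, hGt⟩ := exists_frame_formOf t hx c
  have h1 := isFrameOf_d hx hGt
  rw [← hst] at h1
  have h2 := h1.coeff_eventuallyEq (hGs.update hk)
  -- subtract the restriction to the component
  obtain ⟨q, hq, hqe⟩ := exists_eq_smul_of_vanishing (hGt.1.sub (hGt.1.comp_scale k 0)) k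
    (Eventually.of_forall fun z => by simp [scale_scale])
  obtain ⟨W, hW, hxW, u, hu⟩ := c.exists_section_toForm (E := E) hx hq
  have h3 := (isFrameOf_d hxW hu).update hk
  have h4 := hGs.update hk
  have hu' : c.IsFrameOf (Function.update E T (E T + 1)) (formOf u) x
      (Gt - fun z => Gt (scale (c.chart x) k 0 z)) := by
    refine (hu.update hk).congr ?_
    filter_upwards [hqe] with z hz
    rw [hck, sub_zero] at hz
    exact hz.symm
  have h5 : dLog c.logSet (fun k => c.expo (Function.update E T (E T + 1)) k)
      (Gt - fun z => Gt (scale (c.chart x) k 0 z)) =ᶠ[𝓝 (c.chart x)] fun w => w k • Gs w := by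
    filter_upwards [hGt.1.eventually_analyticAt, (hGt.1.comp_scale k 0).eventually_analyticAt,
      dLog_comp_scale_eventually (μ := fun k => (c.expo (Function.update E T (E T + 1)) k : ℂ))
        hkL hck hGt.1, h2, (tendsto_scale (c.chart x) k 0).eventually h2] with z e1 e2 e3 e4 e5
    rw [dLog_sub e1.differentiableAt e2.differentiableAt, e3, e4, e5, scale_apply_same, hck]
    simp
  have h6 := isFrameOf_d (E := Function.update E T (E T + 1))
    (s := secMap ((logDeRhamInclusion rfl hE).f n) W u) hxW hu'
  obtain ⟨W', hW', hW'', hxW', e⟩ := exists_resL_eq_of_frame hxW hx h6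
    (t := secMap ((logDeRhamInclusion rfl hE).f (n + 1)) V s) h4 h5
  refine ⟨W', hW'', hxW', resL _ hW' u, secMap_logDeRhamInclusion_injective hE ?_⟩
  rw [secMap_inclusion_d, secMap_resL, secMap_resL, secMap_resL]
  exact e

/-- Adding a component to the twist is surjective on cohomology sheaves if the residue of the
differential along this component, `-(E T + 1)`, is not zero: by the homotopy given by contraction with
the logarithmic vector field, the restriction of a closed form to the component is then exact. -/
lemma locSurj_update [DecidableEq (PrimeDivisor d X)] (hsnc : IsSNC S) {T : PrimeDivisor d X}
    (hE : ∀ T' ∈ S, E T' ≤ Function.update E T (E T + 1) T') (hT : E T + 1 ≠ 0) (n : ℕ) :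
    LocSurj (logDeRhamInclusion (S' := S) rfl hE) (n - 1) n (n + 1) ⊤ := by
  intro V _ t ht x hx
  by_cases hxT : T ∈ S ∧ x ∈ T.carrier
  swap
  · obtain ⟨W, hW, hxW, s, hs⟩ := exists_lift_of_eq hE (fun T' hT' hx' => by
      rw [Function.update_of_ne]
      rintro rfl
      exact hxT ⟨hT', hx'⟩) hx t
    refine ⟨W, hW, hxW, s, secMap_logDeRhamInclusion_injective hE ?_, 0, ?_⟩
    · rw [secMap_inclusion_d, hs, secMap_resL, ht, map_zero, map_zero]
    · rw [hs, map_zero, add_zero]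
  obtain ⟨c⟩ := hsnc x
  obtain ⟨k, hk, -⟩ := c.comp_unique T hxT.1 hxT.2
  have hkL : k ∈ c.logSet := AdaptedChart.mem_logSet_iff.2 ⟨T, hk⟩
  have hck := c.chart_apply_eq_zero hkL
  have hμ : (c.expo (Function.update E T (E T + 1)) k : ℂ) ≠ 0 := by
    rw [AdaptedChart.expo_of_comp hk, Function.update_self]
    exact_mod_cast neg_ne_zero.2 hT
  obtain ⟨G, hG⟩ := exists_frame_formOf t hx c
  have hcl := dLog_eq_zero_of_closed hx hG ht
  -- `t - t|_T` is divisible by the equation of `T`, hence comes from a section `s` for the smaller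
  -- twist; it remains to show that `t|_T` is exact
  obtain ⟨q, hq, hqe⟩ := exists_eq_smul_of_vanishing (hG.1.sub (hG.1.comp_scale k 0)) k
    (Eventually.of_forall fun z => by simp [scale_scale])
  obtain ⟨W, hW, hxW, s, hs⟩ := c.exists_section_toForm (E := E) hx hq
  have hs' : c.IsFrameOf (Function.update E T (E T + 1)) (formOf s) x
      (G - fun z => G (scale (c.chart x) k 0 z)) := by
    refine (hs.update hk).congr ?_
    filter_upwards [hqe] with z hz
    rw [hck, sub_zero] at hz
    exact hz.symm
  have h5 : dLog c.logSet (fun k => c.expo (Function.update E T (E T + 1)) k)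
      (G - fun z => G (scale (c.chart x) k 0 z)) =ᶠ[𝓝 (c.chart x)] 0 := by
    filter_upwards [hG.1.eventually_analyticAt, (hG.1.comp_scale k 0).eventually_analyticAt,
      dLog_comp_scale_eventually (μ := fun k => (c.expo (Function.update E T (E T + 1)) k : ℂ))
        hkL hck hG.1, hcl, (tendsto_scale (c.chart x) k 0).eventually hcl] with z e1 e2 e3 e4 e5
    rw [dLog_sub e1.differentiableAt e2.differentiableAt, e3, e4, e5]
    simp
  -- `s` is closed near `x`
  have h6 := isFrameOf_d (E := Function.update E T (E T + 1))
    (s := secMap ((logDeRhamInclusion rfl hE).f n) W s) hxW hs'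
  obtain ⟨W₁, hW₁, _, hxW₁, e₁⟩ := exists_resL_eq_of_frame hxW hxW h6
    (t := (0 : Sec ((logDeRham S (Function.update E T (E T + 1))).X (n + 1)) W))
    AdaptedChart.isFrameOf_zero h5
  have hcls : secMap ((logDeRham S E).d n (n + 1)) W₁ (resL _ hW₁ s) = 0 := by
    refine secMap_logDeRhamInclusion_injective hE ?_
    rw [secMap_inclusion_d, secMap_resL, secMap_resL, e₁, map_zero, map_zero]
  rcases n with _ | n
  · -- in degree zero the restriction to the component vanishes
    have h7 := eq_zero_of_closed_scale hkL hck hμ hG.1 hcl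
    obtain ⟨W₂, hW₂, hW₂', hxW₂, e₂⟩ := exists_resL_eq_of_frame
      (V := W₁) hxW₁ hx (s := secMap ((logDeRhamInclusion rfl hE).f 0) W₁ (resL _ hW₁ s)) (t := t)
      (hs'.congr_form c.mem_source (formOf_resL_eventuallyEq hW₁ s hxW₁).symm) hG (by
        filter_upwards [h7] with z hz
        rw [Pi.sub_apply, hz, sub_zero])
    refine ⟨W₂, hW₂', hxW₂, resL _ hW₂ (resL _ hW₁ s), ?_, 0, ?_⟩
    · rw [secMap_resL, hcls, map_zero]
    · rw [map_zero, add_zero, secMap_resL]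
      exact e₂.symm
  · -- in positive degree it is exact since the residue along `T` is not zero
    have hθ : AnalyticAt ℂ (fun z => (c.expo (Function.update E T (E T + 1)) k : ℂ)⁻¹ •
        contr (Pi.single k 1) (G (scale (c.chart x) k 0 z))) (c.chart x) :=
      analyticAt_const.fun_smul ((hG.1.comp_scale k 0).contr (Pi.single k 1))
    obtain ⟨W₂, hW₂, hxW₂, u, hu⟩ := c.exists_section_toForm
      (E := Function.update E T (E T + 1)) hxW₁ hθ
    have h7 := (isFrameOf_d hxW₂ hu).congr (dLog_contr_scale hkL hck hμ hG.1 hcl)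
    set s₂ : Sec ((logDeRham S (Function.update E T (E T + 1))).X (n + 1)) W₂ :=
      secMap ((logDeRhamInclusion rfl hE).f (n + 1)) W₂ (resL _ hW₂ (resL _ hW₁ s)) +
        secMap ((logDeRham S (Function.update E T (E T + 1))).d n (n + 1)) W₂ u with hs₂
    have h8 : c.IsFrameOf (Function.update E T (E T + 1)) (formOf s) x
        (G - fun z => G (scale (c.chart x) k 0 z)) := hs'
    have h9 : formOf t =ᶠ[𝓝 x] formOf s₂ := by
      have h10 := (hG.sub h8).congr (G' := fun z => G (scale (c.chart x) k 0 z))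
        (Eventually.of_forall fun z => by simp)
      have h11 := h10.eventuallyEq h7 c.mem_source (by
        filter_upwards [formOf_eq_zero t hx, formOf_eq_zero s hxW] with y e1 e2 hy
        rw [Pi.sub_apply, e1 hy, e2 hy, sub_zero]) (formOf_eq_zero _ hxW₂)
      filter_upwards [h11, formOf_resL_eventuallyEq (hW₂.trans hW₁) s hxW₂] with y e1 e2
      have e3 : formOf s₂ y = formOf (resL _ (hW₂.trans hW₁) s) y +
          formOf (secMap ((logDeRham S (Function.update E T (E T + 1))).d n (n + 1)) W₂ u) y := by
        rw [hs₂, resL_resL]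
        rfl
      rw [e3, e2, ← e1, Pi.sub_apply]
      simp
    obtain ⟨W₃, hW₃, hW₃', hxW₃, e₂⟩ := exists_resL_eq hx hxW₂ t s₂ h9
    refine ⟨W₃, hW₃, hxW₃, resL _ hW₃' (resL _ hW₂ (resL _ hW₁ s)), ?_, resL _ hW₃' u, ?_⟩
    · rw [secMap_resL, secMap_resL, hcls, map_zero, map_zero]
    · refine e₂.trans ?_
      rw [hs₂, map_add]
      exact congrArg₂ (· + ·) (secMap_resL _ _ _).symm (secMap_resL _ _ _).symm

lemma quasiIso_of_locally {K L : CochainComplex (CSheaf X) ℕ} (f : K ⟶ L)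
    (h1 : ∀ n, LocInj f (n - 1) n (n + 1) ⊤) (h2 : ∀ n, LocSurj f (n - 1) n (n + 1) ⊤) :
    QuasiIso f := by
  refine ⟨fun n => (quasiIsoAt_iff_locally f (n - 1) n (n + 1) ?_ (by simp)).2 ⟨h1 n, h2 n⟩⟩
  rcases n with _ | n
  · simp
  · simp

lemma logDeRhamInclusion_comp (hE : ∀ T ∈ S, E T ≤ E' T) (hE' : ∀ T ∈ S, E' T ≤ E'' T) :
    logDeRhamInclusion (S' := S) rfl hE ≫ logDeRhamInclusion (S' := S) rfl hE' =
      logDeRhamInclusion (S' := S) rfl fun T hT => (hE T hT).trans (hE' T hT) := by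
  ext n : 1
  exact secMap_ext fun V s => rfl

/-- Enlarging the twist is a quasi-isomorphism as long as no coefficient passes through a value
for which the residue of the differential vanishes. -/
theorem quasiIso_logDeRhamInclusion (hsnc : IsSNC S) (hE : ∀ T ∈ S, E T ≤ E' T)
    (h0 : ∀ T ∈ S, E' T < 0 ∨ 0 ≤ E T) : QuasiIso (logDeRhamInclusion (S' := S) rfl hE) := by
  classical
  -- induction on the total difference of the twists, raising one coefficient by one at a time
  obtain ⟨N, hN⟩ : ∃ N : ℕ, ∑ T ∈ S, (E' T - E T).toNat = N := ⟨_, rfl⟩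
  induction N generalizing E with
  | zero =>
    have heq : ∀ T ∈ S, E' T ≤ E T := by
      intro T hT
      have := Finset.sum_eq_zero_iff.1 hN T hT
      omega
    have h1 : logDeRhamInclusion (S' := S) rfl hE ≫ logDeRhamInclusion (S' := S) rfl heq = 𝟙 _ := by
      ext n : 1
      exact secMap_ext fun V s => rfl
    have h2 : logDeRhamInclusion (S' := S) rfl heq ≫ logDeRhamInclusion (S' := S) rfl hE = 𝟙 _ := by
      ext n : 1
      exact secMap_ext fun V s => rfl
    have : IsIso (logDeRhamInclusion (S' := S) rfl hE) := ⟨_, h1, h2⟩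
    infer_instance
  | succ N ih =>
    obtain ⟨T, hT, hne⟩ : ∃ T ∈ S, (E' T - E T).toNat ≠ 0 := by
      by_contra! h
      rw [Finset.sum_eq_zero h] at hN
      omega
    have hlt : E T + 1 ≤ E' T := by omega
    have hE1 : ∀ T' ∈ S, E T' ≤ Function.update E T (E T + 1) T' := by
      intro T' _
      by_cases h : T' = T
      · subst h
        simp
      · simp [h]
    have hE2 : ∀ T' ∈ S, Function.update E T (E T + 1) T' ≤ E' T' := by
      intro T' hT'
      by_cases h : T' = T
      · subst h
        simpa using hlt
      · simpa [h] using hE T' hT'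
    have hT0 : E T + 1 ≠ 0 := by
      rcases h0 T hT with h | h <;> omega
    have q1 : QuasiIso (logDeRhamInclusion (S' := S) rfl hE1) :=
      quasiIso_of_locally _ (fun n => locInj_update hsnc hE1 n)
        (fun n => locSurj_update hsnc hE1 hT0 n)
    have q2 : QuasiIso (logDeRhamInclusion (S' := S) rfl hE2) := by
      refine ih hE2 (fun T' hT' => ?_) ?_
      · by_cases h : T' = T
        · subst h
          rcases h0 T' hT with h | h
          · exact Or.inl h
          · right
            simp only [Function.update_self]
            omega
        · simpa [h] using h0 T' hT'
      · rw [← Finset.add_sum_erase S _ hT] at hN ⊢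
        have e : ∑ T' ∈ S.erase T, (E' T' - Function.update E T (E T + 1) T').toNat =
            ∑ T' ∈ S.erase T, (E' T' - E T').toNat :=
          Finset.sum_congr rfl fun T' hT' => by
            rw [Function.update_of_ne (Finset.ne_of_mem_erase hT')]
        rw [e, Function.update_self]
        omega
    rw [← logDeRhamInclusion_comp hE1 hE2]
    infer_instance

end TwistChange

/-! ### The complexes attached to a pair of divisors -/

section Omega

variable {d : ℕ} {X : Type} [TopologicalSpace X] [ChartedSpace (Fin d → ℂ) X]

namespace EffectiveDivisor

variable {Y Z Y' Z' : EffectiveDivisor d X}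

lemma mem_support_iff_of_eq_or_red (h : Y' = Y ∨ Y' = Y.red) (T : PrimeDivisor d X) :
    Y' T = 0 ↔ Y T = 0 := by
  rcases h with rfl | rfl
  · rfl
  · rw [red_apply]
    omega

lemma eq_zero_or_eq_zero (hdisj : Disjoint Y.supp Z.supp) (T : PrimeDivisor d X) :
    Y T = 0 ∨ Z T = 0 := by
  by_contra! h
  obtain ⟨x, hx⟩ := T.nonempty
  exact Set.disjoint_left.1 hdisj
    (Set.mem_biUnion (t := fun T : PrimeDivisor d X => T.carrier) (Finsupp.mem_support_iff.2 h.1) hx)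
    (Set.mem_biUnion (t := fun T : PrimeDivisor d X => T.carrier) (Finsupp.mem_support_iff.2 h.2) hx)

lemma support_add_eq' (hY' : Y' = Y ∨ Y' = Y.red) (hZ' : Z' = Z ∨ Z' = Z.red) :
    (Y' + Z').support = (Y + Z).support :=
  support_add_eq hY' hZ' (Or.inl rfl) (Or.inl rfl)

end EffectiveDivisor

variable [IsManifold 𝓘(ℂ, Fin d → ℂ) ω X]

/-- The version for supports that are equal, but not definitionally. -/
lemma quasiIso_logDeRhamInclusion' {S S' : Finset (PrimeDivisor d X)}
    {E E' : PrimeDivisor d X → ℤ} (hS : S = S') (hsnc : IsSNC S) (hE : ∀ T ∈ S, E T ≤ E' T)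
    (h0 : ∀ T ∈ S, E' T < 0 ∨ 0 ≤ E T) : QuasiIso (logDeRhamInclusion hS hE) := by
  subst hS
  exact quasiIso_logDeRhamInclusion hsnc hE h0

/-- Along a component of `Y` both twists are negative, and along a component of `Z` both are
nonnegative. -/
theorem quasiIso_omegaInclusion {Y Z Y₁ Z₁ Y₂ Z₂ : EffectiveDivisor d X}
    (hdisj : Disjoint Y.supp Z.supp) (hsnc : IsSNC (Y + Z).support)
    (hY₁ : Y₁ = Y ∨ Y₁ = Y.red) (hZ₁ : Z₁ = Z ∨ Z₁ = Z.red)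
    (hY₂ : Y₂ = Y ∨ Y₂ = Y.red) (hZ₂ : Z₂ = Z ∨ Z₂ = Z.red)
    (hS : (Y₁ + Z₁).support = (Y₂ + Z₂).support) (hY : Y₂ ≤ Y₁) (hZ : Z₁ ≤ Z₂) :
    QuasiIso (omegaInclusion hS hY hZ) := by
  have hS₁ := EffectiveDivisor.support_add_eq' hY₁ hZ₁
  refine quasiIso_logDeRhamInclusion' hS (hS₁ ▸ hsnc) _ fun T hT => ?_
  rw [hS₁, Finsupp.mem_support_iff, Finsupp.add_apply] at hT
  have e₁ := EffectiveDivisor.mem_support_iff_of_eq_or_red hY₁ T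
  have e₂ := EffectiveDivisor.mem_support_iff_of_eq_or_red hY₂ T
  have e₃ := EffectiveDivisor.mem_support_iff_of_eq_or_red hZ₁ T
  have e₄ := EffectiveDivisor.mem_support_iff_of_eq_or_red hZ₂ T
  have e₅ := EffectiveDivisor.eq_zero_or_eq_zero hdisj T
  simp only [twist, EffectiveDivisor.red_apply]
  omega

lemma augmentation_f_zero {Y Z : EffectiveDivisor d X} {A : Set X} (hA : Y.supp = A) :
    (augmentation Y Z hA).f 0 =
      (zeroFormOperator (subset_of_twist_neg (Z := Z) hA)).sheafHom :=
  CochainComplex.fromSingle₀Equiv_symm_apply_f_zero _ _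

lemma formOf_augmentation {Y Z : EffectiveDivisor d X} {A : Set X} (hA : Y.supp = A)
    {V : Opens X} (s : Sec (constVanishing X A).sheaf V) :
    formOf (secMap ((augmentation Y Z hA).f 0) V s) =
      fun x => cutOff V (toZeroForm (unionOf (Y + Z).support)
        (show (constVanishing X A).sections V from s).1) x :=
  congrArg (fun f => formOf (secMap f V s)) (augmentation_f_zero hA)

end Omega

/-! ### Classes of constant forms -/

section Wedge

open ContinuousAlternatingMap hiding map_zero

variable {d p : ℕ}

/-- The exterior product of the `j`-th coordinate form with a form. -/
def wedge (j : Fin d) : Alt d p →ₗ[ℂ] Alt d (p + 1) where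
  toFun a := alternatizeUncurryFin
    ((ContinuousLinearMap.proj (R := ℂ) (φ := fun _ : Fin d => ℂ) j).smulRight a)
  map_add' a b := by
    have h : (ContinuousLinearMap.proj (R := ℂ) (φ := fun _ : Fin d => ℂ) j).smulRight (a + b) =
        (ContinuousLinearMap.proj (R := ℂ) (φ := fun _ : Fin d => ℂ) j).smulRight a +
        (ContinuousLinearMap.proj (R := ℂ) (φ := fun _ : Fin d => ℂ) j).smulRight b :=
      ContinuousLinearMap.ext fun v => smul_add (v j) a b
    rw [h]
    exact map_add (alternatizeUncurryFinCLM ℂ (Fin d → ℂ) ℂ (n := p)) _ _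
  map_smul' t a := by
    have h : (ContinuousLinearMap.proj (R := ℂ) (φ := fun _ : Fin d => ℂ) j).smulRight (t • a) =
        t • (ContinuousLinearMap.proj (R := ℂ) (φ := fun _ : Fin d => ℂ) j).smulRight a :=
      ContinuousLinearMap.ext fun v => smul_comm (v j) t a
    rw [h]
    exact map_smul (alternatizeUncurryFinCLM ℂ (Fin d → ℂ) ℂ (n := p)) _ _

lemma wedge_apply (j : Fin d) (a : Alt d p) : wedge j a = alternatizeUncurryFin
    ((ContinuousLinearMap.proj (R := ℂ) (φ := fun _ : Fin d => ℂ) j).smulRight a) := rfl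

lemma contr_wedge_zero (j k : Fin d) (a : Alt d 0) :
    contr (Pi.single k 1) (wedge j a) = (Pi.single k 1 : Fin d → ℂ) j • a := by
  rw [wedge_apply, contr_alternatize_zero]
  rfl

lemma alt_sub_smul (s t : ℂ) (a : Alt d p) : (s - t) • a = s • a - t • a :=
  ContinuousAlternatingMap.ext fun v => sub_mul s t (a v)

lemma contr_wedge (j k : Fin d) (a : Alt d (p + 1)) :
    contr (Pi.single k 1) (wedge j a) =
      (Pi.single k 1 : Fin d → ℂ) j • a - wedge j (contr (Pi.single k 1) a) := by
  rw [wedge_apply, contr_alternatize, wedge_apply]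
  congr 2

/-- The constant forms in the coordinates with indices in `P`: those killed by contraction with the
other coordinate vectors. -/
def altOf (P : Finset (Fin d)) : ∀ p, Submodule ℂ (Alt d p)
  | 0 => ⊤
  | p + 1 => ⨅ k : {k // k ∉ P}, LinearMap.ker
      (contr (p := p) (Pi.single (k : Fin d) 1)).toLinearMap

lemma mem_altOf_succ {P : Finset (Fin d)} {a : Alt d (p + 1)} :
    a ∈ altOf P (p + 1) ↔ ∀ k ∉ P, contr (Pi.single k 1) a = 0 := by
  simp only [altOf, Submodule.mem_iInf, Subtype.forall]
  rfl

lemma mem_altOf_zero {P : Finset (Fin d)} (a : Alt d 0) : a ∈ altOf P 0 := Submodule.mem_top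

lemma contr_mem_altOf {P : Finset (Fin d)} {a : Alt d (p + 1)} (ha : a ∈ altOf P (p + 1))
    (r : Fin d → ℂ) : contr r a ∈ altOf P p := by
  rcases p with _ | p
  · exact mem_altOf_zero _
  · rw [mem_altOf_succ] at ha ⊢
    intro k hk
    rw [contr_contr_comm, ha k hk, map_zero, neg_zero]

lemma altOf_mono {P Q : Finset (Fin d)} (h : P ⊆ Q) : altOf P p ≤ altOf Q p := by
  rcases p with _ | p
  · exact le_rfl
  · exact fun a ha => mem_altOf_succ.2 fun k hk => mem_altOf_succ.1 ha k fun hk' => hk (h hk')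

lemma wedge_mem_altOf {P : Finset (Fin d)} {j : Fin d} {a : Alt d p} (ha : a ∈ altOf P p) :
    wedge j a ∈ altOf (insert j P) (p + 1) := by
  rw [mem_altOf_succ]
  intro k hk
  rw [Finset.mem_insert, not_or] at hk
  have h0 : (Pi.single k 1 : Fin d → ℂ) j = 0 := Pi.single_eq_of_ne (Ne.symm hk.1) _
  rcases p with _ | p
  · rw [contr_wedge_zero, h0, alt_zero_smul]
  · rw [contr_wedge, h0, alt_zero_smul, mem_altOf_succ.1 ha k hk.2, map_zero, sub_zero]

/-- The decomposition `a = a₀ + dz_j ∧ ι_j a` with `a₀` free of `dz_j`. -/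
lemma sub_wedge_contr_mem_altOf {P : Finset (Fin d)} {j : Fin d} {a : Alt d (p + 1)}
    (ha : a ∈ altOf (insert j P) (p + 1)) :
    a - wedge j (contr (Pi.single j 1) a) ∈ altOf P (p + 1) := by
  have h1 : contr (Pi.single j 1) (wedge j (contr (Pi.single j 1) a)) =
      contr (Pi.single j 1) a := by
    rcases p with _ | p
    · rw [contr_wedge_zero, Pi.single_eq_same, one_smul]
    · rw [contr_wedge, Pi.single_eq_same, one_smul, contr_contr, map_zero, sub_zero]
  rw [mem_altOf_succ]
  intro k hk
  by_cases hkj : k = j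
  · subst hkj
    rw [map_sub, h1, sub_self]
  · have h2 := mem_altOf_succ.1 ha k (by simp [hk, hkj])
    have h3 := mem_altOf_succ.1 (wedge_mem_altOf (j := j)
      (contr_mem_altOf ha (Pi.single j 1))) k (by simp [hk, hkj])
    rw [map_sub, h2, h3, sub_zero]

lemma contr_mem_altOf_erase {P : Finset (Fin d)} {j : Fin d} {a : Alt d (p + 1)}
    (ha : a ∈ altOf (insert j P) (p + 1)) : contr (Pi.single j 1) a ∈ altOf P p := by
  rcases p with _ | p
  · exact mem_altOf_zero _
  · rw [mem_altOf_succ] at ha ⊢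
    intro k hk
    by_cases hkj : k = j
    · subst hkj
      exact contr_contr _ _
    · rw [contr_contr_comm, ha k (by simp [hk, hkj]), map_zero, neg_zero]

lemma eq_zero_of_mem_altOf_empty {a : Alt d (p + 1)} (ha : a ∈ altOf ∅ (p + 1)) : a = 0 := by
  refine alt_ext fun I => ?_
  have h := congrArg (fun b => b fun i => basisVec I i.succ)
    (mem_altOf_succ.1 ha (I 0) (Finset.notMem_empty _))
  refine Eq.trans ?_ h
  rw [contr_apply]
  congr 1
  funext i
  refine Fin.cases ?_ (fun i => ?_) i <;> rfl

end Wedge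

namespace SecCx

variable {d : ℕ} {E : Type} [TopologicalSpace E] {G : SecCx E}

/-- A section of positive degree is exact; a section of degree zero vanishes. -/
def Exact : ∀ (p : ℕ) {A : Opens E}, G.S p A → Prop
  | 0, _, α => α = 0
  | p + 1, _, α => ∃ β, G.D p β = α

lemma exact_D {p : ℕ} {A : Opens E} (β : G.S p A) : Exact (p + 1) (G.D p β) := ⟨β, rfl⟩

lemma Exact.sub {p : ℕ} {A : Opens E} {α α' : G.S p A} (h : Exact p α) (h' : Exact p α') :
    Exact p (α - α') := by
  rcases p with _ | p
  · exact (congrArg₂ (· - ·) h h').trans (sub_zero 0)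
  · obtain ⟨β, hβ⟩ := h
    obtain ⟨β', hβ'⟩ := h'
    exact ⟨β - β', by rw [map_sub, hβ, hβ']⟩

lemma Exact.res {p : ℕ} {A B : Opens E} {α : G.S p A} (hα : Exact p α) (h : B ≤ A) :
    Exact p (G.res _ h α) := by
  rcases p with _ | p
  · exact (congrArg (G.res _ h) hα).trans (map_zero _)
  · obtain ⟨β, hβ⟩ := hα
    exact ⟨G.res _ h β, by rw [D_res, hβ]⟩

lemma Exact.closed {p : ℕ} {A : Opens E} {α : G.S p A} (hα : Exact p α) : G.D p α = 0 := by
  rcases p with _ | p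
  · exact (congrArg (G.D 0) hα).trans (map_zero _)
  · obtain ⟨β, rfl⟩ := hα
    exact G.d_d β

/-- Primitives on two open sets whose difference is exact on the intersection glue after a
correction. -/
lemma exact_sup {p : ℕ} {A B : Opens E} {α : G.S (p + 1 : ℕ) (A ⊔ B)} (β : G.S p A) (β' : G.S p B)
    (hβ : G.D p β = G.res _ le_sup_left α) (hβ' : G.D p β' = G.res _ le_sup_right α)
    (h : Exact p (G.res _ (inf_le_left : A ⊓ B ≤ A) β - G.res _ inf_le_right β')) :
    Exact (p + 1) α := by
  obtain ⟨β₁, h1, h2⟩ : ∃ β₁ : G.S p A, G.D p β₁ = G.res _ le_sup_left α ∧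
      G.res _ (inf_le_left : A ⊓ B ≤ A) β₁ = G.res _ inf_le_right β' := by
    rcases p with _ | p
    · exact ⟨β, hβ, sub_eq_zero.1 h⟩
    · obtain ⟨δ, hδ⟩ := h
      obtain ⟨δ', rfl⟩ := G.flasque (inf_le_left : A ⊓ B ≤ A) δ
      refine ⟨β - G.D p δ', by rw [map_sub, hβ, (exact_D δ').closed, sub_zero], ?_⟩
      rw [map_sub, ← D_res, hδ, sub_sub_cancel]
  obtain ⟨t, ht, ht'⟩ := G.exists_glue_two β₁ β' h2
  exact ⟨t, G.ext_two (by rw [← D_res, ht, h1]) (by rw [← D_res, ht', hβ'])⟩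

lemma eq_zero_sup {A B : Opens E} {n : ℤ} {α : G.S n (A ⊔ B)}
    (h : G.res _ (le_sup_left : A ≤ A ⊔ B) α = 0) (h' : G.res _ (le_sup_right : B ≤ A ⊔ B) α = 0) :
    α = 0 :=
  G.ext_two (h.trans (map_zero _).symm) (h'.trans (map_zero _).symm)

/-- Exactness on the union of two disjoint open sets. -/
lemma exact_of_disjoint {p : ℕ} {A B C : Opens E} (hA : A ≤ C) (hB : B ≤ C) (hC : C ≤ A ⊔ B)
    (hAB : A ⊓ B ≤ ⊥) {α : G.S p C} (h : Exact p (G.res _ hA α)) (h' : Exact p (G.res _ hB α)) :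
    Exact p α := by
  obtain rfl : C = A ⊔ B := le_antisymm hC (sup_le hA hB)
  rcases p with _ | p
  · exact eq_zero_sup h h'
  · obtain ⟨β, hβ⟩ := h
    obtain ⟨β', hβ'⟩ := h'
    refine exact_sup β β' hβ hβ' ?_
    have h0 : G.res _ (inf_le_left : A ⊓ B ≤ A) β - G.res _ inf_le_right β' = 0 :=
      G.ext_bot (le_bot_iff.1 hAB) _ _
    rw [h0]
    rcases p with _ | p
    · rfl
    · exact ⟨0, map_zero _⟩

variable (G d) in
/-- Closed sections attached to constant forms, compatible with restriction. -/
structure ConstClasses where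
  cl : ∀ (p : ℕ) (A : Opens E), Alt d p →ₗ[ℂ] G.S p A
  res_cl : ∀ {p : ℕ} {A B : Opens E} (h : B ≤ A) (a : Alt d p), G.res _ h (cl p A a) = cl p B a
  d_cl : ∀ {p : ℕ} {A : Opens E} (a : Alt d p), G.D p (cl p A a) = 0

namespace ConstClasses

variable (c : ConstClasses d G)

/-- The cohomology of `A` is given by the constant forms in the coordinates with indices in `P`. -/
structure Represents (P : Finset (Fin d)) (A : Opens E) : Prop where
  inj : ∀ (p : ℕ) (a : Alt d p), a ∈ altOf P p → Exact p (c.cl p A a) → a = 0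
  surj : ∀ (p : ℕ) (α : G.S p A), G.D p α = 0 → ∃ a ∈ altOf P p, Exact p (α - c.cl p A a)

/-- Multiplication of constant forms by a logarithm of the `j`-th coordinate on `A`. -/
structure LogMul (j : Fin d) (A : Opens E) where
  mul : ∀ p : ℕ, Alt d p →ₗ[ℂ] G.S p A
  d_mul : ∀ {p : ℕ} (a : Alt d p), G.D p (mul p a) = c.cl (p + 1) A (wedge j a)

variable {c} {P : Finset (Fin d)} {A B C C' : Opens E}

lemma Represents.eq_of_exact (hA : c.Represents P A) {p : ℕ} {a b : Alt d p} (ha : a ∈ altOf P p)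
    (hb : b ∈ altOf P p) (h : Exact p (c.cl p A a - c.cl p A b)) : a = b :=
  sub_eq_zero.1 (hA.inj p _ (sub_mem ha hb) (by rwa [map_sub]))

lemma exact_cl_of_le {p : ℕ} {a : Alt d p} (h : B ≤ A) (ha : Exact p (c.cl p A a)) :
    Exact p (c.cl p B a) := by
  rw [← c.res_cl h]
  exact ha.res h

/-- If the restrictions of a closed section to `A` and `B` are represented by constant forms, then
these agree if `A` and `B` meet in a set on which constant forms are determined by their class. -/
lemma eq_of_represent {p : ℕ} {U : Opens E} {α : G.S p U} (hA : A ≤ U) (hB : B ≤ U) (hCA : C ≤ A)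
    (hCB : C ≤ B) (hC : c.Represents P C) {a b : Alt d p} (ha : a ∈ altOf P p)
    (hb : b ∈ altOf P p) (h : Exact p (G.res _ hA α - c.cl p A a))
    (h' : Exact p (G.res _ hB α - c.cl p B b)) : a = b := by
  refine hC.eq_of_exact ha hb ?_
  have := (h'.res hCB).sub (h.res hCA)
  rw [map_sub, map_sub, G.res_res, G.res_res, c.res_cl, c.res_cl] at this
  convert this using 1
  abel

/-- The case of a contractible overlap. -/
lemma Represents.sup (hA : c.Represents P A) (hB : c.Represents P B)
    (hAB : c.Represents P (A ⊓ B)) : c.Represents P (A ⊔ B) := by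
  refine ⟨fun p a ha h => hA.inj p a ha (exact_cl_of_le le_sup_left h), fun p α hα => ?_⟩
  obtain ⟨a, ha, h1⟩ := hA.surj p (G.res _ le_sup_left α) (by rw [D_res, hα, map_zero])
  obtain ⟨b, hb, h2⟩ := hB.surj p (G.res _ le_sup_right α) (by rw [D_res, hα, map_zero])
  obtain rfl := eq_of_represent le_sup_left le_sup_right inf_le_left inf_le_right hAB ha hb h1 h2
  refine ⟨a, ha, ?_⟩
  rcases p with _ | p
  · exact eq_zero_sup (by rw [map_sub, c.res_cl]; exact h1) (by rw [map_sub, c.res_cl]; exact h2)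
  obtain ⟨β, hβ⟩ := h1
  obtain ⟨β', hβ'⟩ := h2
  -- the difference of the primitives is constant up to an exact form, and the constant extends to
  -- `A`
  obtain ⟨b, hb, h3⟩ := hAB.surj p (G.res _ inf_le_left β - G.res _ inf_le_right β') (by
    rw [map_sub, D_res, D_res, hβ, hβ', map_sub, map_sub, G.res_res, G.res_res, c.res_cl,
      c.res_cl, sub_self])
  refine exact_sup (β - c.cl p A b) β' (by rw [map_sub, hβ, c.d_cl, sub_zero, map_sub, c.res_cl])
    (by rw [hβ', map_sub, c.res_cl]) ?_
  rw [map_sub, c.res_cl]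
  convert h3 using 1
  abel

/-- The case of an overlap with two contractible components on which two logarithms differ by
different constants. -/
lemma Represents.sup_insert (hA : c.Represents P A) (hB : c.Represents P B)
    (hC : c.Represents P C) (hC' : c.Represents P C') (hCA : C ≤ A ⊓ B) (hCA' : C' ≤ A ⊓ B)
    (hAB : A ⊓ B ≤ C ⊔ C') (hCC' : C ⊓ C' ≤ ⊥) {j : Fin d}
    (l : c.LogMul j A) (l' : c.LogMul j B) {t t' : ℂ} (htt' : t ≠ t')
    (ht : ∀ p (a : Alt d p), G.res _ (hCA.trans inf_le_left) (l.mul p a) -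
      G.res _ (hCA.trans inf_le_right) (l'.mul p a) = t • c.cl p C a)
    (ht' : ∀ p (a : Alt d p), G.res _ (hCA'.trans inf_le_left) (l.mul p a) -
      G.res _ (hCA'.trans inf_le_right) (l'.mul p a) = t' • c.cl p C' a) :
    c.Represents (insert j P) (A ⊔ B) := by
  have hsub : t - t' ≠ 0 := sub_ne_zero.2 htt'
  refine ⟨fun p a ha h => ?_, fun p α hα => ?_⟩
  · -- injectivity: write `a = a₀ + dz_j ∧ b`; as the second term is exact on `A`, `a₀ = 0`, and
    -- comparing a primitive of `dz_j ∧ b` with `log z_j • b` on both components of the overlap gives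
    -- `t • b = t' • b`
    rcases p with _ | p
    · exact hA.inj 0 a (mem_altOf_zero a) (exact_cl_of_le le_sup_left h)
    set b := contr (Pi.single j 1) a with hb
    have hbP : b ∈ altOf P p := contr_mem_altOf_erase ha
    have h0 : a - wedge j b = 0 := by
      refine hA.inj _ _ (sub_wedge_contr_mem_altOf ha) ?_
      rw [map_sub, ← l.d_mul]
      exact (exact_cl_of_le le_sup_left h).sub (exact_D _)
    obtain ⟨β, hβ⟩ := h
    have hab : wedge j b = a := (sub_eq_zero.1 h0).symm
    obtain ⟨s, hs, h1⟩ := hA.surj p (G.res _ le_sup_left β - l.mul p b) (by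
      rw [map_sub, D_res, hβ, c.res_cl, l.d_mul, hab, sub_self])
    obtain ⟨s', hs', h2⟩ := hB.surj p (G.res _ le_sup_right β - l'.mul p b) (by
      rw [map_sub, D_res, hβ, c.res_cl, l'.d_mul, hab, sub_self])
    have key : ∀ {D : Opens E} (hD : D ≤ A ⊓ B) (_ : c.Represents P D) (r : ℂ)
        (_ : G.res _ (hD.trans inf_le_left) (l.mul p b) -
          G.res _ (hD.trans inf_le_right) (l'.mul p b) = r • c.cl p D b), r • b = s' - s := by
      intro D hD hDP r hr
      refine hDP.eq_of_exact (Submodule.smul_mem _ _ hbP) (sub_mem hs' hs) ?_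
      have := (h2.res (hD.trans inf_le_right)).sub (h1.res (hD.trans inf_le_left))
      simp only [map_sub, G.res_res, c.res_cl] at this ⊢
      rw [map_smul, ← hr]
      convert this using 1
      abel
    have h3 := (key hCA hC t (ht p b)).trans (key hCA' hC' t' (ht' p b)).symm
    have h4 : (t - t') • b = 0 := by rw [alt_sub_smul, h3, sub_self]
    rw [← hab, eq_zero_of_alt_smul h4 hsub, map_zero]
  · -- surjectivity: the difference of the primitives on `A` and `B` is given by constants `s` and
    -- `s'` on the two components of the overlap; multiples of the logarithms and constants realise
    -- any such pair
    obtain ⟨a, ha, h1⟩ := hA.surj p (G.res _ le_sup_left α) (by rw [D_res, hα, map_zero])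
    obtain ⟨b, hb, h2⟩ := hB.surj p (G.res _ le_sup_right α) (by rw [D_res, hα, map_zero])
    obtain rfl := eq_of_represent le_sup_left le_sup_right (hCA.trans inf_le_left)
      (hCA.trans inf_le_right) hC ha hb h1 h2
    have haP := altOf_mono (Finset.subset_insert j P) ha
    rcases p with _ | p
    · exact ⟨a, haP, eq_zero_sup (by rw [map_sub, c.res_cl]; exact h1)
        (by rw [map_sub, c.res_cl]; exact h2)⟩
    obtain ⟨β, hβ⟩ := h1
    obtain ⟨β', hβ'⟩ := h2
    set γ : G.S p (A ⊓ B) := G.res _ inf_le_left β - G.res _ inf_le_right β' with hγ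
    have hγ0 : G.D p γ = 0 := by
      rw [map_sub, D_res, D_res, hβ, hβ', map_sub, map_sub, G.res_res, G.res_res, c.res_cl,
        c.res_cl, sub_self]
    obtain ⟨s, hs, h3⟩ := hC.surj p (G.res _ hCA γ) (by rw [D_res, hγ0, map_zero])
    obtain ⟨s', hs', h4⟩ := hC'.surj p (G.res _ hCA' γ) (by rw [D_res, hγ0, map_zero])
    -- solve `t • e + e' = s`, `t' • e + e' = s'`
    obtain ⟨e, e', he, he₁, he₂⟩ : ∃ e e' : Alt d p, e ∈ altOf P p ∧ t • e + e' = s ∧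
        t' • e + e' = s' := by
      refine ⟨(t - t')⁻¹ • (s - s'), s - t • ((t - t')⁻¹ • (s - s')),
        Submodule.smul_mem _ _ (sub_mem hs hs'), add_sub_cancel _ _, ?_⟩
      have : (t - t') • ((t - t')⁻¹ • (s - s')) = s - s' := by
        rw [smul_smul, mul_inv_cancel₀ hsub, one_smul]
      rw [alt_sub_smul] at this
      calc _ = s - (t • (t - t')⁻¹ • (s - s') - t' • (t - t')⁻¹ • (s - s')) := by abel
        _ = s' := by rw [this, sub_sub_cancel]
    refine ⟨a + wedge j e, add_mem haP (wedge_mem_altOf he), ?_⟩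
    refine exact_sup (β - l.mul p e - c.cl p A e') (β' - l'.mul p e)
      (by rw [map_sub, map_sub, hβ, c.d_cl, l.d_mul, map_sub, c.res_cl, map_add]; abel)
      (by rw [map_sub, hβ', l'.d_mul, map_sub, c.res_cl, map_add]; abel) ?_
    refine exact_of_disjoint hCA hCA' hAB hCC' ?_ ?_
    · rw [← he₁] at h3
      convert h3 using 1
      simp only [hγ, map_sub, map_add, map_smul, G.res_res, c.res_cl, ← ht p e]
      abel
    · rw [← he₂] at h4
      convert h4 using 1
      simp only [hγ, map_sub, map_add, map_smul, G.res_res, c.res_cl, ← ht' p e]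
      abel

end ConstClasses

end SecCx

/-! ### The cohomology of punctured boxes -/

section Boxes

variable {d : ℕ}

/-- The real coordinates of `ℂ^d`: the real part of `z_k` has the index `(k, true)`, the imaginary part
the index `(k, false)`. -/
def realCoords (d : ℕ) : (Fin d → ℂ) ≃ₜ (Fin d × Bool → ℝ) where
  toFun z i := if i.2 then (z i.1).re else (z i.1).im
  invFun w k := ⟨w (k, true), w (k, false)⟩
  left_inv z := rfl
  right_inv w := by
    funext ⟨k, b⟩
    cases b <;> rfl
  continuous_toFun := by
    refine continuous_pi fun ⟨k, b⟩ => ?_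
    cases b
    · exact Complex.continuous_im.comp (continuous_apply k)
    · exact Complex.continuous_re.comp (continuous_apply k)
  continuous_invFun := by
    refine continuous_pi fun k => ?_
    simp only [Complex.mk_eq_add_mul_I]
    fun_prop

lemma realCoords_true (z : Fin d → ℂ) (k : Fin d) : realCoords d z (k, true) = (z k).re := rfl

lemma realCoords_false (z : Fin d → ℂ) (k : Fin d) : realCoords d z (k, false) = (z k).im := rfl

lemma isPreconnected_openBox {ι E : Type} [Fintype ι] [TopologicalSpace E] (u : E ≃ₜ (ι → ℝ))
    (a b : ι → ℝ) : IsPreconnected (openBox u a b : Set E) := by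
  have h : (openBox u a b : Set E) = u.symm '' Set.univ.pi fun i => Set.Ioo (a i) (b i) := by
    rw [u.symm.image_eq_preimage_symm]
    ext x
    simp [mem_openBox]
  rw [h]
  exact (isPreconnected_univ_pi fun i => isPreconnected_Ioo).image _ u.symm.continuous.continuousOn

/-- The points with nonzero coordinates for the indices in `P`. -/
def offHyperplanes (P : Finset (Fin d)) : Opens (Fin d → ℂ) where
  carrier := {z | ∀ k ∈ P, z k ≠ 0}
  is_open' := by
    have : {z : Fin d → ℂ | ∀ k ∈ P, z k ≠ 0} = ⋂ k ∈ P, {z | z k ≠ 0} := by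
      ext z
      simp
    rw [this]
    exact isOpen_biInter_finset fun k _ => isOpen_ne_fun (continuous_apply k) continuous_const

lemma mem_offHyperplanes {P : Finset (Fin d)} {z : Fin d → ℂ} :
    z ∈ offHyperplanes P ↔ ∀ k ∈ P, z k ≠ 0 := Iff.rfl

/-- A box punctured along coordinate hyperplanes. -/
def puncturedBox (P : Finset (Fin d)) (a b : Fin d × Bool → ℝ) : Opens (Fin d → ℂ) :=
  openBox (realCoords d) a b ⊓ offHyperplanes P

lemma puncturedBox_inf (P : Finset (Fin d)) (a b a' b' : Fin d × Bool → ℝ) :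
    puncturedBox P a b ⊓ puncturedBox P a' b' = puncturedBox P (a ⊔ a') (b ⊓ b') := by
  ext z
  simp only [puncturedBox, SetLike.mem_coe, Opens.mem_inf, mem_openBox, Pi.sup_apply, Pi.inf_apply,
    sup_lt_iff, lt_inf_iff]
  constructor
  · rintro ⟨⟨h1, h2⟩, h3, -⟩
    exact ⟨fun i => ⟨⟨(h1 i).1, (h3 i).1⟩, (h1 i).2, (h3 i).2⟩, h2⟩
  · rintro ⟨h1, h2⟩
    exact ⟨⟨fun i => ⟨(h1 i).1.1, (h1 i).2.1⟩, h2⟩, fun i => ⟨(h1 i).1.2, (h1 i).2.2⟩, h2⟩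

/-- The analytic functions on `A` with values in the alternating forms. -/
def analyticForms (d p : ℕ) (A : Opens (Fin d → ℂ)) : Submodule ℂ ((Fin d → ℂ) → Alt d p) where
  carrier := {f | AnalyticOnNhd ℂ f A}
  zero_mem' := fun _ _ => analyticAt_const
  add_mem' := fun hf hg z hz => (hf z hz).add (hg z hz)
  smul_mem' := fun _ _ hf z hz => (hf z hz).const_smul

lemma analyticForms_mono {p : ℕ} {A B : Opens (Fin d → ℂ)} (h : B ≤ A) :
    analyticForms d p A ≤ analyticForms d p B := fun _ hf z hz => hf z (h hz)

/-- The constant functions as analytic functions. -/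
def constForm (d p : ℕ) (A : Opens (Fin d → ℂ)) : Alt d p →ₗ[ℂ] analyticForms d p A where
  toFun a := ⟨fun _ => a, fun _ _ => analyticAt_const⟩
  map_add' _ _ := rfl
  map_smul' _ _ := rfl

/-- The constant forms multiplied by the logarithm of `s • z_j`. -/
def logForm (d p : ℕ) (j : Fin d) (s : ℂ) (A : Opens (Fin d → ℂ))
    (hA : ∀ z ∈ A, s * z j ∈ Complex.slitPlane) : Alt d p →ₗ[ℂ] analyticForms d p A where
  toFun a := ⟨fun z => Complex.log (s * z j) • a, fun z hz =>
    AnalyticAt.fun_smul ((analyticAt_const.fun_mul (analyticAt_coord j z)).clog (hA z hz))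
      analyticAt_const⟩
  map_add' a b := Subtype.ext (funext fun z => smul_add (Complex.log (s * z j)) a b)
  map_smul' t a := Subtype.ext (funext fun z => smul_comm (Complex.log (s * z j)) t a)

end Boxes

namespace SecCx

variable {d : ℕ} {G : SecCx (Fin d → ℂ)} {L : Finset (Fin d)}

variable (G L) in
/-- Sections attached to analytic forms written in the logarithmic frame, compatible with
restriction and differentials. -/
structure FormClasses where
  cl : ∀ (p : ℕ) (A : Opens (Fin d → ℂ)), analyticForms d p A →ₗ[ℂ] G.S p A
  res_cl : ∀ {p : ℕ} {A B : Opens (Fin d → ℂ)} (h : B ≤ A) (f : analyticForms d p A)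
    (g : analyticForms d p B), (∀ z ∈ B, f.1 z = g.1 z) → G.res _ h (cl p A f) = cl p B g
  d_cl : ∀ {p : ℕ} {A : Opens (Fin d → ℂ)} (f : analyticForms d p A)
    (g : analyticForms d (p + 1) A), (∀ z ∈ A, dLog L 0 f.1 z = g.1 z) →
    G.D p (cl p A f) = cl (p + 1) A g

namespace FormClasses

variable (c : FormClasses G L)

lemma cl_congr {p : ℕ} {A : Opens (Fin d → ℂ)} {f g : analyticForms d p A}
    (h : ∀ z ∈ A, f.1 z = g.1 z) : c.cl p A f = c.cl p A g := by
  rw [← c.res_cl le_rfl f g h, G.res_self]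

lemma dLog_smul_const {p : ℕ} {l : (Fin d → ℂ) → ℂ} {z : Fin d → ℂ} {l' : (Fin d → ℂ) →L[ℂ] ℂ}
    (hl : HasFDerivAt l l' z) (a : Alt d p) : dLog L 0 (fun w => l w • a) z =
      ContinuousAlternatingMap.alternatizeUncurryFin
        ((l'.comp (diagL (ell L z))).smulRight a) := by
  rw [dLog, (hl.smul_const a).fderiv]
  congr 1
  refine ContinuousLinearMap.ext fun v => ?_
  have h0 : (linForm (0 : Fin d → ℂ)) v = 0 := by simp [linForm_apply]
  rw [_root_.add_apply, ContinuousLinearMap.smulRight_apply, ContinuousLinearMap.smulRight_apply,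
    h0, alt_zero_smul, add_zero]
  rfl

lemma dLog_const {p : ℕ} (a : Alt d p) (z : Fin d → ℂ) : dLog L 0 (fun _ => a) z = 0 := by
  have h := dLog_smul_const (L := L) (hasFDerivAt_const (1 : ℂ) z) a
  have h1 : (fun _ : Fin d → ℂ => (1 : ℂ) • a) = fun _ => a := funext fun _ => one_smul ℂ a
  rw [h1] at h
  rw [h]
  have h2 : (((0 : (Fin d → ℂ) →L[ℂ] ℂ)).comp (diagL (ell L z))).smulRight a = 0 :=
    ContinuousLinearMap.ext fun v => alt_zero_smul a
  rw [h2]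
  exact map_zero (ContinuousAlternatingMap.alternatizeUncurryFinCLM ℂ (Fin d → ℂ) ℂ (n := p))

/-- The classes of the constant forms in the logarithmic frame. -/
def const : ConstClasses d G where
  cl p A := (c.cl p A).comp (constForm d p A)
  res_cl h _ := c.res_cl h _ _ fun _ _ => rfl
  d_cl {p A} a := (c.d_cl (constForm d p A a) 0 fun z _ => dLog_const a z).trans (map_zero _)

lemma const_cl {p : ℕ} {A : Opens (Fin d → ℂ)} (a : Alt d p) :
    c.const.cl p A a = c.cl p A (constForm d p A a) := rfl

/-- Multiplication of constant forms by the logarithm of `s • z_j`. -/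
def logMul {j : Fin d} (hj : j ∈ L) {s : ℂ} (hs : s ≠ 0) {A : Opens (Fin d → ℂ)}
    (hA : ∀ z ∈ A, s * z j ∈ Complex.slitPlane) : c.const.LogMul j A where
  mul p := (c.cl p A).comp (logForm d p j s A hA)
  d_mul {p} a := by
    refine c.d_cl _ _ fun z hz => ?_
    have hz0 : z j ≠ 0 := by
      intro h0
      have := hA z hz
      rw [h0, mul_zero] at this
      exact Complex.zero_notMem_slitPlane this
    have h1 : HasFDerivAt (fun z : Fin d → ℂ => s * z j)
        (s • ContinuousLinearMap.proj (R := ℂ) (φ := fun _ : Fin d => ℂ) j) z :=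
      (ContinuousLinearMap.proj (R := ℂ) (φ := fun _ : Fin d => ℂ) j).hasFDerivAt.const_mul s
    refine (dLog_smul_const (h1.clog (hA z hz)) a).trans ?_
    change _ = wedge j a
    rw [wedge_apply]
    congr 2
    refine ContinuousLinearMap.ext fun v => ?_
    change (s * z j)⁻¹ * (s * (ell L z j * v j)) = v j
    rw [ell, if_pos hj]
    field_simp

lemma logMul_mul {j : Fin d} (hj : j ∈ L) {s : ℂ} (hs : s ≠ 0) {A : Opens (Fin d → ℂ)}
    (hA : ∀ z ∈ A, s * z j ∈ Complex.slitPlane) {p : ℕ} (a : Alt d p) :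
    (c.logMul hj hs hA).mul p a = c.cl p A (logForm d p j s A hA a) := rfl

lemma res_logMul_sub {j : Fin d} (hj : j ∈ L) {s s' : ℂ} (hs : s ≠ 0) (hs' : s' ≠ 0)
    {A B C : Opens (Fin d → ℂ)} (hA : ∀ z ∈ A, s * z j ∈ Complex.slitPlane)
    (hB : ∀ z ∈ B, s' * z j ∈ Complex.slitPlane) (hCA : C ≤ A) (hCB : C ≤ B) {t : ℂ}
    (ht : ∀ z ∈ C, Complex.log (s * z j) - Complex.log (s' * z j) = t) {p : ℕ} (a : Alt d p) :
    G.res _ hCA ((c.logMul hj hs hA).mul p a) - G.res _ hCB ((c.logMul hj hs' hB).mul p a) =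
      t • c.const.cl p C a := by
  rw [logMul_mul, logMul_mul, c.res_cl hCA _ ⟨_, analyticForms_mono hCA (Subtype.property _)⟩
    fun _ _ => rfl, c.res_cl hCB _ ⟨_, analyticForms_mono hCB (Subtype.property _)⟩
    fun _ _ => rfl, const_cl, ← map_sub, ← map_smul]
  refine c.cl_congr fun z hz => ?_
  change Complex.log (s * z j) • a - Complex.log (s' * z j) • a = t • a
  rw [← alt_sub_smul, ht z hz]

/-- The local conditions under which the cohomology of punctured boxes is computed: over `W₀`, closed
sections are locally exact in positive degrees and locally constant in degree zero, and nonzero constants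
have nonzero classes on nonempty sets. In other words, the complex resolves the constant sheaf. -/
structure IsLocalResolution (W₀ : Opens (Fin d → ℂ)) : Prop where
  exact : G.LocallyExact W₀
  const : ∀ (A : Opens (Fin d → ℂ)) (_ : A ≤ W₀) (α : G.S (0 : ℕ) A) (_ : G.D 0 α = 0),
    ∀ x ∈ A, ∃ (W : Opens (Fin d → ℂ)) (h : W ≤ A), x ∈ W ∧ ∃ a, G.res _ h α = c.const.cl 0 W a
  inj : ∀ (A : Opens (Fin d → ℂ)) (_ : A ≤ W₀) (x) (_ : x ∈ A) (a : Alt d 0),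
    c.const.cl 0 A a = 0 → a = 0

variable {c} {W₀ : Opens (Fin d → ℂ)}

lemma IsLocalResolution.exists_eq_const (hc : c.IsLocalResolution W₀) {A : Opens (Fin d → ℂ)}
    (hA : A ≤ W₀) (hA' : IsPreconnected (A : Set (Fin d → ℂ))) (α : G.S (0 : ℕ) A)
    (hα : G.D 0 α = 0) : ∃ a, α = c.const.cl 0 A a := by
  by_cases hne : (A : Set (Fin d → ℂ)).Nonempty
  swap
  · have : A = ⊥ := by
      ext x
      exact ⟨fun hx => hne ⟨x, hx⟩, fun hx => hx.elim⟩
    exact ⟨0, G.ext_bot this _ _⟩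
  obtain ⟨x₀, hx₀⟩ := hne
  choose W hW hx a ha using fun x : A => hc.const A hA α hα x x.2
  have : PreconnectedSpace A := isPreconnected_iff_preconnectedSpace.1 hA'
  have hloc : IsLocallyConstant a := by
    rw [IsLocallyConstant.iff_eventually_eq]
    intro x
    filter_upwards [continuous_subtype_val.continuousAt.eventually ((W x).isOpen.mem_nhds (hx x))]
      with y hy
    have h1 : W x ⊓ W y ≤ W₀ := (inf_le_left.trans (hW x)).trans hA
    refine sub_eq_zero.1 (hc.inj _ h1 y ⟨hy, hx y⟩ _ ?_)
    rw [map_sub, ← c.const.res_cl (inf_le_right : W x ⊓ W y ≤ W y),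
      ← c.const.res_cl (inf_le_left : W x ⊓ W y ≤ W x), ← ha, ← ha, G.res_res, G.res_res, sub_self]
  refine ⟨a ⟨x₀, hx₀⟩, G.ext_local fun x hxA => ⟨_, hW ⟨x, hxA⟩, hx ⟨x, hxA⟩, ?_⟩⟩
  rw [ha, c.const.res_cl, hloc.apply_eq_of_preconnectedSpace ⟨x, hxA⟩ ⟨x₀, hx₀⟩]

lemma IsLocalResolution.represents_openBox (hc : c.IsLocalResolution W₀)
    {ι : Type} [Fintype ι] [DecidableEq ι] (u : (Fin d → ℂ) ≃ₜ (ι → ℝ)) {a b : ι → ℝ}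
    (hab : openBox u a b ≤ W₀) (hlt : ∀ i, a i < b i) :
    c.const.Represents ∅ (openBox u a b) := by
  have hext : G.ExtendsOnBoxes u W₀ := by
    intro a b a' b' h h' α hα
    obtain ⟨t, rfl⟩ := hc.exists_eq_const (h.trans h') (isPreconnected_openBox u a b) α hα
    exact ⟨c.const.cl 0 _ t, c.const.d_cl t, c.const.res_cl h t⟩
  refine ⟨fun p t ht h => ?_, fun p α hα => ?_⟩
  · rcases p with _ | p
    · refine hc.inj _ hab (u.symm fun i => (a i + b i) / 2) ?_ t h
      rw [mem_openBox]
      intro i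
      rw [u.apply_symm_apply]
      have := hlt i
      constructor <;> linarith
    · exact eq_zero_of_mem_altOf_empty ht
  · rcases p with _ | p
    · obtain ⟨t, rfl⟩ := hc.exists_eq_const hab (isPreconnected_openBox u a b) α hα
      exact ⟨t, mem_altOf_zero t, sub_self _⟩
    · refine ⟨0, zero_mem _, ?_⟩
      rw [map_zero, sub_zero]
      exact exact_openBox hc.exact hext p a b hab α hα

lemma mul_mem_slitPlane_of_pos {w : ℂ} (h : 0 < w.re ∨ 0 < w.im) :
    (1 - Complex.I) * w ∈ Complex.slitPlane := by
  rw [Complex.mem_slitPlane_iff]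
  have h1 : ((1 - Complex.I) * w).re = w.re + w.im := by simp
  have h2 : ((1 - Complex.I) * w).im = w.im - w.re := by simp; ring
  rw [h1, h2]
  by_contra! h3
  rcases h with h | h <;> linarith

lemma mul_mem_slitPlane_of_neg {w : ℂ} (h : w.re < 0 ∨ w.im < 0) :
    -(1 - Complex.I) * w ∈ Complex.slitPlane := by
  rw [neg_mul, ← mul_neg]
  exact mul_mem_slitPlane_of_pos (by simpa using h)

lemma log_sub_log_neg_of_im_neg {w : ℂ} (h : w.im < 0) :
    Complex.log w - Complex.log (-w) = -(Real.pi * Complex.I) := by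
  rw [Complex.log, Complex.log, norm_neg, Complex.arg_neg_eq_arg_add_pi_of_im_neg h]
  push_cast
  ring

lemma log_sub_log_neg_of_im_pos {w : ℂ} (h : 0 < w.im) :
    Complex.log w - Complex.log (-w) = Real.pi * Complex.I := by
  rw [Complex.log, Complex.log, norm_neg, Complex.arg_neg_eq_arg_sub_pi_of_im_pos h]
  push_cast
  ring

/-- The box punctured along `z_j = 0` is the union of four boxes, given by the signs of the real and
of the imaginary part of `z_j`; the logarithms on the two halves of the complement differ by
different constants on the two components of their intersection. -/
lemma IsLocalResolution.represents_puncturedBox (hc : c.IsLocalResolution W₀)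
    {P : Finset (Fin d)} (hP : P ⊆ L) {a b : Fin d × Bool → ℝ} (hab : puncturedBox P a b ≤ W₀)
    (hlt : ∀ i, a i < b i) (h0 : ∀ k ∈ P, ∀ e, a (k, e) < 0 ∧ 0 < b (k, e)) :
    c.const.Represents P (puncturedBox P a b) := by
  induction P using Finset.induction_on generalizing a b with
  | empty =>
    have h : puncturedBox ∅ a b = openBox (realCoords d) a b := by
      ext z
      simp [puncturedBox, mem_offHyperplanes]
    rw [h] at hab ⊢
    exact hc.represents_openBox _ hab hlt
  | insert j P hj ih =>
    have hjL : j ∈ L := hP (Finset.mem_insert_self j P)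
    have hja := fun e => (h0 j (Finset.mem_insert_self j P) e).1
    have hjb := fun e => (h0 j (Finset.mem_insert_self j P) e).2
    have mem_insert : ∀ {z}, z ∈ puncturedBox (insert j P) a b ↔
        z ∈ puncturedBox P a b ∧ z j ≠ 0 := by
      intro z
      simp only [puncturedBox, Opens.mem_inf, mem_offHyperplanes, Finset.forall_mem_insert]
      tauto
    -- the half boxes
    let A : Bool → Opens (Fin d → ℂ) := fun e => puncturedBox P (Function.update a (j, e) 0) b
    let B : Bool → Opens (Fin d → ℂ) := fun e => puncturedBox P a (Function.update b (j, e) 0)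
    have mem_A : ∀ {e z}, z ∈ A e ↔ z ∈ puncturedBox P a b ∧ 0 < realCoords d z (j, e) := by
      intro e z
      simp only [A, puncturedBox, Opens.mem_inf, mem_openBox]
      constructor
      · rintro ⟨h1, h2⟩
        have h3 := (h1 (j, e)).1
        rw [Function.update_self] at h3
        refine ⟨⟨fun i => ⟨?_, (h1 i).2⟩, h2⟩, h3⟩
        by_cases hi : i = (j, e)
        · subst hi
          exact (hja e).trans h3
        · simpa [hi] using (h1 i).1
      · rintro ⟨⟨h1, h2⟩, h3⟩
        refine ⟨fun i => ⟨?_, (h1 i).2⟩, h2⟩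
        by_cases hi : i = (j, e)
        · subst hi
          simpa using h3
        · simpa [hi] using (h1 i).1
    have mem_B : ∀ {e z}, z ∈ B e ↔ z ∈ puncturedBox P a b ∧ realCoords d z (j, e) < 0 := by
      intro e z
      simp only [B, puncturedBox, Opens.mem_inf, mem_openBox]
      constructor
      · rintro ⟨h1, h2⟩
        have h3 := (h1 (j, e)).2
        rw [Function.update_self] at h3
        refine ⟨⟨fun i => ⟨(h1 i).1, ?_⟩, h2⟩, h3⟩
        by_cases hi : i = (j, e)
        · subst hi
          exact h3.trans (hjb e)
        · simpa [hi] using (h1 i).2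
      · rintro ⟨⟨h1, h2⟩, h3⟩
        refine ⟨fun i => ⟨(h1 i).1, ?_⟩, h2⟩
        by_cases hi : i = (j, e)
        · subst hi
          simpa using h3
        · simpa [hi] using (h1 i).2
    have ne_of : ∀ {e} {z : Fin d → ℂ}, realCoords d z (j, e) ≠ 0 → z j ≠ 0 := by
      rintro (_ | _) z h rfl' <;> exact h (by simp [realCoords_true, realCoords_false, rfl'])
    have hA : ∀ e, A e ≤ puncturedBox (insert j P) a b := fun e z hz =>
      mem_insert.2 ⟨(mem_A.1 hz).1, ne_of (mem_A.1 hz).2.ne'⟩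
    have hB : ∀ e, B e ≤ puncturedBox (insert j P) a b := fun e z hz =>
      mem_insert.2 ⟨(mem_B.1 hz).1, ne_of (mem_B.1 hz).2.ne⟩
    have hrep : ∀ {a' b' : Fin d × Bool → ℝ}, (∀ e, a' (j, e) < b' (j, e)) →
        (∀ k, k ≠ j → ∀ e, a' (k, e) = a (k, e) ∧ b' (k, e) = b (k, e)) →
        puncturedBox P a' b' ≤ puncturedBox (insert j P) a b →
        c.const.Represents P (puncturedBox P a' b') := by
      intro a' b' hlt' heq hle
      refine ih ((Finset.subset_insert j P).trans hP) (hle.trans hab) ?_ fun k hk e => ?_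
      · rintro ⟨k, e⟩
        by_cases hk : k = j
        · subst hk
          exact hlt' e
        · rw [(heq k hk e).1, (heq k hk e).2]
          exact hlt _
      · have hkj : k ≠ j := fun h => hj (h ▸ hk)
        rw [(heq k hkj e).1, (heq k hkj e).2]
        exact h0 k (Finset.mem_insert_of_mem hk) e
    have repA : ∀ e, c.const.Represents P (A e) := fun e => hrep (fun e' => by
      by_cases h : e' = e
      · subst h
        simpa using hjb e'
      · simpa [h] using (hja e').trans (hjb e')) (fun k hk e' => by simp [hk]) (hA e)
    have repB : ∀ e, c.const.Represents P (B e) := fun e => hrep (fun e' => by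
      by_cases h : e' = e
      · subst h
        simpa using hja e'
      · simpa [h] using (hja e').trans (hjb e')) (fun k hk e' => by simp [hk]) (hB e)
    have repAA : c.const.Represents P (A true ⊓ A false) := by
      have hle : A true ⊓ A false ≤ _ := inf_le_left.trans (hA true)
      rw [puncturedBox_inf] at hle ⊢
      refine hrep (fun e => ?_) (fun k hk e => by simp [hk]) hle
      cases e <;> simp [(hja _).le, (hjb _)]
    have repBB : c.const.Represents P (B true ⊓ B false) := by
      have hle : B true ⊓ B false ≤ _ := inf_le_left.trans (hB true)
      rw [puncturedBox_inf] at hle ⊢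
      refine hrep (fun e => ?_) (fun k hk e => by simp [hk]) hle
      cases e <;> simp [(hjb _).le, (hja _)]
    have repAB : ∀ e, c.const.Represents P (A e ⊓ B !e) := by
      intro e
      have hle : A e ⊓ B (!e) ≤ _ := inf_le_left.trans (hA e)
      rw [puncturedBox_inf] at hle ⊢
      refine hrep (fun e' => ?_) (fun k hk e => by simp [hk]) hle
      cases e <;> cases e' <;> simp [(hja _).le, (hjb _).le, (hja _), (hjb _)]
    have hU : puncturedBox (insert j P) a b = (A true ⊔ A false) ⊔ (B true ⊔ B false) := by
      refine le_antisymm (fun z hz => ?_)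
        (sup_le (sup_le (hA true) (hA false)) (sup_le (hB true) (hB false)))
      obtain ⟨hz, hzj⟩ := mem_insert.1 hz
      simp only [Opens.mem_sup, mem_A, mem_B, hz, true_and, realCoords_true, realCoords_false]
      by_contra! h
      exact hzj (Complex.ext (le_antisymm h.1.1 h.2.1) (le_antisymm h.1.2 h.2.2))
    rw [hU]
    -- the factor `1 - I` rotates the complement of a quadrant, `0 < re ∨ 0 < im`, into the slit
    -- plane, so that there are logarithms on the two halves
    have hs : (1 - Complex.I) ≠ 0 := by
      intro h
      simpa using congrArg Complex.re h
    have hlA : ∀ z ∈ A true ⊔ A false, (1 - Complex.I) * z j ∈ Complex.slitPlane := by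
      intro z hz
      refine mul_mem_slitPlane_of_pos ?_
      simpa only [Opens.mem_sup, mem_A, realCoords_true, realCoords_false] using
        hz.imp (fun h => (mem_A.1 h).2) (fun h => (mem_A.1 h).2)
    have hlB : ∀ z ∈ B true ⊔ B false, -(1 - Complex.I) * z j ∈ Complex.slitPlane := by
      intro z hz
      refine mul_mem_slitPlane_of_neg ?_
      simpa only [Opens.mem_sup, mem_B, realCoords_true, realCoords_false] using
        hz.imp (fun h => (mem_B.1 h).2) (fun h => (mem_B.1 h).2)
    have him : ∀ z : Fin d → ℂ, ((1 - Complex.I) * z j).im = (z j).im - (z j).re := by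
      intro z
      simp
      ring
    refine ((repA true).sup (repA false) repAA).sup_insert ((repB true).sup (repB false) repBB)
      (repAB true) (repAB false) (inf_le_inf le_sup_left le_sup_right)
      (inf_le_inf le_sup_right le_sup_left) ?_ ?_ (c.logMul hjL hs hlA)
      (c.logMul hjL (neg_ne_zero.2 hs) hlB) (t := -(Real.pi * Complex.I)) (t' := Real.pi * Complex.I)
      ?_ (fun p a => c.res_logMul_sub hjL hs (neg_ne_zero.2 hs) hlA hlB _ _ ?_ a)
      (fun p a => c.res_logMul_sub hjL hs (neg_ne_zero.2 hs) hlA hlB _ _ ?_ a)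
    · rintro z ⟨h1 | h1, h2 | h2⟩
      · exact absurd (mem_A.1 h1).2 (mem_B.1 h2).2.asymm
      · exact Or.inl ⟨h1, h2⟩
      · exact Or.inr ⟨h1, h2⟩
      · exact absurd (mem_A.1 h1).2 (mem_B.1 h2).2.asymm
    · rintro z ⟨⟨h1, -⟩, -, h2⟩
      exact (mem_A.1 h1).2.asymm (mem_B.1 h2).2
    · intro h
      have := congrArg Complex.im h
      simp at this
      linarith [Real.pi_pos]
    · rintro z ⟨h1, h2⟩
      have h3 : 0 < (z j).re := (mem_A.1 h1).2
      have h4 : (z j).im < 0 := (mem_B.1 h2).2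
      rw [neg_mul]
      exact log_sub_log_neg_of_im_neg (by rw [him]; linarith)
    · rintro z ⟨h1, h2⟩
      have h3 : 0 < (z j).im := (mem_A.1 h1).2
      have h4 : (z j).re < 0 := (mem_B.1 h2).2
      rw [neg_mul]
      exact log_sub_log_neg_of_im_pos (by rw [him]; linarith)

end FormClasses

end SecCx

/-! ### Sections over adapted charts -/

section Pull

variable {X E : Type} [TopologicalSpace X] [TopologicalSpace E]

/-- The preimage of an open set under a chart. -/
def pull (φ : OpenPartialHomeomorph X E) (A : Opens E) : Opens X :=
  ⟨φ.source ∩ φ ⁻¹' A, φ.isOpen_inter_preimage A.isOpen⟩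

variable {φ : OpenPartialHomeomorph X E}

lemma pull_mono {A B : Opens E} (h : B ≤ A) : pull φ B ≤ pull φ A := fun _ hx => ⟨hx.1, h hx.2⟩

variable (φ) in
/-- Every neighbourhood of a point of the chart contains the preimage of a neighbourhood of the
coordinates of the point. -/
lemma exists_pull_le {W : Opens X} {A : Opens E} {z : E} (hz : z ∈ φ.target) (hzA : z ∈ A)
    (hW : φ.symm z ∈ W) : ∃ (B : Opens E) (_ : B ≤ A), z ∈ B ∧ pull φ B ≤ W := by
  refine ⟨⟨φ.target ∩ φ.symm ⁻¹' W, φ.symm.isOpen_inter_preimage W.isOpen⟩ ⊓ A, inf_le_right,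
    ⟨⟨hz, hW⟩, hzA⟩, fun x hx => ?_⟩
  have h := hx.2.1.2
  rwa [Set.mem_preimage, φ.left_inv hx.1] at h

/-- The sections over the open subsets of a chart, as a complex of flasque sheaves on the model
space. -/
def SecCx.comap (G : SecCx X) (φ : OpenPartialHomeomorph X E) : SecCx E where
  S n A := G.S n (pull φ A)
  res n _ _ h := G.res n (pull_mono h)
  d m n A := G.d m n (pull φ A)
  res_res h h' s := G.res_res _ _ s
  res_self h s := G.res_self _ s
  d_res h s := G.d_res _ s
  d_d s := G.d_d s
  glue {n ι} U s hs := by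
    have hle : pull φ (iSup U) ≤ iSup fun i => pull φ (U i) := by
      intro x hx
      obtain ⟨i, hi⟩ := Opens.mem_iSup.1 hx.2
      exact Opens.mem_iSup.2 ⟨i, hx.1, hi⟩
    have hle' : (iSup fun i => pull φ (U i)) ≤ pull φ (iSup U) :=
      iSup_le fun i => pull_mono (le_iSup U i)
    obtain ⟨t, ht, huniq⟩ := G.glue (fun i => pull φ (U i)) s (fun i j => by
      have hij : pull φ (U i) ⊓ pull φ (U j) ≤ pull φ (U i ⊓ U j) :=
        fun x hx => ⟨hx.1.1, hx.1.2, hx.2.2⟩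
      have := congrArg (G.res n hij) (hs i j)
      rwa [G.res_res, G.res_res] at this)
    refine ⟨G.res n hle t, fun i => by rw [G.res_res, ht], fun t' ht' => ?_⟩
    have := huniq (G.res n hle' t') fun i => by
      rw [G.res_res]
      exact ht' i
    rw [← this, G.res_res, G.res_self]
  flasque h := G.flasque (pull_mono h)
  lower := G.lower
  eq_zero hn s := G.eq_zero hn s

end Pull

section FormSections

variable {d p : ℕ} {X : Type} [TopologicalSpace X] [ChartedSpace (Fin d → ℂ) X]
  {S : Finset (PrimeDivisor d X)} {E : PrimeDivisor d X → ℤ} {x y : X}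

namespace AdaptedChart

variable (c : AdaptedChart S x)

lemma toForm_congr {f g : (Fin d → ℂ) → Alt d p} (h : f (c.chart y) = g (c.chart y)) :
    c.toForm E f y = c.toForm E g y := by
  unfold toForm frame
  rw [h]

/-- A constant function on the domain of the chart, as a form of degree zero. -/
lemma toForm_const_zero (h0 : ∀ k, c.expo E k = 0) (hy : y ∈ c.chart.source)
    (hyS : y ∉ unionOf S) (a : Alt d 0) : c.toForm E (fun _ => a) y = a := by
  rw [toForm, if_pos ⟨hy, hyS⟩]
  have hm : monom (c.expo E) (c.chart y) = 1 :=
    Finset.prod_eq_one fun k _ => by rw [h0, zpow_zero]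
  refine ContinuousAlternatingMap.ext fun v => ?_
  change monom (c.expo E) (c.chart y) * a _ = a v
  rw [hm, one_mul]
  exact congrArg a (Subsingleton.elim _ _)

lemma expo_eq_zero_of_notMem (hx : x ∉ unionOf S) : c.logSet = ∅ ∧ ∀ k, c.expo E k = 0 := by
  have h : c.logSet = ∅ := by
    rw [Finset.eq_empty_iff_forall_notMem]
    intro k hk
    obtain ⟨T, hT⟩ := mem_logSet_iff.1 hk
    exact hx (Set.mem_biUnion (c.comp_mem k T hT).1 (c.comp_mem k T hT).2)
  exact ⟨h, fun k => c.expo_of_notMem (by simp [h])⟩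

variable [IsManifold 𝓘(ℂ, Fin d → ℂ) ω X]

/-- The section with given coefficients with respect to the frame. -/
def formSection (E : PrimeDivisor d X → ℤ) (p : ℕ) (A : Opens (Fin d → ℂ)) :
    analyticForms d p A →ₗ[ℂ] Sec ((logDeRham S E).X p) (pull c.chart A) where
  toFun f := show (logFormCondition S E p).sections (pull c.chart A) from
    ⟨cutOff (pull c.chart A) (c.toForm E f.1), fun y hy => (logFormCondition S E p).congr
      (cutOff_eventuallyEq hy).symm (isLogFormAt_of_frame (fun h => c.toForm_of_mem h) fun c' =>
        (c.isFrameOf_toForm E hy.1 (f.2 _ hy.2)).transition hy.1 c'),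
      fun y hy => cutOff_of_notMem hy⟩
  map_add' f g := by
    refine Subtype.ext ?_
    funext y
    change cutOff (pull c.chart A) (c.toForm E (f.1 + g.1)) y =
      cutOff (pull c.chart A) (c.toForm E f.1) y + cutOff (pull c.chart A) (c.toForm E g.1) y
    by_cases hy : y ∈ pull c.chart A
    · rw [cutOff_of_mem hy, cutOff_of_mem hy, cutOff_of_mem hy]
      unfold toForm
      split_ifs
      · refine ContinuousAlternatingMap.ext fun v => ?_
        exact mul_add (monom (c.expo E) (c.chart y)) _ _
      · exact (add_zero _).symm
    · rw [cutOff_of_notMem hy, cutOff_of_notMem hy, cutOff_of_notMem hy, add_zero]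
  map_smul' t f := by
    refine Subtype.ext ?_
    funext y
    change cutOff (pull c.chart A) (c.toForm E (t • f.1)) y =
      t • cutOff (pull c.chart A) (c.toForm E f.1) y
    by_cases hy : y ∈ pull c.chart A
    · rw [cutOff_of_mem hy, cutOff_of_mem hy]
      unfold toForm
      split_ifs
      · refine ContinuousAlternatingMap.ext fun v => ?_
        exact mul_left_comm (monom (c.expo E) (c.chart y)) _ _
      · exact (alt_smul_zero t).symm
    · rw [cutOff_of_notMem hy, cutOff_of_notMem hy, alt_smul_zero]

lemma formOf_formSection {A : Opens (Fin d → ℂ)} (f : analyticForms d p A) :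
    formOf (c.formSection E p A f) = cutOff (pull c.chart A) (c.toForm E f.1) := rfl

lemma isFrameOf_formSection {A : Opens (Fin d → ℂ)} (f : analyticForms d p A)
    (hy : y ∈ pull c.chart A) : c.IsFrameOf E (formOf (c.formSection E p A f)) y f.1 :=
  (c.isFrameOf_toForm E hy.1 (f.2 _ hy.2)).congr_form hy.1 (cutOff_eventuallyEq hy).symm

lemma resL_formSection {A B : Opens (Fin d → ℂ)} (h : B ≤ A) (f : analyticForms d p A)
    (g : analyticForms d p B) (hfg : ∀ z ∈ B, f.1 z = g.1 z) :
    resL _ (pull_mono h) (c.formSection E p A f) = c.formSection E p B g := by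
  refine formOf_ext ?_
  rw [formOf_resL, formOf_formSection, formOf_formSection, cutOff_cut (pull_mono h)]
  funext y
  by_cases hy : y ∈ pull c.chart B
  · rw [cutOff_of_mem hy, cutOff_of_mem hy, c.toForm_congr (hfg _ hy.2)]
  · rw [cutOff_of_notMem hy, cutOff_of_notMem hy]

lemma d_formSection {A : Opens (Fin d → ℂ)} (f : analyticForms d p A)
    (g : analyticForms d (p + 1) A)
    (hfg : ∀ z ∈ A, dLog c.logSet (fun k => c.expo E k) f.1 z = g.1 z) :
    secMap ((logDeRham S E).d p (p + 1)) (pull c.chart A) (c.formSection E p A f) =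
      c.formSection E (p + 1) A g := by
  refine formOf_ext ?_
  rw [formOf_d, formOf_formSection]
  funext y
  by_cases hy : y ∈ pull c.chart A
  swap
  · rw [cutOff_of_notMem hy, formOf_formSection, cutOff_of_notMem hy]
  rw [cutOff_of_mem hy, formOf_formSection, cutOff_of_mem hy, ← formOf_formSection]
  -- off the divisor, forms are determined by their coefficients with respect to the frame
  have h1 := ((c.isFrameOf_formSection (E := E) f hy).extDerivOff hy.1).congr
    (G' := g.1) (by
      filter_upwards [A.isOpen.mem_nhds hy.2] with z hz using hfg z hz)
  exact (h1.eventuallyEq (c.isFrameOf_toForm E hy.1 (g.2 _ hy.2)) hy.1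
    (Eventually.of_forall fun y hy => if_pos hy)
    (Eventually.of_forall fun y hy => c.toForm_of_mem hy)).self_of_nhds

/-- Closed forms with logarithmic poles are locally constant up to exact forms. -/
lemma exists_const_add_d (h0 : ∀ k, c.expo E k = 0) {V : Opens X} (hx : x ∈ V)
    (s : Sec ((logDeRham S E).X (p + 1)) V)
    (hs : secMap ((logDeRham S E).d (p + 1) (p + 2)) V s = 0) :
    ∃ a ∈ altOf c.logSet (p + 1), ∃ (W : Opens X) (hW : W ≤ V) (hW' : W ≤ pull c.chart ⊤)
      (_ : x ∈ W) (u : Sec ((logDeRham S E).X p) W),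
      resL _ hW s = resL _ hW' (c.formSection E (p + 1) ⊤ (constForm d (p + 1) ⊤ a)) +
        secMap ((logDeRham S E).d p (p + 1)) W u := by
  have h0' : (fun k => (c.expo E k : ℂ)) = 0 := by
    funext k
    rw [h0, Int.cast_zero, Pi.zero_apply]
  obtain ⟨G, hG⟩ := exists_frame_formOf s hx c
  have hcl := dLog_eq_zero_of_closed hx hG hs
  rw [h0'] at hcl
  obtain ⟨a, ha, θ, hθ, hGθ⟩ := exists_const_add_dLog (fun k hk => c.chart_apply_eq_zero hk)
    hG.1 hcl
  have hx' : x ∈ pull c.chart ⊤ := ⟨c.mem_source, trivial⟩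
  obtain ⟨W, hW, hxW, u, hu⟩ := c.exists_section_toForm (E := E) hx' hθ
  have h1 := isFrameOf_d hxW hu
  rw [h0'] at h1
  have h2 := hG.sub (c.isFrameOf_formSection (E := E) (constForm d (p + 1) ⊤ a) hx')
  have h3 := h2.congr (G' := dLog c.logSet 0 θ) (by
    filter_upwards [hGθ] with z hz
    rw [Pi.sub_apply, hz]
    exact add_sub_cancel_left _ _)
  have h4 := h3.eventuallyEq h1 c.mem_source (by
    filter_upwards [formOf_eq_zero s hx, formOf_eq_zero
      (c.formSection E (p + 1) ⊤ (constForm d (p + 1) ⊤ a)) hx'] with y e1 e2 hy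
    rw [Pi.sub_apply, e1 hy, e2 hy, sub_zero]) (formOf_eq_zero _ hxW)
  obtain ⟨W', hW₁, hW₂, hxW', e⟩ := exists_resL_eq hx hxW s
    (resL _ hW (c.formSection E (p + 1) ⊤ (constForm d (p + 1) ⊤ a)) +
      secMap ((logDeRham S E).d p (p + 1)) W u) (by
    filter_upwards [h4, formOf_resL_eventuallyEq hW
      (c.formSection E (p + 1) ⊤ (constForm d (p + 1) ⊤ a)) hxW] with y e1 e2
    rw [formOf_add, Pi.add_apply, e2, ← e1, Pi.sub_apply, add_sub_cancel])
  refine ⟨a, mem_altOf_succ.2 ha, W', hW₁, hW₂.trans hW, hxW', resL _ hW₂ u, ?_⟩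
  rw [e, map_add, resL_resL, secMap_resL]

/-- Closed functions are locally constant. -/
lemma exists_eq_const (h0 : ∀ k, c.expo E k = 0) {V : Opens X} (hx : x ∈ V)
    (s : Sec ((logDeRham S E).X 0) V) (hs : secMap ((logDeRham S E).d 0 1) V s = 0) :
    ∃ (a : Alt d 0) (W : Opens X) (hW : W ≤ V) (hW' : W ≤ pull c.chart ⊤) (_ : x ∈ W),
      resL _ hW s = resL _ hW' (c.formSection E 0 ⊤ (constForm d 0 ⊤ a)) := by
  have h0' : (fun k => (c.expo E k : ℂ)) = 0 := by
    funext k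
    rw [h0, Int.cast_zero, Pi.zero_apply]
  obtain ⟨G, hG⟩ := exists_frame_formOf s hx c
  have hcl := dLog_eq_zero_of_closed hx hG hs
  rw [h0'] at hcl
  have hx' : x ∈ pull c.chart ⊤ := ⟨c.mem_source, trivial⟩
  obtain ⟨W, hW, hW', hxW, e⟩ := exists_resL_eq_of_frame hx hx' hG
    (c.isFrameOf_formSection (E := E) (constForm d 0 ⊤ (G (c.chart x))) hx')
    (eventually_const_of_closed hG.1 hcl)
  exact ⟨_, W, hW, hW', hxW, e⟩

end AdaptedChart

variable [IsManifold 𝓘(ℂ, Fin d → ℂ) ω X]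

/-- The Poincaré lemma off the divisor. -/
lemma exists_d_eq_of_notMem (hsnc : IsSNC S) (hyS : y ∉ unionOf S) {V : Opens X} (hy : y ∈ V)
    (s : Sec ((logDeRham S E).X (p + 1)) V)
    (hs : secMap ((logDeRham S E).d (p + 1) (p + 2)) V s = 0) :
    ∃ (W : Opens X) (hW : W ≤ V) (_ : y ∈ W) (u : Sec ((logDeRham S E).X p) W),
      secMap ((logDeRham S E).d p (p + 1)) W u = resL _ hW s := by
  obtain ⟨c⟩ := hsnc y
  obtain ⟨hL, h0⟩ := c.expo_eq_zero_of_notMem (E := E) hyS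
  obtain ⟨a, ha, W, hW, hW', hyW, u, hu⟩ := c.exists_const_add_d h0 hy s hs
  rw [hL] at ha
  refine ⟨W, hW, hyW, u, ?_⟩
  rw [hu, eq_zero_of_mem_altOf_empty ha, map_zero, map_zero, map_zero, zero_add]

/-- Closed functions are locally constant off the divisor. -/
lemma eventually_eq_const_of_notMem (hsnc : IsSNC S) (hyS : y ∉ unionOf S) {V : Opens X}
    (hy : y ∈ V) (s : Sec ((logDeRham S E).X 0) V)
    (hs : secMap ((logDeRham S E).d 0 1) V s = 0) : ∃ a, ∀ᶠ y' in 𝓝 y, formOf s y' = a := by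
  obtain ⟨c⟩ := hsnc y
  obtain ⟨hL, h0⟩ := c.expo_eq_zero_of_notMem (E := E) hyS
  obtain ⟨a, W, hW, hW', hyW, e⟩ := c.exists_eq_const h0 hy s hs
  refine ⟨a, ?_⟩
  filter_upwards [W.isOpen.mem_nhds hyW, (isClosed_unionOf S).isOpen_compl.mem_nhds hyS]
    with y' h1 h2
  have := congrFun (congrArg formOf e) y'
  rw [formOf_resL, formOf_resL, cutOff_of_mem h1, cutOff_of_mem h1, c.formOf_formSection,
    cutOff_of_mem (hW' h1)] at this
  exact this.trans (c.toForm_const_zero h0 (hW' h1).1 h2 a)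

end FormSections

/-! ### Cohomology with supports along the divisor -/

section Supports

namespace SecCx.ConstClasses

variable {d : ℕ} {E : Type} [TopologicalSpace E] {G : SecCx E} {c : ConstClasses d G}
  {P : Finset (Fin d)} {A B : Opens E}

/-- A closed section which vanishes on a smaller open set whose cohomology is represented by
constant forms has a primitive that vanishes there. -/
lemma Represents.exists_primitive_vanishing (hB : c.Represents P B) (h : B ≤ A) {p : ℕ}
    {a : Alt d (p + 1)} (ha : a ∈ altOf P (p + 1)) (β : G.S p A)
    (h0 : G.res _ h (c.cl (p + 1) A a + G.D p β) = 0) :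
    ∃ γ : G.S p A, G.D p γ = c.cl (p + 1) A a + G.D p β ∧ G.res _ h γ = 0 := by
  rw [map_add, c.res_cl, ← D_res] at h0
  obtain rfl : a = 0 := by
    refine hB.inj _ a ha ⟨-G.res _ h β, ?_⟩
    rw [map_neg, eq_neg_of_add_eq_zero_left h0]
  rw [map_zero, zero_add] at h0
  rw [map_zero, zero_add]
  obtain ⟨a', _, h1⟩ := hB.surj p _ h0
  obtain ⟨δ, hδ, hδ'⟩ : ∃ δ : G.S p A, G.D p δ = 0 ∧
      G.res _ h δ = G.res _ h β - c.cl p B a' := by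
    rcases p with _ | p
    · exact ⟨0, map_zero _, (map_zero _).trans (Eq.symm h1)⟩
    · obtain ⟨δ, hδ⟩ := h1
      obtain ⟨δ, rfl⟩ := G.flasque h δ
      exact ⟨G.D p δ, (exact_D δ).closed, by rw [← D_res, hδ]⟩
  refine ⟨β - c.cl p A a' - δ, by rw [map_sub, map_sub, c.d_cl, hδ, sub_zero, sub_zero], ?_⟩
  rw [map_sub, map_sub, hδ', c.res_cl, sub_self]

end SecCx.ConstClasses

variable {X : Type} [TopologicalSpace X]

section NatHom

variable {K : CochainComplex (CSheaf X) ℕ} {I : CochainComplex (CSheaf X) ℤ}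
  (ι : extendZ K ⟶ I) [QuasiIso ι]

lemma exists_local_natHom_succ (k : ℕ) {V : Opens X} (a : Sec (I.X (k + 1 : ℕ)) V)
    (ha : secMap (I.d (k + 1 : ℕ) (k + 2 : ℕ)) V a = 0) {x : X} (hx : x ∈ V) :
    ∃ (W : Opens X) (h : W ≤ V), x ∈ W ∧ ∃ s : Sec (K.X (k + 1)) W,
      secMap (K.d (k + 1) (k + 2)) W s = 0 ∧ ∃ b : Sec (I.X (k : ℕ)) W,
        resL (I.X (k + 1 : ℕ)) h a =
          secMap (natHom ι (k + 1)) W s + secMap (I.d (k : ℕ) (k + 1 : ℕ)) W b := by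
  obtain ⟨W, h, hxW, s, hs, b, hb⟩ := exists_local_natHom ι (k + 1) a ha hx
  obtain ⟨b', hb'⟩ : ∃ b' : Sec (I.X (k : ℕ)) W, secMap (I.d (k : ℕ) (k + 1 : ℕ)) W b' =
      secMap (I.d ((k + 1 : ℕ) - 1) (k + 1 : ℕ)) W b := by
    have h1 : ((k + 1 : ℕ) : ℤ) - 1 = k := by omega
    revert b
    rw [h1]
    exact fun b _ => ⟨b, rfl⟩
  exact ⟨W, h, hxW, s, hs, b', by rw [hb, hb']⟩

lemma exists_local_natHom_zero [I.IsStrictlyGE 0] {V : Opens X} (a : Sec (I.X (0 : ℕ)) V)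
    (ha : secMap (I.d (0 : ℕ) (1 : ℕ)) V a = 0) {x : X} (hx : x ∈ V) :
    ∃ (W : Opens X) (h : W ≤ V), x ∈ W ∧ ∃ s : Sec (K.X 0) W,
      secMap (K.d 0 1) W s = 0 ∧ resL (I.X (0 : ℕ)) h a = secMap (natHom ι 0) W s := by
  obtain ⟨W, h, hxW, s, hs, b, hb⟩ := exists_local_natHom ι 0 a ha hx
  have hb0 : b = 0 := by
    have h : 𝟙 (I.X (((0 : ℕ) : ℤ) - 1)) = 0 :=
      (I.isZero_of_isStrictlyGE 0 _ (by simp)).eq_of_src _ _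
    exact congrArg (fun f => secMap f W b) h
  exact ⟨W, h, hxW, s, hs, by rw [hb, hb0, map_zero, add_zero]⟩

end NatHom

variable {d : ℕ} [ChartedSpace (Fin d → ℂ) X] [IsManifold 𝓘(ℂ, Fin d → ℂ) ω X]
  {S : Finset (PrimeDivisor d X)} {E : PrimeDivisor d X → ℤ} {x : X}

lemma AdaptedChart.natHom_resL_formSection {I : CochainComplex (CSheaf X) ℤ}
    {ι : extendZ (logDeRham S E) ⟶ I} (c : AdaptedChart S x) {p : ℕ} {W : Opens X}
    {B : Opens (Fin d → ℂ)} (hW : W ≤ pull c.chart ⊤) (hB : pull c.chart B ≤ W) (a : Alt d p) :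
    resL _ hB (secMap (natHom ι p) W (resL _ hW (c.formSection E p ⊤ (constForm d p ⊤ a)))) =
      secMap (natHom ι p) (pull c.chart B) (c.formSection E p B (constForm d p B a)) := by
  rw [← secMap_resL, resL_resL]
  exact congrArg (secMap (natHom ι p) _) (c.resL_formSection (E := E) (le_top : B ≤ ⊤)
    (constForm d p ⊤ a) (constForm d p B a) fun _ _ => rfl)

variable {I : CochainComplex (CSheaf X) ℤ} (hI : ∀ n, Injective (I.X n)) [hl : I.IsStrictlyGE 0]
  (ι : extendZ (logDeRham S E) ⟶ I)

/-- The images of the forms in a chart in a resolution of the logarithmic de Rham complex. -/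
def AdaptedChart.formClasses (c : AdaptedChart S x) (h0 : ∀ k, c.expo E k = 0) :
    ((secCxOf I hI 0 hl).comap c.chart).FormClasses c.logSet where
  cl p A := (secMap (natHom ι p) (pull c.chart A)).comp (c.formSection E p A)
  res_cl h f g hfg := (secMap_resL (natHom ι _) (pull_mono h) (c.formSection E _ _ f)).symm.trans
    (congrArg (secMap (natHom ι _) _) (c.resL_formSection h f g hfg))
  d_cl {p A} f g hfg := (secMap_natHom_d ι p (p + 1) _).trans
    (congrArg (secMap (natHom ι (p + 1)) _) (c.d_formSection f g (by
      have h : (fun k => (c.expo E k : ℂ)) = 0 := by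
        funext k
        rw [h0, Int.cast_zero, Pi.zero_apply]
      rw [h]
      exact hfg)))

variable {hI} {ι}

lemma AdaptedChart.formClasses_cl (c : AdaptedChart S x) (h0 : ∀ k, c.expo E k = 0) {p : ℕ}
    {A : Opens (Fin d → ℂ)} (a : Alt d p) : (c.formClasses hI ι h0).const.cl p A a =
      secMap (natHom ι p) (pull c.chart A) (c.formSection E p A (constForm d p A a)) := rfl

variable [QuasiIso ι]

/-- Off the divisor, an injective resolution of the logarithmic de Rham complex is a resolution of the
constant sheaf. -/
lemma AdaptedChart.isLocalResolution (c : AdaptedChart S x) (hsnc : IsSNC S)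
    (h0 : ∀ k, c.expo E k = 0) : (c.formClasses hI ι h0).IsLocalResolution
      (⟨c.chart.target, c.chart.open_target⟩ ⊓ offHyperplanes c.logSet) := by
  have mem : ∀ {A : Opens (Fin d → ℂ)}
      (_ : A ≤ ⟨c.chart.target, c.chart.open_target⟩ ⊓ offHyperplanes c.logSet) {z} (_ : z ∈ A),
      z ∈ c.chart.target ∧ c.chart.symm z ∉ unionOf S ∧ c.chart.symm z ∈ pull c.chart A := by
    intro A hA z hz
    have hzt : z ∈ c.chart.target := (hA hz).1
    refine ⟨hzt, c.symm_notMem' hzt (hA hz).2, c.chart.map_target hzt, ?_⟩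
    rwa [Set.mem_preimage, c.chart.right_inv hzt]
  -- the conditions hold for the forms off the divisor by the Poincaré lemma, and pass to the
  -- resolution
  refine ⟨fun k A hA α hα z hz => ?_, fun A hA α hα z hz => ?_, fun A hA z hz a ha => ?_⟩
  · obtain ⟨hzt, hyS, hy⟩ := mem hA hz
    obtain ⟨α, rfl⟩ : ∃ α' : Sec (I.X (k + 1 : ℕ)) (pull c.chart A), α' = α := ⟨α, rfl⟩
    obtain ⟨W, hW, hyW, s, hs, b, hb⟩ := exists_local_natHom_succ ι k (V := pull c.chart A) α hα hy
    obtain ⟨W', hW', hyW', u, hu⟩ := exists_d_eq_of_notMem hsnc hyS hyW s hs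
    obtain ⟨B, hB, hzB, hBW⟩ := exists_pull_le c.chart hzt hz hyW'
    refine ⟨B, hB, hzB, secMap (natHom ι k) _ (resL _ hBW u) + resL _ (hBW.trans hW') b, ?_⟩
    have e := congrArg (resL _ (hBW.trans hW')) hb
    rw [map_add, resL_resL, ← secMap_resL, ← secMap_resL, ← resL_resL _ hW' hBW s, ← hu,
      ← secMap_resL, ← secMap_natHom_d, ← map_add] at e
    exact e.symm
  · obtain ⟨hzt, hyS, hy⟩ := mem hA hz
    obtain ⟨α, rfl⟩ : ∃ α' : Sec (I.X (0 : ℕ)) (pull c.chart A), α' = α := ⟨α, rfl⟩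
    obtain ⟨W, hW, hyW, s, hs, hs'⟩ := exists_local_natHom_zero ι (V := pull c.chart A) α hα hy
    obtain ⟨a, ha⟩ := eventually_eq_const_of_notMem hsnc hyS hyW s hs
    obtain ⟨W', hW', hW'o, hyW'⟩ := mem_nhds_iff.1 ha
    obtain ⟨B, hB, hzB, hBW⟩ := exists_pull_le c.chart (W := W ⊓ ⟨W', hW'o⟩) hzt hz ⟨hyW, hyW'⟩
    refine ⟨B, hB, hzB, a, ?_⟩
    have hBW' : pull c.chart B ≤ W := hBW.trans inf_le_left
    have e := congrArg (resL _ hBW') hs'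
    rw [resL_resL, ← secMap_resL] at e
    refine e.trans ((congrArg (secMap (natHom ι 0) _) (formOf_ext ?_)).trans
      (c.formClasses_cl h0 a).symm)
    rw [formOf_resL, c.formOf_formSection]
    funext y
    by_cases hy : y ∈ pull c.chart B
    · rw [cutOff_of_mem hy, cutOff_of_mem hy]
      have hyS' : y ∉ unionOf S := (c.notMem_iff hy.1).2 ((hB.trans hA) hy.2).2
      exact (hW' (hBW hy).2).trans (c.toForm_const_zero h0 hy.1 hyS' a).symm
    · rw [cutOff_of_notMem hy, cutOff_of_notMem hy]
  · obtain ⟨hzt, hyS, hy⟩ := mem hA hz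
    obtain ⟨W, hW, hyW, h⟩ := natHom_zero_injective ι
      (c.formSection E 0 A (constForm d 0 A a)) (by
        rw [c.d_formSection _ 0 fun z _ => ?_, map_zero]
        have h : (fun k => (c.expo E k : ℂ)) = 0 := by
          funext k
          rw [h0, Int.cast_zero, Pi.zero_apply]
        rw [h]
        exact SecCx.FormClasses.dLog_const a z) ha hy
    have e := congrFun (congrArg formOf h) (c.chart.symm z)
    rw [formOf_resL, cutOff_of_mem hyW, c.formOf_formSection, cutOff_of_mem hy] at e
    exact (c.toForm_const_zero h0 hy.1 hyS a).symm.trans e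

/-- The preimages of boxes form a basis of neighbourhoods of the centre of an adapted chart, and
the cohomology of the corresponding punctured boxes is known. -/
lemma AdaptedChart.exists_box (c : AdaptedChart S x) (hsnc : IsSNC S) (h0 : ∀ k, c.expo E k = 0)
    {W : Opens X} (hx : x ∈ W) : ∃ a b : Fin d × Bool → ℝ,
      x ∈ pull c.chart (openBox (realCoords d) a b) ∧ pull c.chart (openBox (realCoords d) a b) ≤ W ∧
        (c.formClasses hI ι h0).const.Represents c.logSet (puncturedBox c.logSet a b) := by
  have hz : c.chart x ∈ c.chart.target := c.chart.map_source c.mem_source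
  obtain ⟨B, hB, hzB, hBW⟩ := exists_pull_le c.chart (W := W)
    (A := ⟨c.chart.target, c.chart.open_target⟩) hz hz (by rwa [c.chart.left_inv c.mem_source])
  obtain ⟨ε, hε, hle⟩ := exists_openBox_le (u := realCoords d) hzB
  refine ⟨_, _, ⟨c.mem_source, fun i => ?_⟩, (pull_mono hle).trans hBW,
    (c.isLocalResolution hsnc h0).represents_puncturedBox subset_rfl
      (inf_le_inf_right _ (hle.trans hB)) (fun i => ?_) fun k hk e => ?_⟩
  · simpa using hε
  · have : realCoords d (c.chart x) i - ε < realCoords d (c.chart x) i + ε := by linarith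
    exact this
  · have h1 := c.chart_apply_eq_zero hk
    have h2 : realCoords d (c.chart x) (k, e) = 0 := by
      cases e
      · rw [realCoords_false, h1, Complex.zero_im]
      · rw [realCoords_true, h1, Complex.zero_re]
    simpa [h2] using hε

/-- A closed section of a resolution in degree zero which vanishes off the divisor vanishes. -/
lemma AdaptedChart.resL_eq_zero_of_vanishing (c : AdaptedChart S x)
    (hI : ∀ n, Injective (I.X n)) (ι : extendZ (logDeRham S E) ⟶ I) [QuasiIso ι] (hsnc : IsSNC S)
    (h0 : ∀ k, c.expo E k = 0) {U : Opens X} (hU : ∀ y ∈ c.chart.source, y ∉ unionOf S → y ∈ U)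
    {V : Opens X} (hx : x ∈ V) (s : Sec (I.X (0 : ℕ)) V)
    (hs : secMap (I.d (0 : ℕ) (1 : ℕ)) V s = 0)
    (hsU : resL _ (inf_le_left : V ⊓ U ≤ V) s = 0) :
    ∃ (W : Opens X) (hW : W ≤ V), x ∈ W ∧ resL _ hW s = 0 := by
  obtain ⟨W, hW, hxW, k, hk, e⟩ := exists_local_natHom_zero ι s hs hx
  obtain ⟨a, W', hW', hW'c, hxW', e'⟩ := c.exists_eq_const h0 hxW k hk
  obtain ⟨l, r, hxB, hBW, hrep⟩ := c.exists_box (hI := hI) (ι := ι) hsnc h0 hxW'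
  have hBV : pull c.chart (openBox (realCoords d) l r) ≤ V := (hBW.trans hW').trans hW
  have e1 : resL _ hBV s = secMap (natHom ι 0) _
      (c.formSection E 0 (openBox (realCoords d) l r) (constForm d 0 _ a)) := by
    rw [← c.natHom_resL_formSection hW'c hBW a, ← e', secMap_resL, ← e, resL_resL, resL_resL]
  have hle : puncturedBox c.logSet l r ≤ openBox (realCoords d) l r := inf_le_left
  have hPU : pull c.chart (puncturedBox c.logSet l r) ≤ V ⊓ U := fun y hy =>
    ⟨hBV (pull_mono hle hy), hU y hy.1 ((c.notMem_iff hy.1).2 hy.2.2)⟩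
  have hs0 : resL _ (pull_mono hle) (resL _ hBV s) = 0 := by
    rw [resL_resL]
    exact (resL_resL _ inf_le_left hPU s).symm.trans ((congrArg _ hsU).trans (map_zero _))
  obtain rfl : a = 0 := hrep.inj 0 a (mem_altOf_zero a)
    (((c.formClasses hI ι h0).const.res_cl hle a).symm.trans
      ((congrArg (resL _ (pull_mono hle)) e1.symm).trans hs0))
  refine ⟨_, hBV, hxB, ?_⟩
  rw [e1, map_zero, map_zero, map_zero]

/-- A closed section of a resolution which vanishes off the divisor has local primitives that
vanish off the divisor. -/
lemma AdaptedChart.exists_primitive_vanishing (c : AdaptedChart S x)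
    (hI : ∀ n, Injective (I.X n)) (ι : extendZ (logDeRham S E) ⟶ I) [QuasiIso ι] (hsnc : IsSNC S)
    (h0 : ∀ k, c.expo E k = 0) {U : Opens X} (hU : ∀ y ∈ c.chart.source, y ∈ U ↔ y ∉ unionOf S)
    {V : Opens X} (hx : x ∈ V) {p : ℕ} (s : Sec (I.X (p + 1 : ℕ)) V)
    (hs : secMap (I.d (p + 1 : ℕ) (p + 2 : ℕ)) V s = 0)
    (hsU : resL _ (inf_le_left : V ⊓ U ≤ V) s = 0) :
    ∃ (W : Opens X) (hW : W ≤ V), x ∈ W ∧ ∃ b : Sec (I.X (p : ℕ)) W,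
      resL _ (inf_le_left : W ⊓ U ≤ W) b = 0 ∧
        secMap (I.d (p : ℕ) (p + 1 : ℕ)) W b = resL _ hW s := by
  -- near `x` the section is the image of a closed form up to an exact section, and that form is the
  -- sum of a constant combination of products of the `dz_k / z_k` and an exact form
  obtain ⟨W, hW, hxW, k, hk, b, e⟩ := exists_local_natHom_succ ι p s hs hx
  obtain ⟨a, ha, W', hW', hW'c, hxW', u, e'⟩ := c.exists_const_add_d h0 hxW k hk
  obtain ⟨l, r, hxB, hBW, hrep⟩ := c.exists_box (hI := hI) (ι := ι) hsnc h0 hxW'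
  have hBV : pull c.chart (openBox (realCoords d) l r) ≤ V := (hBW.trans hW').trans hW
  set β : Sec (I.X (p : ℕ)) (pull c.chart (openBox (realCoords d) l r)) :=
    secMap (natHom ι p) _ (resL _ hBW u) + resL _ (hBW.trans hW') b with hβ
  have e1 : resL _ hBV s = secMap (natHom ι (p + 1)) _
      (c.formSection E (p + 1) (openBox (realCoords d) l r) (constForm d (p + 1) _ a)) +
        secMap (I.d (p : ℕ) (p + 1 : ℕ)) _ β := by
    have e2 := congrArg (resL _ (hBW.trans hW')) e
    rw [resL_resL, map_add, ← resL_resL _ hW' hBW (secMap (natHom ι (p + 1)) W k),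
      ← secMap_resL (natHom ι (p + 1)) hW' k, e', map_add, map_add,
      c.natHom_resL_formSection hW'c hBW a, add_assoc] at e2
    rw [e2, hβ, map_add, secMap_natHom_d, secMap_resL ((logDeRham S E).d p (p + 1)) hBW u,
      secMap_resL (natHom ι (p + 1)) hBW, secMap_resL (I.d (p : ℕ) (p + 1 : ℕ)) (hBW.trans hW') b]
  have hle : puncturedBox c.logSet l r ≤ openBox (realCoords d) l r := inf_le_left
  have hPU : pull c.chart (puncturedBox c.logSet l r) ≤ V ⊓ U := fun y hy =>
    ⟨hBV (pull_mono hle hy), (hU y hy.1).2 ((c.notMem_iff hy.1).2 hy.2.2)⟩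
  have hUP : pull c.chart (openBox (realCoords d) l r) ⊓ U ≤
      pull c.chart (puncturedBox c.logSet l r) := fun y hy =>
    ⟨hy.1.1, hy.1.2, (c.notMem_iff hy.1.1).1 ((hU y hy.1.1).1 hy.2)⟩
  have hs0 : resL _ (pull_mono hle) (resL _ hBV s) = 0 := by
    rw [resL_resL]
    exact (resL_resL _ inf_le_left hPU s).symm.trans ((congrArg _ hsU).trans (map_zero _))
  -- the section vanishes on the punctured box, where the constant combination is not exact unless
  -- it is zero
  obtain ⟨γ, hγ, hγ'⟩ : ∃ γ : Sec (I.X (p : ℕ)) (pull c.chart (openBox (realCoords d) l r)),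
      secMap (I.d (p : ℕ) (p + 1 : ℕ)) _ γ = resL _ hBV s ∧ resL _ (pull_mono hle) γ = 0 := by
    rw [e1] at hs0 ⊢
    exact hrep.exists_primitive_vanishing hle ha β hs0
  refine ⟨_, hBV, hxB, γ, ?_, hγ⟩
  rw [← resL_resL _ (pull_mono hle) hUP, hγ', map_zero]

variable [HasDerivedCategory.{w} (CSheaf X)]

/-- Hypercohomology of the logarithmic de Rham complex is not changed by removing components along
which the twist is trivial. -/
theorem hyperRestrict_logDeRham_bijective (hsnc : IsSNC S) (U : Opens X)
    (h : ∀ x ∉ U, ∀ c : AdaptedChart S x, (∀ k, c.expo E k = 0) ∧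
      ∀ y ∈ c.chart.source, y ∈ U ↔ y ∉ unionOf S) (n : ℤ) :
    Function.Bijective (hyperRestrict (le_top : U ≤ ⊤) (logDeRham S E) n) := by
  obtain ⟨I, ι, _, hI, hl⟩ :=
    CochainComplex.Plus.modelCategoryQuillen.exists_quasiIso_injective (extendZ (logDeRham S E)) 0
  -- the subcomplex of sections with support in the complement of `U` is locally exact
  have hloc : ∀ (n : ℤ) (V : Opens X) (s : Sec (I.X n) V), secMap (I.d n (n + 1)) V s = 0 →
      resL _ (inf_le_left : V ⊓ U ≤ V) s = 0 → ∀ x ∈ V, ∃ (W : Opens X) (hW : W ≤ V), x ∈ W ∧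
        ∃ t : Sec (I.X (n - 1)) W, resL _ (inf_le_left : W ⊓ U ≤ W) t = 0 ∧
          secMap (I.d (n - 1) n) W t = resL _ hW s := by
    intro n V s hs hsU x hx
    by_cases hxU : x ∈ U
    · exact ⟨V ⊓ U, inf_le_left, ⟨hx, hxU⟩, 0, map_zero _, (map_zero _).trans hsU.symm⟩
    obtain ⟨c⟩ := hsnc x
    obtain ⟨h0, hU⟩ := h x hxU c
    rcases lt_or_ge n 0 with hn | hn
    · obtain rfl : s = 0 := (secCxOf I hI 0 hl).eq_zero hn s
      exact ⟨V, le_rfl, hx, 0, map_zero _, (map_zero _).trans (map_zero _).symm⟩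
    obtain ⟨p, rfl⟩ := Int.eq_ofNat_of_zero_le hn
    rcases p with _ | p
    · obtain ⟨W, hW, hxW, e⟩ := c.resL_eq_zero_of_vanishing hI ι hsnc h0
        (fun y hy => (hU y hy).2) hx s hs hsU
      exact ⟨W, hW, hxW, 0, map_zero _, (map_zero _).trans e.symm⟩
    · obtain ⟨W, hW, hxW, b, hb, hb'⟩ := c.exists_primitive_vanishing hI ι hsnc h0 hU hx s hs hsU
      refine ⟨W, hW, hxW, ?_⟩
      have h1 : ((p + 1 : ℕ) : ℤ) - 1 = p := by omega
      rw [h1]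
      exact ⟨b, hb, hb'⟩
  refine hyperRestrict_bijective ι hI U (fun n s hs hsU => ?_) n
  obtain ⟨t, ht, ht'⟩ := (secCxOf I hI 0 hl).exact_of_locally_exact U ⊤
    (fun n V _ s hs hsU x hx => hloc n V s hs hsU x hx) n ⊤ le_rfl s hs (by
      refine (resL_resL (I.X n) (le_top : U ≤ ⊤) (inf_le_right : ⊤ ⊓ U ≤ U) s).symm.trans ?_
      exact (congrArg (resL (I.X n) _) hsU).trans (map_zero _))
  refine ⟨t, ?_, ht'⟩
  have := congrArg (resL (I.X (n - 1)) (le_inf le_top le_rfl : U ≤ ⊤ ⊓ U)) ht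
  exact (resL_resL _ _ _ _).symm.trans (this.trans (map_zero _))

end Supports

/-! ### Comparison with relative cohomology -/

section Comparison

lemma toZeroForm_of_notMem {d : ℕ} {X : Type} {D : Set X} {x : X} (hx : x ∉ D) (f : X → ℂ) :
    toZeroForm (d := d) D f x =
      ContinuousAlternatingMap.constOfIsEmpty ℂ (Fin d → ℂ) (Fin 0) (f x) := if_neg hx

variable {d : ℕ} {X : Type} [TopologicalSpace X] [ChartedSpace (Fin d → ℂ) X]

lemma EffectiveDivisor.red_le (Z : EffectiveDivisor d X) : Z.red ≤ Z := fun T => by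
  rw [EffectiveDivisor.red_apply]
  exact min_le_left _ _

/-- At a point where all components have a negative coefficient in the twist, forms vanish along some
component. -/
lemma AdaptedChart.exists_expo_pos {S : Finset (PrimeDivisor d X)} {E : PrimeDivisor d X → ℤ}
    {x : X} (c : AdaptedChart S x) (hE : ∀ T ∈ S, x ∈ T.carrier → E T < 0) (hx : x ∈ unionOf S) :
    ∃ k ∈ c.logSet, 0 < c.expo E k := by
  obtain ⟨T, hT, hxT⟩ := Set.mem_iUnion₂.1 hx
  obtain ⟨k, hk, -⟩ := c.comp_unique T hT hxT
  refine ⟨k, AdaptedChart.mem_logSet_iff.2 ⟨T, hk⟩, ?_⟩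
  rw [AdaptedChart.expo_of_comp hk]
  exact neg_pos.2 (hE T hT hxT)

variable [IsManifold 𝓘(ℂ, Fin d → ℂ) ω X]
variable {Y Z : EffectiveDivisor d X} {A : Set X}

/-- The only condition is in degree zero, where a locally constant function vanishing on `Y` is
determined by its values off the divisor. -/
lemma locInj_augmentation (hA : Y.supp = A) {U : Opens X}
    (hU : ∀ x ∈ U, ∀ T ∈ (Y + Z).support, x ∈ T.carrier → twist Y Z T < 0) (n : ℕ) :
    LocInj (augmentation Y Z hA) (n - 1) n (n + 1) U := by
  intro V hV s hs t hst x hx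
  refine ⟨V, le_rfl, hx, 0, (map_zero _).trans ?_⟩
  suffices h : s = 0 by rw [h, map_zero]
  rcases n with _ | n
  · obtain ⟨s, rfl⟩ : ∃ s' : Sec (constVanishing X A).sheaf V, s' = s := ⟨s, rfl⟩
    have h0 : secMap ((augmentation Y Z hA).f 0) V s = 0 := by
      refine hst.trans ?_
      rw [HomologicalComplex.shape _ _ _ (by simp)]
      rfl
    have h1 := (formOf_augmentation hA s).symm.trans (congrArg formOf h0)
    refine Subtype.ext (a1 := (show (constVanishing X A).sections V from s)) ?_
    funext y
    by_cases hy : y ∈ V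
    swap
    · exact (show (constVanishing X A).sections V from s).2.2 y hy
    by_cases hyS : y ∈ unionOf (Y + Z).support
    · obtain ⟨T, hT, hyT⟩ := Set.mem_iUnion₂.1 hyS
      exact ((show (constVanishing X A).sections V from s).2.1 y hy).2
        (subset_of_twist_neg hA T hT (hU y (hV hy) T hT hyT) hyT)
    · have h2 := congrFun h1 y
      simp only [cutOff_of_mem hy, toZeroForm_of_notMem hyS] at h2
      exact congrArg (fun f : Alt d 0 => f Fin.elim0) h2
  · have h : 𝟙 (((CochainComplex.single₀ (CSheaf X)).obj (constVanishing X A).sheaf).X (n + 1)) =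
        0 := (HomologicalComplex.isZero_single_obj_X _ _ _ _ (by simp)).eq_of_src _ _
    exact congrArg (fun f => secMap f V s) h

/-- Off `Z`, the complex `Ω_{X|Y,Z}` is a resolution of the sheaf of locally constant functions
vanishing on `Y`: along a component of `Y` the residue of the differential is not zero. -/
lemma locSurj_augmentation (hA : Y.supp = A) (hsnc : IsSNC (Y + Z).support) {U : Opens X}
    (hU : ∀ x ∈ U, ∀ T ∈ (Y + Z).support, x ∈ T.carrier → twist Y Z T < 0) (n : ℕ) :
    LocSurj (augmentation Y Z hA) (n - 1) n (n + 1) U := by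
  intro V hV t ht x hx
  rcases n with _ | n
  · have hd : ∀ (W : Opens X) (s : Sec (((CochainComplex.single₀ (CSheaf X)).obj
        (constVanishing X A).sheaf).X 0) W), secMap (((CochainComplex.single₀ (CSheaf X)).obj
        (constVanishing X A).sheaf).d 0 1) W s = 0 := fun W s =>
      congrArg (fun f => secMap f W s) (HomologicalComplex.single_obj_d _ _ _ _ _)
    -- on `Y` closed functions of the twisted complex vanish, off `Y` they are locally constant
    by_cases hxS : x ∈ unionOf (Y + Z).support
    · obtain ⟨c⟩ := hsnc x
      obtain ⟨k, hk, hpos⟩ := c.exists_expo_pos (hU x (hV hx)) hxS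
      obtain ⟨G, hG⟩ := exists_frame_formOf t hx c
      have h0 := eq_zero_of_closed_of_pos hk (c.chart_apply_eq_zero hk) hpos hG.1
        (dLog_eq_zero_of_closed hx hG ht)
      obtain ⟨W, hW, hW', hxW, e⟩ := exists_resL_eq_of_frame hx hx hG
        (t := (0 : Sec ((logDeRham (Y + Z).support (twist Y Z)).X 0) V))
        AdaptedChart.isFrameOf_zero h0
      refine ⟨W, hW, hxW, 0, hd W 0, 0, ?_⟩
      rw [map_zero, map_zero, add_zero]
      exact e.trans (map_zero _)
    · obtain ⟨a, ha⟩ := eventually_eq_const_of_notMem hsnc hxS hx t ht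
      obtain ⟨B, hB, hBo, hxB⟩ := mem_nhds_iff.1
        (ha.and ((isClosed_unionOf (Y + Z).support).isOpen_compl.mem_nhds hxS))
      let W : Opens X := ⟨B, hBo⟩ ⊓ V
      have hWA : ∀ y ∈ W, y ∉ A := by
        rintro y hy hyA
        rw [← hA] at hyA
        obtain ⟨T, hT, hyT⟩ := Set.mem_iUnion₂.1 hyA
        refine (hB hy.1).2 (Set.mem_iUnion₂.2 ⟨T, ?_, hyT⟩)
        rw [Finsupp.mem_support_iff] at hT ⊢
        rw [Finsupp.add_apply]
        omega
      let s : (constVanishing X A).sections W := ⟨cutOff W fun _ => a Fin.elim0, fun y hy => by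
        refine ⟨?_, fun hyA => absurd hyA (hWA y hy)⟩
        filter_upwards [W.isOpen.mem_nhds hy] with y' hy'
        rw [cutOff_of_mem hy', cutOff_of_mem hy], fun y hy => cutOff_of_notMem hy⟩
      refine ⟨W, inf_le_right, ⟨hxB, hx⟩, (show Sec (constVanishing X A).sheaf W from s),
        hd W _, 0, ?_⟩
      rw [map_zero, add_zero]
      refine formOf_ext ((funext fun y => ?_ : cutOff W (formOf t) = _).trans
        (formOf_augmentation hA (show Sec (constVanishing X A).sheaf W from s)).symm)
      by_cases hy : y ∈ W
      · rw [cutOff_of_mem hy, cutOff_of_mem hy, toZeroForm_of_notMem (hB hy.1).2]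
        refine (hB hy.1).1.trans (ContinuousAlternatingMap.ext fun v => ?_)
        rw [Subsingleton.elim v Fin.elim0]
        exact (cutOff_of_mem (f := fun _ => a Fin.elim0) hy).symm
      · rw [cutOff_of_notMem hy, cutOff_of_notMem hy]
  · suffices h : ∃ (W : Opens X) (hW : W ≤ V) (_ : x ∈ W)
        (u : Sec ((logDeRham (Y + Z).support (twist Y Z)).X n) W),
          secMap ((logDeRham (Y + Z).support (twist Y Z)).d n (n + 1)) W u = resL _ hW t by
      obtain ⟨W, hW, hxW, u, hu⟩ := h
      exact ⟨W, hW, hxW, 0, map_zero _, u, by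
        rw [map_zero, zero_add]
        exact hu.symm⟩
    by_cases hxS : x ∈ unionOf (Y + Z).support
    · obtain ⟨c⟩ := hsnc x
      obtain ⟨k, hk, hpos⟩ := c.exists_expo_pos (hU x (hV hx)) hxS
      obtain ⟨G, hG⟩ := exists_frame_formOf t hx c
      obtain ⟨θ, hθ, e⟩ := exists_dLog_eq_of_pos AdaptedChart.expo_notMem_zero hk
        (c.chart_apply_eq_zero hk) hpos hG.1 (dLog_eq_zero_of_closed hx hG ht)
      obtain ⟨W, hW, hxW, u, hu⟩ := c.exists_section_toForm (E := twist Y Z) hx hθ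
      obtain ⟨W', hW', hW'', hxW', e'⟩ := exists_resL_eq_of_frame hxW hx (isFrameOf_d hxW hu) hG e
      exact ⟨W', hW'', hxW', resL _ hW' u, (secMap_resL _ _ _).trans e'⟩
    · exact exists_d_eq_of_notMem hsnc hxS hx t ht

variable [HasDerivedCategory.{w} (CSheaf X)] {Y' Z' : EffectiveDivisor d X}

/-- The components of the divisor that meet the complement of `Z` are those of `Y`, and their
coefficients in the twist are negative. -/
lemma hyperMap_augmentation_bijective (hsnc : IsSNC (Y + Z).support)
    (hY' : Y' = Y ∨ Y' = Y.red) (hZ' : Z' = Z ∨ Z' = Z.red)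
    (hA : Y'.supp = A) (n : ℤ) :
    Function.Bijective (hyperMap Z.compl (augmentation Y' Z' hA) n) := by
  have hS := EffectiveDivisor.support_add_eq' hY' hZ'
  have hU : ∀ x ∈ Z.compl, ∀ T ∈ (Y' + Z').support, x ∈ T.carrier → twist Y' Z' T < 0 := by
    intro x hx T hT hxT
    rw [hS, Finsupp.mem_support_iff, Finsupp.add_apply] at hT
    have hZT : Z T = 0 := by
      by_contra h
      exact hx (Set.mem_iUnion₂.2 ⟨T, Finsupp.mem_support_iff.2 h, hxT⟩)
    have e₁ := EffectiveDivisor.mem_support_iff_of_eq_or_red hY' T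
    have e₂ := EffectiveDivisor.mem_support_iff_of_eq_or_red hZ' T
    simp only [twist, EffectiveDivisor.red_apply]
    omega
  exact hyperMap_bijective _ _ (locInj_augmentation hA hU)
    (locSurj_augmentation hA (hS ▸ hsnc) hU) n

/-- For reduced `Z` the twist is trivial along `Z`, so that only logarithmic poles occur. -/
lemma hyperRestrict_omegaComplex_red_bijective (hdisj : Disjoint Y.supp Z.supp)
    (hsnc : IsSNC (Y + Z).support) (hY' : Y' = Y ∨ Y' = Y.red) (n : ℤ) :
    Function.Bijective
      (hyperRestrict (le_top : Z.compl ≤ ⊤) (omegaComplex Y' Z.red) n) := by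
  have hS := EffectiveDivisor.support_add_eq' hY' (Z := Z) (Or.inr rfl)
  refine hyperRestrict_logDeRham_bijective (hS ▸ hsnc) _ (fun x hx c => ?_) n
  have hxZ : x ∈ Z.supp := not_not.1 hx
  have hT : ∀ T ∈ (Y' + Z.red).support, x ∈ T.carrier → Y' T = 0 ∧ Z T ≠ 0 := by
    intro T hT hxT
    rw [hS, Finsupp.mem_support_iff, Finsupp.add_apply] at hT
    have hYT : Y T = 0 := by
      by_contra h
      exact Set.disjoint_left.1 hdisj
        (Set.mem_iUnion₂.2 ⟨T, Finsupp.mem_support_iff.2 h, hxT⟩) hxZ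
    exact ⟨(EffectiveDivisor.mem_support_iff_of_eq_or_red hY' T).2 hYT, by omega⟩
  refine ⟨fun k => ?_, fun y hy => not_congr ⟨fun hyZ => ?_, fun hyS => ?_⟩⟩
  · by_cases hk : k ∈ c.logSet
    · obtain ⟨T, hkT⟩ := AdaptedChart.mem_logSet_iff.1 hk
      obtain ⟨hTS, hxT⟩ := c.comp_mem k T hkT
      rw [AdaptedChart.expo_of_comp hkT]
      have := hT T hTS hxT
      simp only [twist, EffectiveDivisor.red_apply]
      omega
    · exact c.expo_of_notMem hk
  · obtain ⟨T, hTZ, hyT⟩ := Set.mem_iUnion₂.1 hyZ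
    refine Set.mem_iUnion₂.2 ⟨T, ?_, hyT⟩
    rw [Finsupp.mem_support_iff] at hTZ
    rw [hS, Finsupp.mem_support_iff, Finsupp.add_apply]
    omega
  · obtain ⟨T, hTS, hyT⟩ := Set.mem_iUnion₂.1 hyS
    have hxT : x ∈ T.carrier := by
      by_contra h
      exact Set.disjoint_left.1 (c.disjoint T hTS h) hyT hy
    exact Set.mem_iUnion₂.2 ⟨T, Finsupp.mem_support_iff.2 (hT T hTS hxT).2, hyT⟩

lemma hyperRestrict_omegaComplex_bijective (hdisj : Disjoint Y.supp Z.supp)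
    (hsnc : IsSNC (Y + Z).support) (hY' : Y' = Y ∨ Y' = Y.red) (hZ' : Z' = Z ∨ Z' = Z.red)
    (n : ℤ) :
    Function.Bijective (hyperRestrict (le_top : Z.compl ≤ ⊤) (omegaComplex Y' Z') n) := by
  rcases hZ' with rfl | rfl
  swap
  · exact hyperRestrict_omegaComplex_red_bijective hdisj hsnc hY' n
  -- reduce to reduced `Z` by the quasi-isomorphism of twists
  let f := omegaInclusion (EffectiveDivisor.support_add_eq hY' (Or.inr rfl) hY' (Or.inl rfl))
    (le_refl Y') Z'.red_le
  have : QuasiIso f := quasiIso_omegaInclusion hdisj hsnc hY' (Or.inr rfl) hY' (Or.inl rfl) _ _ _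
  have h : Function.Bijective (hyperRestrict (le_top : Z'.compl ≤ ⊤) (omegaComplex Y' Z') n ∘
      hyperMap ⊤ f n) := by
    have e : hyperRestrict (le_top : Z'.compl ≤ ⊤) (omegaComplex Y' Z') n ∘ hyperMap ⊤ f n =
        hyperMap Z'.compl f n ∘ hyperRestrict le_top (omegaComplex Y' Z'.red) n :=
      funext fun a => hyperRestrict_hyperMap f le_top n a
    rw [e]
    exact (hyperMap_bijective_of_quasiIso f _ n).comp
      (hyperRestrict_omegaComplex_red_bijective hdisj hsnc hY' n)
  exact (Function.Bijective.of_comp_iff _ (hyperMap_bijective_of_quasiIso f ⊤ n)).1 h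

end Comparison

end

theorem mainTheorem6 {d : ℕ} {X : Type} [TopologicalSpace X] [T2Space X] [CompactSpace X]
    [ConnectedSpace X] [ChartedSpace (Fin d → ℂ) X] [IsManifold 𝓘(ℂ, Fin d → ℂ) ω X]
    [HasDerivedCategory.{w} (CSheaf X)]
    (Y Z : EffectiveDivisor d X) (hdisj : Disjoint Y.supp Z.supp)
    (hsnc : IsSNC (Y + Z).support) :
    (∀ (Y₁ Z₁ Y₂ Z₂ : EffectiveDivisor d X)
      (hY₁ : Y₁ = Y ∨ Y₁ = Y.red) (hZ₁ : Z₁ = Z ∨ Z₁ = Z.red)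
      (hY₂ : Y₂ = Y ∨ Y₂ = Y.red) (hZ₂ : Z₂ = Z ∨ Z₂ = Z.red)
      (hY : Y₂ ≤ Y₁) (hZ : Z₁ ≤ Z₂),
      QuasiIso (omegaInclusion (EffectiveDivisor.support_add_eq hY₁ hZ₁ hY₂ hZ₂) hY hZ)) ∧
    (∀ (Y' Z' : EffectiveDivisor d X)
      (hY' : Y' = Y ∨ Y' = Y.red) (_hZ' : Z' = Z ∨ Z' = Z.red) (n : ℤ),
      Function.Bijective (hyperRestrict (le_top : Z.compl ≤ ⊤) (omegaComplex Y' Z') n) ∧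
      ∃ e : RelCohomology Z.compl Y.supp n ≃ₗ[ℂ] Hyper (⊤ : Opens X) (omegaComplex Y' Z') n,
        ∀ a, hyperRestrict (le_top : Z.compl ≤ ⊤) (omegaComplex Y' Z') n (e a) =
          hyperMap Z.compl (augmentation Y' Z' (EffectiveDivisor.supp_eq hY')) n a) := by
  refine ⟨fun Y₁ Z₁ Y₂ Z₂ hY₁ hZ₁ hY₂ hZ₂ hY hZ =>
    quasiIso_omegaInclusion hdisj hsnc hY₁ hZ₁ hY₂ hZ₂ _ hY hZ, fun Y' Z' hY' hZ' n => ?_⟩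
  have hρ := hyperRestrict_omegaComplex_bijective hdisj hsnc hY' hZ' n
  have hε := hyperMap_augmentation_bijective hsnc hY' hZ' (EffectiveDivisor.supp_eq hY') n
  exact ⟨hρ, (LinearEquiv.ofBijective _ hε).trans (LinearEquiv.ofBijective _ hρ).symm,
    fun a => (LinearEquiv.ofBijective _ hρ).apply_symm_apply _⟩
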